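/- Let $d\ge 1$ and $n\ge 0$ be integers, $\sigma\in[\tfrac12,1]$, $m_f>0$, $\omega(k)=\sqrt{|k|^2+m_f^2}$ on $\mathbb R^d$, $M_1,\dots,M_n>0$, and let either $f_j(p)=\sqrt{p^2+M_j^2}$ for all $j$ (semi-relativistic case) or $f_j(p)=p^2/(2M_j)$ for all $j$ (non-relativistic case). Let $V\in C^2_b(\mathbb R^{dn};\mathbb R)$ and let $\chi:\mathbb R^d\to\mathbb R$ satisfy $\omega^{1/2}\chi\in L^2(\mathbb R^d)$. Let $\mathcal H=L^2(\mathbb R^{dn})\otimes\Gamma_s(L^2(\mathbb R^d))$, where $\Gamma_s(L^2(\mathbb R^d))=\bigoplus_{m\ge0}L^2_s(\mathbb R^{dm})$ is the symmetric Fock space. For $\hbar\in(0,1)$ let $\hat q_j=x_j$, $\hat p_j=-i\hbar\nabla_{x_j}$, let $[d\Gamma(w)\psi]^m=\hbar\sum_{j=1}^m w(k_j)\,\psi^m$ for a function $w:\mathbb R^d\to\mathbb R$, and let $\hat a_\hbar,\hat a^*_\hbar$ be the $\hbar$-scaled annihilation and creation operators: with $G_x(k)=\sum_{j=1}^n\frac{\chi(k)}{\sqrt{\omega(k)}}e^{-2\pi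 i k\cdot x_j}$ and $x=(x_1,\dots,x_n)$, $$[\hat a_\hbar(G)\psi(x)]^m(k_1,\dots,k_m)=\sqrt{\hbar(m+1)}\int\overline{G_x(k)}\,\psi^{m+1}(x;k,k_1,\dots,k_m)\,dk,$$ $$[\hat a^*_\hbar(G)\psi(x)]^m(k_1,\dots,k_m)=\tfrac{\sqrt\hbar}{\sqrt m}\sum_{j=1}^m G_x(k_j)\,\psi^{m-1}(x;k_1,\dots,\widehat{k_j},\dots,k_m)\quad(m\ge 1),\qquad [\hat a^*_\hbar(G)\psi(x)]^0=0.$$ Let $\hat H_{02}=d\Gamma(\omega)$ and let the Nelson Hamiltonian be $$\hat H=\sum_{j=1}^n f_j(\hat p_j)+\hat H_{02}+V(\hat q)+\hat a_\hbar(G)+\hat a^*_\hbar(G).$$ The operators $\hat H$ and $\hat H_{02}$ are self-adjoint (so that they generate unitary groups), and for a density matrix $\varrho_\hbar$ (a positive operator of trace one on $\mathcal H$) one sets $$\varrho_\hbar(t)=e^{-i\frac t\hbar\hat H}\varrho_\hbar\, e^{i\frac t\hbar\hat H},\qquad \tilde\varrho_\hbar(t)=e^{i\frac t\hbar\hat H_{02}}\varrho_\hbar(t)\,e^{-i\frac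 t\hbar\hat H_{02}} .$$ For a positive self-adjoint operator $A$, $\mathrm{Tr}[\varrho A]\in[0,\infty]$ denotes $\mathrm{Tr}[\varrho^{1/2}A\varrho^{1/2}]$ in the sense of quadratic forms; $\hat q^2+\hat p^2$ is understood as a sum of forms. Then there is a constant $C>0$, depending neither on $\hbar$ nor on the states, such that the following holds. Let $(\varrho_\hbar)_{\hbar\in(0,1)}$ be a family of density matrices on $\mathcal H$ such that, for some constants $C_0,C_1>0$ and all $\hbar\in(0,1)$, $$\text{(S0)}\quad \mathrm{Tr}[\varrho_\hbar\, d\Gamma(\omega^{2\sigma})]\le C_0,\qquad\qquad \text{(S1)}\quad \mathrm{Tr}[\varrho_\hbar(\hat q^2+\hat p^2)]\le C_1 .$$ Then $\varrho_\hbar(t)$ and $\tilde\varrho_\hbar(t)$ are density matrices which satisfy (S0) and (S1) uniformly in $\hbar\in(0,1)$ and in $t$ in any compact interval. Moreover, the bounds grow at most exponentially: there are $C_0',C_1'>0$ such that for all $t\in\mathbb R$ and all $\hbar\in(0,1)$ the quantity in (S0), with $\varrho_\hbar$ replaced by $\varrho_\hbar(t)$ or $\tilde\varrho_\hbar(t)$,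 is at most $C_0'e^{C|t|}$, and the quantity in (S1), with the same replacement, is at most $C_1'e^{C|t|}$. -/

import Mathlib

open MeasureTheory Set
open scoped FourierTransform ENNReal InnerProductSpace

noncomputable section

namespace Nelson

/-! ### Configuration spaces and the Hilbert space -/

/-- The one-particle position (or momentum) space `ℝᵈ`. -/
abbrev Space (d : ℕ) := EuclideanSpace ℝ (Fin d)

/-- The configuration space `ℝ^{dn}` of `n` particles in `ℝᵈ`. -/
abbrev Config (d n : ℕ) := EuclideanSpace ℝ (Fin n × Fin d)

/-- The `j`-th component `x_j ∈ ℝᵈ` of `x = (x_1, …, x_n) ∈ ℝ^{dn}`. -/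
def Config.part {d n : ℕ} (x : Config d n) (j : Fin n) : Space d :=
  WithLp.toLp 2 fun a => x (j, a)

/-- If a property holds for almost every `K ∈ (ℝᵈ)^m`, then for almost every
`K' ∈ (ℝᵈ)^{m+1}` it holds for `K'` with its `j`-th entry removed. -/
theorem ae_removeNth {d m : ℕ} (j : Fin (m + 1)) {p : (Fin m → Space d) → Prop}
    (h : ∀ᵐ K : Fin m → Space d, p K) :
    ∀ᵐ K : Fin (m + 1) → Space d, p (j.removeNth K) := by
  have h1 := (volume_preserving_piFinSuccAbove (fun _ : Fin (m + 1) => Space d) j)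
  have h2 : Measure.QuasiMeasurePreserving
      (Prod.snd : Space d × (Fin m → Space d) → (Fin m → Space d)) volume volume :=
    Measure.quasiMeasurePreserving_snd
  exact (h2.comp h1.quasiMeasurePreserving).ae h

/-- If a property holds for almost every `K' ∈ (ℝᵈ)^{m+1}`, then for almost every
`K ∈ (ℝᵈ)^m` it holds for `(k, K)` with almost every `k ∈ ℝᵈ`. -/
theorem ae_ae_cons {d m : ℕ} {p : (Fin (m + 1) → Space d) → Prop}
    (h : ∀ᵐ K : Fin (m + 1) → Space d, p K) :
    ∀ᵐ K : Fin m → Space d, ∀ᵐ k : Space d, p (Fin.cons k K) := by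
  have h1 := (volume_preserving_piFinSuccAbove (fun _ : Fin (m + 1) => Space d) 0).symm
  have h2 : ∀ᵐ z : Space d × (Fin m → Space d),
      p ((MeasurableEquiv.piFinSuccAbove (fun _ : Fin (m + 1) => Space d) 0).symm z) :=
    h1.quasiMeasurePreserving.ae h
  have h3 : Measure.QuasiMeasurePreserving
      (Prod.swap : (Fin m → Space d) × Space d → Space d × (Fin m → Space d))
      (volume.prod volume) (volume.prod volume) :=
    (Measure.measurePreserving_swap).quasiMeasurePreserving
  have h4 := Measure.ae_ae_of_ae_prod (h3.ae h2)
  filter_upwards [h4] with K hK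
  filter_upwards [hK] with k hk
  simpa [MeasurableEquiv.piFinSuccAbove, Fin.insertNthEquiv, Fin.insertNth_zero] using! hk

/-- Permuting the variables preserves the Lebesgue measure of `(ℝᵈ)^m`. -/
theorem measurePreserving_perm {d m : ℕ} (π : Equiv.Perm (Fin m)) :
    MeasurePreserving (fun K : Fin m → Space d => K ∘ π) volume volume := by
  convert! volume_measurePreserving_piCongrLeft (fun _ : Fin m => Space d) π.symm using 1
  ext K i : 2
  obtain ⟨j, rfl⟩ := π.symm.surjective i
  rw [MeasurableEquiv.coe_piCongrLeft, Equiv.piCongrLeft_apply_apply]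
  simp

/-- `L²_s((ℝᵈ)^m; ℂ)`: the square-integrable functions of `m` variables in `ℝᵈ` that are
invariant under all permutations of the variables. -/
def symmL2 (d m : ℕ) : Submodule ℂ (Lp ℂ 2 (volume : Measure (Fin m → Space d))) where
  carrier := {f | ∀ π : Equiv.Perm (Fin m), ∀ᵐ K : Fin m → Space d, f (K ∘ π) = f K}
  zero_mem' := by
    intro π
    have h := Lp.coeFn_zero ℂ 2 (volume : Measure (Fin m → Space d))
    have hm := measurePreserving_perm (d := d) π
    have h' := hm.quasiMeasurePreserving.ae h
    filter_upwards [h, h'] with K h1 h2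
    rw [h1, h2]; rfl
  add_mem' := by
    intro f g hf hg π
    have h := Lp.coeFn_add f g
    have hm := measurePreserving_perm (d := d) π
    have h' := hm.quasiMeasurePreserving.ae h
    filter_upwards [h, h', hf π, hg π] with K h1 h2 h3 h4
    rw [h1, h2]; simp [h3, h4]
  smul_mem' := by
    intro c f hf π
    have h := Lp.coeFn_smul c f
    have hm := measurePreserving_perm (d := d) π
    have h' := hm.quasiMeasurePreserving.ae h
    filter_upwards [h, h', hf π] with K h1 h2 h3
    rw [h1, h2]; simp [h3]

theorem isClosed_symmL2 (d m : ℕ) :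
    IsClosed (symmL2 d m : Set (Lp ℂ 2 (volume : Measure (Fin m → Space d)))) := by
  have hm : ∀ π : Equiv.Perm (Fin m),
      MeasurePreserving (fun K : Fin m → Space d => K ∘ π) volume volume := measurePreserving_perm
  have hs : (symmL2 d m : Set (Lp ℂ 2 (volume : Measure (Fin m → Space d)))) =
      ⋂ π : Equiv.Perm (Fin m), {f | Lp.compMeasurePreserving _ (hm π) f = f} := by
    ext f
    rw [mem_iInter]
    refine forall_congr' fun π => ?_
    change _ ↔ Lp.compMeasurePreserving _ (hm π) f = f
    rw [Lp.ext_iff]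
    have h := Lp.coeFn_compMeasurePreserving f (hm π)
    constructor
    · intro h1
      filter_upwards [h, h1] with K h2 h3
      rw [h2]; exact h3
    · intro h1
      filter_upwards [h, h1] with K h2 h3
      rw [← h3, h2]; rfl
  rw [hs]
  refine isClosed_iInter fun π => ?_
  exact isClosed_eq (Lp.isometry_compMeasurePreserving (hm π)).continuous continuous_id

instance (d m : ℕ) : CompleteSpace (symmL2 d m) :=
  (isClosed_symmL2 d m).completeSpace_coe

/-- The symmetric Fock space `Γ_s(L²(ℝᵈ)) = ⨁_m L²_s((ℝᵈ)^m)` (Hilbert sum). -/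
def Fock (d : ℕ) : Type := lp (fun m : ℕ => symmL2 d m) 2

instance (d : ℕ) : NormedAddCommGroup (Fock d) :=
  inferInstanceAs (NormedAddCommGroup (lp (fun m : ℕ => symmL2 d m) 2))

instance (d : ℕ) : InnerProductSpace ℂ (Fock d) :=
  inferInstanceAs (InnerProductSpace ℂ (lp (fun m : ℕ => symmL2 d m) 2))

instance (d : ℕ) : CompleteSpace (Fock d) :=
  inferInstanceAs (CompleteSpace (lp (fun m : ℕ => symmL2 d m) 2))

/-- The `m`-particle component `ψ^m(k_1, …, k_m)` of a Fock space vector. -/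
def Fock.comp {d : ℕ} (ψ : Fock d) (m : ℕ) : (Fin m → Space d) → ℂ :=
  ((Subtype.val (p := fun z => z ∈ lp (fun m : ℕ => symmL2 d m) 2) ψ m : symmL2 d m) :
    Lp ℂ 2 (volume : Measure (Fin m → Space d)))

/-- The Hilbert space `L²(ℝ^{dn}) ⊗ Γ_s(L²(ℝᵈ))`, realized as the space `L²(ℝ^{dn}; Γ_s)` of
square-integrable Fock-space-valued functions. -/
abbrev Hilb (d n : ℕ) := Lp (Fock d) 2 (volume : Measure (Config d n))

theorem Fock.comp_add {d : ℕ} (ψ φ : Fock d) (m : ℕ) :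
    ∀ᵐ K : Fin m → Space d, (ψ + φ).comp m K = ψ.comp m K + φ.comp m K :=
  Lp.coeFn_add
    ((Subtype.val (p := fun z => z ∈ lp (fun m : ℕ => symmL2 d m) 2) ψ m : symmL2 d m) :
      Lp ℂ 2 (volume : Measure (Fin m → Space d)))
    ((Subtype.val (p := fun z => z ∈ lp (fun m : ℕ => symmL2 d m) 2) φ m : symmL2 d m) :
      Lp ℂ 2 (volume : Measure (Fin m → Space d)))

theorem Fock.comp_smul {d : ℕ} (c : ℂ) (ψ : Fock d) (m : ℕ) :
    ∀ᵐ K : Fin m → Space d, (c • ψ).comp m K = c * ψ.comp m K :=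
  Lp.coeFn_smul c
    ((Subtype.val (p := fun z => z ∈ lp (fun m : ℕ => symmL2 d m) 2) ψ m : symmL2 d m) :
      Lp ℂ 2 (volume : Measure (Fin m → Space d)))

theorem Fock.comp_zero {d : ℕ} (m : ℕ) :
    ∀ᵐ K : Fin m → Space d, (0 : Fock d).comp m K = 0 :=
  (Lp.coeFn_zero ℂ 2 (volume : Measure (Fin m → Space d)) :)

theorem Fock.ext_comp {d : ℕ} {ψ φ : Fock d}
    (h : ∀ m, ∀ᵐ K : Fin m → Space d, ψ.comp m K = φ.comp m K) : ψ = φ := by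
  apply lp.ext
  funext m
  exact Subtype.ext (Lp.ext (h m))

/-! ### Unbounded operators on Fock space, given by their graphs -/

/-- The graph of the second quantization `dΓ(w)` of multiplication by `w`:
`[dΓ(w)ψ]^m (k_1, …, k_m) = ħ ∑_j w(k_j) ψ^m (k_1, …, k_m)`, on its maximal domain. -/
def dGammaGraph {d : ℕ} (ħ : ℝ) (w : Space d → ℝ) : Submodule ℂ (Fock d × Fock d) where
  carrier := {z | ∀ m, ∀ᵐ K : Fin m → Space d,
    z.2.comp m K = ((ħ * ∑ j, w (K j) : ℝ) : ℂ) * z.1.comp m K}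
  zero_mem' := by
    intro m
    filter_upwards [Fock.comp_zero (d := d) m] with K h
    simp [h]
  add_mem' := by
    intro y z hy hz m
    filter_upwards [hy m, hz m, Fock.comp_add y.1 z.1 m, Fock.comp_add y.2 z.2 m]
      with K h1 h2 h3 h4
    rw [Prod.fst_add, Prod.snd_add, h3, h4, h1, h2]; ring
  smul_mem' := by
    intro c z hz m
    filter_upwards [hz m, Fock.comp_smul c z.1 m, Fock.comp_smul c z.2 m] with K h1 h2 h3
    rw [Prod.smul_fst, Prod.smul_snd, h2, h3, h1]; ring

/-- The graph of the `ħ`-scaled annihilation operator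
`[a(f)ψ]^m (K) = √(ħ(m+1)) ∫ conj(f(k)) ψ^{m+1}(k, K) dk`, on its maximal domain. -/
def annihilationGraph {d : ℕ} (ħ : ℝ) (f : Space d → ℂ) : Submodule ℂ (Fock d × Fock d) where
  carrier := {z | ∀ m, ∀ᵐ K : Fin m → Space d,
    Integrable (fun k : Space d => starRingEnd ℂ (f k) * z.1.comp (m + 1) (Fin.cons k K)) ∧
    z.2.comp m K = (√(ħ * (m + 1)) : ℂ) *
      ∫ k : Space d, starRingEnd ℂ (f k) * z.1.comp (m + 1) (Fin.cons k K)}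
  zero_mem' := by
    intro m
    filter_upwards [Fock.comp_zero (d := d) m, ae_ae_cons (Fock.comp_zero (d := d) (m + 1))]
      with K h1 h2
    have h3 : (fun k : Space d => starRingEnd ℂ (f k) *
        (0 : Fock d).comp (m + 1) (Fin.cons k K)) =ᵐ[volume] fun _ => 0 := by
      filter_upwards [h2] with k hk
      rw [hk, mul_zero]
    refine ⟨(integrable_congr h3).2 (integrable_zero _ _ _), ?_⟩
    change (0 : Fock d).comp m K = _ * ∫ k : Space d, starRingEnd ℂ (f k) *
        (0 : Fock d).comp (m + 1) (Fin.cons k K)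
    rw [h1, integral_congr_ae h3]; simp
  add_mem' := by
    intro y z hy hz m
    filter_upwards [hy m, hz m, ae_ae_cons (Fock.comp_add y.1 z.1 (m + 1)),
      Fock.comp_add y.2 z.2 m] with K h1 h2 h3 h4
    have h5 : (fun k : Space d => starRingEnd ℂ (f k) *
        (y + z).1.comp (m + 1) (Fin.cons k K)) =ᵐ[volume] fun k =>
        starRingEnd ℂ (f k) * y.1.comp (m + 1) (Fin.cons k K) +
        starRingEnd ℂ (f k) * z.1.comp (m + 1) (Fin.cons k K) := by
      filter_upwards [h3] with k hk
      rw [Prod.fst_add, hk, mul_add]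
    refine ⟨(integrable_congr h5).2 (h1.1.add h2.1), ?_⟩
    rw [integral_congr_ae h5, integral_add h1.1 h2.1, Prod.snd_add, h4, h1.2, h2.2]; ring
  smul_mem' := by
    intro c z hz m
    filter_upwards [hz m, ae_ae_cons (Fock.comp_smul c z.1 (m + 1)),
      Fock.comp_smul c z.2 m] with K h1 h3 h4
    have h5 : (fun k : Space d => starRingEnd ℂ (f k) *
        (c • z).1.comp (m + 1) (Fin.cons k K)) =ᵐ[volume] fun k =>
        c * (starRingEnd ℂ (f k) * z.1.comp (m + 1) (Fin.cons k K)) := by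
      filter_upwards [h3] with k hk
      rw [Prod.smul_fst, hk]; ring
    refine ⟨(integrable_congr h5).2 (h1.1.const_mul c), ?_⟩
    rw [integral_congr_ae h5, integral_const_mul, Prod.smul_snd, h4, h1.2]; ring

/-- The graph of the `ħ`-scaled creation operator
`[a*(f)ψ]^{m} (k_1, …, k_m) = (√ħ/√m) ∑_j f(k_j) ψ^{m-1}(k_1, …, k_j omitted, …, k_m)`
for `m ≥ 1` and `[a*(f)ψ]^0 = 0`, on its maximal domain. -/
def creationGraph {d : ℕ} (ħ : ℝ) (f : Space d → ℂ) : Submodule ℂ (Fock d × Fock d) where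
  carrier := {z | (∀ᵐ K : Fin 0 → Space d, z.2.comp 0 K = 0) ∧
    ∀ m, ∀ᵐ K : Fin (m + 1) → Space d,
      z.2.comp (m + 1) K =
        (√ħ / √(m + 1) : ℂ) * ∑ j, f (K j) * z.1.comp m (j.removeNth K)}
  zero_mem' := by
    refine ⟨Fock.comp_zero 0, fun m => ?_⟩
    filter_upwards [Fock.comp_zero (d := d) (m + 1),
      ae_all_iff.2 fun j => ae_removeNth j (Fock.comp_zero (d := d) m)] with K h1 h2
    change (0 : Fock d).comp (m + 1) K =
      _ * ∑ j, f (K j) * (0 : Fock d).comp m (j.removeNth K)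
    simp [h1, h2]
  add_mem' := by
    intro y z hy hz
    refine ⟨?_, fun m => ?_⟩
    · filter_upwards [hy.1, hz.1, Fock.comp_add y.2 z.2 0] with K h1 h2 h3
      rw [Prod.snd_add, h3, h1, h2, add_zero]
    · filter_upwards [hy.2 m, hz.2 m, Fock.comp_add y.2 z.2 (m + 1),
        ae_all_iff.2 fun j => ae_removeNth j (Fock.comp_add y.1 z.1 m)] with K h1 h2 h3 h4
      simp only [Prod.snd_add, Prod.fst_add, h3, h4, h1, h2, mul_add, Finset.sum_add_distrib]
  smul_mem' := by
    intro c z hz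
    refine ⟨?_, fun m => ?_⟩
    · filter_upwards [hz.1, Fock.comp_smul c z.2 0] with K h1 h3
      rw [Prod.smul_snd, h3, h1, mul_zero]
    · filter_upwards [hz.2 m, Fock.comp_smul c z.2 (m + 1),
        ae_all_iff.2 fun j => ae_removeNth j (Fock.comp_smul c z.1 m)] with K h1 h3 h4
      simp only [Prod.smul_snd, Prod.smul_fst, h3, h4, h1, Finset.mul_sum]
      exact Finset.sum_congr rfl fun j _ => by ring

/-- The graph of multiplication by a real number on Fock space. -/
def scalarGraph {d : ℕ} (c : ℝ) : Submodule ℂ (Fock d × Fock d) :=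
  ((c : ℂ) • (LinearMap.id : Fock d →ₗ[ℂ] Fock d)).graph

/-! ### Unbounded operators on the full Hilbert space -/

/-- The relation on `L²(ℝ^{dn}; Γ_s)` that acts in the fibre over `x ∈ ℝ^{dn}` by the relation
`A x` on Fock space. -/
def fibreGraph {d n : ℕ} (A : Config d n → Submodule ℂ (Fock d × Fock d)) :
    Submodule ℂ (Hilb d n × Hilb d n) where
  carrier := {z | ∀ᵐ x : Config d n, (z.1 x, z.2 x) ∈ A x}
  zero_mem' := by
    filter_upwards [Lp.coeFn_zero (Fock d) 2 (volume : Measure (Config d n))] with x h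
    change ((0 : Hilb d n) x, (0 : Hilb d n) x) ∈ A x
    rw [h]; exact (A x).zero_mem
  add_mem' := by
    intro y z hy hz
    filter_upwards [hy, hz, Lp.coeFn_add y.1 z.1, Lp.coeFn_add y.2 z.2] with x h1 h2 h3 h4
    rw [Prod.fst_add, Prod.snd_add, h3, h4]
    exact (A x).add_mem h1 h2
  smul_mem' := by
    intro c z hz
    filter_upwards [hz, Lp.coeFn_smul c z.1, Lp.coeFn_smul c z.2] with x h1 h3 h4
    rw [Prod.smul_fst, Prod.smul_snd, h3, h4]
    exact (A x).smul_mem c h1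

/-- The decomposable operator `(Tψ)(x) = A(x) ψ(x)` on `L²(ℝ^{dn}; Γ_s)`, for a field of
operators `A(x)` on Fock space given by their graphs; maximal domain. -/
def fibreOp {d n : ℕ} (A : Config d n → Submodule ℂ (Fock d × Fock d)) :
    Hilb d n →ₗ.[ℂ] Hilb d n :=
  (fibreGraph A).toLinearPMap

/-- The relation `𝓕⁻¹ A 𝓕`, where `𝓕` is the Fourier transform in the particle variables. -/
def fourierConj {d n : ℕ} (A : Submodule ℂ (Hilb d n × Hilb d n)) :
    Submodule ℂ (Hilb d n × Hilb d n) :=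
  A.comap ((Lp.fourierTransformₗᵢ (Config d n) (Fock d)).toLinearEquiv.toLinearMap.prodMap
    (Lp.fourierTransformₗᵢ (Config d n) (Fock d)).toLinearEquiv.toLinearMap)

/-- The operator `g(q̂)` of multiplication by `g(x_1, …, x_n)`. -/
def positionOp {d n : ℕ} (g : Config d n → ℝ) : Hilb d n →ₗ.[ℂ] Hilb d n :=
  fibreOp fun x => scalarGraph (g x)

/-- The operator `g(p̂)`, `p̂ = -iħ∇_x`: since the Fourier transform is
`(𝓕ψ)(ξ) = ∫ e^{-2πi⟨x,ξ⟩} ψ(x) dx`, it is the Fourier multiplier `g(2πħξ)`. -/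
def momentumOp {d n : ℕ} (ħ : ℝ) (g : Config d n → ℝ) : Hilb d n →ₗ.[ℂ] Hilb d n :=
  (fourierConj (fibreGraph fun ξ => scalarGraph (g ((2 * Real.pi * ħ) • ξ)))).toLinearPMap

/-- The second quantization `dΓ(w)` (acting on the field variables only). -/
def dGamma {d : ℕ} (n : ℕ) (ħ : ℝ) (w : Space d → ℝ) : Hilb d n →ₗ.[ℂ] Hilb d n :=
  fibreOp fun _ => dGammaGraph ħ w

/-- The generalized annihilation operator `a(G)`, `[a(G)ψ](x) = a(G_x) ψ(x)`. -/
def annihilation {d n : ℕ} (ħ : ℝ) (G : Config d n → Space d → ℂ) :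
    Hilb d n →ₗ.[ℂ] Hilb d n :=
  fibreOp fun x => annihilationGraph ħ (G x)

/-- The generalized creation operator `a*(G)`, `[a*(G)ψ](x) = a*(G_x) ψ(x)`. -/
def creation {d n : ℕ} (ħ : ℝ) (G : Config d n → Space d → ℂ) :
    Hilb d n →ₗ.[ℂ] Hilb d n :=
  fibreOp fun x => creationGraph ħ (G x)

/-! The relations above are graphs of operators, so that the operators just defined have exactly
these graphs. -/

theorem fibreGraph_functional {d n : ℕ} {A : Config d n → Submodule ℂ (Fock d × Fock d)}
    (hA : ∀ x, ∀ z ∈ A x, z.1 = 0 → z.2 = 0) :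
    ∀ z ∈ fibreGraph A, z.1 = 0 → z.2 = 0 := by
  intro z hz h0
  apply Lp.ext
  have h1 : ∀ᵐ x : Config d n, z.1 x = 0 := by
    rw [h0]; exact Lp.coeFn_zero (Fock d) 2 (volume : Measure (Config d n))
  filter_upwards [hz, h1, Lp.coeFn_zero (Fock d) 2 (volume : Measure (Config d n))]
    with x h2 h3 h4
  rw [h4]
  exact hA x _ h2 h3

theorem graph_positionOp {d n : ℕ} (g : Config d n → ℝ) :
    (positionOp g).graph = fibreGraph fun x => scalarGraph (g x) := by
  refine Submodule.toLinearPMap_graph_eq _ (fibreGraph_functional fun x z hz h0 => ?_)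
  rw [scalarGraph, LinearMap.mem_graph_iff] at hz
  rw [hz, h0, map_zero]

theorem graph_momentumOp {d n : ℕ} (ħ : ℝ) (g : Config d n → ℝ) :
    (momentumOp ħ g).graph =
      fourierConj (fibreGraph fun ξ => scalarGraph (g ((2 * Real.pi * ħ) • ξ))) := by
  refine Submodule.toLinearPMap_graph_eq _ fun z hz h0 => ?_
  have h1 := fibreGraph_functional (A := fun ξ => scalarGraph (g ((2 * Real.pi * ħ) • ξ)))
    (fun x z hz h0 => by
      rw [scalarGraph, LinearMap.mem_graph_iff] at hz
      rw [hz, h0, map_zero]) _ hz (by simp [h0])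
  simpa using h1

theorem graph_dGamma {d : ℕ} (n : ℕ) (ħ : ℝ) (w : Space d → ℝ) :
    (dGamma n ħ w).graph = fibreGraph fun _ => dGammaGraph ħ w := by
  refine Submodule.toLinearPMap_graph_eq _ (fibreGraph_functional fun x z hz h0 => ?_)
  refine Fock.ext_comp fun m => ?_
  filter_upwards [hz m, Fock.comp_zero (d := d) m] with K h1 h2
  rw [h1, h0, h2, mul_zero]

theorem graph_annihilation {d n : ℕ} (ħ : ℝ) (G : Config d n → Space d → ℂ) :
    (annihilation ħ G).graph = fibreGraph fun x => annihilationGraph ħ (G x) := by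
  refine Submodule.toLinearPMap_graph_eq _ (fibreGraph_functional fun x z hz h0 => ?_)
  refine Fock.ext_comp fun m => ?_
  filter_upwards [hz m, Fock.comp_zero (d := d) m,
    ae_ae_cons (Fock.comp_zero (d := d) (m + 1))] with K h1 h2 h3
  rw [h1.2, h2, h0]
  have : ∫ k : Space d, starRingEnd ℂ (G x k) * (0 : Fock d).comp (m + 1) (Fin.cons k K) = 0 := by
    apply integral_eq_zero_of_ae
    filter_upwards [h3] with k hk
    rw [hk]; simp
  rw [this, mul_zero]

theorem graph_creation {d n : ℕ} (ħ : ℝ) (G : Config d n → Space d → ℂ) :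
    (creation ħ G).graph = fibreGraph fun x => creationGraph ħ (G x) := by
  refine Submodule.toLinearPMap_graph_eq _ (fibreGraph_functional fun x z hz h0 => ?_)
  refine Fock.ext_comp fun m => ?_
  rcases m with _ | m
  · filter_upwards [hz.1, Fock.comp_zero (d := d) 0] with K h1 h2
    rw [h1, h2]
  · filter_upwards [hz.2 m, Fock.comp_zero (d := d) (m + 1),
      ae_all_iff.2 fun j => ae_removeNth j (Fock.comp_zero (d := d) m)] with K h1 h2 h3
    rw [h1, h2, h0]
    simp [h3]

/-! ### The Nelson model -/

/-- The two choices of kinetic energy of the particles. -/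
inductive Kinematics
  | semiRelativistic
  | nonRelativistic

/-- The data of the Nelson model with `n` particles in `ℝᵈ`: the kind of kinetic energy, the
particle masses `M_j`, the field mass `m_f`, the potential `V` and the form factor `χ`. -/
structure Model (d n : ℕ) where
  kin : Kinematics
  M : Fin n → ℝ
  mf : ℝ
  V : Config d n → ℝ
  χ : Space d → ℝ

/-- The dispersion relation `ω(k) = √(k² + m_f²)`. -/
def Model.ω {d n : ℕ} (S : Model d n) (k : Space d) : ℝ := √(‖k‖ ^ 2 + S.mf ^ 2)

/-- The one-particle kinetic energy: `√(p² + M_j²)`, respectively `p² / (2 M_j)`. -/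
def Model.f {d n : ℕ} (S : Model d n) (j : Fin n) (p : Space d) : ℝ :=
  match S.kin with
  | .semiRelativistic => √(‖p‖ ^ 2 + S.M j ^ 2)
  | .nonRelativistic => ‖p‖ ^ 2 / (2 * S.M j)

/-- `G_x(k) = ∑_j χ(k)/√ω(k) e^{-2πi k·x_j}`. -/
def Model.G {d n : ℕ} (S : Model d n) (x : Config d n) (k : Space d) : ℂ :=
  ∑ j, ((S.χ k / √(S.ω k) : ℝ) : ℂ) *
    Complex.exp (-(2 * Real.pi * Complex.I * (⟪k, x.part j⟫_ℝ : ℝ)))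

/-- `Ĥ₀₁ = ∑_j f_j(p̂_j)`. -/
def Model.H01 {d n : ℕ} (S : Model d n) (ħ : ℝ) : Hilb d n →ₗ.[ℂ] Hilb d n :=
  momentumOp ħ fun p => ∑ j, S.f j (p.part j)

/-- The free field energy `Ĥ₀₂ = dΓ(ω)`. -/
def Model.H02 {d n : ℕ} (S : Model d n) (ħ : ℝ) : Hilb d n →ₗ.[ℂ] Hilb d n :=
  dGamma n ħ S.ω

/-- The Nelson Hamiltonian `Ĥ = Ĥ₀₁ + Ĥ₀₂ + V(q̂) + a(G) + a*(G)`, on the intersection of the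
domains of the summands. -/
def Model.H {d n : ℕ} (S : Model d n) (ħ : ℝ) : Hilb d n →ₗ.[ℂ] Hilb d n :=
  S.H01 ħ + S.H02 ħ + positionOp S.V + (annihilation ħ S.G + creation ħ S.G)

/-- `V ∈ C²_b`: twice continuously differentiable, bounded together with its derivatives up to
order two. -/
def IsCb2 {d n : ℕ} (V : Config d n → ℝ) : Prop :=
  ContDiff ℝ 2 V ∧ ∀ i ≤ 2, ∃ C : ℝ, ∀ x, ‖iteratedFDeriv ℝ i V x‖ ≤ C

/-! ### Unitary groups, traces and density matrices -/

section General

variable {E : Type*} [NormedAddCommGroup E] [InnerProductSpace ℂ E]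

/-- The value `⟨ψ, Aψ⟩ = ‖A^{1/2}ψ‖² ∈ [0, ∞]` of the closed quadratic form of a positive
self-adjoint operator `A` (it is `∞` if `ψ` is not in the form domain `D(A^{1/2})`). It is
expressed without the square root: as
`2 Re⟨ψ, Aφ⟩ - ⟨φ, Aφ⟩ = ‖A^{1/2}ψ‖² - ‖A^{1/2}(ψ - φ)‖²` for `ψ ∈ D(A^{1/2})` and
`D(A)` is a form core, it is the supremum of these numbers over `φ ∈ D(A)`. -/
def quadForm (A : E →ₗ.[ℂ] E) (ψ : E) : ℝ≥0∞ :=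
  ⨆ φ : A.domain,
    ENNReal.ofReal (2 * (⟪ψ, A φ⟫_ℂ).re - (⟪(φ : E), A φ⟫_ℂ).re)

/-- On the operator domain the quadratic form of a positive symmetric operator is `⟨ψ, Aψ⟩`. -/
theorem quadForm_of_mem_domain (A : E →ₗ.[ℂ] E)
    (hs : ∀ φ ψ : A.domain, ⟪A φ, (ψ : E)⟫_ℂ = ⟪(φ : E), A ψ⟫_ℂ)
    (hp : ∀ φ : A.domain, 0 ≤ (⟪(φ : E), A φ⟫_ℂ).re) (ψ : A.domain) :
    quadForm A ψ = ENNReal.ofReal (⟪(ψ : E), A ψ⟫_ℂ).re := by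
  apply le_antisymm
  · refine iSup_le fun φ => ENNReal.ofReal_le_ofReal ?_
    have h := hp (ψ - φ)
    have h1 : (⟪(φ : E), A ψ⟫_ℂ).re = (⟪(ψ : E), A φ⟫_ℂ).re := by
      rw [← hs, ← inner_conj_symm, Complex.conj_re]
    simp only [LinearPMap.map_sub, Submodule.coe_sub, inner_sub_left, inner_sub_right,
      Complex.sub_re, h1] at h
    linarith
  · refine le_iSup_of_le ψ (ENNReal.ofReal_le_ofReal ?_)
    linarith

/-- The trace `∑_i c(e_i)` over an orthonormal basis `(e_i)` as the supremum of the finite sums over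
orthonormal families; used for `c(e) = ⟨e, Te⟩` with a positive `T`. -/
def traceOf (c : E → ℝ≥0∞) : ℝ≥0∞ :=
  ⨆ s : {s : Finset E // Orthonormal ℂ ((↑) : s → E)}, ∑ e ∈ s.1, c e

variable [CompleteSpace E]

/-- `U(s) = e^{-isA}`: `U` is a strongly continuous one-parameter group of unitary operators whose
generator is exactly `-iA`, domain included. -/
structure IsUnitaryGroupOf (A : E →ₗ.[ℂ] E) (U : ℝ → E →L[ℂ] E) : Prop where
  mem_unitary : ∀ s, U s ∈ unitary (E →L[ℂ] E)
  map_zero : U 0 = 1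
  map_add : ∀ s t, U (s + t) = U s * U t
  continuous : ∀ ψ, Continuous fun s => U s ψ
  generator : ∀ ψ φ, (ψ, φ) ∈ A.graph ↔
    HasDerivAt (fun s => U s ψ) (-(Complex.I • φ)) 0

open Classical in
/-- The unitary group `s ↦ e^{-isA}` generated by `A`; by Stone's theorem it exists and is unique
when `A` is self-adjoint. The value is `1` if there is no such group. -/
def unitaryGroup (A : E →ₗ.[ℂ] E) : ℝ → E →L[ℂ] E :=
  if h : ∃ U, IsUnitaryGroupOf A U then h.choose else fun _ => 1

/-- A density matrix: a positive operator of trace one. -/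
def IsDensityMatrix (ρ : E →L[ℂ] E) : Prop :=
  ρ.IsPositive ∧ traceOf (fun e => ENNReal.ofReal (⟪e, ρ e⟫_ℂ).re) = 1

/-- `Tr[ρ A] = Tr[ρ^{1/2} A ρ^{1/2}] ∈ [0, ∞]` for a density matrix `ρ` and a positive
self-adjoint operator `A`. -/
def traceWith (ρ : E →L[ℂ] E) (A : E →ₗ.[ℂ] E) : ℝ≥0∞ :=
  traceOf fun e => quadForm A (CFC.sqrt ρ e)

end General

/-- `Tr[ρ dΓ(ω^{2σ})]`. -/
def Model.fieldTrace {d n : ℕ} (S : Model d n) (σ ħ : ℝ) (ρ : Hilb d n →L[ℂ] Hilb d n) :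
    ℝ≥0∞ :=
  traceWith ρ (dGamma n ħ fun k => S.ω k ^ (2 * σ))

/-- `Tr[ρ (q̂² + p̂²)]`, the sum `q̂² + p̂²` being understood in the sense of forms. -/
def particleTrace {d n : ℕ} (ħ : ℝ) (ρ : Hilb d n →L[ℂ] Hilb d n) : ℝ≥0∞ :=
  traceWith ρ (positionOp fun q => ‖q‖ ^ 2) + traceWith ρ (momentumOp ħ fun p => ‖p‖ ^ 2)

/-- `ρ(t) = e^{-itĤ/ħ} ρ e^{itĤ/ħ}`. -/
def Model.evolved {d n : ℕ} (S : Model d n) (ħ t : ℝ) (ρ : Hilb d n →L[ℂ] Hilb d n) :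
    Hilb d n →L[ℂ] Hilb d n :=
  unitaryGroup (S.H ħ) (t / ħ) * ρ * unitaryGroup (S.H ħ) (-(t / ħ))

/-- The interaction picture `ρ̃(t) = e^{itĤ₀₂/ħ} ρ(t) e^{-itĤ₀₂/ħ}`. -/
def Model.evolvedInt {d n : ℕ} (S : Model d n) (ħ t : ℝ) (ρ : Hilb d n →L[ℂ] Hilb d n) :
    Hilb d n →L[ℂ] Hilb d n :=
  unitaryGroup (S.H02 ħ) (-(t / ħ)) * S.evolved ħ t ρ * unitaryGroup (S.H02 ħ) (t / ħ)

end Nelson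

end

/-!
The moments grow at most exponentially because the relevant commutators with the Nelson Hamiltonian
`H` are bounded relative to the moments themselves. Since the operators are unbounded, each
commutator argument is carried out with bounded operators and estimates uniform in the cutoff, and
the moments enter through their closed quadratic forms `q_A(ψ) = ‖A^{1/2}ψ‖² ∈ [0, ∞]`.

*The evolution.* Domination by the particle number, `‖a(G)ψ‖ ≤ √ħ ‖G‖ ‖√(N+1) ψ‖`, makes the
interaction small relative to the free Hamiltonian, because `√(N+1) (H_free + il)⁻¹` tends to `0` in
norm as `|l| → ∞`. A Neumann series then shows that `H ± il` is onto (`Model.Admissible.isResolvable_H`).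
A symmetric operator with this property is self-adjoint (`IsResolvable.isSelfAdjoint`), and its
unitary group is the strong limit of the groups generated by commuting bounded approximants
(`IsResolvable.isUnitaryGroupOf`).

*Forms as suprema.* For each of `q̂²`, `p̂²`, `dΓ(w)` the form is the supremum over `ε > 0` of the forms
of the bounded Yosida approximations `A (1 + εA)⁻¹` (`IsYosida.ofReal_inner_le_quadForm`,
`IsYosida.quadForm_le`), so bounds uniform in `ε` suffice.

*The field energy.* Only `a(G)` and `a*(G)` fail to commute with `A = dΓ(ω^{2σ})`. The increment of
`s ↦ s / (1 + εs)` from `s` to `s + a` splits as a product of square roots, one of which is absorbed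
by the Yosida approximation of `A`, which gives a commutator of the order of
`ħ ‖ω^{σ-1/2} χ‖ ⟨ψ, A_ε ψ⟩^{1/2} ‖ψ‖` uniformly in `ε` (`Weight.norm_commutator_annOp_le`). The norm is
finite because `σ ≤ 1`. The inequality of Gronwall (`IsUnitaryGroupOf.expectation_le`) then bounds the
form of `A` along the evolution, the factor `ħ` cancelling the `1/ħ` in front of the time. As
`ω ≥ m_f`, this also controls `ħN`.

*The particles.* In place of `p̂` and `q̂` one uses the unitary groups that they generate. Translations
of the particles commute with the free Hamiltonian, and their commutator with the rest of `H` is of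
first order in the displacement, because `V` and `x ↦ G_x` are Lipschitz continuous
(`Model.Admissible.exists_translate_mem_graph`); the second one because `|k| |χ| ω^{-1/2} ≤ |χ| ω^{1/2}`
is square integrable. Modulations by a plane wave commute with everything except the kinetic energy,
whose increment under a momentum shift `h` is of order `ħ |h| (1 + |p|)`
(`Model.Admissible.exists_modulate_mem_graph`). Duhamel estimates bound the difference quotients
`‖(T_h - 1) e^{-isH} ψ‖ / |h|`: for translations in terms of the kinetic moment and the field energy of
`ψ`, for modulations in terms of all three moments. A bound on the difference quotients uniform in
`h` is a bound on the second moment (`moment_le`). The estimates are made on the domain of `H` and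
transferred to all vectors by a family of contractions into the domain that do not increase the
moments (`Model.Admissible.smoothing`).

*The interaction picture and traces.* The free field evolution commutes with the resolvents of all
three operators and so does not increase their forms. Finally
`Tr[WρW* A] = Tr[(Wρ^{1/2})* A (Wρ^{1/2})]` for unitary `W` turns the bounds on forms into bounds on
traces (`traceWith_conj_le`). All bounds are polynomial in `t` or exponential with a universal rate, so
that the rate `C = 3` serves every model.
-/

noncomputable section

namespace Nelson

open Filter Topology

/-! ### Bounded self-adjoint operators and their exponentials -/

section Stone

variable {E : Type*} [NormedAddCommGroup E] [InnerProductSpace ℂ E]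

variable {A : E →ₗ.[ℂ] E}

theorem graph_unique {ψ φ φ' : E} (h : (ψ, φ) ∈ A.graph) (h' : (ψ, φ') ∈ A.graph) : φ = φ' := by
  have h2 := A.graph.sub_mem h h'
  simp only [Prod.mk_sub_mk, sub_self] at h2
  exact sub_eq_zero.1 (A.graph_fst_eq_zero_snd h2 rfl)

theorem mem_domain_iff_exists_graph {ψ : E} : ψ ∈ A.domain ↔ ∃ φ, (ψ, φ) ∈ A.graph :=
  ⟨fun h => ⟨A ⟨ψ, h⟩, A.mem_graph ⟨ψ, h⟩⟩, fun ⟨_, h⟩ => A.mem_domain_of_mem_graph h⟩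

/-- If the derivative of `f` has norm at most `c` on the segment from `0` to `s`, then
`‖f s - f 0‖ ≤ c |s|`. -/
theorem norm_sub_zero_le_of_norm_deriv_le {F : Type*} [NormedAddCommGroup F] [NormedSpace ℝ F]
    {f f' : ℝ → F} {c s : ℝ} (hf : ∀ r, HasDerivAt f (f' r) r)
    (hc : ∀ r, |r| ≤ |s| → ‖f' r‖ ≤ c) : ‖f s - f 0‖ ≤ c * |s| := by
  have h := (convex_uIcc (0 : ℝ) s).norm_image_sub_le_of_norm_hasDerivWithin_le (f := f)
    (f' := f') (C := c) (fun r _ => (hf r).hasDerivWithinAt)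
    (fun r hr => hc r (by simpa using abs_sub_left_of_mem_uIcc hr)) left_mem_uIcc right_mem_uIcc
  simpa using h

/-- Pythagoras: `‖(A + il)ψ‖² = ‖Aψ‖² + l²‖ψ‖²` for symmetric `A`. -/
theorem norm_sq_add_I_smul {u v : E} (h : ⟪v, u⟫_ℂ = ⟪u, v⟫_ℂ) (l : ℝ) :
    ‖v + (l * Complex.I : ℂ) • u‖ ^ 2 = ‖v‖ ^ 2 + l ^ 2 * ‖u‖ ^ 2 := by
  have h0 : (⟪u, v⟫_ℂ).im = 0 := by
    rw [← inner_conj_symm] at h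
    exact Complex.conj_eq_iff_im.1 h
  rw [@norm_add_sq ℂ, inner_smul_right, h]
  have : RCLike.re ((l * Complex.I : ℂ) * ⟪u, v⟫_ℂ) = 0 := by simp [h0]
  rw [this, norm_smul]
  simp [mul_pow]

variable [CompleteSpace E]

/-- The exponential `e^{-isa}` of a bounded operator `a`. -/
def expGroup (a : E →L[ℂ] E) (s : ℝ) : E →L[ℂ] E :=
  NormedSpace.exp (s • (-(Complex.I • a)))

theorem expGroup_zero (a : E →L[ℂ] E) : expGroup a 0 = 1 := by
  simp [expGroup]

theorem expGroup_add (a : E →L[ℂ] E) (s t : ℝ) :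
    expGroup a (s + t) = expGroup a s * expGroup a t := by
  let +nondep : NormedAlgebra ℚ (E →L[ℂ] E) := .restrictScalars ℚ ℂ _
  rw [expGroup, add_smul]
  exact NormedSpace.exp_add_of_commute (((Commute.refl _).smul_left s).smul_right t)

theorem expGroup_sub_mul {a b : E →L[ℂ] E} (h : Commute a b) (s : ℝ) :
    expGroup b s * expGroup (a - b) s = expGroup a s := by
  let +nondep : NormedAlgebra ℚ (E →L[ℂ] E) := .restrictScalars ℚ ℂ _
  have hc : Commute b (a - b) := h.symm.sub_right (Commute.refl b)
  rw [expGroup, expGroup, expGroup, ← NormedSpace.exp_add_of_commute]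
  · congr 1
    rw [← smul_add, ← neg_add, ← smul_add]; simp
  · exact ((((hc.smul_left Complex.I).smul_right Complex.I).neg_left.neg_right).smul_left
      s).smul_right s

theorem expGroup_mem_unitary {a : E →L[ℂ] E} (ha : IsSelfAdjoint a) (s : ℝ) :
    expGroup a s ∈ unitary (E →L[ℂ] E) := by
  let +nondep : NormedAlgebra ℚ (E →L[ℂ] E) := .restrictScalars ℚ ℂ _
  apply NormedSpace.exp_mem_unitary_of_mem_skewAdjoint
  rw [skewAdjoint.mem_iff]
  simp [ha.star_eq, star_smul]

theorem norm_apply_of_mem_unitary {U : E →L[ℂ] E} (h : U ∈ unitary (E →L[ℂ] E)) (ψ : E) :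
    ‖U ψ‖ = ‖ψ‖ :=
  ((ContinuousLinearMap.norm_map_iff_adjoint_comp_self U).2 (Unitary.mem_iff.1 h).1) ψ

theorem hasDerivAt_expGroup (a : E →L[ℂ] E) (ψ : E) (s : ℝ) :
    HasDerivAt (fun r => expGroup a r ψ) (expGroup a s (-(Complex.I • a ψ))) s := by
  have h := hasDerivAt_exp_smul_const (𝕂 := ℝ) (-(Complex.I • a)) s
  have h2 := ((ContinuousLinearMap.apply ℂ E ψ).restrictScalars ℝ).hasFDerivAt.comp_hasDerivAt s h
  simpa [expGroup, Function.comp_def] using h2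

theorem norm_expGroup_sub_le {a : E →L[ℂ] E} (ha : IsSelfAdjoint a) (ψ : E) (s : ℝ) :
    ‖expGroup a s ψ - ψ‖ ≤ |s| * ‖a ψ‖ := by
  have h := norm_sub_zero_le_of_norm_deriv_le (s := s) (c := ‖a ψ‖)
    (fun r => hasDerivAt_expGroup a ψ r) (fun r _ => by
      rw [norm_apply_of_mem_unitary (expGroup_mem_unitary ha r)]
      simp [norm_smul])
  rw [expGroup_zero, mul_comm] at h
  exact h

theorem norm_expGroup_sub_expGroup_le {a b : E →L[ℂ] E} (ha : IsSelfAdjoint a)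
    (hb : IsSelfAdjoint b) (h : Commute a b) (ψ : E) (s : ℝ) :
    ‖expGroup a s ψ - expGroup b s ψ‖ ≤ |s| * ‖a ψ - b ψ‖ := by
  have h1 : expGroup a s ψ - expGroup b s ψ = expGroup b s (expGroup (a - b) s ψ - ψ) := by
    rw [map_sub, ← expGroup_sub_mul h]; rfl
  rw [h1, norm_apply_of_mem_unitary (expGroup_mem_unitary hb s)]
  exact norm_expGroup_sub_le (ha.sub hb) ψ s

/-- The remainder in the first-order expansion of `e^{-isa}ψ`. The vector `v` is a stand-in for `aψ` on
which `a` stays bounded, so that the estimate is uniform along bounded approximants of an unbounded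
operator. -/
theorem norm_expGroup_sub_sub_le {a : E →L[ℂ] E} (ha : IsSelfAdjoint a) (ψ v : E) (s : ℝ) :
    ‖expGroup a s ψ - ψ + (s : ℂ) • Complex.I • a ψ‖ ≤
      |s| * (|s| * ‖a v‖ + 2 * ‖a ψ - v‖) := by
  have hd : ∀ r, HasDerivAt (fun r : ℝ => expGroup a r ψ - ψ + (r : ℂ) • Complex.I • a ψ)
      (expGroup a r (-(Complex.I • a ψ)) + Complex.I • a ψ) r := by
    intro r
    have h1 : HasDerivAt (fun r : ℝ => (r : ℂ) • Complex.I • a ψ) ((1 : ℂ) • Complex.I • a ψ) r :=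
      (Complex.ofRealCLM.hasDerivAt (x := r)).smul_const _
    have h2 := ((hasDerivAt_expGroup a ψ r).sub_const ψ).add h1
    rw [one_smul] at h2
    exact h2
  have h := norm_sub_zero_le_of_norm_deriv_le (s := s) (c := |s| * ‖a v‖ + 2 * ‖a ψ - v‖)
    hd (fun r hr => by
      have e : expGroup a r (-(Complex.I • a ψ)) + Complex.I • a ψ =
          -(Complex.I • ((expGroup a r v - v) + (expGroup a r (a ψ - v) - (a ψ - v)))) := by
        simp only [map_neg, map_smul, map_sub]
        module
      rw [e, norm_neg, norm_smul, Complex.norm_I, one_mul]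
      refine (norm_add_le _ _).trans (add_le_add ?_ ?_)
      · exact (norm_expGroup_sub_le ha v r).trans (by gcongr)
      · refine (norm_sub_le _ _).trans ?_
        rw [norm_apply_of_mem_unitary (expGroup_mem_unitary ha r)]
        linarith)
  rw [expGroup_zero, mul_comm] at h
  simpa using h

/-! ### Symmetric operators with surjective `A + iλ`, and Stone's theorem -/

/-- A symmetric operator `A` for which `A + iλ` is onto for all real `λ` of large modulus. These
are exactly the self-adjoint operators. -/
structure IsResolvable (A : E →ₗ.[ℂ] E) : Prop where
  symm : ∀ z ∈ A.graph, ∀ y ∈ A.graph, ⟪z.2, y.1⟫_ℂ = ⟪z.1, y.2⟫_ℂ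
  surj : ∃ l₀ : ℝ, ∀ l : ℝ, l₀ ≤ |l| → ∀ φ, ∃ z ∈ A.graph, z.2 + (l * Complex.I : ℂ) • z.1 = φ

/-- The resolvent `(A + il)⁻¹`, together with its basic properties. -/
theorem IsResolvable.exists_resolvent (hA : IsResolvable A) : ∃ l₀ : ℝ, 0 < l₀ ∧ ∀ l : ℝ,
    l₀ ≤ |l| → ∃ R : E →L[ℂ] E, (∀ φ, (R φ, φ - (l * Complex.I : ℂ) • R φ) ∈ A.graph) ∧
      (∀ z ∈ A.graph, R (z.2 + (l * Complex.I : ℂ) • z.1) = z.1) ∧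
      ∀ φ, |l| * ‖R φ‖ ≤ ‖φ‖ := by
  obtain ⟨l₀, h⟩ := hA.surj
  refine ⟨max l₀ 1, by positivity, fun l hl => ?_⟩
  have hl0 : l₀ ≤ |l| := (le_max_left _ _).trans hl
  have hl1 : 0 < |l| := lt_of_lt_of_le one_pos ((le_max_right _ _).trans hl)
  choose z hz hz2 using h l hl0
  -- `A + il` is bounded below by `|l|`, hence injective, and its inverse has norm at most `1 /
  -- |l|`.
  have hb : ∀ y ∈ A.graph, |l| * ‖y.1‖ ≤ ‖y.2 + (l * Complex.I : ℂ) • y.1‖ := by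
    intro y hy
    refine (pow_le_pow_iff_left₀ (by positivity) (norm_nonneg _) two_ne_zero).1 ?_
    rw [norm_sq_add_I_smul (hA.symm y hy y hy), mul_pow, sq_abs]
    nlinarith [sq_nonneg ‖y.2‖]
  have hinj : ∀ y ∈ A.graph, ∀ y' ∈ A.graph,
      y.2 + (l * Complex.I : ℂ) • y.1 = y'.2 + (l * Complex.I : ℂ) • y'.1 → y.1 = y'.1 := by
    intro y hy y' hy' he
    have h1 := hb (y - y') (A.graph.sub_mem hy hy')
    have h2 : (y - y').2 + (l * Complex.I : ℂ) • (y - y').1 = 0 := by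
      rw [Prod.fst_sub, Prod.snd_sub, smul_sub, ← sub_eq_zero.2 he]; abel
    rw [h2, norm_zero] at h1
    have h3 : ‖(y - y').1‖ = 0 := le_antisymm (by
      by_contra! hc; nlinarith [mul_pos hl1 hc]) (norm_nonneg _)
    exact sub_eq_zero.1 (norm_eq_zero.1 h3)
  let R₀ : E →ₗ[ℂ] E :=
    { toFun := fun φ => (z φ).1
      map_add' := fun φ φ' => by
        refine hinj _ (hz _) (z φ + z φ') (A.graph.add_mem (hz _) (hz _)) ?_
        rw [hz2, Prod.fst_add, Prod.snd_add, smul_add, add_add_add_comm, hz2, hz2]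
      map_smul' := fun c φ => by
        refine hinj _ (hz _) (c • z φ) (A.graph.smul_mem c (hz _)) ?_
        rw [hz2, Prod.smul_fst, Prod.smul_snd, smul_comm, ← smul_add, hz2] }
  have hR : ∀ φ, |l| * ‖R₀ φ‖ ≤ ‖φ‖ := fun φ => by
    have := hb _ (hz φ); rwa [hz2] at this
  refine ⟨R₀.mkContinuous (|l|⁻¹) fun φ => ?_, fun φ => ?_, fun y hy => ?_, hR⟩
  · rw [inv_mul_eq_div, le_div_iff₀ hl1, mul_comm]; exact hR φ
  · have e : (R₀ φ, φ - (l * Complex.I : ℂ) • R₀ φ) = z φ := by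
      refine Prod.ext rfl ?_
      change φ - (l * Complex.I : ℂ) • (z φ).1 = (z φ).2
      nth_rewrite 1 [← hz2 φ]
      abel
    change (R₀ φ, φ - (l * Complex.I : ℂ) • R₀ φ) ∈ A.graph
    rw [e]; exact hz φ
  · exact hinj _ (hz _) y hy (hz2 _)

/-- A vector `v` orthogonal to the domain satisfies `⟪v, Rv⟫ = 0`; symmetry then forces `Rv = 0`,
and `v = (A + il)Rv = 0`. -/
theorem IsResolvable.dense_domain (hA : IsResolvable A) : Dense (A.domain : Set E) := by
  rw [Submodule.dense_iff_topologicalClosure_eq_top, Submodule.topologicalClosure_eq_top_iff,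
    Submodule.eq_bot_iff]
  intro v hv
  obtain ⟨l, hl, hR⟩ := hA.exists_resolvent
  obtain ⟨R, hR1, -, -⟩ := hR l (le_abs_self l)
  have h1 := (Submodule.mem_orthogonal _ _).1 hv (R v) (A.mem_domain_of_mem_graph (hR1 v))
  have h2 := hA.symm _ (hR1 v) _ (hR1 v)
  simp only [inner_sub_left, inner_sub_right, inner_smul_left, inner_smul_right, h1] at h2
  rw [← inner_conj_symm, h1] at h2
  simp only [map_mul, Complex.conj_I, Complex.conj_ofReal, map_zero] at h2
  -- Symmetry at `Rv` says that `⟪ARv, Rv⟫` is real, while `ARv = v - il Rv` makes it `il‖Rv‖²`.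
  have h6 : (l * Complex.I : ℂ) * ⟪R v, R v⟫_ℂ = 0 := by linear_combination h2 / 2
  have h7 : R v = 0 := by
    rcases mul_eq_zero.1 h6 with h | h
    · exact absurd h (by simp [hl.ne'])
    · exact inner_self_eq_zero.1 h
  have h8 := hR1 v
  rw [h7, smul_zero, sub_zero] at h8
  exact A.graph_fst_eq_zero_snd h8 rfl

/-- For `y` in the domain of `A*`, the vector `u = R(A*y + ily)` lies in the domain of `A`, and `y -
u` is orthogonal to the range of `A - il`, which is everything. -/
theorem IsResolvable.isSelfAdjoint (hA : IsResolvable A) : IsSelfAdjoint A := by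
  have hd := hA.dense_domain
  rw [LinearPMap.isSelfAdjoint_def]
  have hform : A.IsFormalAdjoint A := fun x y =>
    hA.symm _ (A.mem_graph x) _ (A.mem_graph y)
  refine le_antisymm ?_ (hform.le_adjoint hd)
  obtain ⟨l, hl, hR⟩ := hA.exists_resolvent
  obtain ⟨R, hR1, -, -⟩ := hR l (le_abs_self l)
  obtain ⟨R', hR1', -, -⟩ := hR (-l) (by rw [abs_neg]; exact le_abs_self l)
  have key : ∀ (y : A.adjoint.domain), ((y : E), A.adjoint y) ∈ A.graph := by
    intro y
    have hadj : ∀ z ∈ A.graph, ⟪A.adjoint y, z.1⟫_ℂ = ⟪(y : E), z.2⟫_ℂ := by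
      intro z hz
      obtain ⟨x, hx1, hx2⟩ := (LinearPMap.mem_graph_iff A).1 hz
      rw [← hx1, ← hx2]
      exact LinearPMap.adjoint_isFormalAdjoint hd y x
    have h1 := hR1 (A.adjoint y + (l * Complex.I : ℂ) • (y : E))
    set u := R (A.adjoint y + (l * Complex.I : ℂ) • (y : E)) with hu
    have h2 : (y : E) - u = 0 := by
      -- Write `y - u = (A - il)w` and pair it with `y - u`.
      have h3 := hR1' ((y : E) - u)
      set w := R' ((y : E) - u)
      have h4 := hadj _ h3
      have h5 := hA.symm _ h1 _ h3
      simp only [inner_sub_left, inner_sub_right, inner_smul_left, inner_smul_right, inner_add_left]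
        at h4 h5
      have h6 : ⟪(y : E) - u, (y : E) - u⟫_ℂ = 0 := by
        simp only [inner_sub_left, inner_sub_right]
        simp only [map_mul, Complex.conj_I, Complex.conj_ofReal, Complex.ofReal_neg] at h4 h5
        linear_combination h5 - h4
      exact inner_self_eq_zero.1 h6
    have h7 : (y : E) = u := sub_eq_zero.1 h2
    rw [← h7] at h1
    simpa using h1
  constructor
  · intro y hy
    exact A.mem_domain_of_mem_graph (key ⟨y, hy⟩)
  · intro y x hyx
    have h1 := key y
    have h2 := A.mem_graph x
    rw [← hyx] at h2
    exact graph_unique h1 h2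

end Stone

section Stone

variable {E : Type*} [NormedAddCommGroup E] [InnerProductSpace ℂ E] {A : E →ₗ.[ℂ] E}

/-- Contractions that converge strongly to the identity on a dense set do so everywhere. -/
theorem tendsto_of_tendsto_on_dense {ι : Type*} {l : Filter ι} {T : ι → E →L[ℂ] E} {D : Set E}
    (hD : Dense D) (hT : ∀ᶠ i in l, ∀ x, ‖T i x‖ ≤ ‖x‖)
    (h : ∀ x ∈ D, Tendsto (fun i => T i x) l (𝓝 x)) (x : E) :
    Tendsto (fun i => T i x) l (𝓝 x) := by
  rw [Metric.tendsto_nhds]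
  intro ε hε
  obtain ⟨y, hy, hxy⟩ := hD.exists_dist_lt x (by positivity : 0 < ε / 3)
  filter_upwards [hT, Metric.tendsto_nhds.1 (h y hy) (ε / 3) (by positivity)] with i hi hyi
  have h1 : dist (T i x) (T i y) ≤ dist x y := by
    rw [dist_eq_norm, dist_eq_norm, ← map_sub]; exact hi _
  calc dist (T i x) x ≤ dist (T i x) (T i y) + dist (T i y) y + dist y x := dist_triangle4 _ _ _ _
    _ < ε := by rw [dist_comm y x]; linarith

/-- The resolvents at `il` and `-il` are adjoint to each other. -/
theorem inner_resolvent (hA : IsResolvable A) {l : ℝ} {R R' : E →L[ℂ] E}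
    (hR : ∀ φ, (R φ, φ - (l * Complex.I : ℂ) • R φ) ∈ A.graph)
    (hR' : ∀ φ, (R' φ, φ - ((-l : ℝ) * Complex.I : ℂ) • R' φ) ∈ A.graph) (φ χ : E) :
    ⟪R φ, χ⟫_ℂ = ⟪φ, R' χ⟫_ℂ := by
  have h := hA.symm _ (hR φ) _ (hR' χ)
  simp only [inner_sub_left, inner_sub_right, inner_smul_left, inner_smul_right, map_mul,
    Complex.conj_I, Complex.conj_ofReal, Complex.ofReal_neg] at h
  linear_combination -h

/-- Two resolvents commute, by the resolvent identity. -/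
theorem commute_resolvent {l m : ℝ} {R Q : E →L[ℂ] E}
    (hR : ∀ φ, (R φ, φ - (l * Complex.I : ℂ) • R φ) ∈ A.graph)
    (hR' : ∀ z ∈ A.graph, R (z.2 + (l * Complex.I : ℂ) • z.1) = z.1)
    (hQ : ∀ φ, (Q φ, φ - (m * Complex.I : ℂ) • Q φ) ∈ A.graph)
    (hQ' : ∀ z ∈ A.graph, Q (z.2 + (m * Complex.I : ℂ) • z.1) = z.1) : Commute R Q := by
  ext φ
  change R (Q φ) = Q (R φ)
  have h1 := hR' _ (hQ φ)
  have h2 := hQ' _ (hR φ)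
  simp only [map_add, map_sub, map_smul] at h1 h2
  by_cases hlm : l = m
  · subst hlm
    have e : ∀ χ, R χ = Q χ := fun χ => by
      have := hR' _ (hQ χ)
      simpa using this
    rw [e, e]
  -- `RQ` and `QR` both equal `(Q - R) / (il - im)`.
  · have h3 : ((l - m : ℂ) * Complex.I) • (R (Q φ) - Q (R φ)) = 0 := by
      linear_combination (norm := module) h1 + h2
    have h4 : ((l - m : ℂ) * Complex.I) ≠ 0 := by
      refine mul_ne_zero ?_ Complex.I_ne_zero
      rw [← Complex.ofReal_sub]
      exact_mod_cast sub_ne_zero.2 hlm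
    exact sub_eq_zero.1 ((smul_eq_zero.1 h3).resolve_left h4)

variable [CompleteSpace E]

/-- The resolvents at `±i l` with `l = l₀, l₀ + 1, …`, packaged as sequences. -/
theorem IsResolvable.exists_resolvent_seq (hA : IsResolvable A) :
    ∃ (l : ℕ → ℝ) (R R' : ℕ → E →L[ℂ] E), Tendsto l atTop atTop ∧ (∀ n, 0 < l n) ∧
      (∀ n φ, (R n φ, φ - (l n * Complex.I : ℂ) • R n φ) ∈ A.graph) ∧
      (∀ n, ∀ z ∈ A.graph, R n (z.2 + (l n * Complex.I : ℂ) • z.1) = z.1) ∧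
      (∀ n φ, l n * ‖R n φ‖ ≤ ‖φ‖) ∧
      (∀ n φ, (R' n φ, φ - ((-l n : ℝ) * Complex.I : ℂ) • R' n φ) ∈ A.graph) ∧
      (∀ n, ∀ z ∈ A.graph, R' n (z.2 + ((-l n : ℝ) * Complex.I : ℂ) • z.1) = z.1) ∧
      (∀ n φ, l n * ‖R' n φ‖ ≤ ‖φ‖) ∧
      (∀ φ, Tendsto (fun n => (l n * Complex.I : ℂ) • R n φ) atTop (𝓝 φ)) ∧
      (∀ φ, Tendsto (fun n => ((-l n : ℝ) * Complex.I : ℂ) • R' n φ) atTop (𝓝 φ)) := by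
  obtain ⟨l₀, hl₀, h⟩ := hA.exists_resolvent
  have hp : ∀ n : ℕ, 0 < l₀ + n := fun n => by positivity
  choose R hR1 hR2 hR3 using fun n : ℕ => h (l₀ + n) (by rw [abs_of_pos (hp n)]; simp)
  choose R' hR1' hR2' hR3' using fun n : ℕ => h (-(l₀ + n)) (by
    rw [abs_neg, abs_of_pos (hp n)]; simp)
  simp only [abs_neg, fun n => abs_of_pos (hp n)] at hR3 hR3'
  have hl : Tendsto (fun n : ℕ => l₀ + n) atTop atTop :=
    tendsto_atTop_add_const_left _ _ tendsto_natCast_atTop_atTop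
  have key : ∀ (Q : ℕ → E →L[ℂ] E) (m : ℕ → ℝ), (∀ n, |m n| = l₀ + n) →
      (∀ n, ∀ z ∈ A.graph, Q n (z.2 + (m n * Complex.I : ℂ) • z.1) = z.1) →
      (∀ n φ, (l₀ + n) * ‖Q n φ‖ ≤ ‖φ‖) →
      ∀ φ, Tendsto (fun n => (m n * Complex.I : ℂ) • Q n φ) atTop (𝓝 φ) := by
    intro Q m hm h1 h2
    refine tendsto_of_tendsto_on_dense (T := fun n => (m n * Complex.I : ℂ) • Q n)
      hA.dense_domain (Eventually.of_forall fun n x => ?_) fun ψ hψ => ?_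
    · have e : ‖(m n * Complex.I : ℂ)‖ = l₀ + n := by simp [hm]
      rw [smul_apply, norm_smul, e]; exact h2 n x
    · obtain ⟨φ, hφ⟩ := mem_domain_iff_exists_graph.1 hψ
      rw [tendsto_iff_norm_sub_tendsto_zero]
      refine squeeze_zero (fun _ => norm_nonneg _) (g := fun n : ℕ => ‖φ‖ / (l₀ + n))
        (fun n => ?_) (tendsto_const_nhds.div_atTop hl)
      have h3 := h1 n _ hφ
      simp only [map_add, map_smul] at h3
      rw [smul_apply]
      have h4 : (m n * Complex.I : ℂ) • Q n ψ - ψ = -Q n φ := by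
        nth_rewrite 2 [← h3]; abel
      rw [h4, norm_neg, le_div_iff₀ (hp n), mul_comm]; exact h2 n φ
  refine ⟨fun n => l₀ + n, R, R', hl, hp, hR1, hR2, hR3, hR1', hR2', hR3', ?_, ?_⟩
  · exact key R _ (fun n => abs_of_pos (hp n)) hR2 hR3
  · exact key R' (fun n => -(l₀ + n)) (fun n => by rw [abs_neg, abs_of_pos (hp n)]) hR2' hR3'

/-- Bounded, mutually commuting self-adjoint operators that approximate `A` on its domain:
`A_n = A l_n² (A² + l_n²)⁻¹`. -/
theorem IsResolvable.exists_approx (hA : IsResolvable A) :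
    ∃ a : ℕ → E →L[ℂ] E, (∀ n, IsSelfAdjoint (a n)) ∧ (∀ n m, Commute (a n) (a m)) ∧
      ∀ z ∈ A.graph, Tendsto (fun n => a n z.1) atTop (𝓝 z.2) := by
  obtain ⟨l, R, R', -, hl, h1, h2, -, h1', h2', -, ht, ht'⟩ := hA.exists_resolvent_seq
  -- `A l² (A² + l²)⁻¹` is `l²/2` times the sum of the resolvents `(A + il)⁻¹` and `(A - il)⁻¹`.
  refine ⟨fun n => ((l n ^ 2 / 2 : ℝ) : ℂ) • (R n + R' n), fun n => ?_, fun n m => ?_,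
    fun z hz => ?_⟩
  · refine IsSelfAdjoint.smul (Complex.conj_ofReal _) ?_
    rw [ContinuousLinearMap.isSelfAdjoint_iff_isSymmetric]
    intro x y
    have e1 := inner_resolvent hA (h1 n) (h1' n)
    have e2 : ∀ φ χ : E, ⟪R' n φ, χ⟫_ℂ = ⟪φ, R n χ⟫_ℂ := fun φ χ => by
      rw [← inner_conj_symm, ← e1, inner_conj_symm]
    change ⟪R n x + R' n x, y⟫_ℂ = ⟪x, R n y + R' n y⟫_ℂ
    rw [inner_add_left, inner_add_right, e1, e2, add_comm]
  · refine Commute.smul_left (Commute.smul_right ?_ _) _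
    refine Commute.add_left (Commute.add_right ?_ ?_) (Commute.add_right ?_ ?_)
    · exact commute_resolvent (h1 n) (h2 n) (h1 m) (h2 m)
    · exact commute_resolvent (h1 n) (h2 n) (h1' m) (h2' m)
    · exact commute_resolvent (h1' n) (h2' n) (h1 m) (h2 m)
    · exact commute_resolvent (h1' n) (h2' n) (h1' m) (h2' m)
  -- On the domain, `A_n ψ` is the mean of `il (A + il)⁻¹ Aψ` and `-il (A - il)⁻¹ Aψ`, which tend to `Aψ`.
  · have e : ∀ n, (((l n ^ 2 / 2 : ℝ) : ℂ) • (R n + R' n)) z.1 =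
        (2⁻¹ : ℂ) • ((l n * Complex.I : ℂ) • R n z.2 +
          ((-l n : ℝ) * Complex.I : ℂ) • R' n z.2) := by
      intro n
      have e1 := h2 n z hz
      have e2 := h2' n z hz
      simp only [map_add, map_smul] at e1 e2
      have e3 : R n z.2 = z.1 - (l n * Complex.I : ℂ) • R n z.1 := by
        linear_combination (norm := module) e1
      have e4 : R' n z.2 = z.1 - ((-l n : ℝ) * Complex.I : ℂ) • R' n z.1 := by
        linear_combination (norm := module) e2
      rw [e3, e4, smul_apply, add_apply]
      have hI : Complex.I * Complex.I = -1 := Complex.I_mul_I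
      simp only [smul_sub, smul_add, smul_smul]
      have c1 : (2⁻¹ : ℂ) * (l n * Complex.I * (l n * Complex.I)) = -((l n ^ 2 / 2 : ℝ) : ℂ) := by
        push_cast; linear_combination (2⁻¹ * l n ^ 2 : ℂ) * hI
      have c2 : (2⁻¹ : ℂ) * ((-l n : ℝ) * Complex.I * ((-l n : ℝ) * Complex.I)) =
          -((l n ^ 2 / 2 : ℝ) : ℂ) := by
        push_cast; linear_combination (2⁻¹ * l n ^ 2 : ℂ) * hI
      rw [c1, c2]; push_cast; module
    simp only [e]
    have h3 := ((ht z.2).add (ht' z.2)).const_smul (2⁻¹ : ℂ)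
    convert h3 using 2
    module

/-- The existence half of the theorem of Stone: `e^{-isA}` is the strong limit of the groups of the
bounded approximants `A_n`. -/
theorem IsResolvable.exists_isUnitaryGroupOf (hA : IsResolvable A) :
    ∃ U, IsUnitaryGroupOf A U := by
  obtain ⟨a, ha, hc, hlim⟩ := hA.exists_approx
  have hD := hA.dense_domain
  have hn : ∀ n s ψ, ‖expGroup (a n) s ψ‖ = ‖ψ‖ := fun n s ψ =>
    norm_apply_of_mem_unitary (expGroup_mem_unitary (ha n) s) ψ
  -- Since the approximants commute, `e^{-isA_n} - e^{-isA_m}` is bounded by `|s| ‖A_n ψ - A_m ψ‖`,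
  -- which controls the sequence on the domain; unitarity extends this to all vectors.
  have hcauchy : ∀ s ψ, CauchySeq fun n => expGroup (a n) s ψ := by
    intro s ψ
    rw [Metric.cauchySeq_iff']
    intro ε hε
    obtain ⟨v, hv, hψv⟩ := hD.exists_dist_lt ψ (by positivity : 0 < ε / 4)
    obtain ⟨φ, hφ⟩ := mem_domain_iff_exists_graph.1 hv
    obtain ⟨N, hN⟩ := Metric.cauchySeq_iff'.1 (hlim _ hφ).cauchySeq (ε / (2 * (|s| + 1)))
      (by positivity)
    refine ⟨N, fun n hnN => ?_⟩
    have h1 : dist (expGroup (a n) s v) (expGroup (a N) s v) < ε / 2 := by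
      rw [dist_eq_norm]
      refine (norm_expGroup_sub_expGroup_le (ha n) (ha N) (hc n N) v s).trans_lt ?_
      have h2 := hN n hnN
      rw [dist_eq_norm] at h2
      have h3 : |s| * ‖a n v - a N v‖ ≤ (|s| + 1) * ‖a n v - a N v‖ := by
        gcongr; linarith
      refine h3.trans_lt ?_
      calc _ < (|s| + 1) * (ε / (2 * (|s| + 1))) := by gcongr
        _ = ε / 2 := by field_simp
    have h2 : ∀ k, dist (expGroup (a k) s ψ) (expGroup (a k) s v) < ε / 4 := fun k => by
      rw [dist_eq_norm, ← map_sub, hn, ← dist_eq_norm]; exact hψv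
    calc _ ≤ dist (expGroup (a n) s ψ) (expGroup (a n) s v) +
          dist (expGroup (a n) s v) (expGroup (a N) s v) +
          dist (expGroup (a N) s v) (expGroup (a N) s ψ) := dist_triangle4 _ _ _ _
      _ < ε := by
        have := h2 N
        rw [dist_comm] at this
        linarith [h2 n]
  choose u hu using fun s ψ => cauchySeq_tendsto_of_complete (hcauchy s ψ)
  let U : ℝ → E →L[ℂ] E := fun s =>
    continuousLinearMapOfTendsto (fun n => expGroup (a n) s) (tendsto_pi_nhds.2 (hu s))
  have hU : ∀ s ψ, Tendsto (fun n => expGroup (a n) s ψ) atTop (𝓝 (U s ψ)) := hu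
  have hUn : ∀ s ψ, ‖U s ψ‖ = ‖ψ‖ := fun s ψ =>
    tendsto_nhds_unique (hU s ψ).norm (by simp only [hn]; exact tendsto_const_nhds)
  have hU0 : U 0 = 1 := by
    ext ψ
    refine tendsto_nhds_unique (hU 0 ψ) ?_
    simp only [expGroup_zero]; exact tendsto_const_nhds
  have hUadd : ∀ s t, U (s + t) = U s * U t := by
    intro s t
    ext ψ
    refine tendsto_nhds_unique (hU (s + t) ψ) ?_
    have h1 := hU s (U t ψ)
    have h2 : Tendsto (fun n => expGroup (a n) s (expGroup (a n) t ψ - U t ψ)) atTop (𝓝 0) := by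
      rw [tendsto_zero_iff_norm_tendsto_zero]
      simp only [hn]
      exact tendsto_iff_norm_sub_tendsto_zero.1 (hU t ψ)
    have h3 := h2.add h1
    simp only [← map_add, sub_add_cancel, zero_add] at h3
    simp only [expGroup_add]
    exact h3
  have hUunit : ∀ s, U s ∈ unitary (E →L[ℂ] E) := by
    intro s
    have h1 : star (U s) * U s = 1 :=
      (ContinuousLinearMap.norm_map_iff_adjoint_comp_self (U s)).1 (hUn s)
    have h2 : U s * U (-s) = 1 := by rw [← hUadd, add_neg_cancel, hU0]
    have h3 : star (U s) = U (-s) := by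
      calc star (U s) = star (U s) * (U s * U (-s)) := by rw [h2, mul_one]
        _ = U (-s) := by rw [← mul_assoc, h1, one_mul]
    exact Unitary.mem_iff.2 ⟨h1, by rw [h3, h2]⟩
  have hlip : ∀ z ∈ A.graph, ∀ s, ‖U s z.1 - z.1‖ ≤ |s| * ‖z.2‖ := by
    intro z hz s
    exact le_of_tendsto_of_tendsto' ((hU s z.1).sub_const z.1).norm
      ((hlim z hz).norm.const_mul |s|) fun n => norm_expGroup_sub_le (ha n) z.1 s
  -- The derivative at `0`: the first-order remainder is bounded uniformly in `n`, with `A_n ψ`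
  -- replaced by a nearby vector of the domain.
  have hder : ∀ z ∈ A.graph, HasDerivAt (fun s => U s z.1) (-(Complex.I • z.2)) 0 := by
    intro z hz
    have h1 : ∀ y ∈ A.graph, ∀ s : ℝ, ‖U s z.1 - z.1 + (s : ℂ) • Complex.I • z.2‖ ≤
        |s| * (|s| * ‖y.2‖ + 2 * ‖z.2 - y.1‖) := by
      intro y hy s
      refine le_of_tendsto_of_tendsto'
        (((hU s z.1).sub_const z.1).add (((hlim z hz).const_smul Complex.I).const_smul (s : ℂ))).norm
        ((((hlim y hy).norm.const_mul |s|).add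
          (((hlim z hz).sub_const y.1).norm.const_mul 2)).const_mul |s|)
        fun n => norm_expGroup_sub_sub_le (ha n) z.1 y.1 s
    rw [hasDerivAt_iff_isLittleO, Asymptotics.isLittleO_iff]
    intro ε hε
    obtain ⟨v, hv, hψv⟩ := hD.exists_dist_lt z.2 (by positivity : 0 < ε / 4)
    obtain ⟨φ, hφ⟩ := mem_domain_iff_exists_graph.1 hv
    have h2 : ∀ᶠ s : ℝ in 𝓝 0, |s| < ε / (2 * (‖φ‖ + 1)) := by
      have : Tendsto (fun s : ℝ => |s|) (𝓝 0) (𝓝 0) := by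
        simpa using (continuous_abs.tendsto (0 : ℝ))
      exact this.eventually (gt_mem_nhds (by positivity))
    filter_upwards [h2] with s hs
    have h3 := h1 _ hφ s
    rw [dist_eq_norm] at hψv
    have h4 : |s| * ‖φ‖ ≤ ε / 2 := by
      have : |s| * (‖φ‖ + 1) ≤ ε / (2 * (‖φ‖ + 1)) * (‖φ‖ + 1) := by gcongr
      have e : ε / (2 * (‖φ‖ + 1)) * (‖φ‖ + 1) = ε / 2 := by field_simp
      nlinarith [abs_nonneg s]
    have e : U s z.1 - U 0 z.1 - (s - 0) • -(Complex.I • z.2) =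
        U s z.1 - z.1 + (s : ℂ) • Complex.I • z.2 := by
      rw [hU0, sub_zero, smul_neg, sub_neg_eq_add]; rfl
    rw [e, sub_zero, Real.norm_eq_abs, mul_comm]
    refine h3.trans ?_
    gcongr
    change |s| * ‖φ‖ + 2 * ‖z.2 - v‖ ≤ ε
    linarith
  refine ⟨U, hUunit, hU0, hUadd, fun ψ => ?_, fun ψ φ => ⟨hder (ψ, φ), fun h => ?_⟩⟩
  · have h0 : ∀ ψ, Tendsto (fun s => U s ψ) (𝓝 0) (𝓝 ψ) := by
      refine tendsto_of_tendsto_on_dense hD (Eventually.of_forall fun s x => (hUn s x).le) ?_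
      intro x hx
      obtain ⟨φ, hφ⟩ := mem_domain_iff_exists_graph.1 hx
      have := (hder _ hφ).continuousAt.tendsto
      simpa [hU0] using this
    rw [continuous_iff_continuousAt]
    intro s
    have h1 : Tendsto (fun r : ℝ => U (r - s) ψ) (𝓝 s) (𝓝 ψ) :=
      (h0 ψ).comp (by simpa using (continuous_sub_right s).tendsto s)
    have h2 := ((U s).continuous.tendsto ψ).comp h1
    refine Tendsto.congr (fun r => ?_) h2
    change U s (U (r - s) ψ) = U r ψ
    rw [← mul_apply_eq_comp, ← hUadd, add_sub_cancel]
  -- A vector `ψ` at which the group is differentiable lies in the domain: compare it with the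
  -- vector `χ` of the domain that satisfies `(A + il)χ = φ + ilψ`.
  · obtain ⟨l, hl, hR⟩ := hA.exists_resolvent
    obtain ⟨R, hR1, -, -⟩ := hR l (le_abs_self l)
    have h1 := hR1 (φ + (l * Complex.I : ℂ) • ψ)
    set χ := R (φ + (l * Complex.I : ℂ) • ψ) with hχ
    have h2 := h.sub (hder _ h1)
    -- The difference `δ = ψ - χ` satisfies `δ' = -l δ` at `0`, but `‖U s δ‖` is constant.
    have h3 : HasDerivAt (fun s => U s (ψ - χ)) (((-l : ℝ) : ℂ) • (ψ - χ)) 0 := by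
      have e1 : (fun s => U s (ψ - χ)) = (fun s => U s ψ) - fun s => U s χ := by
        funext s; simp
      rw [e1]
      convert h2 using 1
      have hI : Complex.I * (l * Complex.I) = ((-l : ℝ) : ℂ) := by
        push_cast; linear_combination (l : ℂ) * Complex.I_mul_I
      simp only [smul_sub, smul_add, smul_smul, hI]
      push_cast; module
    have h4 : HasDerivAt (fun s => ‖U s (ψ - χ)‖ ^ 2)
        (2 * (⟪U 0 (ψ - χ), ((-l : ℝ) : ℂ) • (ψ - χ)⟫_ℂ).re) 0 := by
      let _ : InnerProductSpace ℝ E := InnerProductSpace.rclikeToReal ℂ E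
      exact h3.norm_sq
    have h5 : (fun s => ‖U s (ψ - χ)‖ ^ 2) = fun _ => ‖ψ - χ‖ ^ 2 := by
      funext s; rw [hUn]
    rw [h5] at h4
    have h6 := h4.unique (hasDerivAt_const (0 : ℝ) _)
    have h7 : (⟪ψ - χ, ψ - χ⟫_ℂ).re = ‖ψ - χ‖ ^ 2 := by
      rw [inner_self_eq_norm_sq_to_K]; norm_cast
    rw [hU0, inner_smul_right, one_apply_eq_self, Complex.re_ofReal_mul, h7] at h6
    have h8 : ψ - χ = 0 := by
      have : ‖ψ - χ‖ ^ 2 = 0 := by nlinarith [sq_nonneg ‖ψ - χ‖]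
      exact norm_eq_zero.1 (pow_eq_zero_iff two_ne_zero |>.1 this)
    rw [← sub_eq_zero.1 h8] at h1
    simpa using h1

theorem IsResolvable.isUnitaryGroupOf (hA : IsResolvable A) :
    IsUnitaryGroupOf A (unitaryGroup A) := by
  have h := hA.exists_isUnitaryGroupOf
  rw [unitaryGroup, dif_pos h]
  exact h.choose_spec

end Stone

/-! ### Unitary groups: invariance of the domain, commutators and expectation values -/

section Group

variable {E : Type*} [NormedAddCommGroup E] [InnerProductSpace ℂ E] [CompleteSpace E]
  {A : E →ₗ.[ℂ] E} {U : ℝ → E →L[ℂ] E}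

namespace IsUnitaryGroupOf

theorem norm_apply (hU : IsUnitaryGroupOf A U) (s : ℝ) (ψ : E) : ‖U s ψ‖ = ‖ψ‖ :=
  norm_apply_of_mem_unitary (hU.mem_unitary s) ψ

theorem apply_add (hU : IsUnitaryGroupOf A U) (s t : ℝ) (ψ : E) :
    U (s + t) ψ = U s (U t ψ) := by rw [hU.map_add]; rfl

theorem apply_neg_apply (hU : IsUnitaryGroupOf A U) (s : ℝ) (ψ : E) : U (-s) (U s ψ) = ψ := by
  rw [← hU.apply_add, neg_add_cancel, hU.map_zero]; rfl

theorem star_eq (hU : IsUnitaryGroupOf A U) (s : ℝ) : star (U s) = U (-s) := by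
  have h2 : U s * U (-s) = 1 := by rw [← hU.map_add, add_neg_cancel, hU.map_zero]
  calc star (U s) = star (U s) * (U s * U (-s)) := by rw [h2, mul_one]
    _ = U (-s) := by rw [← mul_assoc, (Unitary.mem_iff.1 (hU.mem_unitary s)).1, one_mul]

theorem hasDerivAt (hU : IsUnitaryGroupOf A U) {z : E × E} (hz : z ∈ A.graph) (s : ℝ) :
    HasDerivAt (fun r => U r z.1) (-(Complex.I • U s z.2)) s := by
  have h := (hU.generator z.1 z.2).1 hz
  have h1 : HasDerivAt (fun r => U (r - s) z.1) (-(Complex.I • z.2)) s := by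
    have h2 : HasDerivAt (fun r => U r z.1) (-(Complex.I • z.2)) (s - s) := by rwa [sub_self]
    exact h2.comp_sub_const s s
  have h2 := ((U s).restrictScalars ℝ).hasFDerivAt.comp_hasDerivAt s h1
  have e : (fun r => U r z.1) = ⇑((U s).restrictScalars ℝ) ∘ fun r => U (r - s) z.1 := by
    funext r
    change _ = U s (U (r - s) z.1)
    rw [← hU.apply_add, add_sub_cancel]
  rw [e]
  convert h2 using 1
  simp

theorem mem_graph (hU : IsUnitaryGroupOf A U) {z : E × E} (hz : z ∈ A.graph) (s : ℝ) :
    (U s z.1, U s z.2) ∈ A.graph := by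
  rw [hU.generator]
  have h := ((U s).restrictScalars ℝ).hasFDerivAt.comp_hasDerivAt (0 : ℝ)
    ((hU.generator z.1 z.2).1 hz)
  have e : (fun r => U r (U s z.1)) = ⇑((U s).restrictScalars ℝ) ∘ fun r => U r z.1 := by
    funext r
    change _ = U s (U r z.1)
    rw [← hU.apply_add, ← hU.apply_add, add_comm]
  change HasDerivAt (fun r => U r (U s z.1)) _ 0
  rw [e]
  convert h using 1
  simp

/-- The product rule for `r ↦ U(-r) v(r)`; only strong continuity of the group is available, so it
holds at points where `v(s)` lies in the domain. -/
theorem hasDerivAt_neg_apply (hU : IsUnitaryGroupOf A U) {v : ℝ → E} {v' χ : E} {s : ℝ}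
    (hv : HasDerivAt v v' s) (hχ : (v s, χ) ∈ A.graph) :
    HasDerivAt (fun r => U (-r) (v r)) (U (-s) v' + Complex.I • U (-s) χ) s := by
  have h1 : HasDerivAt (fun r => U (-r) (v s)) (Complex.I • U (-s) χ) s := by
    have := (hU.hasDerivAt hχ (-s)).scomp s (hasDerivAt_neg s)
    simpa [Function.comp_def] using this
  have h2 : HasDerivAt (fun r => U (-r) (v r - v s)) (U (-s) v') s := by
    rw [hasDerivAt_iff_isLittleO]
    have h3 : (fun r => U (-r) (v r - v s - (r - s) • v')) =o[𝓝 s] fun r => r - s :=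
      ((hasDerivAt_iff_isLittleO.1 hv).norm_left.congr_left fun r =>
        (hU.norm_apply (-r) _).symm).of_norm_left
    have h4 : (fun r => (r - s) • (U (-r) v' - U (-s) v')) =o[𝓝 s] fun r => r - s := by
      have h5 : Tendsto (fun r => U (-r) v' - U (-s) v') (𝓝 s) (𝓝 0) := by
        have := ((hU.continuous v').comp continuous_neg).tendsto s
        simpa using this.sub_const (U (-s) v')
      have h6 := (Asymptotics.isBigO_refl (fun r : ℝ => r - s) (𝓝 s)).smul_isLittleO
        ((Asymptotics.isLittleO_one_iff ℝ).2 h5)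
      simpa using h6
    refine (h3.add h4).congr_left fun r => ?_
    have e : U (-r) ((r - s) • v') = (r - s) • U (-r) v' :=
      ((U (-r)).restrictScalars ℝ).map_smul (r - s) v'
    simp only [map_sub, e, smul_sub]; abel
  have h3 := h2.add h1
  refine h3.congr_of_eventuallyEq (Eventually.of_forall fun r => ?_)
  simp

/-- If the commutator of the generator with a bounded operator `T` is bounded by `K` along the
trajectory of `ψ`, then `T` is almost conserved along it. -/
theorem norm_conj_sub_le (hU : IsUnitaryGroupOf A U) {T : E →L[ℂ] E} {z : E × E}
    (hz : z ∈ A.graph) {K s : ℝ} (hT : ∀ y ∈ A.graph, T y.1 ∈ A.domain)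
    (hK : ∀ r, |r| ≤ |s| → ∀ χ, (T (U r z.1), χ) ∈ A.graph → ‖T (U r z.2) - χ‖ ≤ K) :
    ‖U (-s) (T (U s z.1)) - T z.1‖ ≤ K * |s| := by
  choose χ hχ using fun r => mem_domain_iff_exists_graph.1 (hT _ (hU.mem_graph hz r))
  have h : ∀ r, HasDerivAt (fun r => U (-r) (T (U r z.1)))
      (U (-r) (T (-(Complex.I • U r z.2))) + Complex.I • U (-r) (χ r)) r := fun r =>
    hU.hasDerivAt_neg_apply
      ((T.restrictScalars ℝ).hasFDerivAt.comp_hasDerivAt r (hU.hasDerivAt hz r)) (hχ r)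
  have h2 := norm_sub_zero_le_of_norm_deriv_le (s := s) (c := K) h (fun r hr => by
    have e : U (-r) (T (-(Complex.I • U r z.2))) + Complex.I • U (-r) (χ r) =
        -(Complex.I • U (-r) (T (U r z.2) - χ r)) := by
      simp only [map_neg, map_smul, map_sub, smul_sub]; abel
    rw [e, norm_neg, norm_smul, Complex.norm_I, one_mul, hU.norm_apply]
    exact hK r hr _ (hχ r))
  simpa [hU.map_zero] using h2

/-- The form in which translations and modulations are compared with the evolution: `‖Tψ - ψ‖` grows
at most linearly in time, with the size of the commutator as rate. -/
theorem norm_apply_sub_le (hU : IsUnitaryGroupOf A U) {T : E →L[ℂ] E} {z : E × E}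
    (hz : z ∈ A.graph) {K s : ℝ} (hT : ∀ y ∈ A.graph, T y.1 ∈ A.domain)
    (hK : ∀ r, |r| ≤ |s| → ∀ χ, (T (U r z.1), χ) ∈ A.graph → ‖T (U r z.2) - χ‖ ≤ K) :
    ‖T (U s z.1) - U s z.1‖ ≤ ‖T z.1 - z.1‖ + K * |s| := by
  have h := hU.norm_conj_sub_le hz hT hK
  rw [← hU.norm_apply (-s), map_sub, hU.apply_neg_apply]
  calc _ = ‖(U (-s) (T (U s z.1)) - T z.1) + (T z.1 - z.1)‖ := by congr 1; abel
    _ ≤ _ := by rw [add_comm ‖T z.1 - z.1‖]; exact (norm_add_le _ _).trans (by gcongr)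

/-- A bounded operator that leaves the graph of the generator invariant commutes with the group. -/
theorem apply_comm (hU : IsUnitaryGroupOf A U) (hd : Dense (A.domain : Set E)) {T : E →L[ℂ] E}
    (hT : ∀ z ∈ A.graph, (T z.1, T z.2) ∈ A.graph) (s : ℝ) (ψ : E) :
    T (U s ψ) = U s (T ψ) := by
  have h : ∀ ψ ∈ A.domain, T (U s ψ) = U s (T ψ) := by
    intro ψ hψ
    obtain ⟨φ, hφ⟩ := mem_domain_iff_exists_graph.1 hψ
    have h1 := hU.norm_conj_sub_le hφ (T := T) (K := 0) (s := s)
      (fun y hy => A.mem_domain_of_mem_graph (hT y hy)) (fun r _ χ hχ => by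
        rw [graph_unique (hT _ (hU.mem_graph hφ r)) hχ]; simp)
    rw [zero_mul] at h1
    have h2 := sub_eq_zero.1 (norm_eq_zero.1 (le_antisymm h1 (norm_nonneg _)))
    rw [← h2]
    change _ = U s (U (-s) (T (U s ψ)))
    rw [← hU.apply_add, add_neg_cancel, hU.map_zero]; rfl
  have h2 := Continuous.ext_on hd (T.continuous.comp (U s).continuous)
    ((U s).continuous.comp T.continuous) (fun x hx => h x hx)
  exact congrFun h2 ψ

/-- Gronwall's estimate for the expectation value of a bounded operator `B`. -/
theorem expectation_le (hU : IsUnitaryGroupOf A U) {B : E →L[ℂ] E} (hB : IsSelfAdjoint B)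
    {z : E × E} (hz : z ∈ A.graph) {γ c : ℝ}
    (h : ∀ r, |2 * (⟪U r z.2, B (U r z.1)⟫_ℂ).im| ≤
      γ * ((⟪U r z.1, B (U r z.1)⟫_ℂ).re + c)) (s : ℝ) :
    (⟪U s z.1, B (U s z.1)⟫_ℂ).re + c ≤
      Real.exp (γ * |s|) * ((⟪z.1, B z.1⟫_ℂ).re + c) := by
  set y : ℝ → ℝ := fun s => (⟪U s z.1, B (U s z.1)⟫_ℂ).re + c with hy
  have hder : ∀ r, HasDerivAt y (-(2 * (⟪U r z.2, B (U r z.1)⟫_ℂ).im)) r := by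
    intro r
    have h1 := hU.hasDerivAt hz r
    have h2 := (B.restrictScalars ℝ).hasFDerivAt.comp_hasDerivAt r h1
    have h3 := ((Complex.reCLM.hasFDerivAt.comp_hasDerivAt r (h1.inner ℂ h2)).add_const c)
    refine h3.congr_deriv ?_
    have hs : ∀ u v, ⟪B u, v⟫_ℂ = ⟪u, B v⟫_ℂ := fun u v =>
      (ContinuousLinearMap.isSelfAdjoint_iff_isSymmetric.1 hB) u v
    simp only [ContinuousLinearMap.coe_restrictScalars', Complex.reCLM_apply, Complex.add_re,
      map_neg, map_smul, inner_neg_left, inner_neg_right, inner_smul_left, inner_smul_right,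
      Function.comp_apply, Complex.conj_I]
    have h4 : (⟪B (U r z.1), U r z.2⟫_ℂ).im = -(⟪U r z.2, B (U r z.1)⟫_ℂ).im := by
      rw [← inner_conj_symm, Complex.conj_im]
    rw [← hs]
    simp [h4]
    ring
  have hy0 : y 0 = (⟪z.1, B z.1⟫_ℂ).re + c := by simp [hy, hU.map_zero]
  rw [← hy0]
  change y s ≤ _
  -- Gronwall: `e^{-γr} y` decreases for `r ≥ 0`, and `e^{γr} y` increases for `r ≤ 0`.
  rcases le_total 0 s with hs | hs
  · have hanti : Antitone fun r => Real.exp (-(γ * r)) * y r := by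
      refine antitone_of_hasDerivAt_nonpos (f' := fun r => Real.exp (-(γ * r)) * (-(γ * 1)) * y r +
        Real.exp (-(γ * r)) * (-(2 * (⟪U r z.2, B (U r z.1)⟫_ℂ).im))) (fun r => ?_) fun r => ?_
      · exact ((((hasDerivAt_id r).const_mul γ).neg).exp).mul (hder r)
      · have := (abs_le.1 (h r)).1
        have e : Real.exp (-(γ * r)) * (-(γ * 1)) * y r +
          Real.exp (-(γ * r)) * (-(2 * (⟪U r z.2, B (U r z.1)⟫_ℂ).im)) = - (Real.exp (-(γ * r)) *
          (γ * y r + 2 * (⟪U r z.2, B (U r z.1)⟫_ℂ).im)) := by ring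
        refine e.trans_le (neg_nonpos.2 ?_)
        exact mul_nonneg (Real.exp_pos _).le (by linarith)
    have h1 := hanti hs
    simp only [mul_zero, neg_zero, Real.exp_zero, one_mul] at h1
    rw [abs_of_nonneg hs]
    calc y s = Real.exp (γ * s) * (Real.exp (-(γ * s)) * y s) := by
          rw [← mul_assoc, ← Real.exp_add]; simp
      _ ≤ _ := by gcongr
  · have hmono : Monotone fun r => Real.exp (γ * r) * y r := by
      refine monotone_of_hasDerivAt_nonneg (f' := fun r => Real.exp (γ * r) * (γ * 1) * y r +
        Real.exp (γ * r) * (-(2 * (⟪U r z.2, B (U r z.1)⟫_ℂ).im))) (fun r => ?_) fun r => ?_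
      · exact ((((hasDerivAt_id r).const_mul γ)).exp).mul (hder r)
      · have := (abs_le.1 (h r)).2
        have e : Real.exp (γ * r) * (γ * 1) * y r +
          Real.exp (γ * r) * (-(2 * (⟪U r z.2, B (U r z.1)⟫_ℂ).im)) = (Real.exp (γ * r) *
          (γ * y r - 2 * (⟪U r z.2, B (U r z.1)⟫_ℂ).im)) := by ring
        refine le_of_le_of_eq ?_ e.symm
        exact mul_nonneg (Real.exp_pos _).le (by linarith)
    have h1 := hmono hs
    simp only [mul_zero, Real.exp_zero, one_mul] at h1
    rw [abs_of_nonpos hs]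
    calc y s = Real.exp (γ * -s) * (Real.exp (γ * s) * y s) := by
          rw [← mul_assoc, ← Real.exp_add]; simp
      _ ≤ _ := by gcongr

end IsUnitaryGroupOf

end Group

/-! ### Yosida approximation and quadratic forms -/

section Yosida

variable {E : Type*} [NormedAddCommGroup E] [InnerProductSpace ℂ E]

/-- `A` is symmetric and nonnegative, and `J ε = (1 + εA)⁻¹` for all `ε > 0`. -/
structure IsYosida (A : E →ₗ.[ℂ] E) (J : ℝ → E →L[ℂ] E) : Prop where
  symm : ∀ z ∈ A.graph, ∀ y ∈ A.graph, ⟪z.2, y.1⟫_ℂ = ⟪z.1, y.2⟫_ℂ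
  nonneg : ∀ z ∈ A.graph, 0 ≤ (⟪z.1, z.2⟫_ℂ).re
  res : ∀ ε > 0, ∀ φ, (J ε φ, (ε⁻¹ : ℂ) • (φ - J ε φ)) ∈ A.graph

variable {A : E →ₗ.[ℂ] E} {J : ℝ → E →L[ℂ] E} {ε : ℝ}

/-- The Yosida approximation `ε⁻¹(1 - J ε) = A (1 + εA)⁻¹`. -/
def yosida (J : ℝ → E →L[ℂ] E) (ε : ℝ) : E →L[ℂ] E := (ε⁻¹ : ℂ) • (1 - J ε)

theorem yosida_apply (J : ℝ → E →L[ℂ] E) (ε : ℝ) (φ : E) :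
    yosida J ε φ = (ε⁻¹ : ℂ) • (φ - J ε φ) := rfl

theorem smul_inv_smul_ofReal (hε : 0 < ε) (φ : E) : (ε : ℂ) • (ε⁻¹ : ℂ) • φ = φ := by
  rw [smul_smul, mul_inv_cancel₀ (by exact_mod_cast hε.ne'), one_smul]

namespace IsYosida

theorem norm_le (hJ : IsYosida A J) (hε : 0 < ε) (z : E × E) (hz : z ∈ A.graph) :
    ‖z.1‖ ≤ ‖z.1 + (ε : ℂ) • z.2‖ := by
  refine (pow_le_pow_iff_left₀ (norm_nonneg _) (norm_nonneg _) two_ne_zero).1 ?_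
  rw [@norm_add_sq ℂ, inner_smul_right]
  have h := hJ.nonneg z hz
  have : RCLike.re ((ε : ℂ) * ⟪z.1, z.2⟫_ℂ) = ε * (⟪z.1, z.2⟫_ℂ).re := Complex.re_ofReal_mul _ _
  rw [this]
  nlinarith [mul_nonneg hε.le h, sq_nonneg ‖(ε : ℂ) • z.2‖]

theorem apply_graph (hJ : IsYosida A J) (hε : 0 < ε) {z : E × E} (hz : z ∈ A.graph) :
    J ε (z.1 + (ε : ℂ) • z.2) = z.1 := by
  have h1 := hJ.res ε hε (z.1 + (ε : ℂ) • z.2)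
  have h2 := hJ.norm_le hε _ (A.graph.sub_mem h1 hz)
  simp only [Prod.fst_sub, Prod.snd_sub] at h2
  rw [smul_sub, smul_inv_smul_ofReal hε] at h2
  have e : J ε (z.1 + (ε : ℂ) • z.2) - z.1 +
      (z.1 + (ε : ℂ) • z.2 - J ε (z.1 + (ε : ℂ) • z.2) - (ε : ℂ) • z.2) = 0 := by abel
  rw [e, norm_zero] at h2
  exact sub_eq_zero.1 (norm_eq_zero.1 (le_antisymm h2 (norm_nonneg _)))

theorem norm_apply_le (hJ : IsYosida A J) (hε : 0 < ε) (φ : E) : ‖J ε φ‖ ≤ ‖φ‖ := by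
  have h := hJ.norm_le hε _ (hJ.res ε hε φ)
  simp only at h
  rwa [smul_inv_smul_ofReal hε, add_sub_cancel] at h

theorem inner_apply (hJ : IsYosida A J) (hε : 0 < ε) (φ χ : E) : ⟪J ε φ, χ⟫_ℂ = ⟪φ, J ε χ⟫_ℂ := by
  have h := hJ.symm _ (hJ.res ε hε φ) _ (hJ.res ε hε χ)
  simp only [inner_smul_left, inner_smul_right, inner_sub_left, inner_sub_right, map_inv₀,
    Complex.conj_ofReal] at h
  have h2 := mul_left_cancel₀ (inv_ne_zero (by exact_mod_cast hε.ne' : (ε : ℂ) ≠ 0)) h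
  linear_combination -h2

theorem inner_yosida (hJ : IsYosida A J) (hε : 0 < ε) (φ χ : E) :
    ⟪yosida J ε φ, χ⟫_ℂ = ⟪φ, yosida J ε χ⟫_ℂ := by
  simp only [yosida_apply, inner_smul_left, inner_smul_right, inner_sub_left, inner_sub_right,
    map_inv₀, Complex.conj_ofReal, hJ.inner_apply hε]

theorem yosida_nonneg (hJ : IsYosida A J) (hε : 0 < ε) (ψ : E) :
    (⟪J ε ψ, yosida J ε ψ⟫_ℂ).re ≤ (⟪ψ, yosida J ε ψ⟫_ℂ).re ∧
      0 ≤ (⟪ψ, yosida J ε ψ⟫_ℂ).re := by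
  have h := hJ.nonneg _ (hJ.res ε hε ψ)
  rw [← yosida_apply] at h
  -- With `B` the Yosida approximation, `⟪ψ, Bψ⟫ = ⟪Jψ, Bψ⟫ + ε‖Bψ‖²` and `Bψ = AJψ`.
  have e : ψ = J ε ψ + (ε : ℂ) • yosida J ε ψ := by
    rw [yosida_apply, smul_inv_smul_ofReal hε]; abel
  have h2 : (⟪ψ, yosida J ε ψ⟫_ℂ).re = (⟪J ε ψ, yosida J ε ψ⟫_ℂ).re + ε * ‖yosida J ε ψ‖ ^ 2 := by
    nth_rewrite 1 [e]
    rw [inner_add_left, inner_smul_left, Complex.add_re, Complex.conj_ofReal,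
      inner_self_eq_norm_sq_to_K, Complex.re_ofReal_mul]
    norm_cast
  have h3 : 0 ≤ ε * ‖yosida J ε ψ‖ ^ 2 := by positivity
  constructor <;> linarith

theorem dense_domain [CompleteSpace E] (hJ : IsYosida A J) : Dense (A.domain : Set E) := by
  rw [Submodule.dense_iff_topologicalClosure_eq_top, Submodule.topologicalClosure_eq_top_iff,
    Submodule.eq_bot_iff]
  intro v hv
  have h1 := (Submodule.mem_orthogonal _ _).1 hv _
    (A.mem_domain_of_mem_graph (hJ.res 1 one_pos (J 1 v)))
  have h2 : J 1 v = 0 := by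
    rw [hJ.inner_apply one_pos] at h1
    exact inner_self_eq_zero.1 h1
  have h3 := hJ.res 1 one_pos v
  rw [h2] at h3
  have := A.graph_fst_eq_zero_snd h3 rfl
  simpa using this

/-- Strong convergence `(1 + εA)⁻¹ → 1`. -/
theorem tendsto_apply [CompleteSpace E] (hJ : IsYosida A J) (φ : E) :
    Tendsto (fun ε => J ε φ) (𝓝[>] 0) (𝓝 φ) := by
  refine tendsto_of_tendsto_on_dense hJ.dense_domain ?_ (fun ψ hψ => ?_) φ
  · filter_upwards [self_mem_nhdsWithin] with ε hε using hJ.norm_apply_le hε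
  · obtain ⟨χ, hχ⟩ := mem_domain_iff_exists_graph.1 hψ
    rw [tendsto_iff_norm_sub_tendsto_zero]
    have h0 : Tendsto (fun ε : ℝ => ε * ‖χ‖) (𝓝[>] 0) (𝓝 0) := by
      have : Tendsto (fun ε : ℝ => ε * ‖χ‖) (𝓝 0) (𝓝 (0 * ‖χ‖)) :=
        (continuous_id.mul continuous_const).tendsto 0
      rw [zero_mul] at this
      exact this.mono_left nhdsWithin_le_nhds
    refine squeeze_zero' (Eventually.of_forall fun _ => norm_nonneg _) ?_ h0
    filter_upwards [self_mem_nhdsWithin] with ε hε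
    have h1 := hJ.apply_graph hε hχ
    simp only [map_add, map_smul] at h1
    have e : J ε ψ - ψ = -((ε : ℂ) • J ε χ) := by
      linear_combination (norm := module) h1
    rw [e, norm_neg, norm_smul, Complex.norm_real, Real.norm_of_nonneg hε.le]
    gcongr
    · exact hε.le
    · exact hJ.norm_apply_le hε χ

/-- Together with `IsYosida.quadForm_le` this says that the form of `A` is the supremum of the forms
of its Yosida approximations. -/
theorem ofReal_inner_le_quadForm (hJ : IsYosida A J) (hε : 0 < ε) (ψ : E) :
    ENNReal.ofReal (⟪ψ, yosida J ε ψ⟫_ℂ).re ≤ quadForm A ψ := by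
  obtain ⟨x, hx1, hx2⟩ := (LinearPMap.mem_graph_iff A).1 (hJ.res ε hε ψ)
  refine le_iSup_of_le x (ENNReal.ofReal_le_ofReal ?_)
  rw [hx2, hx1, ← yosida_apply]
  linarith [(hJ.yosida_nonneg hε ψ).1]

/-- Each term `2 Re⟪ψ, Aφ⟫ - ⟪φ, Aφ⟫` of the supremum that defines the form is a limit of the same
expressions for the Yosida approximations `B`, and these are at most `⟪ψ, Bψ⟫` because `B` is
nonnegative. -/
theorem quadForm_le [CompleteSpace E] (hJ : IsYosida A J) {ψ : E} {c : ℝ≥0∞}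
    (h : ∀ ε > 0, ENNReal.ofReal (⟪ψ, yosida J ε ψ⟫_ℂ).re ≤ c) : quadForm A ψ ≤ c := by
  refine iSup_le fun φ => ?_
  have hφ := A.mem_graph φ
  have h1 : Tendsto (fun ε => yosida J ε φ) (𝓝[>] 0) (𝓝 (A φ)) := by
    refine (hJ.tendsto_apply (A φ)).congr' ?_
    filter_upwards [self_mem_nhdsWithin] with ε hε
    have h2 := hJ.apply_graph hε hφ
    simp only [map_add, map_smul] at h2
    have e : (φ : E) - J ε φ = (ε : ℂ) • J ε (A φ) := sub_eq_of_eq_add' h2.symm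
    rw [yosida_apply, e, smul_smul, inv_mul_cancel₀ (by exact_mod_cast (ne_of_gt hε)),
      one_smul]
  have h2 : Tendsto (fun ε => ENNReal.ofReal
      (2 * (⟪ψ, yosida J ε φ⟫_ℂ).re - (⟪(φ : E), yosida J ε φ⟫_ℂ).re)) (𝓝[>] 0)
      (𝓝 (ENNReal.ofReal (2 * (⟪ψ, A φ⟫_ℂ).re - (⟪(φ : E), A φ⟫_ℂ).re))) := by
    refine (ENNReal.continuous_ofReal.tendsto _).comp (Tendsto.sub (Tendsto.const_mul 2 ?_) ?_)
    · exact (Complex.continuous_re.tendsto _).comp (tendsto_const_nhds.inner h1)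
    · exact (Complex.continuous_re.tendsto _).comp (tendsto_const_nhds.inner h1)
  refine le_of_tendsto h2 ?_
  filter_upwards [self_mem_nhdsWithin] with ε hε
  refine (ENNReal.ofReal_le_ofReal ?_).trans (h ε hε)
  -- Expand `⟪ψ - φ, B(ψ - φ)⟫ ≥ 0`.
  have h3 := (hJ.yosida_nonneg hε (ψ - φ)).2
  have h4 : (⟪(φ : E), yosida J ε ψ⟫_ℂ).re = (⟪ψ, yosida J ε φ⟫_ℂ).re := by
    rw [← hJ.inner_yosida hε, ← inner_conj_symm, Complex.conj_re]
  simp only [map_sub, inner_sub_left, inner_sub_right, Complex.sub_re, h4] at h3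
  linarith

/-- Bounded operators that commute with the resolvents leave the graph invariant. -/
theorem mem_graph_of_comm (hJ : IsYosida A J) {T : E →L[ℂ] E} (hT : ∀ ψ, T (J 1 ψ) = J 1 (T ψ))
    {z : E × E} (hz : z ∈ A.graph) : (T z.1, T z.2) ∈ A.graph := by
  have h1 := hJ.apply_graph one_pos hz
  have h2 := hJ.res 1 one_pos (T (z.1 + z.2))
  simp only [Complex.ofReal_one, one_smul, inv_one] at h1 h2
  rw [← hT, h1] at h2
  simpa using h2

end IsYosida

/-- A unitary operator whose adjoint leaves the graph invariant does not increase the form: replace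
`φ` by `W*φ` in the supremum. -/
theorem quadForm_unitary_le [CompleteSpace E] {W : E →L[ℂ] E}
    (hW' : ∀ z ∈ A.graph, (star W z.1, star W z.2) ∈ A.graph)
    (hW : W ∈ unitary (E →L[ℂ] E)) (ψ : E) :
    quadForm A (W ψ) ≤ quadForm A ψ := by
  refine iSup_le fun φ => ?_
  obtain ⟨x, hx1, hx2⟩ := (LinearPMap.mem_graph_iff A).1 (hW' _ (A.mem_graph φ))
  -- The vector `W*φ` gives the term for `ψ` that equals the one of `φ` for `Wψ`.
  refine le_iSup_of_le x (ENNReal.ofReal_le_ofReal (le_of_eq ?_))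
  have h3 : ∀ u v, ⟪star W u, star W v⟫_ℂ = ⟪u, v⟫_ℂ := fun u v => by
    rw [ContinuousLinearMap.star_eq_adjoint, ContinuousLinearMap.adjoint_inner_left,
      ← ContinuousLinearMap.star_eq_adjoint, ← mul_apply_eq_comp,
      (Unitary.mem_iff.1 hW).2, one_apply_eq_self]
  have h4 : ⟪ψ, star W (A φ)⟫_ℂ = ⟪W ψ, A φ⟫_ℂ := by
    rw [ContinuousLinearMap.star_eq_adjoint, ContinuousLinearMap.adjoint_inner_right]
  rw [hx1, hx2]
  simp only
  rw [h3, h4]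

end Yosida

/-! ### Traces of unitarily conjugated density matrices -/

section Trace

variable {E : Type*} [NormedAddCommGroup E] [InnerProductSpace ℂ E]

theorem traceOf_mono {c c' : E → ℝ≥0∞} (h : ∀ e, c e ≤ c' e) : traceOf c ≤ traceOf c' :=
  iSup_mono fun _ => Finset.sum_le_sum fun e _ => h e

/-- An isometry maps finite orthonormal sets to finite orthonormal sets. -/
theorem traceOf_comp_le {W : E →L[ℂ] E} (hW : ∀ ψ φ, ⟪W ψ, W φ⟫_ℂ = ⟪ψ, φ⟫_ℂ) (c : E → ℝ≥0∞) :
    traceOf (fun e => c (W e)) ≤ traceOf c := by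
  classical
  have hinj : Function.Injective W := by
    intro x y hxy
    have h := hW (x - y) (x - y)
    rw [map_sub, hxy, sub_self, inner_zero_left] at h
    exact sub_eq_zero.1 (inner_self_eq_zero.1 h.symm)
  refine iSup_le fun s => ?_
  have ho : Orthonormal ℂ ((↑) : (s.1.image W : Finset E) → E) := by
    rw [orthonormal_subtype_iff_ite]
    intro v hv w hw
    obtain ⟨v, hv', rfl⟩ := Finset.mem_image.1 hv
    obtain ⟨w, hw', rfl⟩ := Finset.mem_image.1 hw
    rw [hW, (orthonormal_subtype_iff_ite.1 s.2) v hv' w hw']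
    simp [hinj.eq_iff]
  refine le_iSup_of_le ⟨s.1.image W, ho⟩ ?_
  rw [Finset.sum_image hinj.injOn]

theorem traceOf_add_le (c c' : E → ℝ≥0∞) :
    traceOf (fun e => c e + c' e) ≤ traceOf c + traceOf c' := by
  refine iSup_le fun s => ?_
  rw [Finset.sum_add_distrib]
  exact add_le_add (le_iSup (fun s : {s : Finset E // Orthonormal ℂ ((↑) : s → E)} =>
    ∑ e ∈ s.1, c e) s) (le_iSup (fun s : {s : Finset E // Orthonormal ℂ ((↑) : s → E)} =>
    ∑ e ∈ s.1, c' e) s)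

theorem traceOf_const_mul_le (a : ℝ≥0∞) (c : E → ℝ≥0∞) :
    traceOf (fun e => a * c e) ≤ a * traceOf c := by
  refine iSup_le fun s => ?_
  rw [← Finset.mul_sum]
  gcongr
  exact le_iSup (fun s : {s : Finset E // Orthonormal ℂ ((↑) : s → E)} => ∑ e ∈ s.1, c e) s

variable [CompleteSpace E] {W ρ : E →L[ℂ] E}

theorem inner_map_of_mem_unitary (hW : W ∈ unitary (E →L[ℂ] E)) (ψ φ : E) :
    ⟪W ψ, W φ⟫_ℂ = ⟪ψ, φ⟫_ℂ :=
  (ContinuousLinearMap.inner_map_map_iff_adjoint_comp_self W).2 (Unitary.mem_iff.1 hW).1 ψ φ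

/-- Unitary conjugation commutes with the square root of a positive operator. -/
theorem sqrt_conj (hW : W ∈ unitary (E →L[ℂ] E)) (hρ : ρ.IsPositive) :
    CFC.sqrt (W * ρ * star W) = W * CFC.sqrt ρ * star W := by
  have hρ' : 0 ≤ ρ := (ContinuousLinearMap.nonneg_iff_isPositive ρ).2 hρ
  refine CFC.sqrt_unique ?_ ?_
  · calc W * CFC.sqrt ρ * star W * (W * CFC.sqrt ρ * star W)
        = W * CFC.sqrt ρ * (star W * W) * CFC.sqrt ρ * star W := by simp only [mul_assoc]
      _ = W * (CFC.sqrt ρ * CFC.sqrt ρ) * star W := by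
        rw [(Unitary.mem_iff.1 hW).1, mul_one]; simp only [mul_assoc]
      _ = W * ρ * star W := by rw [CFC.sqrt_mul_sqrt_self ρ hρ']
  · exact star_right_conjugate_nonneg (CFC.sqrt_nonneg ρ) W

theorem IsDensityMatrix.conj (hρ : IsDensityMatrix ρ) (hW : W ∈ unitary (E →L[ℂ] E)) :
    IsDensityMatrix (W * ρ * star W) := by
  have e : ∀ e : E, ⟪e, (W * ρ * star W) e⟫_ℂ = ⟪star W e, ρ (star W e)⟫_ℂ := fun e => by
    change ⟪e, W (ρ (star W e))⟫_ℂ = _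
    rw [ContinuousLinearMap.star_eq_adjoint, ContinuousLinearMap.adjoint_inner_left]
  refine ⟨?_, ?_⟩
  · rw [← ContinuousLinearMap.nonneg_iff_isPositive]
    exact star_right_conjugate_nonneg ((ContinuousLinearMap.nonneg_iff_isPositive ρ).2 hρ.1) W
  · simp only [e]
    have hW' : star W ∈ unitary (E →L[ℂ] E) := Unitary.star_mem hW
    rw [← hρ.2]
    refine le_antisymm
      (traceOf_comp_le (inner_map_of_mem_unitary hW') fun e => ENNReal.ofReal (⟪e, ρ e⟫_ℂ).re) ?_
    refine le_of_eq_of_le ?_ (traceOf_comp_le (inner_map_of_mem_unitary hW)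
      fun e => ENNReal.ofReal (⟪star W e, ρ (star W e)⟫_ℂ).re)
    congr 1
    funext e
    rw [← mul_apply_eq_comp, (Unitary.mem_iff.1 hW).1, one_apply_eq_self]

/-- Since `(WρW*)^{1/2} = W ρ^{1/2} W*`, a bound on the form of `A` at `Wψ` bounds the trace of `A`
against `WρW*`; the factor `W*` on the right only rotates the orthonormal sets. -/
theorem traceWith_conj_le {A : E →ₗ.[ℂ] E} {q : E → ℝ≥0∞} (hρ : ρ.IsPositive)
    (hW : W ∈ unitary (E →L[ℂ] E)) (h : ∀ ψ, quadForm A (W ψ) ≤ q ψ) :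
    traceWith (W * ρ * star W) A ≤ traceOf fun e => q (CFC.sqrt ρ e) := by
  rw [traceWith, sqrt_conj hW hρ]
  refine (traceOf_mono fun e => h (CFC.sqrt ρ (star W e))).trans ?_
  exact traceOf_comp_le (inner_map_of_mem_unitary (Unitary.star_mem hW))
    fun e => q (CFC.sqrt ρ e)

/-- The normalization `Tr ρ = 1`, as the Hilbert–Schmidt norm of `ρ^{1/2}`. -/
theorem IsDensityMatrix.traceOf_norm_sq (hρ : IsDensityMatrix ρ) :
    traceOf (fun e => ENNReal.ofReal (‖CFC.sqrt ρ e‖ ^ 2)) = 1 := by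
  rw [← hρ.2]
  congr 1
  funext e
  congr 1
  have h0 : 0 ≤ ρ := (ContinuousLinearMap.nonneg_iff_isPositive ρ).2 hρ.1
  have h1 : IsSelfAdjoint (CFC.sqrt ρ) := IsSelfAdjoint.of_nonneg (CFC.sqrt_nonneg ρ)
  have h2 := (ContinuousLinearMap.isSelfAdjoint_iff_isSymmetric.1 h1) e (CFC.sqrt ρ e)
  nth_rewrite 2 [← CFC.sqrt_mul_sqrt_self ρ h0]
  rw [mul_apply_eq_comp]
  change ⟪CFC.sqrt ρ e, CFC.sqrt ρ e⟫_ℂ = ⟪e, CFC.sqrt ρ (CFC.sqrt ρ e)⟫_ℂ at h2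
  rw [← h2, inner_self_eq_norm_sq_to_K]
  norm_cast

end Trace

/-! ### Fock space: components, norms and inner products -/

section FockBasic

variable {d : ℕ}

/-- The `m`-particle component of a Fock space vector as an element of `L²`. -/
def Fock.level (ψ : Fock d) (m : ℕ) : Lp ℂ 2 (volume : Measure (Fin m → Space d)) :=
  ((Subtype.val (p := fun z => z ∈ lp (fun m : ℕ => symmL2 d m) 2) ψ m : symmL2 d m) :
    Lp ℂ 2 (volume : Measure (Fin m → Space d)))

theorem Fock.comp_eq_level (ψ : Fock d) (m : ℕ) : ψ.comp m = ψ.level m := rfl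

theorem Fock.aestronglyMeasurable_comp (ψ : Fock d) (m : ℕ) :
    AEStronglyMeasurable (ψ.comp m) volume :=
  Lp.aestronglyMeasurable (ψ.level m)

theorem Fock.comp_perm (ψ : Fock d) (m : ℕ) (π : Equiv.Perm (Fin m)) :
    ∀ᵐ K : Fin m → Space d, ψ.comp m (K ∘ π) = ψ.comp m K :=
  (Subtype.val (p := fun z => z ∈ lp (fun m : ℕ => symmL2 d m) 2) ψ m : symmL2 d m).2 π

theorem Fock.comp_sub (ψ φ : Fock d) (m : ℕ) :
    ∀ᵐ K : Fin m → Space d, (ψ - φ).comp m K = ψ.comp m K - φ.comp m K :=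
  Lp.coeFn_sub (ψ.level m) (φ.level m)

theorem enorm_sq_level {α : Type*} [MeasurableSpace α] {μ : Measure α} (f : Lp ℂ 2 μ) :
    ENNReal.ofReal (‖f‖ ^ 2) = ∫⁻ x, ‖f x‖ₑ ^ 2 ∂μ := by
  rw [Lp.norm_def, ← ENNReal.toReal_pow, ENNReal.ofReal_toReal
    (ENNReal.pow_ne_top (Lp.eLpNorm_ne_top f)),
    eLpNorm_eq_lintegral_rpow_enorm_toReal two_ne_zero ENNReal.ofNat_ne_top]
  simp only [ENNReal.toReal_ofNat, one_div, ENNReal.rpow_ofNat]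
  rw [← ENNReal.rpow_natCast, ← ENNReal.rpow_mul]
  simp

theorem Fock.hasSum_norm_sq (ψ : Fock d) : HasSum (fun m => ‖ψ.level m‖ ^ 2) (‖ψ‖ ^ 2) := by
  have h := lp.hasSum_norm (p := 2) (by norm_num)
    (show lp (fun m : ℕ => symmL2 d m) 2 from ψ)
  simp only [ENNReal.toReal_ofNat, Real.rpow_ofNat] at h
  exact h

theorem Fock.ofReal_norm_sq (ψ : Fock d) :
    ENNReal.ofReal (‖ψ‖ ^ 2) = ∑' m, ∫⁻ K, ‖ψ.comp m K‖ₑ ^ 2 := by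
  have h := ψ.hasSum_norm_sq
  rw [← h.tsum_eq, ENNReal.ofReal_tsum_of_nonneg (fun _ => by positivity) h.summable]
  exact tsum_congr fun m => enorm_sq_level (ψ.level m)

theorem Fock.lintegral_comp_ne_top (ψ : Fock d) (m : ℕ) : ∫⁻ K, ‖ψ.comp m K‖ₑ ^ 2 ≠ ∞ := by
  rw [Fock.comp_eq_level, ← enorm_sq_level]; exact ENNReal.ofReal_ne_top

theorem Fock.norm_le_of_tsum_le {ψ : Fock d} {C : ℝ} (hC : 0 ≤ C)
    (h : ∑' m, ∫⁻ K, ‖ψ.comp m K‖ₑ ^ 2 ≤ ENNReal.ofReal (C ^ 2)) : ‖ψ‖ ≤ C := by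
  rw [← ψ.ofReal_norm_sq, ENNReal.ofReal_le_ofReal_iff (by positivity)] at h
  exact (pow_le_pow_iff_left₀ (norm_nonneg _) hC two_ne_zero).1 h

theorem Fock.norm_le_of_comp_le {ψ φ : Fock d} {C : ℝ} (hC : 0 ≤ C)
    (h : ∀ m, ∀ᵐ K, ‖ψ.comp m K‖ ≤ C * ‖φ.comp m K‖) : ‖ψ‖ ≤ C * ‖φ‖ := by
  refine Fock.norm_le_of_tsum_le (by positivity) ?_
  rw [mul_pow, ENNReal.ofReal_mul (by positivity), φ.ofReal_norm_sq, ← ENNReal.tsum_mul_left]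
  refine ENNReal.tsum_le_tsum fun m => ?_
  rw [← lintegral_const_mul' _ _ ENNReal.ofReal_ne_top]
  refine lintegral_mono_ae ?_
  filter_upwards [h m] with K hK
  rw [ENNReal.ofReal_pow hC, ← mul_pow, ← ofReal_norm, ← ofReal_norm, ← ENNReal.ofReal_mul hC]
  gcongr

/-- A square-summable sequence of symmetric functions defines a Fock space vector. -/
theorem Fock.exists_of_comp (f : ∀ m, (Fin m → Space d) → ℂ)
    (hm : ∀ m, AEStronglyMeasurable (f m) volume)
    (hs : ∀ m (π : Equiv.Perm (Fin m)), ∀ᵐ K, f m (K ∘ π) = f m K)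
    (hf : ∑' m, ∫⁻ K, ‖f m K‖ₑ ^ 2 ≠ ∞) : ∃ ψ : Fock d, ∀ m, ψ.comp m =ᵐ[volume] f m := by
  have h1 : ∀ m, MemLp (f m) 2 volume := fun m => by
    refine ⟨hm m, ?_⟩
    rw [eLpNorm_lt_top_iff_lintegral_rpow_enorm_lt_top two_ne_zero ENNReal.ofNat_ne_top]
    simp only [ENNReal.toReal_ofNat, ENNReal.rpow_ofNat]
    exact lt_of_le_of_lt (ENNReal.le_tsum m) (lt_top_iff_ne_top.2 hf)
  let g : ∀ m, symmL2 d m := fun m => ⟨(h1 m).toLp (f m), fun π => by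
    have h2 := (h1 m).coeFn_toLp
    filter_upwards [h2, (measurePreserving_perm (d := d) π).quasiMeasurePreserving.ae h2, hs m π]
      with K h3 h4 h5
    rw [h3, h4, h5]⟩
  have hg : ∀ m, ENNReal.ofReal (‖g m‖ ^ 2) = ∫⁻ K, ‖f m K‖ₑ ^ 2 := fun m => by
    have := enorm_sq_level ((h1 m).toLp (f m))
    refine this.trans (lintegral_congr_ae ?_)
    filter_upwards [(h1 m).coeFn_toLp] with K hK
    rw [hK]
  have hmem : Memℓp g 2 := by
    refine memℓp_gen ?_
    simp only [ENNReal.toReal_ofNat, Real.rpow_ofNat]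
    have h3 : ∀ m, ‖g m‖ ^ 2 = (∫⁻ K, ‖f m K‖ₑ ^ 2).toReal := fun m => by
      rw [← hg, ENNReal.toReal_ofReal (by positivity)]
    simp only [h3]
    exact ENNReal.summable_toReal hf
  exact ⟨(⟨g, hmem⟩ : lp (fun m : ℕ => symmL2 d m) 2), fun m => (h1 m).coeFn_toLp⟩

/-- A family of symmetric functions that depends linearly and boundedly on a Fock space vector
defines a bounded operator. -/
theorem Fock.exists_clm (f : Fock d → ∀ m, (Fin m → Space d) → ℂ)
    (hm : ∀ ψ m, AEStronglyMeasurable (f ψ m) volume)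
    (hs : ∀ ψ m (π : Equiv.Perm (Fin m)), ∀ᵐ K, f ψ m (K ∘ π) = f ψ m K)
    (hadd : ∀ ψ φ m, ∀ᵐ K, f (ψ + φ) m K = f ψ m K + f φ m K)
    (hsmul : ∀ (c : ℂ) ψ m, ∀ᵐ K, f (c • ψ) m K = c * f ψ m K) {C : ℝ} (hC : 0 ≤ C)
    (hf : ∀ ψ, ∑' m, ∫⁻ K, ‖f ψ m K‖ₑ ^ 2 ≤ ENNReal.ofReal ((C * ‖ψ‖) ^ 2)) :
    ∃ T : Fock d →L[ℂ] Fock d, (∀ ψ m, (T ψ).comp m =ᵐ[volume] f ψ m) ∧ ‖T‖ ≤ C := by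
  choose T hT using fun ψ => Fock.exists_of_comp (f ψ) (hm ψ) (hs ψ)
    (ne_top_of_le_ne_top ENNReal.ofReal_ne_top (hf ψ))
  let T₀ : Fock d →ₗ[ℂ] Fock d :=
    { toFun := T
      map_add' := fun ψ φ => Fock.ext_comp fun m => by
        filter_upwards [hT (ψ + φ) m, hT ψ m, hT φ m, hadd ψ φ m, Fock.comp_add (T ψ) (T φ) m]
          with K h1 h2 h3 h4 h5
        rw [h1, h4, h5, h2, h3]
      map_smul' := fun c ψ => Fock.ext_comp fun m => by
        filter_upwards [hT (c • ψ) m, hT ψ m, hsmul c ψ m, Fock.comp_smul c (T ψ) m]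
          with K h1 h2 h3 h4
        simp only [RingHom.id_apply]
        rw [h1, h3, h4, h2] }
  have hb : ∀ ψ, ‖T₀ ψ‖ ≤ C * ‖ψ‖ := fun ψ => by
    refine Fock.norm_le_of_tsum_le (by positivity) (le_of_eq_of_le ?_ (hf ψ))
    refine tsum_congr fun m => lintegral_congr_ae ?_
    filter_upwards [hT ψ m] with K hK
    change ‖(T ψ).comp m K‖ₑ ^ 2 = _
    rw [hK]
  exact ⟨T₀.mkContinuous C hb, hT, T₀.mkContinuous_norm_le hC hb⟩

theorem Fock.integrable_inner (ψ φ : Fock d) (m : ℕ) :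
    Integrable (fun K => starRingEnd ℂ (ψ.comp m K) * φ.comp m K) volume := by
  have := L2.integrable_inner (𝕜 := ℂ) (ψ.level m) (φ.level m)
  refine this.congr (Eventually.of_forall fun K => ?_)
  simp [Fock.comp_eq_level, mul_comm]

theorem Fock.hasSum_inner (ψ φ : Fock d) :
    HasSum (fun m => ∫ K, starRingEnd ℂ (ψ.comp m K) * φ.comp m K) ⟪ψ, φ⟫_ℂ := by
  have h := lp.hasSum_inner (𝕜 := ℂ) (show lp (fun m : ℕ => symmL2 d m) 2 from ψ)
    (show lp (fun m : ℕ => symmL2 d m) 2 from φ)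
  refine h.congr_fun fun m => ?_
  change _ = ⟪ψ.level m, φ.level m⟫_ℂ
  rw [L2.inner_def]
  refine integral_congr_ae (Eventually.of_forall fun K => ?_)
  simp [Fock.comp_eq_level, mul_comm]

theorem Fock.inner_congr {ψ φ ψ' φ' : Fock d} (h : ∀ m, ∀ᵐ K,
    starRingEnd ℂ (ψ.comp m K) * φ.comp m K = starRingEnd ℂ (ψ'.comp m K) * φ'.comp m K) :
    ⟪ψ, φ⟫_ℂ = ⟪ψ', φ'⟫_ℂ := by
  rw [← (Fock.hasSum_inner ψ φ).tsum_eq, ← (Fock.hasSum_inner ψ' φ').tsum_eq]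
  exact tsum_congr fun m => integral_congr_ae (h m)

theorem Fock.re_inner_nonneg {ψ φ : Fock d} (h : ∀ m, ∀ᵐ K,
    0 ≤ (starRingEnd ℂ (ψ.comp m K) * φ.comp m K).re) : 0 ≤ (⟪ψ, φ⟫_ℂ).re := by
  have h1 := Complex.reCLM.hasSum (Fock.hasSum_inner ψ φ)
  refine h1.nonneg fun m => ?_
  simp only [Complex.reCLM_apply]
  change 0 ≤ RCLike.re (∫ K, starRingEnd ℂ (ψ.comp m K) * φ.comp m K)
  rw [← integral_re (Fock.integrable_inner ψ φ m)]
  exact integral_nonneg_of_ae (h m)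

end FockBasic

/-! ### Bounded multiplication operators on Fock space -/

section Symbol

variable {d : ℕ}

/-- A bounded measurable symmetric function of finitely many variables in `ℝᵈ`, that is, the symbol
of a bounded multiplication operator on Fock space. -/
structure Symbol (d : ℕ) where
  toFun : ∀ m, (Fin m → Space d) → ℂ
  meas : ∀ m, Measurable (toFun m)
  symm : ∀ m (π : Equiv.Perm (Fin m)) K, toFun m (K ∘ π) = toFun m K
  bound : ∃ C : ℝ, 0 ≤ C ∧ ∀ m K, ‖toFun m K‖ ≤ C

theorem Symbol.exists_op (b : Symbol d) : ∃ T : Fock d →L[ℂ] Fock d,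
    ∀ ψ m, ∀ᵐ K, (T ψ).comp m K = b.toFun m K * ψ.comp m K := by
  obtain ⟨C, hC, hb⟩ := b.bound
  obtain ⟨T, hT, -⟩ := Fock.exists_clm (fun ψ m K => b.toFun m K * ψ.comp m K)
    (fun ψ m => (b.meas m).aestronglyMeasurable.mul (ψ.aestronglyMeasurable_comp m))
    (fun ψ m π => by
      filter_upwards [ψ.comp_perm m π] with K hK
      rw [b.symm, hK])
    (fun ψ φ m => by
      filter_upwards [Fock.comp_add ψ φ m] with K hK
      rw [hK, mul_add])
    (fun c ψ m => by
      filter_upwards [Fock.comp_smul c ψ m] with K hK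
      rw [hK]; ring) hC (fun ψ => by
      rw [mul_pow, ENNReal.ofReal_mul (by positivity), ψ.ofReal_norm_sq, ← ENNReal.tsum_mul_left]
      refine ENNReal.tsum_le_tsum fun m => ?_
      rw [← lintegral_const_mul' _ _ ENNReal.ofReal_ne_top]
      refine lintegral_mono fun K => ?_
      simp only
      rw [enorm_mul, mul_pow, ENNReal.ofReal_pow hC, ← ofReal_norm (b.toFun m K)]
      gcongr
      exact hb m K)
  exact ⟨T, hT⟩

/-- The multiplication operator on Fock space with a given symbol. -/
def Symbol.op (b : Symbol d) : Fock d →L[ℂ] Fock d := b.exists_op.choose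

theorem Symbol.comp_op (b : Symbol d) (ψ : Fock d) (m : ℕ) :
    ∀ᵐ K, (b.op ψ).comp m K = b.toFun m K * ψ.comp m K :=
  b.exists_op.choose_spec ψ m

theorem Symbol.norm_op_apply_le (b : Symbol d) {C : ℝ} (hC : 0 ≤ C) (h : ∀ m K, ‖b.toFun m K‖ ≤ C)
    (ψ : Fock d) : ‖b.op ψ‖ ≤ C * ‖ψ‖ := by
  refine Fock.norm_le_of_comp_le hC fun m => ?_
  filter_upwards [b.comp_op ψ m] with K hK
  rw [hK, norm_mul]
  gcongr
  exact h m K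

theorem Symbol.norm_op_le (b : Symbol d) {C : ℝ} (hC : 0 ≤ C) (h : ∀ m K, ‖b.toFun m K‖ ≤ C) :
    ‖b.op‖ ≤ C :=
  ContinuousLinearMap.opNorm_le_bound _ hC (b.norm_op_apply_le hC h)

theorem Symbol.norm_op_sub_le (b b' : Symbol d) {C : ℝ} (hC : 0 ≤ C)
    (h : ∀ m K, ‖b.toFun m K - b'.toFun m K‖ ≤ C) : ‖b.op - b'.op‖ ≤ C := by
  refine ContinuousLinearMap.opNorm_le_bound _ hC fun ψ => Fock.norm_le_of_comp_le hC fun m => ?_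
  filter_upwards [b.comp_op ψ m, b'.comp_op ψ m, Fock.comp_sub (b.op ψ) (b'.op ψ) m]
    with K h1 h2 h3
  change ‖(b.op ψ - b'.op ψ).comp m K‖ ≤ _
  rw [h3, h1, h2, ← sub_mul, norm_mul]
  gcongr
  exact h m K

theorem Symbol.op_comm (b b' : Symbol d) (ψ : Fock d) : b.op (b'.op ψ) = b'.op (b.op ψ) := by
  refine Fock.ext_comp fun m => ?_
  filter_upwards [b.comp_op (b'.op ψ) m, b'.comp_op (b.op ψ) m, b.comp_op ψ m, b'.comp_op ψ m]
    with K h1 h2 h3 h4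
  rw [h1, h2, h3, h4]; ring

theorem Symbol.inner_op (b : Symbol d) (hb : ∀ m K, starRingEnd ℂ (b.toFun m K) = b.toFun m K)
    (ψ φ : Fock d) : ⟪b.op ψ, φ⟫_ℂ = ⟪ψ, b.op φ⟫_ℂ := by
  refine Fock.inner_congr fun m => ?_
  filter_upwards [b.comp_op ψ m, b.comp_op φ m] with K h1 h2
  rw [h1, h2, map_mul, hb]; ring

end Symbol

/-! ### Annihilation and creation operators on Fock space -/

section Kernel

variable {d m : ℕ}

theorem measurePreserving_cons :
    MeasurePreserving (fun z : Space d × (Fin m → Space d) =>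
      (Fin.cons z.1 z.2 : Fin (m + 1) → Space d)) volume volume := by
  have h1 := (volume_preserving_piFinSuccAbove (fun _ : Fin (m + 1) => Space d) 0).symm
  convert! h1 using 1
  funext z
  simp [MeasurableEquiv.piFinSuccAbove, Fin.insertNthEquiv]

theorem measurePreserving_removeNth (j : Fin (m + 1)) :
    MeasurePreserving (fun K : Fin (m + 1) → Space d => (K j, j.removeNth K)) volume volume :=
  volume_preserving_piFinSuccAbove (fun _ : Fin (m + 1) => Space d) j

theorem lintegral_cons {F : (Fin (m + 1) → Space d) → ℝ≥0∞} (hF : AEMeasurable F volume) :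
    ∫⁻ K, ∫⁻ k, F (Fin.cons k K) = ∫⁻ K, F K := by
  have h := measurePreserving_cons (d := d) (m := m)
  have h1 : AEMeasurable (fun z : Space d × (Fin m → Space d) => F (Fin.cons z.1 z.2))
      (volume.prod volume) := hF.comp_quasiMeasurePreserving h.quasiMeasurePreserving
  rw [← h.map_eq] at hF ⊢
  rw [lintegral_map' hF h.aemeasurable]
  exact (lintegral_prod_symm _ h1).symm

theorem integral_cons {F : (Fin (m + 1) → Space d) → ℂ} (hF : Integrable F volume) :
    ∫ K, ∫ k, F (Fin.cons k K) = ∫ K, F K := by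
  have h := measurePreserving_cons (d := d) (m := m)
  have h1 : Integrable (fun z : Space d × (Fin m → Space d) => F (Fin.cons z.1 z.2))
      (volume.prod volume) := h.integrable_comp_of_integrable hF
  rw [← h.map_eq]
  rw [integral_map h.aemeasurable (by rw [h.map_eq]; exact hF.1)]
  exact (integral_prod_symm _ h1).symm

/-- The partial pairing `K ↦ ∫ conj(u(k)) v(k, K) dk`. -/
def annKernel (u : Space d → ℂ) (v : (Fin (m + 1) → Space d) → ℂ) (K : Fin m → Space d) : ℂ :=
  ∫ k : Space d, starRingEnd ℂ (u k) * v (Fin.cons k K)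

variable {u : Space d → ℂ} {v : (Fin (m + 1) → Space d) → ℂ}

theorem aestronglyMeasurable_comp_cons (hv : AEStronglyMeasurable v volume) :
    AEStronglyMeasurable (fun z : (Fin m → Space d) × Space d => v (Fin.cons z.2 z.1))
      (volume.prod volume) := by
  have h1 : AEStronglyMeasurable (fun z : Space d × (Fin m → Space d) => v (Fin.cons z.1 z.2))
      (volume.prod volume) :=
    hv.comp_quasiMeasurePreserving measurePreserving_cons.quasiMeasurePreserving
  exact h1.prod_swap

theorem aestronglyMeasurable_annKernel (hu : AEStronglyMeasurable u volume)
    (hv : AEStronglyMeasurable v volume) : AEStronglyMeasurable (annKernel u v) volume := by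
  have h1 : AEStronglyMeasurable (fun z : (Fin m → Space d) × Space d =>
      starRingEnd ℂ (u z.2) * v (Fin.cons z.2 z.1)) (volume.prod volume) :=
    (Complex.continuous_conj.comp_aestronglyMeasurable hu.comp_snd).mul
      (aestronglyMeasurable_comp_cons hv)
  exact h1.integral_prod_right'

/-- The Cauchy–Schwarz inequality, for nonnegative functions. -/
theorem sq_lintegral_mul_le {α : Type*} [MeasurableSpace α] {μ : Measure α} {f g : α → ℝ≥0∞}
    (hf : AEMeasurable f μ) (hg : AEMeasurable g μ) :
    (∫⁻ a, f a * g a ∂μ) ^ 2 ≤ (∫⁻ a, f a ^ 2 ∂μ) * ∫⁻ a, g a ^ 2 ∂μ := by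
  have h := ENNReal.lintegral_mul_le_Lp_mul_Lq μ Real.HolderConjugate.two_two hf hg
  simp only [Pi.mul_apply, ENNReal.rpow_ofNat] at h
  refine (pow_le_pow_left₀ zero_le h 2).trans_eq ?_
  rw [mul_pow, ← ENNReal.rpow_natCast, ← ENNReal.rpow_natCast, ← ENNReal.rpow_mul,
    ← ENNReal.rpow_mul]
  simp

/-- For almost every `K` the pairing converges absolutely and satisfies the Cauchy–Schwarz
inequality. -/
theorem ae_integrable_and_enorm_annKernel_le (hu : AEStronglyMeasurable u volume)
    (hu2 : ∫⁻ k, ‖u k‖ₑ ^ 2 ≠ ∞) (hv : AEStronglyMeasurable v volume)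
    (hv2 : ∫⁻ K, ‖v K‖ₑ ^ 2 ≠ ∞) :
    ∀ᵐ K : Fin m → Space d,
      Integrable (fun k : Space d => starRingEnd ℂ (u k) * v (Fin.cons k K)) ∧
      ‖annKernel u v K‖ₑ ^ 2 ≤ (∫⁻ k, ‖u k‖ₑ ^ 2) * ∫⁻ k, ‖v (Fin.cons k K)‖ₑ ^ 2 := by
  have h1 := (aestronglyMeasurable_comp_cons hv).prodMk_left
  have hm : AEMeasurable (fun z : (Fin m → Space d) × Space d => ‖v (Fin.cons z.2 z.1)‖ₑ ^ 2)
      (volume.prod volume) := (aestronglyMeasurable_comp_cons hv).enorm.pow_const 2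
  have h2 : ∀ᵐ K : Fin m → Space d, ∫⁻ k, ‖v (Fin.cons k K)‖ₑ ^ 2 < ∞ := by
    refine ae_lt_top' hm.lintegral_prod_right' ?_
    rw [lintegral_cons (F := fun K => ‖v K‖ₑ ^ 2) (hv.enorm.pow_const 2)]
    exact hv2
  filter_upwards [h1, h2] with K hK hK2
  have h3 : (∫⁻ k, ‖starRingEnd ℂ (u k) * v (Fin.cons k K)‖ₑ) ^ 2 ≤
      (∫⁻ k, ‖u k‖ₑ ^ 2) * ∫⁻ k, ‖v (Fin.cons k K)‖ₑ ^ 2 := by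
    have := sq_lintegral_mul_le hu.enorm hK.enorm
    simpa [enorm_mul] using this
  refine ⟨⟨(Complex.continuous_conj.comp_aestronglyMeasurable hu).mul hK, ?_⟩, ?_⟩
  · rw [HasFiniteIntegral]
    by_contra hc
    rw [not_lt, top_le_iff] at hc
    rw [hc] at h3
    simp only [ne_eq, OfNat.ofNat_ne_zero, not_false_eq_true, ENNReal.top_pow, top_le_iff] at h3
    exact ENNReal.mul_ne_top hu2 hK2.ne h3
  · exact (pow_le_pow_left₀ zero_le (enorm_integral_le_lintegral_enorm _) 2).trans h3

theorem lintegral_annKernel_le (hu : AEStronglyMeasurable u volume)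
    (hu2 : ∫⁻ k, ‖u k‖ₑ ^ 2 ≠ ∞) (hv : AEStronglyMeasurable v volume)
    (hv2 : ∫⁻ K, ‖v K‖ₑ ^ 2 ≠ ∞) :
    ∫⁻ K, ‖annKernel u v K‖ₑ ^ 2 ≤ (∫⁻ k, ‖u k‖ₑ ^ 2) * ∫⁻ K, ‖v K‖ₑ ^ 2 := by
  rw [← lintegral_cons (F := fun K => ‖v K‖ₑ ^ 2) (hv.enorm.pow_const 2),
    ← lintegral_const_mul' _ _ hu2]
  refine lintegral_mono_ae ?_
  filter_upwards [ae_integrable_and_enorm_annKernel_le hu hu2 hv hv2] with K hK using hK.2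

theorem annKernel_perm (hv : ∀ π : Equiv.Perm (Fin (m + 1)), ∀ᵐ K, v (K ∘ π) = v K)
    (π : Equiv.Perm (Fin m)) : ∀ᵐ K, annKernel u v (K ∘ π) = annKernel u v K := by
  filter_upwards [ae_ae_cons (hv (Equiv.Perm.decomposeFin.symm (0, π)))] with K hK
  refine integral_congr_ae ?_
  filter_upwards [hK] with k hk
  -- Extend `π` to `m + 1` variables by fixing the first one.
  have e : (Fin.cons k (K ∘ π) : Fin (m + 1) → Space d) =
      (Fin.cons k K : Fin (m + 1) → Space d) ∘ Equiv.Perm.decomposeFin.symm (0, π) := by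
    funext i
    cases i using Fin.cases <;> simp
  rw [e, hk]

/-- Permuting the variables, as a measurable equivalence. -/
def permEquiv (d : ℕ) {m : ℕ} (π : Equiv.Perm (Fin m)) :
    (Fin m → Space d) ≃ᵐ (Fin m → Space d) where
  toFun K := K ∘ π
  invFun K := K ∘ π.symm
  left_inv K := by funext i; simp
  right_inv K := by funext i; simp
  measurable_toFun := measurable_pi_iff.2 fun i => measurable_pi_apply (π i)
  measurable_invFun := measurable_pi_iff.2 fun i => measurable_pi_apply (π.symm i)

theorem lintegral_perm (π : Equiv.Perm (Fin m)) (F : (Fin m → Space d) → ℝ≥0∞) :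
    ∫⁻ K, F (K ∘ π) = ∫⁻ K, F K :=
  (measurePreserving_perm π).lintegral_comp_emb (permEquiv d π).measurableEmbedding F

theorem integral_perm (π : Equiv.Perm (Fin m)) (F : (Fin m → Space d) → ℂ) :
    ∫ K, F (K ∘ π) = ∫ K, F K :=
  (measurePreserving_perm π).integral_comp (permEquiv d π).measurableEmbedding F

theorem cons_apply_removeNth (j : Fin (m + 1)) (K : Fin (m + 1) → Space d) :
    K ∘ j.cycleRange.symm = Fin.cons (K j) (j.removeNth K) :=
  (Fin.cons_removeNth_eq_comp_cycleRange_symm K j).symm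

/-- Removing an entry after a permutation is the same as permuting after removing an entry. -/
theorem exists_perm_removeNth (π : Equiv.Perm (Fin (m + 1))) (j : Fin (m + 1)) :
    ∃ σ : Equiv.Perm (Fin m), ∀ K : Fin (m + 1) → Space d,
      j.removeNth (K ∘ π) = (π j).removeNth K ∘ σ := by
  let σ : Equiv.Perm (Fin m) := ((finSuccAboveEquiv j).trans
    (π.subtypeEquiv fun i => by simp)).trans (finSuccAboveEquiv (π j)).symm
  refine ⟨σ, fun K => funext fun i => ?_⟩
  have h : (π j).succAbove (σ i) = π (j.succAbove i) := by
    have h1 : finSuccAboveEquiv (π j) (σ i) =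
        (π.subtypeEquiv fun i => by simp) (finSuccAboveEquiv j i) := by
      simp [σ]
    exact congrArg Subtype.val h1
  simp only [Fin.removeNth_apply, Function.comp_apply]
  rw [h]

end Kernel

section AnnCre

variable {d : ℕ}

theorem lintegral_enorm_sq_ne_top {α : Type*} [MeasurableSpace α] {μ : Measure α} {f : α → ℂ}
    (hf : MemLp f 2 μ) : ∫⁻ k, ‖f k‖ₑ ^ 2 ∂μ ≠ ∞ := by
  have := (eLpNorm_lt_top_iff_lintegral_rpow_enorm_lt_top two_ne_zero ENNReal.ofNat_ne_top).1 hf.2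
  simpa using this.ne

/-- The norm of a square-integrable function. -/
def l2norm (f : Space d → ℂ) : ℝ := √(∫⁻ k, ‖f k‖ₑ ^ 2).toReal

theorem l2norm_nonneg (f : Space d → ℂ) : 0 ≤ l2norm f := Real.sqrt_nonneg _

theorem ofReal_l2norm_sq {f : Space d → ℂ} (hf : MemLp f 2 volume) :
    ENNReal.ofReal (l2norm f ^ 2) = ∫⁻ k, ‖f k‖ₑ ^ 2 := by
  rw [l2norm, Real.sq_sqrt ENNReal.toReal_nonneg,
    ENNReal.ofReal_toReal (lintegral_enorm_sq_ne_top hf)]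

theorem l2norm_le {f g : Space d → ℂ} {C : ℝ} (hC : 0 ≤ C) (hg : MemLp g 2 volume)
    (h : ∀ᵐ k, ‖f k‖ ≤ C * ‖g k‖) : l2norm f ≤ C * l2norm g := by
  rw [l2norm, ← Real.sqrt_sq (mul_nonneg hC (l2norm_nonneg g))]
  refine Real.sqrt_le_sqrt (ENNReal.toReal_le_of_le_ofReal (by positivity) ?_)
  rw [mul_pow, ENNReal.ofReal_mul (by positivity), ofReal_l2norm_sq hg,
    ← lintegral_const_mul' _ _ ENNReal.ofReal_ne_top]
  refine lintegral_mono_ae ?_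
  filter_upwards [h] with k hk
  rw [ENNReal.ofReal_pow hC, ← mul_pow, ← ofReal_norm, ← ofReal_norm, ← ENNReal.ofReal_mul hC]
  gcongr

/-- The symbol `1/√(m+1)`; its operator regularizes the annihilation and creation operators. -/
def numSymbol (d : ℕ) : Symbol d where
  toFun m _ := ((√(m + 1))⁻¹ : ℝ)
  meas _ := measurable_const
  symm _ _ _ := rfl
  bound := ⟨1, zero_le_one, fun m _ => by
    rw [Complex.norm_real, Real.norm_of_nonneg (by positivity)]
    refine inv_le_one_of_one_le₀ ?_
    rw [← Real.sqrt_one]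
    exact Real.sqrt_le_sqrt (by simp)⟩

variable {ħ : ℝ} {f : Space d → ℂ}

theorem enorm_sq_ofReal_mul {c : ℝ} (hc : 0 ≤ c) (z : ℂ) :
    ‖((√c : ℝ) : ℂ) * z‖ₑ ^ 2 = ENNReal.ofReal c * ‖z‖ₑ ^ 2 := by
  rw [enorm_mul, mul_pow, ← ofReal_norm ((√c : ℝ) : ℂ), ← ENNReal.ofReal_pow (norm_nonneg _)]
  congr 2
  rw [Complex.norm_real, Real.norm_of_nonneg (Real.sqrt_nonneg _), Real.sq_sqrt hc]

theorem numSymbol_comp (η : Fock d) (m : ℕ) :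
    ∀ᵐ K, ((numSymbol d).op η).comp m K = ((√(m + 1))⁻¹ : ℝ) * η.comp m K :=
  (numSymbol d).comp_op η m

theorem lintegral_numSymbol (η : Fock d) (m : ℕ) :
    ENNReal.ofReal (m + 1) * ∫⁻ K, ‖((numSymbol d).op η).comp m K‖ₑ ^ 2 =
      ∫⁻ K, ‖η.comp m K‖ₑ ^ 2 := by
  rw [← lintegral_const_mul' _ _ ENNReal.ofReal_ne_top]
  refine lintegral_congr_ae ?_
  filter_upwards [numSymbol_comp η m] with K hK
  rw [← enorm_sq_ofReal_mul (by positivity), hK, ← mul_assoc]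
  rw [← Complex.ofReal_mul, mul_inv_cancel₀ (by positivity), Complex.ofReal_one, one_mul]

/-- The operator `a(f)(N+1)^{-1/2}`, with `N` the particle number, is bounded. -/
theorem exists_ann (hħ : 0 ≤ ħ) (hf : MemLp f 2 volume) : ∃ T : Fock d →L[ℂ] Fock d,
    (∀ η m, ∀ᵐ K, (T η).comp m K =
      ((√(ħ * (m + 1)) : ℝ) : ℂ) * annKernel f (((numSymbol d).op η).comp (m + 1)) K) ∧
    ‖T‖ ≤ √ħ * l2norm f := by
  have hf2 := lintegral_enorm_sq_ne_top hf
  have hint := fun (η : Fock d) m => ae_integrable_and_enorm_annKernel_le hf.1 hf2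
    (((numSymbol d).op η).aestronglyMeasurable_comp (m + 1))
    (((numSymbol d).op η).lintegral_comp_ne_top (m + 1))
  -- The factor `√(m+1)` of the annihilation operator is compensated by `(N+1)^{-1/2}`, which acts
  -- on the component of index `m + 1` as `1/√(m+2)`.
  refine Fock.exists_clm (fun η m K => ((√(ħ * (m + 1)) : ℝ) : ℂ) *
      annKernel f (((numSymbol d).op η).comp (m + 1)) K) (fun η m => ?_) (fun η m π => ?_)
    (fun η θ m => ?_) (fun c η m => ?_) (mul_nonneg (Real.sqrt_nonneg _) (l2norm_nonneg f))
    (fun η => ?_)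
  · exact (aestronglyMeasurable_annKernel hf.1
      (((numSymbol d).op η).aestronglyMeasurable_comp (m + 1))).const_mul _
  · filter_upwards [annKernel_perm (u := f) (((numSymbol d).op η).comp_perm (m + 1)) π] with K hK
    rw [hK]
  · filter_upwards [hint η m, hint θ m, ae_ae_cons
      (Fock.comp_add ((numSymbol d).op η) ((numSymbol d).op θ) (m + 1))] with K h1 h2 h3
    rw [← mul_add]
    congr 1
    rw [annKernel, annKernel, annKernel, ← integral_add h1.1 h2.1]
    refine integral_congr_ae ?_
    filter_upwards [h3] with k hk
    rw [map_add, hk, mul_add]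
  · filter_upwards [ae_ae_cons (Fock.comp_smul c ((numSymbol d).op η) (m + 1))] with K h3
    rw [mul_left_comm]
    congr 1
    rw [annKernel, annKernel, ← integral_const_mul]
    refine integral_congr_ae ?_
    filter_upwards [h3] with k hk
    rw [map_smul, hk]; ring
  · calc ∑' m : ℕ, ∫⁻ K, ‖((√(ħ * ((m : ℝ) + 1)) : ℝ) : ℂ) *
          annKernel f (((numSymbol d).op η).comp (m + 1)) K‖ₑ ^ 2
        ≤ ∑' m, ENNReal.ofReal (ħ * l2norm f ^ 2) * ∫⁻ K, ‖η.comp (m + 1) K‖ₑ ^ 2 := by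
          refine ENNReal.tsum_le_tsum fun m => ?_
          simp_rw [enorm_sq_ofReal_mul (by positivity : 0 ≤ ħ * ((m : ℝ) + 1))]
          rw [lintegral_const_mul' _ _ ENNReal.ofReal_ne_top,
            ← lintegral_numSymbol η (m + 1), ENNReal.ofReal_mul hħ, ENNReal.ofReal_mul hħ,
            ofReal_l2norm_sq hf]
          calc _ ≤ ENNReal.ofReal ħ * ENNReal.ofReal ((m : ℝ) + 1) * ((∫⁻ k, ‖f k‖ₑ ^ 2) *
                ∫⁻ K, ‖((numSymbol d).op η).comp (m + 1) K‖ₑ ^ 2) := by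
                gcongr
                exact lintegral_annKernel_le hf.1 hf2
                  (((numSymbol d).op η).aestronglyMeasurable_comp (m + 1))
                  (((numSymbol d).op η).lintegral_comp_ne_top (m + 1))
            _ ≤ ENNReal.ofReal ħ * ENNReal.ofReal (((m + 1 : ℕ) : ℝ) + 1) * ((∫⁻ k, ‖f k‖ₑ ^ 2) *
                ∫⁻ K, ‖((numSymbol d).op η).comp (m + 1) K‖ₑ ^ 2) := by
                gcongr
                simp
            _ = _ := by ring
      _ ≤ ENNReal.ofReal (ħ * l2norm f ^ 2) * ENNReal.ofReal (‖η‖ ^ 2) := by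
          rw [ENNReal.tsum_mul_left, η.ofReal_norm_sq]
          exact mul_le_mul' le_rfl (ENNReal.tsum_comp_le_tsum_of_injective (add_left_injective 1)
            fun m => ∫⁻ K, ‖η.comp m K‖ₑ ^ 2)
      _ = _ := by
          rw [← ENNReal.ofReal_mul (by positivity), mul_pow, mul_pow, Real.sq_sqrt hħ]

/-- The `m`-particle component of `a*(f)φ`. -/
def creKernel (ħ : ℝ) (f : Space d → ℂ) (φ : ∀ m, (Fin m → Space d) → ℂ) :
    ∀ m, (Fin m → Space d) → ℂ
  | 0, _ => 0
  | m + 1, K => (√ħ / √(m + 1) : ℂ) * ∑ j, f (K j) * φ m (j.removeNth K)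

theorem enorm_sq_sum_le {ι : Type*} (s : Finset ι) (a : ι → ℂ) :
    ‖∑ i ∈ s, a i‖ₑ ^ 2 ≤ s.card * ∑ i ∈ s, ‖a i‖ₑ ^ 2 := by
  refine (pow_le_pow_left₀ zero_le (enorm_sum_le s a) 2).trans ?_
  simp only [enorm_eq_nnnorm]
  exact_mod_cast sq_sum_le_card_mul_sum_sq (s := s) (f := fun i => ‖a i‖₊)

theorem aestronglyMeasurable_mul_removeNth {m : ℕ} {φ : (Fin m → Space d) → ℂ}
    (hf : AEStronglyMeasurable f volume) (hφ : AEStronglyMeasurable φ volume) (j : Fin (m + 1)) :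
    AEStronglyMeasurable (fun K : Fin (m + 1) → Space d => f (K j) * φ (j.removeNth K))
      volume := by
  have h : AEStronglyMeasurable (fun z : Space d × (Fin m → Space d) => f z.1 * φ z.2)
      (volume.prod volume) := hf.comp_fst.mul hφ.comp_snd
  exact h.comp_quasiMeasurePreserving (measurePreserving_removeNth j).quasiMeasurePreserving

theorem lintegral_mul_removeNth {m : ℕ} {φ : (Fin m → Space d) → ℂ}
    (hf : AEStronglyMeasurable f volume) (hφ : AEStronglyMeasurable φ volume) (j : Fin (m + 1)) :
    ∫⁻ K : Fin (m + 1) → Space d, ‖f (K j) * φ (j.removeNth K)‖ₑ ^ 2 =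
      (∫⁻ k, ‖f k‖ₑ ^ 2) * ∫⁻ K, ‖φ K‖ₑ ^ 2 := by
  rw [← lintegral_prod_mul (hf.enorm.pow_const 2) (hφ.enorm.pow_const 2)]
  have h := (measurePreserving_removeNth (d := d) j).lintegral_comp_emb
    (MeasurableEquiv.piFinSuccAbove (fun _ : Fin (m + 1) => Space d) j).measurableEmbedding
    (fun z => ‖f z.1‖ₑ ^ 2 * ‖φ z.2‖ₑ ^ 2)
  simp only [enorm_mul, mul_pow]
  exact h

/-- The operator `a*(f)(N+1)^{-1/2}`, with `N` the particle number, is bounded. -/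
theorem exists_cre (hħ : 0 ≤ ħ) (hf : MemLp f 2 volume) : ∃ T : Fock d →L[ℂ] Fock d,
    (∀ η m, ∀ᵐ K, (T η).comp m K = creKernel ħ f ((numSymbol d).op η).comp m K) ∧
    ‖T‖ ≤ √ħ * l2norm f := by
  have hf2 := lintegral_enorm_sq_ne_top hf
  refine Fock.exists_clm (fun η m K => creKernel ħ f ((numSymbol d).op η).comp m K)
    (fun η m => ?_) (fun η m π => ?_) (fun η θ m => ?_) (fun c η m => ?_)
    (mul_nonneg (Real.sqrt_nonneg _) (l2norm_nonneg f)) (fun η => ?_)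
  · rcases m with _ | m
    · exact aestronglyMeasurable_const
    · have := Finset.aestronglyMeasurable_fun_sum Finset.univ fun j _ =>
        aestronglyMeasurable_mul_removeNth hf.1
          (((numSymbol d).op η).aestronglyMeasurable_comp m) j
      exact this.const_mul _
  · rcases m with _ | m
    · exact Eventually.of_forall fun K => rfl
    · choose σ hσ using exists_perm_removeNth (d := d) π
      filter_upwards [ae_all_iff.2 fun j => ae_removeNth (π j)
        (((numSymbol d).op η).comp_perm m (σ j))] with K hK
      simp only [creKernel, hσ, Function.comp_apply]
      congr 1
      rw [← Equiv.sum_comp π fun j => f (K j) * ((numSymbol d).op η).comp m (j.removeNth K)]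
      exact Finset.sum_congr rfl fun j _ => by rw [← hK j]
  · rcases m with _ | m
    · exact Eventually.of_forall fun K => (add_zero _).symm
    · filter_upwards [ae_all_iff.2 fun j => ae_removeNth j
        (Fock.comp_add ((numSymbol d).op η) ((numSymbol d).op θ) m)] with K hK
      simp only [creKernel, map_add, hK, mul_add, Finset.sum_add_distrib]
  · rcases m with _ | m
    · exact Eventually.of_forall fun K => (mul_zero _).symm
    · filter_upwards [ae_all_iff.2 fun j => ae_removeNth j
        (Fock.comp_smul c ((numSymbol d).op η) m)] with K hK
      simp only [creKernel, map_smul, hK, Finset.mul_sum]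
      exact Finset.sum_congr rfl fun j _ => by ring
  · have hlev : ∀ m, ∫⁻ K, ‖creKernel ħ f ((numSymbol d).op η).comp (m + 1) K‖ₑ ^ 2 ≤
        ENNReal.ofReal (ħ * l2norm f ^ 2) * ∫⁻ K, ‖η.comp m K‖ₑ ^ 2 := by
      intro m
      have e : (√ħ / √(m + 1) : ℂ) = ((√(ħ / (m + 1)) : ℝ) : ℂ) := by
        rw [Real.sqrt_div hħ]; push_cast; rfl
      have hp : (0 : ℝ) ≤ ħ / (m + 1) := by positivity
      simp only [creKernel, e, enorm_sq_ofReal_mul hp]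
      rw [lintegral_const_mul' _ _ ENNReal.ofReal_ne_top]
      -- The Cauchy–Schwarz inequality for the sum of `m + 1` terms costs a factor `m + 1`, and the
      -- integral of the sum has `m + 1` equal bounds: one of these factors cancels the `1/(m+1)` of
      -- the creation operator, the other one the weight of `(N+1)^{-1/2}`.
      have h1 : ∫⁻ K : Fin (m + 1) → Space d, ‖∑ j, f (K j) *
          ((numSymbol d).op η).comp m (j.removeNth K)‖ₑ ^ 2 ≤
          ENNReal.ofReal (m + 1) * (ENNReal.ofReal (l2norm f ^ 2) * ∫⁻ K, ‖η.comp m K‖ₑ ^ 2) := by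
        calc _ ≤ ∫⁻ K : Fin (m + 1) → Space d, ((m + 1 : ℕ) : ℝ≥0∞) * ∑ j, ‖f (K j) *
              ((numSymbol d).op η).comp m (j.removeNth K)‖ₑ ^ 2 := by
              refine lintegral_mono fun K => ?_
              simpa using enorm_sq_sum_le Finset.univ fun j => f (K j) *
                ((numSymbol d).op η).comp m (j.removeNth K)
          _ = ((m + 1 : ℕ) : ℝ≥0∞) * ∑ j : Fin (m + 1), ∫⁻ K : Fin (m + 1) → Space d, ‖f (K j) *
              ((numSymbol d).op η).comp m (j.removeNth K)‖ₑ ^ 2 := by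
              rw [lintegral_const_mul' _ _ (ENNReal.natCast_ne_top _),
                lintegral_finsetSum' _ fun j _ => (aestronglyMeasurable_mul_removeNth hf.1
                  (((numSymbol d).op η).aestronglyMeasurable_comp m) j).enorm.pow_const 2]
          _ = _ := by
              simp only [lintegral_mul_removeNth hf.1
                (((numSymbol d).op η).aestronglyMeasurable_comp m)]
              rw [Finset.sum_const, Finset.card_univ, Fintype.card_fin, nsmul_eq_mul,
                ← lintegral_numSymbol η m, ofReal_l2norm_sq hf]
              have e2 : ((m + 1 : ℕ) : ℝ≥0∞) = ENNReal.ofReal (m + 1) := by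
                rw [← ENNReal.ofReal_natCast]; push_cast; rfl
              rw [e2]; ring
      calc _ ≤ ENNReal.ofReal (ħ / (m + 1)) * (ENNReal.ofReal (m + 1) *
            (ENNReal.ofReal (l2norm f ^ 2) * ∫⁻ K, ‖η.comp m K‖ₑ ^ 2)) := by gcongr
        _ = _ := by
            rw [← mul_assoc, ← mul_assoc, ← ENNReal.ofReal_mul hp, ← ENNReal.ofReal_mul
              (by positivity), div_mul_cancel₀ _ (by positivity)]
    have h0 : ∫⁻ K, ‖creKernel ħ f ((numSymbol d).op η).comp 0 K‖ₑ ^ 2 = 0 := by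
      simp [creKernel]
    rw [tsum_eq_zero_add' ENNReal.summable, h0, zero_add]
    refine (ENNReal.tsum_le_tsum hlev).trans_eq ?_
    rw [ENNReal.tsum_mul_left, ← η.ofReal_norm_sq, ← ENNReal.ofReal_mul (by positivity),
      mul_pow, mul_pow, Real.sq_sqrt hħ]

end AnnCre

section AnnCreOp

variable {d : ℕ} {ħ : ℝ} {f g : Space d → ℂ}

open Classical in
/-- The bounded operator `a(f)(N+1)^{-1/2}`, with `N` the particle number; zero if `f` is not
square-integrable. -/
def annOp (ħ : ℝ) (f : Space d → ℂ) : Fock d →L[ℂ] Fock d :=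
  if h : 0 ≤ ħ ∧ MemLp f 2 volume then (exists_ann h.1 h.2).choose else 0

open Classical in
/-- The bounded operator `a*(f)(N+1)^{-1/2}`, with `N` the particle number; zero if `f` is not
square-integrable. -/
def creOp (ħ : ℝ) (f : Space d → ℂ) : Fock d →L[ℂ] Fock d :=
  if h : 0 ≤ ħ ∧ MemLp f 2 volume then (exists_cre h.1 h.2).choose else 0

theorem comp_annOp (hħ : 0 ≤ ħ) (hf : MemLp f 2 volume) (η : Fock d) (m : ℕ) :
    ∀ᵐ K, (annOp ħ f η).comp m K =
      ((√(ħ * (m + 1)) : ℝ) : ℂ) * annKernel f (((numSymbol d).op η).comp (m + 1)) K := by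
  rw [annOp, dif_pos ⟨hħ, hf⟩]
  exact (exists_ann hħ hf).choose_spec.1 η m

theorem norm_annOp_le (hħ : 0 ≤ ħ) (hf : MemLp f 2 volume) : ‖annOp ħ f‖ ≤ √ħ * l2norm f := by
  rw [annOp, dif_pos ⟨hħ, hf⟩]
  exact (exists_ann hħ hf).choose_spec.2

theorem comp_creOp (hħ : 0 ≤ ħ) (hf : MemLp f 2 volume) (η : Fock d) (m : ℕ) :
    ∀ᵐ K, (creOp ħ f η).comp m K = creKernel ħ f ((numSymbol d).op η).comp m K := by
  rw [creOp, dif_pos ⟨hħ, hf⟩]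
  exact (exists_cre hħ hf).choose_spec.1 η m

theorem norm_creOp_le (hħ : 0 ≤ ħ) (hf : MemLp f 2 volume) : ‖creOp ħ f‖ ≤ √ħ * l2norm f := by
  rw [creOp, dif_pos ⟨hħ, hf⟩]
  exact (exists_cre hħ hf).choose_spec.2

theorem ae_integrable_annKernel (hf : MemLp f 2 volume) (ψ : Fock d) (m : ℕ) :
    ∀ᵐ K : Fin m → Space d,
      Integrable (fun k : Space d => starRingEnd ℂ (f k) * ψ.comp (m + 1) (Fin.cons k K)) := by
  filter_upwards [ae_integrable_and_enorm_annKernel_le hf.1 (lintegral_enorm_sq_ne_top hf)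
    (ψ.aestronglyMeasurable_comp (m + 1)) (ψ.lintegral_comp_ne_top (m + 1))] with K hK using hK.1

theorem mem_annihilationGraph (hħ : 0 ≤ ħ) (hf : MemLp f 2 volume) (η : Fock d) :
    ((numSymbol d).op η, annOp ħ f η) ∈ annihilationGraph ħ f := by
  intro m
  filter_upwards [comp_annOp hħ hf η m, ae_integrable_annKernel hf ((numSymbol d).op η) m]
    with K h1 h2
  exact ⟨h2, h1⟩

theorem mem_creationGraph (hħ : 0 ≤ ħ) (hf : MemLp f 2 volume) (η : Fock d) :
    ((numSymbol d).op η, creOp ħ f η) ∈ creationGraph ħ f :=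
  ⟨comp_creOp hħ hf η 0, fun m => comp_creOp hħ hf η (m + 1)⟩

theorem annOp_sub (hħ : 0 ≤ ħ) (hf : MemLp f 2 volume) (hg : MemLp g 2 volume) :
    annOp ħ f - annOp ħ g = annOp ħ (f - g) := by
  ext η
  refine Fock.ext_comp fun m => ?_
  filter_upwards [comp_annOp hħ hf η m, comp_annOp hħ hg η m, comp_annOp hħ (hf.sub hg) η m,
    Fock.comp_sub (annOp ħ f η) (annOp ħ g η) m,
    ae_integrable_annKernel hf ((numSymbol d).op η) m,
    ae_integrable_annKernel hg ((numSymbol d).op η) m] with K h1 h2 h3 h4 h5 h6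
  change (annOp ħ f η - annOp ħ g η).comp m K = _
  rw [h4, h1, h2, h3, ← mul_sub]
  congr 1
  rw [annKernel, annKernel, annKernel, ← integral_sub h5 h6]
  congr 1
  funext k
  rw [Pi.sub_apply, map_sub, sub_mul]

theorem creOp_sub (hħ : 0 ≤ ħ) (hf : MemLp f 2 volume) (hg : MemLp g 2 volume) :
    creOp ħ f - creOp ħ g = creOp ħ (f - g) := by
  ext η
  refine Fock.ext_comp fun m => ?_
  filter_upwards [comp_creOp hħ hf η m, comp_creOp hħ hg η m, comp_creOp hħ (hf.sub hg) η m,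
    Fock.comp_sub (creOp ħ f η) (creOp ħ g η) m] with K h1 h2 h3 h4
  change (creOp ħ f η - creOp ħ g η).comp m K = _
  rw [h4, h1, h2, h3]
  rcases m with _ | m
  · simp [creKernel]
  · simp only [creKernel, ← mul_sub, ← Finset.sum_sub_distrib, ← sub_mul, Pi.sub_apply]

theorem Fock.memLp_comp (ψ : Fock d) (m : ℕ) : MemLp (ψ.comp m) 2 volume :=
  Lp.memLp (ψ.level m)

theorem memLp_mul_removeNth {m : ℕ} {φ : (Fin m → Space d) → ℂ}
    (hf : MemLp f 2 volume) (hφ : MemLp φ 2 volume) (j : Fin (m + 1)) :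
    MemLp (fun K : Fin (m + 1) → Space d => f (K j) * φ (j.removeNth K)) 2 volume := by
  refine ⟨aestronglyMeasurable_mul_removeNth hf.1 hφ.1 j, ?_⟩
  rw [eLpNorm_lt_top_iff_lintegral_rpow_enorm_lt_top two_ne_zero ENNReal.ofNat_ne_top]
  simp only [ENNReal.toReal_ofNat, ENNReal.rpow_ofNat]
  rw [lintegral_mul_removeNth hf.1 hφ.1]
  exact ENNReal.mul_lt_top (lintegral_enorm_sq_ne_top hf).lt_top
    (lintegral_enorm_sq_ne_top hφ).lt_top

theorem integrable_conj_mul {α : Type*} [MeasurableSpace α] {μ : Measure α} {u v : α → ℂ}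
    (hu : MemLp u 2 μ) (hv : MemLp v 2 μ) : Integrable (fun x => starRingEnd ℂ (u x) * v x) μ :=
  MemLp.integrable_mul hu.star hv

/-- The duality of the two kernels. By the symmetry of `ψ` all terms of the sum in the creation
operator contribute equally, so that the sum is `m + 1` times its first term. -/
theorem integral_creKernel (hf : MemLp f 2 volume) (ψ φ : Fock d) (m : ℕ) (hħ : 0 ≤ ħ) :
    ∫ K, starRingEnd ℂ (((√(ħ * (m + 1)) : ℝ) : ℂ) * annKernel f (ψ.comp (m + 1)) K) *
      φ.comp m K = ∫ K, starRingEnd ℂ (ψ.comp (m + 1) K) * creKernel ħ f φ.comp (m + 1) K := by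
  set F : (Fin (m + 1) → Space d) → ℂ := fun K =>
    starRingEnd ℂ (ψ.comp (m + 1) K) * (f (K 0) * φ.comp m ((0 : Fin (m + 1)).removeNth K))
  have hF : Integrable F volume :=
    integrable_conj_mul (ψ.memLp_comp _) (memLp_mul_removeNth hf (φ.memLp_comp m) 0)
  -- Moving the `j`-th variable to the front does not change `ψ`.
  have hj : ∀ j : Fin (m + 1), ∫ K, starRingEnd ℂ (ψ.comp (m + 1) K) *
      (f (K j) * φ.comp m (j.removeNth K)) = ∫ K, F K := by
    intro j
    rw [← integral_perm j.cycleRange.symm F]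
    refine integral_congr_ae ?_
    filter_upwards [ψ.comp_perm (m + 1) j.cycleRange.symm] with K hK
    simp only [F, cons_apply_removeNth, Fin.cons_zero, Fin.removeNth_zero, Fin.tail_cons]
    rw [← cons_apply_removeNth, hK]
  have hL : ∫ K, starRingEnd ℂ (annKernel f (ψ.comp (m + 1)) K) * φ.comp m K = ∫ K, F K := by
    rw [← integral_cons hF]
    refine integral_congr_ae (Eventually.of_forall fun K => ?_)
    simp only [F, annKernel, Fin.cons_zero, Fin.removeNth_zero, Fin.tail_cons]
    rw [← integral_conj, ← integral_mul_const]
    congr 1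
    funext k
    simp only [map_mul, Complex.conj_conj]
    ring
  have hR : ∫ K, starRingEnd ℂ (ψ.comp (m + 1) K) * creKernel ħ f φ.comp (m + 1) K =
      (√ħ / √(m + 1) : ℂ) * ((m + 1) * ∫ K, F K) := by
    simp only [creKernel]
    have e : ∀ K : Fin (m + 1) → Space d, starRingEnd ℂ (ψ.comp (m + 1) K) *
        ((√ħ / √(m + 1) : ℂ) * ∑ j, f (K j) * φ.comp m (j.removeNth K)) =
        (√ħ / √(m + 1) : ℂ) * ∑ j, starRingEnd ℂ (ψ.comp (m + 1) K) *
          (f (K j) * φ.comp m (j.removeNth K)) := by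
      intro K
      rw [mul_left_comm, Finset.mul_sum]
    simp only [e]
    rw [integral_const_mul, integral_finsetSum _ fun j _ =>
      integrable_conj_mul (ψ.memLp_comp _) (memLp_mul_removeNth hf (φ.memLp_comp m) j)]
    simp only [hj]
    simp
  have hc : ((√(ħ * (m + 1)) : ℝ) : ℂ) = (√ħ / √(m + 1) : ℂ) * (m + 1) := by
    have h1 : √(ħ * (m + 1)) = √ħ / √((m : ℝ) + 1) * (m + 1) := by
      have h2 : √((m : ℝ) + 1) * √((m : ℝ) + 1) = m + 1 := Real.mul_self_sqrt (by positivity)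
      have h3 : √((m : ℝ) + 1) ≠ 0 := by positivity
      rw [Real.sqrt_mul hħ]
      field_simp
      rw [sq, h2]
    rw [h1]; push_cast; rfl
  rw [hR]
  simp only [map_mul, Complex.conj_ofReal, mul_assoc]
  rw [integral_const_mul, hL, hc]
  ring

/-- `a*(f)` is the adjoint of `a(f)`. -/
theorem inner_annOp (hħ : 0 ≤ ħ) (hf : MemLp f 2 volume) (η θ : Fock d) :
    ⟪annOp ħ f η, (numSymbol d).op θ⟫_ℂ = ⟪(numSymbol d).op η, creOp ħ f θ⟫_ℂ := by
  have h1 := Fock.hasSum_inner (annOp ħ f η) ((numSymbol d).op θ)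
  have h2 := Fock.hasSum_inner ((numSymbol d).op η) (creOp ħ f θ)
  have h3 := (hasSum_nat_add_iff' 1).2 h2
  have h0 : ∫ K, starRingEnd ℂ (((numSymbol d).op η).comp 0 K) * (creOp ħ f θ).comp 0 K = 0 := by
    refine integral_eq_zero_of_ae ?_
    filter_upwards [comp_creOp hħ hf θ 0] with K hK
    rw [hK]; simp [creKernel]
  rw [Finset.sum_range_one, h0, sub_zero] at h3
  refine h1.unique (h3.congr_fun fun m => ?_)
  have e1 : ∫ K, starRingEnd ℂ ((annOp ħ f η).comp m K) * ((numSymbol d).op θ).comp m K =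
      ∫ K, starRingEnd ℂ (((√(ħ * (m + 1)) : ℝ) : ℂ) *
        annKernel f (((numSymbol d).op η).comp (m + 1)) K) * ((numSymbol d).op θ).comp m K := by
    refine integral_congr_ae ?_
    filter_upwards [comp_annOp hħ hf η m] with K hK
    rw [hK]
  rw [e1, integral_creKernel hf _ _ m hħ]
  refine integral_congr_ae ?_
  filter_upwards [comp_creOp hħ hf θ (m + 1)] with K hK
  rw [hK]

end AnnCreOp

/-! ### The commutator of the annihilation operator with a bounded function of `dΓ(w)` -/

section Weight

variable {d : ℕ}

/-- A measurable one-particle observable that is bounded below by a positive constant. -/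
structure Weight (d : ℕ) where
  toFun : Space d → ℝ
  meas : Measurable toFun
  lower : ∃ c : ℝ, 0 < c ∧ ∀ k, c ≤ toFun k

namespace Weight

variable (W : Weight d)

theorem pos (k : Space d) : 0 < W.toFun k := by
  obtain ⟨c, hc, h⟩ := W.lower
  exact hc.trans_le (h k)

/-- The sum `∑ⱼ W(kⱼ)`. -/
def total {m : ℕ} (K : Fin m → Space d) : ℝ := ∑ j, W.toFun (K j)

theorem total_nonneg {m : ℕ} (K : Fin m → Space d) : 0 ≤ W.total K :=
  Finset.sum_nonneg fun j _ => (W.pos (K j)).le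

theorem measurable_total {m : ℕ} : Measurable fun K : Fin m → Space d => W.total K :=
  Finset.measurable_sum _ fun j _ => W.meas.comp (measurable_pi_apply j)

theorem total_perm {m : ℕ} (π : Equiv.Perm (Fin m)) (K : Fin m → Space d) :
    W.total (K ∘ π) = W.total K :=
  Equiv.sum_comp π fun j => W.toFun (K j)

/-- The symbol `F m (∑ⱼ W(kⱼ))`. -/
def symbol (F : ℕ → ℝ → ℂ) (hF : ∀ m, Measurable (F m))
    (hb : ∃ C : ℝ, 0 ≤ C ∧ ∀ m s, 0 ≤ s → (∃ K : Fin m → Space d, s = W.total K) →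
      ‖F m s‖ ≤ C) : Symbol d where
  toFun m K := F m (W.total K)
  meas m := (hF m).comp W.measurable_total
  symm m π K := by rw [W.total_perm]
  bound := by
    obtain ⟨C, hC, h⟩ := hb
    exact ⟨C, hC, fun m K => h m _ (W.total_nonneg K) ⟨K, rfl⟩⟩

/-- The symbol `(1 + |ε| ∑ⱼ W(kⱼ))⁻¹`. -/
def res (ε : ℝ) : Symbol d :=
  W.symbol (fun _ s => ((1 + |ε| * s)⁻¹ : ℝ)) (fun _ => by fun_prop) ⟨1, zero_le_one,
    fun m s hs _ => by
      rw [Complex.norm_real, Real.norm_of_nonneg (by positivity)]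
      exact inv_le_one_of_one_le₀ (by linarith [mul_nonneg (abs_nonneg ε) hs])⟩

theorem div_one_add_le {ε s : ℝ} (hε : 0 < ε) (hs : 0 ≤ s) : s / (1 + ε * s) ≤ ε⁻¹ := by
  rw [div_le_iff₀ (by positivity)]
  have : ε⁻¹ * (1 + ε * s) = ε⁻¹ + s := by field_simp
  rw [this]
  linarith [inv_pos.2 hε]

/-- The symbol `(N / (1 + ε N))^{1/2}` with `N = ∑ⱼ W(kⱼ)`. -/
def sqrtYos (ε : ℝ) (hε : 0 < ε) : Symbol d :=
  W.symbol (fun _ s => ((√(s / (1 + ε * s)) : ℝ))) (fun _ => by fun_prop)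
    ⟨√ε⁻¹, Real.sqrt_nonneg _, fun m s hs _ => by
      rw [Complex.norm_real, Real.norm_of_nonneg (Real.sqrt_nonneg _)]
      exact Real.sqrt_le_sqrt (div_one_add_le hε hs)⟩

/-- The Yosida approximation of `dΓ(W)` on Fock space. -/
def fockYos (ε : ℝ) : Fock d →L[ℂ] Fock d := (ε⁻¹ : ℂ) • (1 - (W.res ε).op)

variable {ε : ℝ}

theorem comp_fockYos (hε : 0 < ε) (ψ : Fock d) (m : ℕ) : ∀ᵐ K, (W.fockYos ε ψ).comp m K =
    ((W.total K / (1 + ε * W.total K) : ℝ) : ℂ) * ψ.comp m K := by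
  filter_upwards [Fock.comp_smul (ε⁻¹ : ℂ) (ψ - (W.res ε).op ψ) m,
    Fock.comp_sub ψ ((W.res ε).op ψ) m, (W.res ε).comp_op ψ m] with K h1 h2 h3
  change ((ε⁻¹ : ℂ) • (ψ - (W.res ε).op ψ)).comp m K = _
  rw [h1, h2, h3]
  have h0 := W.total_nonneg K
  have e : (W.total K / (1 + ε * W.total K) : ℝ) = ε⁻¹ * (1 - (1 + |ε| * W.total K)⁻¹) := by
    rw [abs_of_pos hε]
    have : 1 + ε * W.total K ≠ 0 := by positivity
    field_simp
    ring
  rw [e]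
  simp only [res, symbol]
  push_cast
  ring

/-- The Yosida approximation is the square of its square root. -/
theorem fockYos_eq (hε : 0 < ε) (ψ : Fock d) :
    W.fockYos ε ψ = (W.sqrtYos ε hε).op ((W.sqrtYos ε hε).op ψ) := by
  refine Fock.ext_comp fun m => ?_
  filter_upwards [W.comp_fockYos hε ψ m, (W.sqrtYos ε hε).comp_op ((W.sqrtYos ε hε).op ψ) m,
    (W.sqrtYos ε hε).comp_op ψ m] with K h1 h2 h3
  rw [h1, h2, h3, ← mul_assoc]
  congr 1
  have h0 := W.total_nonneg K
  simp only [sqrtYos, symbol]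
  rw [← Complex.ofReal_mul, Real.mul_self_sqrt (by positivity)]

theorem inner_sqrtYos (hε : 0 < ε) (ψ φ : Fock d) :
    ⟪(W.sqrtYos ε hε).op ψ, φ⟫_ℂ = ⟪ψ, (W.sqrtYos ε hε).op φ⟫_ℂ :=
  (W.sqrtYos ε hε).inner_op (fun _ _ => Complex.conj_ofReal _) ψ φ

theorem re_inner_fockYos (hε : 0 < ε) (ψ : Fock d) :
    (⟪ψ, W.fockYos ε ψ⟫_ℂ).re = ‖(W.sqrtYos ε hε).op ψ‖ ^ 2 := by
  rw [W.fockYos_eq hε, ← W.inner_sqrtYos hε, inner_self_eq_norm_sq_to_K]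
  norm_cast

theorem ofReal_inner_fockYos (hε : 0 < ε) (ψ : Fock d) :
    ENNReal.ofReal (⟪ψ, W.fockYos ε ψ⟫_ℂ).re =
      ∑' m, ∫⁻ K, ENNReal.ofReal (W.total K / (1 + ε * W.total K)) * ‖ψ.comp m K‖ₑ ^ 2 := by
  rw [W.re_inner_fockYos hε, Fock.ofReal_norm_sq]
  refine tsum_congr fun m => lintegral_congr_ae ?_
  filter_upwards [(W.sqrtYos ε hε).comp_op ψ m] with K h
  rw [h]
  have h0 := W.total_nonneg K
  exact enorm_sq_ofReal_mul (by positivity) _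

variable {ħ : ℝ} {f : Space d → ℂ}

theorem enorm_sq_ofReal (c : ℝ) : ‖(c : ℂ)‖ₑ ^ 2 = ENNReal.ofReal (c ^ 2) := by
  rw [← ofReal_norm, ← ENNReal.ofReal_pow (norm_nonneg _), Complex.norm_real, Real.norm_eq_abs,
    sq_abs]

/-- The increment of `s ↦ s / (1 + ε s)` between `s` and `s + a`, squared and divided by `a`. -/
theorem sq_sub_div_le {s a : ℝ} (hε : 0 < ε) (hs : 0 ≤ s) (ha : 0 < a) :
    ((s / (1 + ε * s) - (a + s) / (1 + ε * (a + s))) / √a) ^ 2 ≤ a / (1 + ε * (a + s)) := by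
  have h1 : 0 < 1 + ε * s := by positivity
  have h2 : 0 < 1 + ε * (a + s) := by positivity
  have e : s / (1 + ε * s) - (a + s) / (1 + ε * (a + s)) =
      -(a / ((1 + ε * s) * (1 + ε * (a + s)))) := by
    field_simp; ring
  rw [e, div_pow, Real.sq_sqrt ha.le, neg_sq, div_pow, div_div, div_le_div_iff₀ (by positivity) h2]
  have h3 : 1 ≤ 1 + ε * s := by linarith [mul_nonneg hε.le hs]
  have h4 : 1 ≤ 1 + ε * (a + s) := by linarith [mul_nonneg hε.le (add_pos_of_pos_of_nonneg ha hs).le]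
  have h5 : 1 ≤ (1 + ε * s) ^ 2 * (1 + ε * (a + s)) := by
    nlinarith [one_le_pow₀ h3 (n := 2)]
  calc a ^ 2 * (1 + ε * (a + s)) = (a * a * (1 + ε * (a + s))) * 1 := by ring
    _ ≤ (a * a * (1 + ε * (a + s))) * ((1 + ε * s) ^ 2 * (1 + ε * (a + s))) := by gcongr
    _ = _ := by ring

/-- Summing the weight over all particles: the symmetrization step of the commutator bound. -/
theorem lintegral_weight (ψ : Fock d) (m : ℕ) (hε : 0 < ε) :
    ENNReal.ofReal (m + 1) * ∫⁻ K : Fin (m + 1) → Space d,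
      ENNReal.ofReal (W.toFun (K 0) / (1 + ε * W.total K)) * ‖ψ.comp (m + 1) K‖ₑ ^ 2 =
    ∫⁻ K, ENNReal.ofReal (W.total K / (1 + ε * W.total K)) * ‖ψ.comp (m + 1) K‖ₑ ^ 2 := by
  have hj : ∀ j : Fin (m + 1), ∫⁻ K : Fin (m + 1) → Space d,
      ENNReal.ofReal (W.toFun (K j) / (1 + ε * W.total K)) * ‖ψ.comp (m + 1) K‖ₑ ^ 2 =
      ∫⁻ K : Fin (m + 1) → Space d,
      ENNReal.ofReal (W.toFun (K 0) / (1 + ε * W.total K)) * ‖ψ.comp (m + 1) K‖ₑ ^ 2 := by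
    intro j
    rw [← lintegral_perm (Equiv.swap 0 j) (fun K : Fin (m + 1) → Space d =>
      ENNReal.ofReal (W.toFun (K 0) / (1 + ε * W.total K)) * ‖ψ.comp (m + 1) K‖ₑ ^ 2)]
    refine lintegral_congr_ae ?_
    filter_upwards [ψ.comp_perm (m + 1) (Equiv.swap 0 j)] with K hK
    rw [hK, W.total_perm]
    simp
  have hsum : ∀ K : Fin (m + 1) → Space d,
      ENNReal.ofReal (W.total K / (1 + ε * W.total K)) * ‖ψ.comp (m + 1) K‖ₑ ^ 2 =
      ∑ j, ENNReal.ofReal (W.toFun (K j) / (1 + ε * W.total K)) * ‖ψ.comp (m + 1) K‖ₑ ^ 2 := by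
    intro K
    have h0 := W.total_nonneg K
    rw [← Finset.sum_mul, ← ENNReal.ofReal_sum_of_nonneg fun j _ =>
      div_nonneg (W.pos (K j)).le (by positivity), ← Finset.sum_div]
    rfl
  simp only [hsum]
  rw [lintegral_finsetSum']
  · simp only [hj]
    rw [Finset.sum_const, Finset.card_univ, Fintype.card_fin, nsmul_eq_mul]
    congr 1
    rw [← ENNReal.ofReal_natCast]; push_cast; rfl
  · intro j _
    refine AEMeasurable.mul ?_ ((ψ.aestronglyMeasurable_comp (m + 1)).enorm.pow_const 2)
    refine (Measurable.ennreal_ofReal ?_).aemeasurable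
    exact (W.meas.comp (measurable_pi_apply j)).div
      ((W.measurable_total.const_mul ε).const_add 1)

/-- The key commutator estimate: if `B = N/(1 + εN)` with `N = dΓ(W)`, then
`‖[B, a(f)]ψ‖ ≤ √ħ ‖√W f‖ ⟨ψ, Bψ⟩^{1/2}`, uniformly in `ε`. -/
theorem norm_commutator_annOp_le (hħ : 0 ≤ ħ) (hε : 0 < ε) (hf : MemLp f 2 volume)
    (hWf : MemLp (fun k => ((√(W.toFun k) : ℝ) : ℂ) * f k) 2 volume) (η : Fock d) :
    ‖W.fockYos ε (annOp ħ f η) - annOp ħ f (W.fockYos ε η)‖ ≤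
      √ħ * l2norm (fun k => ((√(W.toFun k) : ℝ) : ℂ) * f k) *
        √(⟪(numSymbol d).op η, W.fockYos ε ((numSymbol d).op η)⟫_ℂ).re := by
  set ψ := (numSymbol d).op η with hψ
  set u : Space d → ℂ := fun k => ((√(W.toFun k) : ℝ) : ℂ) * f k with hu
  have hS : (numSymbol d).op (W.fockYos ε η) = W.fockYos ε ψ := by
    rw [W.fockYos_eq hε, W.fockYos_eq hε, Symbol.op_comm, (numSymbol d).op_comm]
  have hpos : 0 ≤ (⟪ψ, W.fockYos ε ψ⟫_ℂ).re := by
    rw [W.re_inner_fockYos hε]; positivity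
  -- The commutator has the kernel of `a(f)` times the increment of `s ↦ s/(1 + εs)` when the
  -- particle `k` is removed. The factor `√W(k)` is moved from the increment to `f`: the commutator
  -- is the pairing of `u = √W f` with `v`.
  let v : ∀ m, (Fin (m + 1) → Space d) → ℂ := fun m K =>
    (((W.total ((0 : Fin (m + 1)).removeNth K) / (1 + ε * W.total ((0 : Fin (m + 1)).removeNth K)) -
      W.total K / (1 + ε * W.total K)) / √(W.toFun (K 0)) : ℝ) : ℂ) * ψ.comp (m + 1) K
  have hvm : ∀ m, AEStronglyMeasurable (v m) volume := by
    intro m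
    refine AEStronglyMeasurable.mul (Measurable.aestronglyMeasurable ?_)
      (ψ.aestronglyMeasurable_comp (m + 1))
    have h1 : Measurable fun K : Fin (m + 1) → Space d => W.total ((0 : Fin (m + 1)).removeNth K) :=
      W.measurable_total.comp (measurable_snd.comp (measurePreserving_removeNth 0).measurable)
    refine Complex.measurable_ofReal.comp (Measurable.div (Measurable.sub ?_ ?_) ?_)
    · exact h1.div ((h1.const_mul ε).const_add 1)
    · exact W.measurable_total.div ((W.measurable_total.const_mul ε).const_add 1)
    · exact (W.meas.comp (measurable_pi_apply 0)).sqrt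
  have hv : ∀ m K, ‖v m K‖ₑ ^ 2 ≤
      ENNReal.ofReal (W.toFun (K 0) / (1 + ε * W.total K)) * ‖ψ.comp (m + 1) K‖ₑ ^ 2 := by
    intro m K
    have h1 : W.total K = W.toFun (K 0) + W.total ((0 : Fin (m + 1)).removeNth K) := by
      simp [total, Fin.sum_univ_succ, Fin.removeNth_apply]
    simp only [v]
    rw [enorm_mul, mul_pow, enorm_sq_ofReal]
    gcongr
    rw [h1]
    exact sq_sub_div_le hε (W.total_nonneg _) (W.pos _)
  -- Symmetrization turns `(m+1) W(k₁)` into the sum of all `W(kⱼ)`.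
  have hvint : ∀ m : ℕ, ENNReal.ofReal ((m : ℝ) + 1) * ∫⁻ K, ‖v m K‖ₑ ^ 2 ≤
      ∫⁻ K, ENNReal.ofReal (W.total K / (1 + ε * W.total K)) * ‖ψ.comp (m + 1) K‖ₑ ^ 2 := by
    intro m
    rw [← W.lintegral_weight ψ m hε]
    gcongr
    exact hv m _
  have hB := W.ofReal_inner_fockYos hε ψ
  have hvtop : ∀ m, ∫⁻ K, ‖v m K‖ₑ ^ 2 ≠ ∞ := by
    intro m htop
    have h1 := hvint m
    rw [htop, ENNReal.mul_top (by simp; positivity), top_le_iff] at h1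
    have h2 := ENNReal.le_tsum (f := fun m => ∫⁻ K, ENNReal.ofReal
      (W.total K / (1 + ε * W.total K)) * ‖ψ.comp m K‖ₑ ^ 2) (m + 1)
    rw [h1, ← hB, top_le_iff] at h2
    exact ENNReal.ofReal_ne_top h2
  have hcomp : ∀ m, ∀ᵐ K, (W.fockYos ε (annOp ħ f η) - annOp ħ f (W.fockYos ε η)).comp m K =
      ((√(ħ * (m + 1)) : ℝ) : ℂ) * annKernel u (v m) K := by
    intro m
    filter_upwards [Fock.comp_sub (W.fockYos ε (annOp ħ f η)) (annOp ħ f (W.fockYos ε η)) m,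
      W.comp_fockYos hε (annOp ħ f η) m, comp_annOp hħ hf η m, comp_annOp hħ hf (W.fockYos ε η) m,
      ae_ae_cons (W.comp_fockYos hε ψ (m + 1)), ae_integrable_annKernel hf ψ m,
      ae_integrable_annKernel hf (W.fockYos ε ψ) m] with K h1 h2 h3 h4 h5 h6 h7
    rw [h1, h2, h3, h4, hS, mul_left_comm, ← mul_sub, ← hψ]
    congr 1
    rw [annKernel, annKernel, annKernel, ← integral_const_mul, ← integral_sub (h6.const_mul _) h7]
    refine integral_congr_ae ?_
    filter_upwards [h5] with k hk
    have hw : ((√(W.toFun k) : ℝ) : ℂ) ≠ 0 := by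
      have := Real.sqrt_pos.2 (W.pos k)
      exact_mod_cast this.ne'
    rw [hk]
    simp only [u, v, Fin.cons_zero, Fin.removeNth_zero, Fin.tail_cons, map_mul, Complex.conj_ofReal]
    push_cast
    field_simp
  refine Fock.norm_le_of_tsum_le (by have := l2norm_nonneg u; positivity) ?_
  have hb : ∀ m, ∫⁻ K, ‖(W.fockYos ε (annOp ħ f η) - annOp ħ f (W.fockYos ε η)).comp m K‖ₑ ^ 2 ≤
      ENNReal.ofReal (ħ * l2norm u ^ 2) * ∫⁻ K, ENNReal.ofReal (W.total K / (1 + ε * W.total K)) *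
        ‖ψ.comp (m + 1) K‖ₑ ^ 2 := by
    intro m
    have e : ∫⁻ K, ‖(W.fockYos ε (annOp ħ f η) - annOp ħ f (W.fockYos ε η)).comp m K‖ₑ ^ 2 =
        ENNReal.ofReal (ħ * (m + 1)) * ∫⁻ K, ‖annKernel u (v m) K‖ₑ ^ 2 := by
      rw [← lintegral_const_mul' _ _ ENNReal.ofReal_ne_top]
      refine lintegral_congr_ae ?_
      filter_upwards [hcomp m] with K hK
      rw [hK, enorm_sq_ofReal_mul (by positivity)]
    rw [e]
    calc _ ≤ ENNReal.ofReal (ħ * (m + 1)) * ((∫⁻ k, ‖u k‖ₑ ^ 2) * ∫⁻ K, ‖v m K‖ₑ ^ 2) := by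
          gcongr
          exact lintegral_annKernel_le hWf.1 (lintegral_enorm_sq_ne_top hWf) (hvm m) (hvtop m)
      _ = ENNReal.ofReal (ħ * l2norm u ^ 2) *
          (ENNReal.ofReal (m + 1) * ∫⁻ K, ‖v m K‖ₑ ^ 2) := by
          rw [← ofReal_l2norm_sq hWf, ENNReal.ofReal_mul hħ, ENNReal.ofReal_mul hħ]; ring
      _ ≤ _ := by gcongr; exact hvint m
  -- Summing over the particle number bounds the square of the norm by `ħ ‖u‖² ⟨ψ, Bψ⟩`.
  refine (ENNReal.tsum_le_tsum hb).trans ?_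
  rw [ENNReal.tsum_mul_left, mul_pow, mul_pow, Real.sq_sqrt hħ, Real.sq_sqrt hpos,
    ENNReal.ofReal_mul (show 0 ≤ ħ * l2norm u ^ 2 by positivity), hB]
  exact mul_le_mul' le_rfl (ENNReal.tsum_comp_le_tsum_of_injective (add_left_injective 1)
    fun m => ∫⁻ K, ENNReal.ofReal (W.total K / (1 + ε * W.total K)) * ‖ψ.comp m K‖ₑ ^ 2)

end Weight

end Weight

/-! ### Decomposable operators on `L²(ℝ^{dn}; Γ_s)` -/

section OpField

variable {d n : ℕ}

/-- A bounded measurable field of bounded operators on Fock space over the configuration space. -/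
structure OpField (d n : ℕ) where
  toFun : Config d n → Fock d →L[ℂ] Fock d
  meas : StronglyMeasurable toFun
  bound : ∃ C : ℝ, 0 ≤ C ∧ ∀ x, ‖toFun x‖ ≤ C

namespace OpField

theorem memLp_apply (L : OpField d n) (ψ : Hilb d n) :
    MemLp (fun x => L.toFun x (ψ x)) 2 volume := by
  obtain ⟨C, -, hL⟩ := L.bound
  refine (Lp.memLp ψ).of_le_mul (c := C) ?_ (Eventually.of_forall fun x => ?_)
  · exact isBoundedBilinearMap_apply.continuous.comp_aestronglyMeasurable
      (L.meas.aestronglyMeasurable.prodMk (Lp.aestronglyMeasurable ψ))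
  · exact (L.toFun x).le_of_opNorm_le (hL x) _

/-- The decomposable operator as a linear map. -/
def lin (L : OpField d n) : Hilb d n →ₗ[ℂ] Hilb d n where
  toFun ψ := (L.memLp_apply ψ).toLp
  map_add' ψ φ := by
    apply Lp.ext
    filter_upwards [(L.memLp_apply (ψ + φ)).coeFn_toLp, (L.memLp_apply ψ).coeFn_toLp,
      (L.memLp_apply φ).coeFn_toLp, Lp.coeFn_add ψ φ,
      Lp.coeFn_add (L.memLp_apply ψ).toLp (L.memLp_apply φ).toLp] with x h1 h2 h3 h4 h5
    rw [h1, h5, Pi.add_apply, h2, h3, h4, Pi.add_apply, map_add]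
  map_smul' c ψ := by
    apply Lp.ext
    filter_upwards [(L.memLp_apply (c • ψ)).coeFn_toLp, (L.memLp_apply ψ).coeFn_toLp,
      Lp.coeFn_smul c ψ, Lp.coeFn_smul c (L.memLp_apply ψ).toLp] with x h1 h2 h3 h4
    rw [RingHom.id_apply, h1, h4, Pi.smul_apply, h2, h3, Pi.smul_apply, map_smul]

theorem coeFn_lin (L : OpField d n) (ψ : Hilb d n) : ∀ᵐ x, L.lin ψ x = L.toFun x (ψ x) :=
  (L.memLp_apply ψ).coeFn_toLp

theorem exists_bound_lin (L : OpField d n) : ∃ C : ℝ, ∀ ψ, ‖L.lin ψ‖ ≤ C * ‖ψ‖ := by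
  obtain ⟨C, -, hL⟩ := L.bound
  refine ⟨C, fun ψ => Lp.norm_le_mul_norm_of_ae_le_mul ?_⟩
  filter_upwards [L.coeFn_lin ψ] with x h
  rw [h]
  exact (L.toFun x).le_of_opNorm_le (hL x) _

/-- The decomposable operator `(Lψ)(x) = L(x) ψ(x)`. -/
def op (L : OpField d n) : Hilb d n →L[ℂ] Hilb d n :=
  L.lin.mkContinuousOfExistsBound L.exists_bound_lin

theorem coeFn_op (L : OpField d n) (ψ : Hilb d n) : ∀ᵐ x, L.op ψ x = L.toFun x (ψ x) :=
  L.coeFn_lin ψ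

theorem norm_op_apply_le (L : OpField d n) {C : ℝ} (h : ∀ x, ‖L.toFun x‖ ≤ C) (ψ : Hilb d n) :
    ‖L.op ψ‖ ≤ C * ‖ψ‖ := by
  refine Lp.norm_le_mul_norm_of_ae_le_mul ?_
  filter_upwards [L.coeFn_op ψ] with x hx
  rw [hx]
  exact (L.toFun x).le_of_opNorm_le (h x) _

theorem op_comm {L L' : OpField d n} (h : ∀ x v, L.toFun x (L'.toFun x v) =
    L'.toFun x (L.toFun x v)) (ψ : Hilb d n) : L.op (L'.op ψ) = L'.op (L.op ψ) := by
  apply Lp.ext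
  filter_upwards [L.coeFn_op (L'.op ψ), L'.coeFn_op (L.op ψ), L.coeFn_op ψ, L'.coeFn_op ψ]
    with x h1 h2 h3 h4
  rw [h1, h2, h3, h4, h]

/-- The field constantly equal to `T`. -/
def const (n : ℕ) (T : Fock d →L[ℂ] Fock d) : OpField d n where
  toFun _ := T
  meas := stronglyMeasurable_const
  bound := ⟨‖T‖, norm_nonneg _, fun _ => le_rfl⟩

/-- The field `g(x) • 1` for a bounded function `g`. -/
def scalar (g : Config d n → ℂ) (hg : Measurable g) (hb : ∃ C : ℝ, ∀ x, ‖g x‖ ≤ C) :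
    OpField d n where
  toFun x := g x • ContinuousLinearMap.id ℂ (Fock d)
  meas := hg.stronglyMeasurable.smul_const _
  bound := by
    obtain ⟨C, hC⟩ := hb
    refine ⟨C, (norm_nonneg _).trans (hC 0), fun x => ?_⟩
    refine ContinuousLinearMap.opNorm_le_bound _ ((norm_nonneg _).trans (hC 0)) fun v => ?_
    rw [smul_apply, norm_smul]
    exact mul_le_mul_of_nonneg_right (hC x) (norm_nonneg _)

theorem coeFn_scalar_op {g : Config d n → ℂ} (hg : Measurable g) (hb : ∃ C : ℝ, ∀ x, ‖g x‖ ≤ C)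
    (ψ : Hilb d n) : ∀ᵐ x, (scalar g hg hb).op ψ x = g x • ψ x :=
  (scalar g hg hb).coeFn_op ψ

theorem coeFn_const_op (T : Fock d →L[ℂ] Fock d) (ψ : Hilb d n) :
    ∀ᵐ x, (const n T).op ψ x = T (ψ x) :=
  (const n T).coeFn_op ψ

theorem scalar_op_comm {g : Config d n → ℂ} (hg : Measurable g) (hb : ∃ C : ℝ, ∀ x, ‖g x‖ ≤ C)
    (L : OpField d n) (ψ : Hilb d n) :
    (scalar g hg hb).op (L.op ψ) = L.op ((scalar g hg hb).op ψ) :=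
  op_comm (fun x v => by simp [scalar]) ψ

theorem const_op_comm {T T' : Fock d →L[ℂ] Fock d} (h : ∀ v, T (T' v) = T' (T v))
    (ψ : Hilb d n) : (const n T).op ((const n T').op ψ) = (const n T').op ((const n T).op ψ) :=
  op_comm (fun _ => h) ψ

end OpField

theorem Hilb.integrable_norm_sq (ψ : Hilb d n) : Integrable (fun x => ‖ψ x‖ ^ 2) volume :=
  (memLp_two_iff_integrable_sq_norm (Lp.aestronglyMeasurable ψ)).1 (Lp.memLp ψ)

theorem Hilb.norm_sq_eq (ψ : Hilb d n) : ‖ψ‖ ^ 2 = ∫ x, ‖ψ x‖ ^ 2 := by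
  have h : ((‖ψ‖ ^ 2 : ℝ) : ℂ) = ((∫ x, ‖ψ x‖ ^ 2 : ℝ) : ℂ) := by
    have h2 := inner_self_eq_norm_sq_to_K (𝕜 := ℂ) ψ
    rw [L2.inner_def] at h2
    rw [← integral_complex_ofReal]
    have e : (fun x => (((‖ψ x‖ ^ 2 : ℝ)) : ℂ)) = fun x => ⟪ψ x, ψ x⟫_ℂ := by
      funext x
      rw [inner_self_eq_norm_sq_to_K]; norm_cast
    rw [e, h2]; norm_cast
  exact_mod_cast h

theorem Hilb.ofReal_norm_sq (ψ : Hilb d n) : ENNReal.ofReal (‖ψ‖ ^ 2) = ∫⁻ x, ‖ψ x‖ₑ ^ 2 := by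
  rw [Hilb.norm_sq_eq, ofReal_integral_eq_lintegral_ofReal (Hilb.integrable_norm_sq ψ)
    (Eventually.of_forall fun x => by positivity)]
  refine lintegral_congr fun x => ?_
  rw [ENNReal.ofReal_pow (norm_nonneg _), ofReal_norm]

/-- Fibrewise quadratic inequalities can be integrated. -/
theorem Hilb.norm_sq_le_of_ae {ψ φ χ : Hilb d n} {a b : ℝ}
    (h : ∀ᵐ x, ‖ψ x‖ ^ 2 ≤ a * ‖φ x‖ ^ 2 + b * ‖χ x‖ ^ 2) :
    ‖ψ‖ ^ 2 ≤ a * ‖φ‖ ^ 2 + b * ‖χ‖ ^ 2 := by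
  rw [Hilb.norm_sq_eq ψ, Hilb.norm_sq_eq φ, Hilb.norm_sq_eq χ, ← integral_const_mul, ← integral_const_mul,
    ← integral_add ((Hilb.integrable_norm_sq φ).const_mul a) ((Hilb.integrable_norm_sq χ).const_mul b)]
  exact integral_mono_ae (Hilb.integrable_norm_sq ψ)
    (((Hilb.integrable_norm_sq φ).const_mul a).add ((Hilb.integrable_norm_sq χ).const_mul b)) h

theorem Hilb.inner_congr {ψ φ ψ' φ' : Hilb d n} (h : ∀ᵐ x, ⟪ψ x, φ x⟫_ℂ = ⟪ψ' x, φ' x⟫_ℂ) :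
    ⟪ψ, φ⟫_ℂ = ⟪ψ', φ'⟫_ℂ := by
  rw [L2.inner_def, L2.inner_def]
  exact integral_congr_ae h

theorem Hilb.re_inner_nonneg {ψ φ : Hilb d n} (h : ∀ᵐ x, 0 ≤ (⟪ψ x, φ x⟫_ℂ).re) :
    0 ≤ (⟪ψ, φ⟫_ℂ).re := by
  rw [L2.inner_def]
  change 0 ≤ RCLike.re (∫ x, ⟪ψ x, φ x⟫_ℂ)
  rw [← integral_re (L2.integrable_inner ψ φ)]
  exact integral_nonneg_of_ae h

end OpField

/-! ### The Fourier transform, translations and modulations -/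

section Fourier

variable {d n : ℕ}

/-- The Fourier transform in the particle variables commutes with operators on the Fock space. -/
theorem fourier_const_op (T : Fock d →L[ℂ] Fock d) (ψ : Hilb d n) :
    𝓕 ((OpField.const n T).op ψ) = (OpField.const n T).op (𝓕 ψ) := by
  -- Both sides are continuous in `ψ`, so Schwartz functions suffice.
  refine DenseRange.induction_on (p := fun ψ : Hilb d n =>
    𝓕 ((OpField.const n T).op ψ) = (OpField.const n T).op (𝓕 ψ))
    (SchwartzMap.denseRange_toLpCLM (E := Config d n) (F := Fock d) (p := 2)
      ENNReal.ofNat_ne_top) ψ ?_ ?_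
  · exact isClosed_eq
      ((Lp.fourierTransformₗᵢ _ _).continuous.comp (OpField.const n T).op.continuous)
      ((OpField.const n T).op.continuous.comp (Lp.fourierTransformₗᵢ _ _).continuous)
  · intro f
    change 𝓕 ((OpField.const n T).op (f.toLp 2)) = (OpField.const n T).op (𝓕 (f.toLp 2))
    have e : (OpField.const n T).op (f.toLp 2) = (SchwartzMap.postcompCLM T f).toLp 2 := by
      apply Lp.ext
      filter_upwards [OpField.coeFn_const_op T (f.toLp 2 : Hilb d n), f.coeFn_toLp 2,
        (SchwartzMap.postcompCLM T f).coeFn_toLp 2] with x h1 h2 h3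
      rw [h1, h2, h3]; rfl
    rw [e, SchwartzMap.toLp_fourier_eq, SchwartzMap.toLp_fourier_eq]
    apply Lp.ext
    filter_upwards [OpField.coeFn_const_op T ((𝓕 f).toLp 2 : Hilb d n), (𝓕 f).coeFn_toLp 2,
        (𝓕 (SchwartzMap.postcompCLM T f)).coeFn_toLp 2] with x h1 h2 h3
    rw [h1, h2, h3, SchwartzMap.fourier_coe, SchwartzMap.fourier_coe, Real.fourier_eq,
      Real.fourier_eq, ← ContinuousLinearMap.integral_comp_comm]
    · refine integral_congr_ae (Eventually.of_forall fun v => ?_)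
      simp [Circle.smul_def]
    · exact (Real.fourierIntegral_convergent_iff x).2 f.integrable

/-- Translation `ψ ↦ ψ(· + h)`. -/
def translate (h : Config d n) : Hilb d n →L[ℂ] Hilb d n :=
  (Lp.compMeasurePreservingₗᵢ ℂ (fun x => x + h)
    (measurePreserving_add_right volume h)).toContinuousLinearMap

theorem coeFn_translate (h : Config d n) (ψ : Hilb d n) :
    ∀ᵐ x, translate h ψ x = ψ (x + h) :=
  Lp.coeFn_compMeasurePreserving ψ (measurePreserving_add_right volume h)

theorem norm_translate (h : Config d n) (ψ : Hilb d n) : ‖translate h ψ‖ = ‖ψ‖ :=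
  (Lp.compMeasurePreservingₗᵢ ℂ (fun x => x + h)
    (measurePreserving_add_right volume h)).norm_map ψ

/-- The phase `e^{2πi⟨h, x⟩}`. -/
def phase (h x : Config d n) : ℂ := Complex.exp ((2 * Real.pi * ⟪h, x⟫_ℝ : ℝ) * Complex.I)

theorem norm_phase (h x : Config d n) : ‖phase h x‖ = 1 := Complex.norm_exp_ofReal_mul_I _

theorem continuous_phase (h : Config d n) : Continuous (phase h) := by
  unfold phase; fun_prop

/-- Multiplication by the phase `e^{2πi⟨h, x⟩}`. -/
def modulate (h : Config d n) : OpField d n :=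
  OpField.scalar (phase h) (continuous_phase h).measurable ⟨1, fun x => (norm_phase h x).le⟩

theorem coeFn_modulate (h : Config d n) (ψ : Hilb d n) :
    ∀ᵐ x, (modulate h).op ψ x = phase h x • ψ x :=
  OpField.coeFn_scalar_op (continuous_phase h).measurable _ ψ

theorem translate_toLp (h : Config d n) (f : SchwartzMap (Config d n) (Fock d)) :
    translate h (f.toLp 2) = (SchwartzMap.compSubConstCLM ℂ (-h) f).toLp 2 := by
  apply Lp.ext
  filter_upwards [coeFn_translate h (f.toLp 2 : Hilb d n),
    (measurePreserving_add_right volume h).quasiMeasurePreserving.ae_eq_comp (f.coeFn_toLp 2 volume),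
    (SchwartzMap.compSubConstCLM ℂ (-h) f).coeFn_toLp 2] with x h1 h2 h3
  rw [h1, h3]
  exact h2.trans (by simp)

theorem fourier_translate (h : Config d n) (ψ : Hilb d n) :
    𝓕 (translate h ψ) = (modulate h).op (𝓕 ψ) := by
  -- Both sides are continuous in `ψ`; on Schwartz functions this is a change of variables.
  refine DenseRange.induction_on (p := fun ψ : Hilb d n =>
    𝓕 (translate h ψ) = (modulate h).op (𝓕 ψ))
    (SchwartzMap.denseRange_toLpCLM (E := Config d n) (F := Fock d) (p := 2)
      ENNReal.ofNat_ne_top) ψ ?_ ?_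
  · exact isClosed_eq ((Lp.fourierTransformₗᵢ _ _).continuous.comp (translate h).continuous)
      ((modulate h).op.continuous.comp (Lp.fourierTransformₗᵢ _ _).continuous)
  · intro f
    change 𝓕 (translate h (f.toLp 2)) = (modulate h).op (𝓕 (f.toLp 2))
    rw [translate_toLp, SchwartzMap.toLp_fourier_eq, SchwartzMap.toLp_fourier_eq]
    apply Lp.ext
    filter_upwards [coeFn_modulate h ((𝓕 f).toLp 2 : Hilb d n), (𝓕 f).coeFn_toLp 2,
        (𝓕 (SchwartzMap.compSubConstCLM ℂ (-h) f)).coeFn_toLp 2] with x h1 h2 h3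
    rw [h1, h2, h3, SchwartzMap.fourier_coe, SchwartzMap.fourier_coe, Real.fourier_eq',
      Real.fourier_eq', ← integral_smul]
    rw [← integral_add_right_eq_self (fun v => Complex.exp (((-2 * Real.pi * ⟪v, x⟫_ℝ : ℝ) : ℂ) *
      Complex.I) • (SchwartzMap.compSubConstCLM ℂ (-h) f) v) (-h)]
    refine integral_congr_ae (Eventually.of_forall fun v => ?_)
    simp only [SchwartzMap.compSubConstCLM_apply, sub_neg_eq_add, neg_add_cancel_right, smul_smul,
      phase, ← Complex.exp_add]
    congr 2
    rw [inner_add_left, inner_neg_left]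
    push_cast
    ring

theorem fourierInv_translate (h : Config d n) (ψ : Hilb d n) :
    𝓕⁻ (translate h ψ) = (modulate (-h)).op (𝓕⁻ ψ) := by
  -- Both sides are continuous in `ψ`; on Schwartz functions this is a change of variables.
  refine DenseRange.induction_on (p := fun ψ : Hilb d n =>
    𝓕⁻ (translate h ψ) = (modulate (-h)).op (𝓕⁻ ψ))
    (SchwartzMap.denseRange_toLpCLM (E := Config d n) (F := Fock d) (p := 2)
      ENNReal.ofNat_ne_top) ψ ?_ ?_
  · exact isClosed_eq
      ((Lp.fourierTransformₗᵢ _ _).symm.continuous.comp (translate h).continuous)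
      ((modulate (-h)).op.continuous.comp (Lp.fourierTransformₗᵢ _ _).symm.continuous)
  · intro f
    change 𝓕⁻ (translate h (f.toLp 2)) = (modulate (-h)).op (𝓕⁻ (f.toLp 2))
    rw [translate_toLp, SchwartzMap.toLp_fourierInv_eq, SchwartzMap.toLp_fourierInv_eq]
    apply Lp.ext
    filter_upwards [coeFn_modulate (-h) ((𝓕⁻ f).toLp 2 : Hilb d n), (𝓕⁻ f).coeFn_toLp 2,
        (𝓕⁻ (SchwartzMap.compSubConstCLM ℂ (-h) f)).coeFn_toLp 2] with x h1 h2 h3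
    rw [h1, h2, h3, SchwartzMap.fourierInv_coe, SchwartzMap.fourierInv_coe, Real.fourierInv_eq',
      Real.fourierInv_eq', ← integral_smul]
    rw [← integral_add_right_eq_self (fun v => Complex.exp (((2 * Real.pi * ⟪v, x⟫_ℝ : ℝ) : ℂ) *
      Complex.I) • (SchwartzMap.compSubConstCLM ℂ (-h) f) v) (-h)]
    refine integral_congr_ae (Eventually.of_forall fun v => ?_)
    simp only [SchwartzMap.compSubConstCLM_apply, sub_neg_eq_add, neg_add_cancel_right, smul_smul,
      phase, ← Complex.exp_add]
    congr 2
    rw [inner_add_left, inner_neg_left]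
    push_cast
    ring

theorem fourier_modulate (h : Config d n) (ψ : Hilb d n) :
    𝓕 ((modulate h).op ψ) = translate (-h) (𝓕 ψ) := by
  have h1 := fourierInv_translate (-h) (𝓕 ψ)
  rw [neg_neg, FourierTransform.fourierInv_fourier_eq] at h1
  rw [← h1, FourierTransform.fourier_fourierInv_eq]

end Fourier

/-! ### The graphs and the resolvents of `g(q̂)`, `g(p̂)` and `dΓ(w)` -/

section Graphs

variable {d n : ℕ} {ħ : ℝ} {g : Config d n → ℝ} {w : Space d → ℝ} {ψ φ : Hilb d n}

theorem mem_graph_positionOp :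
    (ψ, φ) ∈ (positionOp g).graph ↔ ∀ᵐ x, φ x = (g x : ℂ) • ψ x := by
  rw [graph_positionOp]
  change (∀ᵐ x, (ψ x, φ x) ∈ scalarGraph (g x)) ↔ _
  simp only [scalarGraph, LinearMap.mem_graph_iff]
  rfl

theorem mem_graph_momentumOp : (ψ, φ) ∈ (momentumOp ħ g).graph ↔
    (𝓕 ψ, 𝓕 φ) ∈ (positionOp fun ξ : Config d n => g ((2 * Real.pi * ħ) • ξ)).graph := by
  rw [graph_momentumOp, graph_positionOp]
  rfl

theorem mem_graph_dGamma :
    (ψ, φ) ∈ (dGamma n ħ w).graph ↔ ∀ᵐ x, (ψ x, φ x) ∈ dGammaGraph ħ w := by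
  rw [graph_dGamma]
  rfl

/-- The operator `𝓕⁻¹ T 𝓕`. -/
def fconj (T : Hilb d n →L[ℂ] Hilb d n) : Hilb d n →L[ℂ] Hilb d n :=
  (Lp.fourierTransformₗᵢ (Config d n) (Fock d)).symm.toContinuousLinearEquiv.toContinuousLinearMap
    ∘L T ∘L (Lp.fourierTransformₗᵢ (Config d n) (Fock d)).toContinuousLinearEquiv

theorem fconj_apply (T : Hilb d n →L[ℂ] Hilb d n) (ψ : Hilb d n) :
    fconj T ψ = 𝓕⁻ (T (𝓕 ψ)) := rfl

theorem fourier_fconj (T : Hilb d n →L[ℂ] Hilb d n) (ψ : Hilb d n) :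
    𝓕 (fconj T ψ) = T (𝓕 ψ) := by
  rw [fconj_apply, FourierTransform.fourier_fourierInv_eq]

theorem eq_of_fourier_eq (h : 𝓕 ψ = 𝓕 φ) : ψ = φ :=
  (Lp.fourierTransformₗᵢ (Config d n) (Fock d)).injective h

theorem inner_fourier (ψ φ : Hilb d n) : ⟪ψ, φ⟫_ℂ = ⟪(𝓕 ψ : Hilb d n), (𝓕 φ : Hilb d n)⟫_ℂ :=
  (Lp.inner_fourier_eq ψ φ).symm

theorem fourier_inv (ψ : Hilb d n) : 𝓕 (𝓕⁻ ψ : Hilb d n) = ψ :=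
  (Lp.fourierTransformₗᵢ (Config d n) (Fock d)).apply_symm_apply ψ

theorem inv_fourier (ψ : Hilb d n) : 𝓕⁻ (𝓕 ψ : Hilb d n) = ψ :=
  (Lp.fourierTransformₗᵢ (Config d n) (Fock d)).symm_apply_apply ψ

theorem fourier_smul' (c : ℂ) (ψ : Hilb d n) : 𝓕 (c • ψ) = c • 𝓕 ψ :=
  (Lp.fourierTransformₗᵢ (Config d n) (Fock d)).map_smul c ψ

theorem fourier_sub' (ψ φ : Hilb d n) : 𝓕 (ψ - φ) = 𝓕 ψ - 𝓕 φ :=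
  (Lp.fourierTransformₗᵢ (Config d n) (Fock d)).map_sub ψ φ

theorem norm_fconj_apply_le {T : Hilb d n →L[ℂ] Hilb d n} {C : ℝ}
    (h : ∀ ψ, ‖T ψ‖ ≤ C * ‖ψ‖) (ψ : Hilb d n) : ‖fconj T ψ‖ ≤ C * ‖ψ‖ := by
  rw [← Lp.norm_fourier_eq (fconj T ψ), fourier_fconj, ← Lp.norm_fourier_eq ψ]
  exact h _

theorem fconj_comm {T T' : Hilb d n →L[ℂ] Hilb d n} (h : ∀ ψ, T (T' ψ) = T' (T ψ))
    (ψ : Hilb d n) : fconj T (fconj T' ψ) = fconj T' (fconj T ψ) := by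
  apply eq_of_fourier_eq
  simp only [fourier_fconj, h]

/-- Operators on the Fock space are unchanged by conjugation with the Fourier transform. -/
theorem fconj_const (T : Fock d →L[ℂ] Fock d) (ψ : Hilb d n) :
    fconj (OpField.const n T).op ψ = (OpField.const n T).op ψ := by
  apply eq_of_fourier_eq
  rw [fourier_fconj, fourier_const_op]

theorem fconj_const_comm {T : Hilb d n →L[ℂ] Hilb d n} {T' : Fock d →L[ℂ] Fock d}
    (h : ∀ ψ, T ((OpField.const n T').op ψ) = (OpField.const n T').op (T ψ)) (ψ : Hilb d n) :
    fconj T ((OpField.const n T').op ψ) = (OpField.const n T').op (fconj T ψ) := by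
  rw [← fconj_const T' ψ, fconj_comm h, fconj_const]

/-- Multiplication by `(1 + |ε| |g|)⁻¹`. -/
def scalarRes (g : Config d n → ℝ) (hg : Measurable g) (ε : ℝ) : OpField d n :=
  OpField.scalar (fun x => ((1 + |ε| * |g x|)⁻¹ : ℝ))
    (Complex.measurable_ofReal.comp ((hg.abs.const_mul _).const_add _).inv)
    ⟨1, fun x => by
      rw [Complex.norm_real, Real.norm_of_nonneg (by positivity)]
      exact inv_le_one_of_one_le₀ (by linarith [mul_nonneg (abs_nonneg ε) (abs_nonneg (g x))])⟩

theorem coeFn_scalarRes (hg : Measurable g) (ε : ℝ) (ψ : Hilb d n) :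
    ∀ᵐ x, (scalarRes g hg ε).op ψ x = (((1 + |ε| * |g x|)⁻¹ : ℝ) : ℂ) • ψ x :=
  OpField.coeFn_scalar_op _ _ ψ

theorem coeFn_yosida_scalarRes (hg : Measurable g) (h0 : ∀ x, 0 ≤ g x) {ε : ℝ} (hε : 0 < ε)
    (ψ : Hilb d n) : ∀ᵐ x, yosida (fun ε => (scalarRes g hg ε).op) ε ψ x =
      ((g x / (1 + ε * g x) : ℝ) : ℂ) • ψ x := by
  filter_upwards [coeFn_scalarRes hg ε ψ, Lp.coeFn_smul (ε⁻¹ : ℂ) (ψ - (scalarRes g hg ε).op ψ),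
    Lp.coeFn_sub ψ ((scalarRes g hg ε).op ψ)] with x h1 h2 h3
  rw [yosida_apply, h2, Pi.smul_apply, h3, Pi.sub_apply, h1]
  have h4 := h0 x
  have e : (g x / (1 + ε * g x) : ℝ) = ε⁻¹ * (1 - (1 + |ε| * |g x|)⁻¹) := by
    rw [abs_of_pos hε, abs_of_nonneg h4]
    have : 1 + ε * g x ≠ 0 := by positivity
    field_simp
    ring
  rw [e]
  push_cast
  module

/-- For nonnegative `g` the resolvent of `g(q̂)` is multiplication by `(1 + εg)⁻¹`. -/
theorem isYosida_positionOp (hg : Measurable g) (h0 : ∀ x, 0 ≤ g x) :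
    IsYosida (positionOp g : Hilb d n →ₗ.[ℂ] Hilb d n) (fun ε => (scalarRes g hg ε).op) where
  symm := by
    intro z hz y hy
    refine Hilb.inner_congr ?_
    filter_upwards [mem_graph_positionOp.1 hz, mem_graph_positionOp.1 hy] with x h1 h2
    rw [h1, h2, inner_smul_left, inner_smul_right, Complex.conj_ofReal]
  nonneg := by
    intro z hz
    refine Hilb.re_inner_nonneg ?_
    filter_upwards [mem_graph_positionOp.1 hz] with x h1
    rw [h1, inner_smul_right, Complex.re_ofReal_mul]
    exact mul_nonneg (h0 x) (inner_self_nonneg (𝕜 := ℂ))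
  res := by
    intro ε hε φ
    rw [mem_graph_positionOp]
    filter_upwards [coeFn_yosida_scalarRes hg h0 hε φ, coeFn_scalarRes hg ε φ] with x h1 h2
    rw [yosida_apply] at h1
    rw [h1, h2, smul_smul]
    congr 1
    have h4 := h0 x
    rw [abs_of_pos hε, abs_of_nonneg h4]
    push_cast
    rfl

/-- For nonnegative `g` the resolvent of `g(p̂)` is a Fourier multiplier. -/
theorem isYosida_momentumOp (hg : Measurable fun ξ : Config d n => g ((2 * Real.pi * ħ) • ξ))
    (h0 : ∀ x, 0 ≤ g x) : IsYosida (momentumOp ħ g : Hilb d n →ₗ.[ℂ] Hilb d n)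
      (fun ε => fconj (scalarRes _ hg ε).op) := by
  have h := isYosida_positionOp (d := d) (n := n) hg fun x => h0 ((2 * Real.pi * ħ) • x)
  constructor
  · intro z hz y hy
    have h1 := h.symm _ (mem_graph_momentumOp.1 hz) _ (mem_graph_momentumOp.1 hy)
    exact (inner_fourier _ _).trans (h1.trans (inner_fourier _ _).symm)
  · intro z hz
    have h1 := h.nonneg _ (mem_graph_momentumOp.1 hz)
    rw [inner_fourier]
    exact h1
  · intro ε hε φ
    rw [mem_graph_momentumOp, fourier_smul', fourier_sub', fourier_fconj]
    exact h.res ε hε _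

theorem inner_dGammaGraph {z y : Fock d × Fock d} (hz : z ∈ dGammaGraph ħ w)
    (hy : y ∈ dGammaGraph ħ w) : ⟪z.2, y.1⟫_ℂ = ⟪z.1, y.2⟫_ℂ := by
  refine Fock.inner_congr fun m => ?_
  filter_upwards [hz m, hy m] with K h1 h2
  rw [h1, h2, map_mul, Complex.conj_ofReal]
  ring

theorem re_inner_dGammaGraph (h0 : ∀ k, 0 ≤ ħ * w k) {z : Fock d × Fock d}
    (hz : z ∈ dGammaGraph ħ w) : 0 ≤ (⟪z.1, z.2⟫_ℂ).re := by
  refine Fock.re_inner_nonneg fun m => ?_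
  filter_upwards [hz m] with K h1
  rw [h1, mul_left_comm, Complex.re_ofReal_mul, ← Complex.normSq_eq_conj_mul_self,
    Complex.ofReal_re]
  refine mul_nonneg ?_ (Complex.normSq_nonneg _)
  rw [Finset.mul_sum]
  exact Finset.sum_nonneg fun j _ => h0 _

theorem res_mem_dGammaGraph (W : Weight d) (hW : ∀ k, W.toFun k = ħ * w k) {ε : ℝ} (hε : 0 < ε)
    (v : Fock d) : ((W.res ε).op v, W.fockYos ε v) ∈ dGammaGraph ħ w := by
  intro m
  filter_upwards [W.comp_fockYos hε v m, (W.res ε).comp_op v m] with K h1 h2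
  rw [h1, h2, ← mul_assoc]
  congr 1
  have e : ħ * ∑ j, w (K j) = W.total K := by
    rw [Weight.total, Finset.mul_sum]
    exact Finset.sum_congr rfl fun j _ => (hW _).symm
  simp only [Weight.res, Weight.symbol]
  rw [e, abs_of_pos hε, ← Complex.ofReal_mul, div_eq_mul_inv]

theorem yosida_const_res (W : Weight d) (ε : ℝ) (ψ : Hilb d n) :
    yosida (fun ε => (OpField.const n (W.res ε).op).op) ε ψ =
      (OpField.const n (W.fockYos ε)).op ψ := by
  apply Lp.ext
  filter_upwards [OpField.coeFn_const_op (W.fockYos ε) ψ, OpField.coeFn_const_op (W.res ε).op ψ,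
    Lp.coeFn_smul (ε⁻¹ : ℂ) (ψ - (OpField.const n (W.res ε).op).op ψ),
    Lp.coeFn_sub ψ ((OpField.const n (W.res ε).op).op ψ)] with x h1 h2 h3 h4
  rw [yosida_apply, h3, Pi.smul_apply, h4, Pi.sub_apply, h2, h1]
  rfl

/-- The resolvent of `dΓ(w)` is multiplication by `(1 + εħ ∑ⱼ w(kⱼ))⁻¹`. -/
theorem isYosida_dGamma (W : Weight d) (hW : ∀ k, W.toFun k = ħ * w k) :
    IsYosida (dGamma n ħ w) (fun ε => (OpField.const n (W.res ε).op).op) where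
  symm := by
    intro z hz y hy
    refine Hilb.inner_congr ?_
    filter_upwards [mem_graph_dGamma.1 hz, mem_graph_dGamma.1 hy] with x h1 h2 using inner_dGammaGraph h1 h2
  nonneg := by
    intro z hz
    refine Hilb.re_inner_nonneg ?_
    filter_upwards [mem_graph_dGamma.1 hz] with x h1
    exact re_inner_dGammaGraph (fun k => by rw [← hW]; exact (W.pos k).le) h1
  res := by
    intro ε hε φ
    change (_, yosida (fun ε => (OpField.const n (W.res ε).op).op) ε φ) ∈ _
    rw [yosida_const_res, mem_graph_dGamma]
    filter_upwards [OpField.coeFn_const_op (W.fockYos ε) φ, OpField.coeFn_const_op (W.res ε).op φ]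
      with x h1 h2
    rw [h1, h2]
    exact res_mem_dGammaGraph W hW hε _

/-! ### The quadratic forms of `g(q̂)` and `g(p̂)` -/

theorem ofReal_inner_yosida_scalarRes (hg : Measurable g) (h0 : ∀ x, 0 ≤ g x) {ε : ℝ}
    (hε : 0 < ε) (ψ : Hilb d n) :
    ENNReal.ofReal (⟪ψ, yosida (fun ε => (scalarRes g hg ε).op) ε ψ⟫_ℂ).re =
      ∫⁻ x, ENNReal.ofReal (g x / (1 + ε * g x)) * ‖ψ x‖ₑ ^ 2 := by
  set φ := yosida (fun ε => (scalarRes g hg ε).op) ε ψ with hφ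
  have h : ∀ᵐ x, (⟪ψ x, φ x⟫_ℂ).re = g x / (1 + ε * g x) * ‖ψ x‖ ^ 2 := by
    filter_upwards [coeFn_yosida_scalarRes hg h0 hε ψ] with x hx
    rw [hφ, hx, inner_smul_right, Complex.re_ofReal_mul, inner_self_eq_norm_sq_to_K]
    norm_cast
  have hi : Integrable (fun x => (⟪ψ x, φ x⟫_ℂ).re) volume := (L2.integrable_inner (𝕜 := ℂ) ψ φ).re
  have e : (⟪ψ, φ⟫_ℂ).re = ∫ x, (⟪ψ x, φ x⟫_ℂ).re := by
    rw [L2.inner_def]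
    exact (integral_re (L2.integrable_inner (𝕜 := ℂ) ψ φ)).symm
  rw [e, ofReal_integral_eq_lintegral_ofReal hi]
  · refine lintegral_congr_ae ?_
    filter_upwards [h] with x hx
    have := h0 x
    rw [hx, ENNReal.ofReal_mul (by positivity), ENNReal.ofReal_pow (norm_nonneg _), ofReal_norm]
  · filter_upwards [h] with x hx
    have := h0 x
    rw [hx]
    simp only [Pi.zero_apply]
    positivity

/-- The form of `g(q̂)` is the integral of `g ‖ψ‖²`: the forms of the Yosida approximations are the
integrals of `g/(1+εg) ‖ψ‖²`, and Fatou's lemma gives the limit `ε → 0`. -/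
theorem quadForm_positionOp (hg : Measurable g) (h0 : ∀ x, 0 ≤ g x) (ψ : Hilb d n) :
    quadForm (positionOp g) ψ = ∫⁻ x, ENNReal.ofReal (g x) * ‖ψ x‖ₑ ^ 2 := by
  have hJ := isYosida_positionOp (d := d) (n := n) hg h0
  apply le_antisymm
  · refine hJ.quadForm_le fun ε hε => ?_
    rw [ofReal_inner_yosida_scalarRes hg h0 hε]
    refine lintegral_mono fun x => ?_
    have := h0 x
    gcongr
    exact div_le_self (h0 x) (by linarith [mul_nonneg hε.le (h0 x)])
  · let u : ℕ → ℝ := fun m => 1 / ((m : ℝ) + 1)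
    have hu : ∀ m, 0 < u m := fun m => Nat.one_div_pos_of_nat
    have hlim : ∀ x, Tendsto (fun m => ENNReal.ofReal (g x / (1 + u m * g x)) * ‖ψ x‖ₑ ^ 2) atTop
        (𝓝 (ENNReal.ofReal (g x) * ‖ψ x‖ₑ ^ 2)) := by
      intro x
      refine ENNReal.Tendsto.mul_const (ENNReal.tendsto_ofReal ?_)
        (Or.inr (ENNReal.pow_ne_top enorm_ne_top))
      have h1 : Tendsto (fun m => 1 + u m * g x) atTop (𝓝 (1 + 0 * g x)) :=
        (tendsto_one_div_add_atTop_nhds_zero_nat.mul_const _).const_add _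
      have h2 := (tendsto_const_nhds (x := g x)).div h1 (by simp)
      simp only [zero_mul, add_zero, div_one] at h2
      exact h2
    have hm : ∀ m, AEMeasurable (fun x => ENNReal.ofReal (g x / (1 + u m * g x)) * ‖ψ x‖ₑ ^ 2)
        volume := fun m =>
      ((hg.div ((hg.const_mul _).const_add _)).ennreal_ofReal.aemeasurable).mul
        ((Lp.aestronglyMeasurable ψ).enorm.pow_const 2)
    calc ∫⁻ x, ENNReal.ofReal (g x) * ‖ψ x‖ₑ ^ 2
        = ∫⁻ x, liminf (fun m => ENNReal.ofReal (g x / (1 + u m * g x)) * ‖ψ x‖ₑ ^ 2) atTop :=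
          lintegral_congr fun x => (hlim x).liminf_eq.symm
      _ ≤ liminf (fun m => ∫⁻ x, ENNReal.ofReal (g x / (1 + u m * g x)) * ‖ψ x‖ₑ ^ 2) atTop :=
          lintegral_liminf_le' hm
      _ ≤ quadForm (positionOp g) ψ := by
          refine liminf_le_of_le (by isBoundedDefault) fun b hb => ?_
          obtain ⟨m, hm⟩ := hb.exists
          refine hm.trans ?_
          rw [← ofReal_inner_yosida_scalarRes hg h0 (hu m)]
          exact hJ.ofReal_inner_le_quadForm (hu m) ψ

/-- An isometry that maps the graph of `A` into the graph of `B` does not decrease the form. -/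
theorem quadForm_le_of_isometry {E E' : Type*} [NormedAddCommGroup E] [InnerProductSpace ℂ E]
    [NormedAddCommGroup E'] [InnerProductSpace ℂ E'] {A : E →ₗ.[ℂ] E} {B : E' →ₗ.[ℂ] E'}
    (F : E →ₗᵢ[ℂ] E') (h : ∀ z ∈ A.graph, (F z.1, F z.2) ∈ B.graph) (ψ : E) :
    quadForm A ψ ≤ quadForm B (F ψ) := by
  refine iSup_le fun φ => ?_
  obtain ⟨x, hx1, hx2⟩ := (LinearPMap.mem_graph_iff B).1 (h _ (A.mem_graph φ))
  refine le_iSup_of_le x (ENNReal.ofReal_le_ofReal (le_of_eq ?_))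
  rw [hx2, hx1, F.inner_map_map, F.inner_map_map]

/-- The form of `g(p̂)` is computed in Fourier space. -/
theorem quadForm_momentumOp (ħ : ℝ) (g : Config d n → ℝ) (ψ : Hilb d n) :
    quadForm (momentumOp ħ g) ψ =
      quadForm (positionOp fun ξ : Config d n => g ((2 * Real.pi * ħ) • ξ)) (𝓕 ψ) := by
  apply le_antisymm
  · exact quadForm_le_of_isometry (Lp.fourierTransformₗᵢ (Config d n) (Fock d)).toLinearIsometry
      (fun z hz => mem_graph_momentumOp.1 hz) ψ
  · have h := quadForm_le_of_isometry
      (A := positionOp fun ξ : Config d n => g ((2 * Real.pi * ħ) • ξ)) (B := momentumOp ħ g)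
      (Lp.fourierTransformₗᵢ (Config d n) (Fock d)).symm.toLinearIsometry (fun z hz => by
        change ((𝓕⁻ z.1 : Hilb d n), (𝓕⁻ z.2 : Hilb d n)) ∈ _
        rw [mem_graph_momentumOp, fourier_inv, fourier_inv]
        exact hz) (𝓕 ψ)
    refine h.trans (le_of_eq ?_)
    congr 1
    exact inv_fourier ψ

end Graphs

/-! ### The form factor, the potential and the kinetic energy -/

section Data

variable {d n : ℕ}

/-- The standing assumptions on the data of the model. -/
structure Model.Admissible (S : Model d n) : Prop where
  mass : ∀ j, 0 < S.M j
  mf : 0 < S.mf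
  V : IsCb2 S.V
  χ : MemLp (fun k => S.ω k ^ (1 / 2 : ℝ) * S.χ k) 2 volume

theorem Config.norm_sq_eq_sum_part (x : Config d n) : ‖x‖ ^ 2 = ∑ j, ‖x.part j‖ ^ 2 := by
  simp only [EuclideanSpace.norm_sq_eq, Fintype.sum_prod_type]
  rfl

theorem Config.norm_part_le (x : Config d n) (j : Fin n) : ‖x.part j‖ ≤ ‖x‖ := by
  refine (pow_le_pow_iff_left₀ (norm_nonneg _) (norm_nonneg _) two_ne_zero).1 ?_
  rw [x.norm_sq_eq_sum_part]
  exact Finset.single_le_sum (f := fun j => ‖x.part j‖ ^ 2) (fun i _ => by positivity)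
    (Finset.mem_univ j)

theorem Config.norm_le_sum_part (x : Config d n) : ‖x‖ ≤ ∑ j, ‖x.part j‖ := by
  refine (pow_le_pow_iff_left₀ (norm_nonneg _)
    (Finset.sum_nonneg fun j _ => norm_nonneg _) two_ne_zero).1 ?_
  rw [x.norm_sq_eq_sum_part]
  exact Finset.sum_sq_le_sq_sum_of_nonneg fun j _ => norm_nonneg _

theorem Config.part_add (x y : Config d n) (j : Fin n) :
    (x + y).part j = x.part j + y.part j := rfl

theorem Config.part_sub (x y : Config d n) (j : Fin n) :
    (x - y).part j = x.part j - y.part j := rfl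

theorem Config.continuous_part (j : Fin n) : Continuous fun x : Config d n => x.part j := by
  unfold Config.part
  fun_prop

namespace Model

variable {S : Model d n}

theorem mf_le_ω (k : Space d) : S.mf ≤ S.ω k :=
  Real.le_sqrt_of_sq_le (by nlinarith [sq_nonneg ‖k‖])

theorem ω_pos (hmf : 0 < S.mf) (k : Space d) : 0 < S.ω k := hmf.trans_le (mf_le_ω k)

theorem norm_le_ω (k : Space d) : ‖k‖ ≤ S.ω k :=
  Real.le_sqrt_of_sq_le (by nlinarith [sq_nonneg S.mf])

theorem continuous_ω : Continuous S.ω := by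
  unfold Model.ω
  fun_prop

/-- The function `ω^{1/2} χ`, which is square-integrable by assumption. -/
def u (S : Model d n) (k : Space d) : ℂ := ((S.ω k ^ (1 / 2 : ℝ) * S.χ k : ℝ) : ℂ)

theorem Admissible.memLp_u (hS : S.Admissible) : MemLp S.u 2 volume := hS.χ.ofReal

/-- The form factor `χ/√ω` of the interaction is `u/ω`. -/
theorem coeff_eq (hmf : 0 < S.mf) (k : Space d) :
    ((S.χ k / √(S.ω k) : ℝ) : ℂ) = S.u k / (S.ω k : ℝ) := by
  have h := ω_pos hmf k
  rw [u, ← Complex.ofReal_div]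
  congr 1
  rw [← Real.sqrt_eq_rpow]
  have h2 : √(S.ω k) * √(S.ω k) = S.ω k := Real.mul_self_sqrt h.le
  have h3 : √(S.ω k) ≠ 0 := (Real.sqrt_pos.2 h).ne'
  rw [div_eq_div_iff h3 h.ne']
  linear_combination -S.χ k * h2

theorem norm_phase_eq (t : ℝ) :
    ‖Complex.exp (-(2 * Real.pi * Complex.I * (t : ℝ)))‖ = 1 := by
  have e : (-(2 * Real.pi * Complex.I * (t : ℝ)) : ℂ) = ((-(2 * Real.pi * t) : ℝ) : ℂ) * Complex.I := by
    push_cast; ring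
  rw [e, Complex.norm_exp_ofReal_mul_I]

theorem norm_phase_sub_le (s t : ℝ) :
    ‖Complex.exp (-(2 * Real.pi * Complex.I * (s : ℝ))) -
      Complex.exp (-(2 * Real.pi * Complex.I * (t : ℝ)))‖ ≤ 2 * Real.pi * |s - t| := by
  have e : Complex.exp (-(2 * Real.pi * Complex.I * (s : ℝ))) -
      Complex.exp (-(2 * Real.pi * Complex.I * (t : ℝ))) =
      Complex.exp (-(2 * Real.pi * Complex.I * (t : ℝ))) *
        (Complex.exp (Complex.I * ((-(2 * Real.pi * (s - t)) : ℝ) : ℂ)) - 1) := by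
    rw [mul_sub, mul_one, ← Complex.exp_add]
    congr 2
    push_cast; ring
  rw [e, norm_mul, norm_phase_eq, one_mul]
  refine (Real.norm_exp_I_mul_ofReal_sub_one_le (x := -(2 * Real.pi * (s - t)))).trans (le_of_eq ?_)
  rw [norm_neg, Real.norm_eq_abs, abs_mul, abs_of_pos Real.two_pi_pos]

theorem norm_G_le (hmf : 0 < S.mf) (x : Config d n) (k : Space d) :
    ‖S.G x k‖ ≤ n * (‖S.u k‖ / S.ω k) := by
  refine (norm_sum_le _ _).trans ?_
  have h : ∀ j ∈ Finset.univ, ‖((S.χ k / √(S.ω k) : ℝ) : ℂ) *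
      Complex.exp (-(2 * Real.pi * Complex.I * (⟪k, x.part j⟫_ℝ : ℝ)))‖ ≤ ‖S.u k‖ / S.ω k := by
    intro j _
    rw [norm_mul, norm_phase_eq, mul_one, coeff_eq hmf, norm_div, Complex.norm_real,
      Real.norm_of_nonneg (ω_pos hmf k).le]
  exact (Finset.sum_le_card_nsmul _ _ _ h).trans (by simp)

/-- The phases in `G_x` have gradient of size `2π|k| ≤ 2πω`, and `ω · |u|/ω = |u|` is
square-integrable. This is where the hypothesis on `χ` enters. -/
theorem norm_G_sub_le (hmf : 0 < S.mf) (x y : Config d n) (k : Space d) :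
    ‖S.G x k - S.G y k‖ ≤ n * (2 * Real.pi) * ‖x - y‖ * ‖S.u k‖ := by
  rw [G, G, ← Finset.sum_sub_distrib]
  refine (norm_sum_le _ _).trans ?_
  have hω := ω_pos hmf k
  have h : ∀ j ∈ Finset.univ, ‖((S.χ k / √(S.ω k) : ℝ) : ℂ) *
      Complex.exp (-(2 * Real.pi * Complex.I * (⟪k, x.part j⟫_ℝ : ℝ))) -
      ((S.χ k / √(S.ω k) : ℝ) : ℂ) *
      Complex.exp (-(2 * Real.pi * Complex.I * (⟪k, y.part j⟫_ℝ : ℝ)))‖ ≤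
      2 * Real.pi * ‖x - y‖ * ‖S.u k‖ := by
    intro j _
    rw [← mul_sub, norm_mul, coeff_eq hmf, norm_div, Complex.norm_real,
      Real.norm_of_nonneg hω.le]
    have h1 := norm_phase_sub_le ⟪k, x.part j⟫_ℝ ⟪k, y.part j⟫_ℝ
    rw [← inner_sub_right, ← Config.part_sub] at h1
    have h2 : |⟪k, (x - y).part j⟫_ℝ| ≤ S.ω k * ‖x - y‖ :=
      (abs_real_inner_le_norm _ _).trans
        (mul_le_mul (norm_le_ω k) ((x - y).norm_part_le j) (norm_nonneg _) hω.le)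
    calc _ ≤ ‖S.u k‖ / S.ω k * (2 * Real.pi * (S.ω k * ‖x - y‖)) := by
          gcongr
          exact h1.trans (by gcongr)
      _ = _ := by field_simp
  refine (Finset.sum_le_card_nsmul _ _ _ h).trans (le_of_eq ?_)
  rw [Finset.card_univ, Fintype.card_fin, nsmul_eq_mul]
  ring

theorem Admissible.aestronglyMeasurable_G (hS : S.Admissible) (x : Config d n) :
    AEStronglyMeasurable (S.G x) volume := by
  have h : S.G x = fun k => ∑ j, S.u k / (S.ω k : ℝ) *
      Complex.exp (-(2 * Real.pi * Complex.I * (⟪k, x.part j⟫_ℝ : ℝ))) := by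
    funext k
    simp only [G, coeff_eq hS.mf]
  rw [h]
  refine Finset.aestronglyMeasurable_fun_sum _ fun j _ => ?_
  refine AEStronglyMeasurable.mul ?_ ?_
  · simp only [div_eq_mul_inv]
    exact hS.memLp_u.1.mul
      (Complex.continuous_ofReal.comp continuous_ω).measurable.inv.aestronglyMeasurable
  · refine Continuous.aestronglyMeasurable ?_
    fun_prop

/-- A weighted bound on the form factor. -/
theorem Admissible.memLp_mul_G (hS : S.Admissible) {b : Space d → ℝ} (hb : Measurable b) {c : ℝ}
    (hc : 0 ≤ c) (h : ∀ k, |b k| ≤ c * S.ω k) (x : Config d n) :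
    MemLp (fun k => (b k : ℂ) * S.G x k) 2 volume ∧
      l2norm (fun k => (b k : ℂ) * S.G x k) ≤ c * n * l2norm S.u := by
  have h1 : ∀ k, ‖(b k : ℂ) * S.G x k‖ ≤ c * n * ‖S.u k‖ := by
    intro k
    have hω := ω_pos hS.mf k
    rw [norm_mul, Complex.norm_real, Real.norm_eq_abs]
    calc _ ≤ (c * S.ω k) * (n * (‖S.u k‖ / S.ω k)) :=
          mul_le_mul (h k) (norm_G_le hS.mf x k) (norm_nonneg _) (by positivity)
      _ = _ := by field_simp
  refine ⟨hS.memLp_u.of_le_mul ?_ (Eventually.of_forall h1),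
    l2norm_le (by positivity) hS.memLp_u (Eventually.of_forall h1)⟩
  exact (Complex.measurable_ofReal.comp hb).aestronglyMeasurable.mul (hS.aestronglyMeasurable_G x)

theorem Admissible.memLp_G (hS : S.Admissible) (x : Config d n) :
    MemLp (S.G x) 2 volume ∧ l2norm (S.G x) ≤ S.mf⁻¹ * n * l2norm S.u := by
  have hmf := hS.mf
  have h := hS.memLp_mul_G (b := fun _ => 1) measurable_const (inv_pos.2 hS.mf).le (fun k => by
    rw [abs_one, ← div_eq_inv_mul, le_div_iff₀ hmf, one_mul]
    exact mf_le_ω k) x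
  simpa using h

theorem Admissible.l2norm_G_sub_le (hS : S.Admissible) (x y : Config d n) :
    l2norm (S.G x - S.G y) ≤ n * (2 * Real.pi) * l2norm S.u * ‖x - y‖ := by
  refine (l2norm_le (C := n * (2 * Real.pi) * ‖x - y‖) (by positivity) hS.memLp_u
    (Eventually.of_forall fun k => norm_G_sub_le hS.mf x y k)).trans (le_of_eq (by ring))

theorem Admissible.V_bound (hS : S.Admissible) : ∃ C : ℝ, 0 ≤ C ∧ ∀ x, |S.V x| ≤ C := by
  obtain ⟨C, hC⟩ := hS.V.2 0 (by norm_num)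
  refine ⟨C, (norm_nonneg _).trans (hC 0), fun x => ?_⟩
  have := hC x
  rwa [norm_iteratedFDeriv_zero, Real.norm_eq_abs] at this

theorem Admissible.V_lipschitz (hS : S.Admissible) :
    ∃ C : ℝ, 0 ≤ C ∧ ∀ x y, |S.V x - S.V y| ≤ C * ‖x - y‖ := by
  obtain ⟨C, hC⟩ := hS.V.2 1 (by norm_num)
  refine ⟨C, (norm_nonneg _).trans (hC 0), fun x y => ?_⟩
  refine (convex_univ).norm_image_sub_le_of_norm_fderiv_le (𝕜 := ℝ)
    (fun z _ => (hS.V.1.differentiable (by norm_num)).differentiableAt) (fun z _ => ?_)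
    (mem_univ y) (mem_univ x)
  have := hC z
  rwa [norm_iteratedFDeriv_one] at this

/-- The kinetic energy `∑ⱼ fⱼ(pⱼ)`. -/
def kinetic (S : Model d n) (p : Config d n) : ℝ := ∑ j, S.f j (p.part j)

theorem f_nonneg (hM : ∀ j, 0 < S.M j) (j : Fin n) (p : Space d) : 0 ≤ S.f j p := by
  have := hM j
  unfold f
  split <;> positivity

theorem kinetic_nonneg (hM : ∀ j, 0 < S.M j) (p : Config d n) : 0 ≤ S.kinetic p :=
  Finset.sum_nonneg fun j _ => f_nonneg hM j _

theorem continuous_f (j : Fin n) : Continuous (S.f j) := by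
  unfold f
  split <;> fun_prop

theorem continuous_kinetic : Continuous S.kinetic :=
  continuous_finsetSum _ fun j _ => (continuous_f j).comp (Config.continuous_part j)

/-- In the semi-relativistic case `f` is `1`-Lipschitz and `|p| ≤ f(p)`. In the non-relativistic
case `f` is quadratic, so that its increments grow linearly. -/
theorem exists_f_growth (hM : ∀ j, 0 < S.M j) (j : Fin n) :
    ∃ c : ℝ, 0 ≤ c ∧ (∀ p v, |S.f j (p + v) - S.f j p| ≤ c * (‖v‖ * (1 + ‖v‖ + ‖p‖))) ∧
      ∀ p, ‖p‖ ≤ c * (1 + S.f j p) := by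
  have hj := hM j
  unfold f
  split
  · refine ⟨1, zero_le_one, fun p v => ?_, fun p => ?_⟩
    · have h1 : ∀ p v : Space d, √(‖p + v‖ ^ 2 + S.M j ^ 2) ≤ √(‖p‖ ^ 2 + S.M j ^ 2) + ‖v‖ := by
        intro p v
        rw [Real.sqrt_le_left (by positivity), add_sq, Real.sq_sqrt (by positivity)]
        have h2 : ‖p‖ ≤ √(‖p‖ ^ 2 + S.M j ^ 2) := Real.le_sqrt_of_sq_le (by nlinarith)
        have h3 := norm_add_le p v
        nlinarith [norm_nonneg p, norm_nonneg v, norm_nonneg (p + v),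
          mul_le_mul_of_nonneg_right h2 (norm_nonneg v)]
      have h4 : |√(‖p + v‖ ^ 2 + S.M j ^ 2) - √(‖p‖ ^ 2 + S.M j ^ 2)| ≤ ‖v‖ := by
        rw [abs_le]
        have h5 := h1 (p + v) (-v)
        rw [norm_neg, add_neg_cancel_right] at h5
        constructor <;> linarith [h1 p v]
      nlinarith [norm_nonneg p, norm_nonneg v, mul_nonneg (norm_nonneg v) (norm_nonneg p),
        mul_nonneg (norm_nonneg v) (norm_nonneg v)]
    · have h2 : ‖p‖ ≤ √(‖p‖ ^ 2 + S.M j ^ 2) := Real.le_sqrt_of_sq_le (by nlinarith)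
      linarith
  · refine ⟨max (1 / S.M j) (1 + 2 * S.M j), by positivity, fun p v => ?_, fun p => ?_⟩
    · have h1 : |‖p + v‖ ^ 2 - ‖p‖ ^ 2| ≤ ‖v‖ * (‖v‖ + 2 * ‖p‖) := by
        have h2 : |‖p + v‖ - ‖p‖| ≤ ‖v‖ := by
          have := abs_norm_sub_norm_le (p + v) p
          rwa [add_sub_cancel_left] at this
        have h3 := norm_add_le p v
        rw [sq_sub_sq, abs_mul, mul_comm]
        refine mul_le_mul h2 ?_ (abs_nonneg _) (norm_nonneg _)
        rw [abs_of_nonneg (by positivity)]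
        linarith
      rw [← sub_div, abs_div, abs_of_pos (by positivity : 0 < 2 * S.M j),
        div_le_iff₀ (by positivity)]
      have h5 : 1 ≤ max (1 / S.M j) (1 + 2 * S.M j) * S.M j := by
        calc 1 = 1 / S.M j * S.M j := by field_simp
          _ ≤ _ := by gcongr; exact le_max_left _ _
      have h6 : 0 ≤ ‖v‖ * (1 + ‖v‖ + ‖p‖) := by positivity
      have h7 := mul_le_mul_of_nonneg_left h5 h6
      nlinarith [norm_nonneg v, mul_nonneg (norm_nonneg v) (norm_nonneg v)]
    · have h8 : 0 ≤ ‖p‖ ^ 2 / (2 * S.M j) := by positivity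
      calc ‖p‖ ≤ 1 + ‖p‖ ^ 2 := by nlinarith [sq_nonneg (‖p‖ - 1)]
        _ = 1 + 2 * S.M j * (‖p‖ ^ 2 / (2 * S.M j)) := by field_simp
        _ ≤ (1 + 2 * S.M j) * (1 + ‖p‖ ^ 2 / (2 * S.M j)) := by nlinarith
        _ ≤ _ := by gcongr; exact le_max_right _ _

/-- The kinetic energy grows at least linearly, and its increments grow at most linearly. -/
theorem exists_kinetic_growth (hM : ∀ j, 0 < S.M j) : ∃ c : ℝ, 0 ≤ c ∧
    (∀ p v, |S.kinetic (p + v) - S.kinetic p| ≤ c * (‖v‖ * (1 + ‖v‖ + ‖p‖))) ∧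
    ∀ p, ‖p‖ ≤ c * (1 + S.kinetic p) := by
  choose c hc h1 h2 using exists_f_growth hM
  refine ⟨∑ j, c j, Finset.sum_nonneg fun j _ => hc j, fun p v => ?_, fun p => ?_⟩
  · rw [kinetic, kinetic, ← Finset.sum_sub_distrib, Finset.sum_mul]
    refine (Finset.abs_sum_le_sum_abs _ _).trans (Finset.sum_le_sum fun j _ => ?_)
    rw [Config.part_add]
    refine (h1 j _ _).trans (mul_le_mul_of_nonneg_left ?_ (hc j))
    gcongr <;> exact Config.norm_part_le _ j
  · rw [Finset.sum_mul]
    refine p.norm_le_sum_part.trans (Finset.sum_le_sum fun j _ => (h2 j _).trans ?_)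
    refine mul_le_mul_of_nonneg_left ?_ (hc j)
    gcongr
    exact Finset.single_le_sum (f := fun j => S.f j (p.part j)) (fun i _ => f_nonneg hM i _)
      (Finset.mem_univ j)

end Model

end Data

/-! ### The Hamiltonian: its graph, symmetry and resolvent -/

/-- The sum of two operators is defined on the intersection of their domains. -/
theorem mem_graph_add {E : Type*} [NormedAddCommGroup E] [InnerProductSpace ℂ E]
    {A B : E →ₗ.[ℂ] E} {ψ φ : E} : (ψ, φ) ∈ (A + B).graph ↔
      ∃ φ₁ φ₂, (ψ, φ₁) ∈ A.graph ∧ (ψ, φ₂) ∈ B.graph ∧ φ = φ₁ + φ₂ := by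
  constructor
  · intro h
    obtain ⟨x, hx1, hx2⟩ := (LinearPMap.mem_graph_iff _).1 h
    have hA : (x : E) ∈ A.domain := x.2.1
    have hB : (x : E) ∈ B.domain := x.2.2
    refine ⟨A ⟨x, hA⟩, B ⟨x, hB⟩, ?_, ?_, ?_⟩
    · have := A.mem_graph ⟨x, hA⟩
      simp only at hx1
      rwa [← hx1]
    · have := B.mem_graph ⟨x, hB⟩
      simp only at hx1
      rwa [← hx1]
    · exact hx2.symm
  · rintro ⟨φ₁, φ₂, h1, h2, rfl⟩
    obtain ⟨x, hx1, hx2⟩ := (LinearPMap.mem_graph_iff _).1 h1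
    obtain ⟨y, hy1, hy2⟩ := (LinearPMap.mem_graph_iff _).1 h2
    simp only at hx1 hx2 hy1 hy2
    subst hx1 hx2 hy2
    refine (LinearPMap.mem_graph_iff _).2 ⟨⟨x, ⟨x.2, by rw [← hy1]; exact y.2⟩⟩, rfl, ?_⟩
    change A x + B ⟨x, _⟩ = A x + B y
    congr 2
    exact Subtype.ext hy1.symm

theorem IsYosida.mem_graph_iff {E : Type*} [NormedAddCommGroup E] [InnerProductSpace ℂ E]
    {A : E →ₗ.[ℂ] E} {J : ℝ → E →L[ℂ] E} (hJ : IsYosida A J) {z : E × E} :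
    z ∈ A.graph ↔ J 1 (z.1 + z.2) = z.1 := by
  constructor
  · intro hz
    have := hJ.apply_graph one_pos hz
    simpa using this
  · intro h
    have h1 := hJ.res 1 one_pos (z.1 + z.2)
    rw [h] at h1
    simpa using h1

section Symbols

variable {d : ℕ} (W : Weight d)

theorem Weight.exists_le_total : ∃ c : ℝ, 0 < c ∧
    ∀ (m : ℕ) (K : Fin m → Space d), c * m ≤ W.total K := by
  obtain ⟨c, hc, h⟩ := W.lower
  refine ⟨c, hc, fun m K => ?_⟩
  have := Finset.card_nsmul_le_sum (s := Finset.univ) (fun j => W.toFun (K j)) c fun j _ => h _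
  rwa [Finset.card_univ, Fintype.card_fin, nsmul_eq_mul, mul_comm] at this

theorem Weight.exists_number_le : ∃ b : ℝ, 0 < b ∧
    ∀ (m : ℕ) (K : Fin m → Space d), (m : ℝ) ≤ b * W.total K := by
  obtain ⟨c, hc, h⟩ := W.exists_le_total
  refine ⟨c⁻¹, by positivity, fun m K => ?_⟩
  rw [← div_eq_inv_mul, le_div_iff₀ hc, mul_comm]
  exact h m K

/-- The symbol `√(m+1) / (1 + N)` with `N = ∑ⱼ W(kⱼ)`. -/
def Weight.rootSymbol : Symbol d :=
  W.symbol (fun m s => ((√((m : ℝ) + 1) / (1 + s) : ℝ) : ℂ)) (fun _ => by fun_prop) (by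
    obtain ⟨b, hb, h⟩ := W.exists_number_le
    refine ⟨1 + b, by positivity, ?_⟩
    rintro m s hs ⟨K, rfl⟩
    rw [Complex.norm_real, Real.norm_of_nonneg (by positivity), div_le_iff₀ (by positivity)]
    have h1 : √((m : ℝ) + 1) ≤ m + 1 := by
      rw [Real.sqrt_le_left (by positivity)]
      nlinarith [(Nat.cast_nonneg m : (0 : ℝ) ≤ m)]
    nlinarith [h m K])

/-- The domain of `dΓ(W)` is contained in that of the square root of the particle number. -/
theorem Weight.numSymbol_rootSymbol {w : Space d → ℝ} {ħ : ℝ} (hW : ∀ k, W.toFun k = ħ * w k)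
    {v v' : Fock d} (h : (v, v') ∈ dGammaGraph ħ w) :
    (numSymbol d).op (W.rootSymbol.op (v + v')) = v := by
  refine Fock.ext_comp fun m => ?_
  filter_upwards [numSymbol_comp (W.rootSymbol.op (v + v')) m, W.rootSymbol.comp_op (v + v') m,
    Fock.comp_add v v' m, h m] with K h1 h2 h3 h4
  have e : ħ * ∑ j, w (K j) = W.total K := by
    rw [Weight.total, Finset.mul_sum]
    exact Finset.sum_congr rfl fun j _ => (hW _).symm
  have h0 := W.total_nonneg K
  have e1 : ((√((m : ℝ) + 1) : ℝ) : ℂ) ≠ 0 :=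
    Complex.ofReal_ne_zero.2 (Real.sqrt_pos.2 (by positivity)).ne'
  have e2 : ((1 + W.total K : ℝ) : ℂ) ≠ 0 := Complex.ofReal_ne_zero.2 (by positivity)
  rw [h1, h2, h3, h4]
  simp only [Weight.rootSymbol, Weight.symbol]
  rw [e, Complex.ofReal_inv, Complex.ofReal_div]
  field_simp
  push_cast
  ring

/-- A bound for `√(m+1) / |N + a + il|`. -/
def kappa (b l : ℝ) : ℝ := √(1 / l ^ 2 + b / (2 * |l|))

theorem norm_add_mul_I_ge (t l : ℝ) : |l| ≤ ‖(t + l * Complex.I : ℂ)‖ := by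
  have := Complex.abs_im_le_norm (t + l * Complex.I : ℂ)
  simpa using this

theorem add_mul_I_ne_zero (t : ℝ) {l : ℝ} (hl : l ≠ 0) : (t + l * Complex.I : ℂ) ≠ 0 := by
  intro h
  have := norm_add_mul_I_ge t l
  rw [h, norm_zero] at this
  exact hl (abs_nonpos_iff.1 this)

theorem sqrt_div_norm_le {b s a l : ℝ} {m : ℕ} (hl : l ≠ 0)
    (ha : 0 ≤ a) (hb : 0 ≤ b) (hm : m ≤ b * s) : √((m : ℝ) + 1) / ‖((s + a : ℝ) + l * Complex.I : ℂ)‖ ≤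
      kappa b l := by
  have hl' : 0 < |l| := abs_pos.2 hl
  have hz : 0 < ‖((s + a : ℝ) + l * Complex.I : ℂ)‖ := hl'.trans_le (norm_add_mul_I_ge _ _)
  rw [kappa]
  refine Real.le_sqrt_of_sq_le ?_
  rw [div_pow, Real.sq_sqrt (by positivity), Complex.sq_norm, Complex.normSq_add_mul_I,
    ← sq_abs l]
  have h1 : 0 < (s + a) ^ 2 + |l| ^ 2 := by positivity
  rw [div_le_iff₀ h1]
  have h2 : 1 ≤ 1 / |l| ^ 2 * ((s + a) ^ 2 + |l| ^ 2) := by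
    rw [one_div, ← div_eq_inv_mul, le_div_iff₀ (by positivity)]
    nlinarith [sq_nonneg (s + a)]
  -- The arithmetic–geometric mean inequality `2|l|(s + a) ≤ (s + a)² + l²`.
  have h3 : s ≤ 1 / (2 * |l|) * ((s + a) ^ 2 + |l| ^ 2) := by
    rw [one_div, ← div_eq_inv_mul, le_div_iff₀ (by positivity)]
    nlinarith [sq_nonneg (s + a - |l|), mul_nonneg ha hl'.le]
  have h4 := mul_le_mul_of_nonneg_left h3 hb
  calc (m : ℝ) + 1 ≤ b * (1 / (2 * |l|) * ((s + a) ^ 2 + |l| ^ 2)) +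
        1 / |l| ^ 2 * ((s + a) ^ 2 + |l| ^ 2) := by linarith
    _ = _ := by ring

/-- The symbol `√(m+1) / (N + |a| + il)`. -/
def Weight.rootRes (a : ℝ) {l : ℝ} (hl : l ≠ 0) : Symbol d :=
  W.symbol (fun m s => √((m : ℝ) + 1) / ((s + |a| : ℝ) + l * Complex.I))
    (fun _ => by fun_prop) (by
    obtain ⟨b, hb, h⟩ := W.exists_number_le
    refine ⟨kappa b l, Real.sqrt_nonneg _, ?_⟩
    rintro m s hs ⟨K, rfl⟩
    rw [norm_div, Complex.norm_real, Real.norm_of_nonneg (Real.sqrt_nonneg _)]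
    exact sqrt_div_norm_le hl (abs_nonneg a) hb.le (h m K))

theorem Weight.norm_rootRes_le {b : ℝ} (hb : 0 ≤ b)
    (h : ∀ (m : ℕ) (K : Fin m → Space d), (m : ℝ) ≤ b * W.total K) (a : ℝ) {l : ℝ} (hl : l ≠ 0) :
    ‖(W.rootRes a hl).op‖ ≤ kappa b l := by
  refine Symbol.norm_op_le _ (Real.sqrt_nonneg _) fun m K => ?_
  simp only [Weight.rootRes, Weight.symbol]
  rw [norm_div, Complex.norm_real, Real.norm_of_nonneg (Real.sqrt_nonneg _)]
  exact sqrt_div_norm_le hl (abs_nonneg a) hb (h m K)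

theorem Weight.norm_rootRes_sub_le {b : ℝ} (hb : 0 ≤ b)
    (h : ∀ (m : ℕ) (K : Fin m → Space d), (m : ℝ) ≤ b * W.total K) (a a' : ℝ) {l : ℝ}
    (hl : l ≠ 0) : ‖(W.rootRes a hl).op - (W.rootRes a' hl).op‖ ≤ kappa b l / |l| * |a - a'| := by
  have hk : 0 ≤ kappa b l := Real.sqrt_nonneg _
  refine Symbol.norm_op_sub_le _ _ (by positivity) fun m K => ?_
  simp only [Weight.rootRes, Weight.symbol]
  have h1 := add_mul_I_ne_zero (W.total K + |a|) hl
  have h2 := add_mul_I_ne_zero (W.total K + |a'|) hl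
  have e : (√((m : ℝ) + 1) : ℂ) / ((W.total K + |a| : ℝ) + l * Complex.I) -
      √((m : ℝ) + 1) / ((W.total K + |a'| : ℝ) + l * Complex.I) =
      (√((m : ℝ) + 1) / ((W.total K + |a| : ℝ) + l * Complex.I)) *
      (((|a'| - |a| : ℝ) : ℂ) / ((W.total K + |a'| : ℝ) + l * Complex.I)) := by
    field_simp
    push_cast
    ring
  rw [e, norm_mul, norm_div, norm_div, Complex.norm_real,
    Real.norm_of_nonneg (Real.sqrt_nonneg _), Complex.norm_real, Real.norm_eq_abs]
  have h3 := sqrt_div_norm_le hl (abs_nonneg a) hb (h m K)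
  have h4 : |(|a'| - |a|)| / ‖((W.total K + |a'| : ℝ) + l * Complex.I : ℂ)‖ ≤ |a - a'| / |l| := by
    have := abs_pos.2 hl
    refine div_le_div₀ (abs_nonneg _) ?_ this (norm_add_mul_I_ge _ _)
    rw [abs_sub_comm]
    exact abs_abs_sub_abs_le_abs_sub a a'
  calc _ ≤ kappa b l * (|a - a'| / |l|) := mul_le_mul h3 h4 (by positivity) hk
    _ = _ := by ring

theorem comp_numSymbol_rootRes (a : ℝ) {l : ℝ} (hl : l ≠ 0) (v : Fock d) (m : ℕ) :
    ∀ᵐ K, ((numSymbol d).op ((W.rootRes a hl).op v)).comp m K =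
      v.comp m K / ((W.total K + |a| : ℝ) + l * Complex.I) := by
  filter_upwards [numSymbol_comp ((W.rootRes a hl).op v) m, (W.rootRes a hl).comp_op v m]
    with K h1 h2
  have e1 : ((√((m : ℝ) + 1) : ℝ) : ℂ) ≠ 0 :=
    Complex.ofReal_ne_zero.2 (Real.sqrt_pos.2 (by positivity)).ne'
  rw [h1, h2]
  simp only [Weight.rootRes, Weight.symbol]
  rw [Complex.ofReal_inv]
  field_simp

theorem mem_dGammaGraph_rootRes {w : Space d → ℝ} {ħ : ℝ} (hW : ∀ k, W.toFun k = ħ * w k)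
    {a : ℝ} (ha : 0 ≤ a) {l : ℝ} (hl : l ≠ 0) (v : Fock d) :
    ((numSymbol d).op ((W.rootRes a hl).op v),
      v - (a : ℂ) • (numSymbol d).op ((W.rootRes a hl).op v) -
        (l * Complex.I : ℂ) • (numSymbol d).op ((W.rootRes a hl).op v)) ∈ dGammaGraph ħ w := by
  intro m
  set r := (numSymbol d).op ((W.rootRes a hl).op v)
  filter_upwards [comp_numSymbol_rootRes W a hl v m, Fock.comp_sub (v - (a : ℂ) • r)
    ((l * Complex.I : ℂ) • r) m, Fock.comp_sub v ((a : ℂ) • r) m, Fock.comp_smul (a : ℂ) r m,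
    Fock.comp_smul (l * Complex.I : ℂ) r m] with K h1 h2 h3 h4 h5
  have e : ħ * ∑ j, w (K j) = W.total K := by
    rw [Weight.total, Finset.mul_sum]
    exact Finset.sum_congr rfl fun j _ => (hW _).symm
  have hz := add_mul_I_ne_zero (W.total K + a) hl
  rw [h2, h3, h4, h5, h1, e, abs_of_nonneg ha]
  field_simp
  push_cast
  ring

theorem norm_smul_rootRes_le {a : ℝ} (ha : 0 ≤ a) {l : ℝ} (hl : l ≠ 0) :
    ‖(a : ℂ) • ((numSymbol d).op ∘L (W.rootRes a hl).op)‖ ≤ 1 := by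
  refine ContinuousLinearMap.opNorm_le_bound _ zero_le_one fun v => ?_
  refine Fock.norm_le_of_comp_le zero_le_one fun m => ?_
  filter_upwards [comp_numSymbol_rootRes W a hl v m,
    Fock.comp_smul (a : ℂ) ((numSymbol d).op ((W.rootRes a hl).op v)) m] with K h1 h2
  change ‖((a : ℂ) • (numSymbol d).op ((W.rootRes a hl).op v)).comp m K‖ ≤ _
  rw [h2, h1, norm_mul, norm_div, Complex.norm_real, Real.norm_of_nonneg ha, one_mul,
    abs_of_nonneg ha]
  have hz := norm_pos_iff.2 (add_mul_I_ne_zero (W.total K + a) hl)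
  have h3 : a ≤ ‖((W.total K + a : ℝ) + l * Complex.I : ℂ)‖ := by
    have h4 := Complex.abs_re_le_norm ((W.total K + a : ℝ) + l * Complex.I : ℂ)
    have h5 := W.total_nonneg K
    simp only [Complex.add_re, Complex.ofReal_re, Complex.mul_re, Complex.I_re, mul_zero,
      Complex.ofReal_im, Complex.I_im, mul_one, sub_self, add_zero] at h4
    rw [abs_of_nonneg (by positivity)] at h4
    linarith
  rw [mul_div_assoc', div_le_iff₀ hz, mul_comm]
  gcongr

end Symbols

section Hamiltonian

variable {d n : ℕ} {ħ : ℝ}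

/-- The operator `(N+1)^{-1/2}` on the full Hilbert space, with `N` the particle number. -/
def numOp (d n : ℕ) : Hilb d n →L[ℂ] Hilb d n := (OpField.const n (numSymbol d).op).op

theorem coeFn_numOp (ψ : Hilb d n) : ∀ᵐ x, numOp d n ψ x = (numSymbol d).op (ψ x) :=
  OpField.coeFn_const_op _ ψ

namespace Model

variable {S : Model d n}

/-- A bound for `‖G_x‖`. -/
def supG (S : Model d n) : ℝ := S.mf⁻¹ * n * l2norm S.u

/-- A Lipschitz constant for `x ↦ G_x`. -/
def lipG (S : Model d n) : ℝ := n * (2 * Real.pi) * l2norm S.u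

theorem lipG_nonneg : 0 ≤ S.lipG := by
  have := l2norm_nonneg S.u
  unfold lipG
  positivity

theorem Admissible.supG_nonneg (hS : S.Admissible) : 0 ≤ S.supG := by
  have := l2norm_nonneg S.u
  have := hS.mf
  unfold supG
  positivity

theorem Admissible.norm_annOp_sub_le (hS : S.Admissible) (hħ : 0 ≤ ħ) (x y : Config d n) :
    ‖annOp ħ (S.G x) - annOp ħ (S.G y)‖ ≤ √ħ * (S.lipG * ‖x - y‖) := by
  rw [annOp_sub hħ (hS.memLp_G x).1 (hS.memLp_G y).1]
  refine (norm_annOp_le hħ ((hS.memLp_G x).1.sub (hS.memLp_G y).1)).trans ?_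
  gcongr
  exact hS.l2norm_G_sub_le x y

theorem Admissible.norm_creOp_sub_le (hS : S.Admissible) (hħ : 0 ≤ ħ) (x y : Config d n) :
    ‖creOp ħ (S.G x) - creOp ħ (S.G y)‖ ≤ √ħ * (S.lipG * ‖x - y‖) := by
  rw [creOp_sub hħ (hS.memLp_G x).1 (hS.memLp_G y).1]
  refine (norm_creOp_le hħ ((hS.memLp_G x).1.sub (hS.memLp_G y).1)).trans ?_
  gcongr
  exact hS.l2norm_G_sub_le x y

theorem continuous_of_norm_sub_le {E F : Type*} [NormedAddCommGroup E] [NormedAddCommGroup F]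
    {f : E → F} {C : ℝ} (h : ∀ x y, ‖f x - f y‖ ≤ C * ‖x - y‖) : Continuous f :=
  (LipschitzWith.of_dist_le_mul (K := C.toNNReal) fun x y => by
    rw [dist_eq_norm, dist_eq_norm]
    refine (h x y).trans ?_
    gcongr
    exact Real.le_coe_toNNReal C).continuous

/-- The field `x ↦ a(G_x)(N+1)^{-1/2}`. -/
def Admissible.annField (hS : S.Admissible) (hħ : 0 ≤ ħ) : OpField d n where
  toFun x := annOp ħ (S.G x)
  meas := (continuous_of_norm_sub_le (C := √ħ * S.lipG) fun x y =>
    (hS.norm_annOp_sub_le hħ x y).trans (le_of_eq (by ring))).stronglyMeasurable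
  bound := by
    have := hS.supG_nonneg
    refine ⟨√ħ * S.supG, by positivity, fun x => (norm_annOp_le hħ (hS.memLp_G x).1).trans ?_⟩
    gcongr
    exact (hS.memLp_G x).2

/-- The field `x ↦ a*(G_x)(N+1)^{-1/2}`. -/
def Admissible.creField (hS : S.Admissible) (hħ : 0 ≤ ħ) : OpField d n where
  toFun x := creOp ħ (S.G x)
  meas := (continuous_of_norm_sub_le (C := √ħ * S.lipG) fun x y =>
    (hS.norm_creOp_sub_le hħ x y).trans (le_of_eq (by ring))).stronglyMeasurable
  bound := by
    have := hS.supG_nonneg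
    refine ⟨√ħ * S.supG, by positivity, fun x => (norm_creOp_le hħ (hS.memLp_G x).1).trans ?_⟩
    gcongr
    exact (hS.memLp_G x).2

/-- Multiplication by the potential. -/
def Admissible.potField (hS : S.Admissible) : OpField d n :=
  OpField.scalar (fun x => (S.V x : ℂ))
    (Complex.measurable_ofReal.comp hS.V.1.continuous.measurable) (by
      obtain ⟨C, -, h⟩ := hS.V_bound
      exact ⟨C, fun x => by rw [Complex.norm_real]; exact h x⟩)

theorem Admissible.coeFn_potField (hS : S.Admissible) (ψ : Hilb d n) :
    ∀ᵐ x, hS.potField.op ψ x = (S.V x : ℂ) • ψ x :=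
  OpField.coeFn_scalar_op _ _ ψ

/-- The weight `ħ ω^{2σ}`. -/
def Admissible.weight (hS : S.Admissible) (hħ : 0 < ħ) {σ : ℝ} (hσ : 0 ≤ σ) : Weight d where
  toFun k := ħ * S.ω k ^ (2 * σ)
  meas := (continuous_ω.measurable.pow_const _).const_mul _
  lower := ⟨ħ * S.mf ^ (2 * σ), mul_pos hħ (Real.rpow_pos_of_pos hS.mf _), fun k => by
    gcongr
    · exact hS.mf.le
    · exact mf_le_ω k⟩

/-- The weight `ħ ω`. -/
def Admissible.weightOne (hS : S.Admissible) (hħ : 0 < ħ) : Weight d where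
  toFun k := ħ * S.ω k
  meas := continuous_ω.measurable.const_mul _
  lower := ⟨ħ * S.mf, mul_pos hħ hS.mf, fun k => by gcongr; exact mf_le_ω k⟩

/-- The resolvents of the free field energy. -/
theorem Admissible.isYosida_H02 (hS : S.Admissible) (hħ : 0 < ħ) : IsYosida (S.H02 ħ)
    (fun ε => (OpField.const n ((hS.weightOne hħ).res ε).op).op) :=
  isYosida_dGamma (hS.weightOne hħ) fun _ => rfl

theorem measurable_kinetic_smul (S : Model d n) (ħ : ℝ) :
    Measurable fun ξ : Config d n => S.kinetic ((2 * Real.pi * ħ) • ξ) :=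
  (continuous_kinetic.comp (continuous_const_smul _)).measurable

/-- The resolvents of the kinetic energy. -/
theorem Admissible.isYosida_H01 (hS : S.Admissible) (ħ : ℝ) : IsYosida (S.H01 ħ)
    (fun ε => fconj (scalarRes _ (measurable_kinetic_smul S ħ) ε).op) :=
  isYosida_momentumOp (measurable_kinetic_smul S ħ) (kinetic_nonneg hS.mass)

theorem mem_graph_H01 {ψ φ : Hilb d n} : (ψ, φ) ∈ (S.H01 ħ).graph ↔
    ∀ᵐ ξ, (𝓕 φ : Hilb d n) ξ = (S.kinetic ((2 * Real.pi * ħ) • ξ) : ℂ) • (𝓕 ψ : Hilb d n) ξ := by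
  rw [H01, mem_graph_momentumOp, mem_graph_positionOp]
  rfl

theorem Admissible.mem_graph_fourier_H02 (hS : S.Admissible) (hħ : 0 < ħ) {ψ φ : Hilb d n} :
    (ψ, φ) ∈ (S.H02 ħ).graph ↔ ((𝓕 ψ : Hilb d n), (𝓕 φ : Hilb d n)) ∈ (S.H02 ħ).graph := by
  have e : (𝓕 ψ + 𝓕 φ : Hilb d n) = 𝓕 (ψ + φ) :=
    ((Lp.fourierTransformₗᵢ (Config d n) (Fock d)).map_add ψ φ).symm
  rw [(hS.isYosida_H02 hħ).mem_graph_iff, (hS.isYosida_H02 hħ).mem_graph_iff]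
  simp only
  rw [e, ← fourier_const_op]
  exact ⟨fun h => by rw [h], fun h => eq_of_fourier_eq h⟩

theorem Admissible.mem_graph_ann (hS : S.Admissible) (hħ : 0 ≤ ħ) (θ : Hilb d n) :
    (numOp d n θ, (hS.annField hħ).op θ) ∈ (annihilation ħ S.G).graph := by
  rw [graph_annihilation]
  change ∀ᵐ x, _
  filter_upwards [coeFn_numOp θ, (hS.annField hħ).coeFn_op θ] with x h1 h2
  rw [h1, h2]
  exact mem_annihilationGraph hħ (hS.memLp_G x).1 _

theorem Admissible.mem_graph_cre (hS : S.Admissible) (hħ : 0 ≤ ħ) (θ : Hilb d n) :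
    (numOp d n θ, (hS.creField hħ).op θ) ∈ (creation ħ S.G).graph := by
  rw [graph_creation]
  change ∀ᵐ x, _
  filter_upwards [coeFn_numOp θ, (hS.creField hħ).coeFn_op θ] with x h1 h2
  rw [h1, h2]
  exact mem_creationGraph hħ (hS.memLp_G x).1 _

/-- The vector `θ` is `(N+1)^{1/2}ψ`, which exists because the field energy dominates the particle
number. -/
theorem Admissible.exists_numOp_eq (hS : S.Admissible) (hħ : 0 < ħ) {ψ φ : Hilb d n}
    (h : (ψ, φ) ∈ (S.H02 ħ).graph) : ∃ θ, numOp d n θ = ψ := by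
  refine ⟨(OpField.const n (hS.weightOne hħ).rootSymbol.op).op (ψ + φ), Lp.ext ?_⟩
  filter_upwards [coeFn_numOp ((OpField.const n (hS.weightOne hħ).rootSymbol.op).op (ψ + φ)),
    OpField.coeFn_const_op (hS.weightOne hħ).rootSymbol.op (ψ + φ), Lp.coeFn_add ψ φ,
    mem_graph_dGamma.1 h] with x h1 h2 h3 h4
  rw [h1, h2, h3]
  exact (hS.weightOne hħ).numSymbol_rootSymbol (fun _ => rfl) h4

/-- The graph of the Hamiltonian: since `ψ` lies in the domain of the field energy, it is of the
form `(N+1)^{-1/2} θ`, and the interaction acts on it by bounded operators applied to `θ`. -/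
theorem Admissible.mem_graph_H (hS : S.Admissible) (hħ : 0 < ħ) {ψ φ : Hilb d n} :
    (ψ, φ) ∈ (S.H ħ).graph ↔ ∃ φ₁ φ₂ θ, (ψ, φ₁) ∈ (S.H01 ħ).graph ∧ (ψ, φ₂) ∈ (S.H02 ħ).graph ∧
      numOp d n θ = ψ ∧ φ = φ₁ + φ₂ + hS.potField.op ψ +
        ((hS.annField hħ.le).op θ + (hS.creField hħ.le).op θ) := by
  rw [H, mem_graph_add]
  constructor
  · rintro ⟨a, b, ha, hb, rfl⟩
    obtain ⟨a', v, ha', hv, rfl⟩ := mem_graph_add.1 ha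
    obtain ⟨φ₁, φ₂, h1, h2, rfl⟩ := mem_graph_add.1 ha'
    obtain ⟨b₁, b₂, hb1, hb2, rfl⟩ := mem_graph_add.1 hb
    obtain ⟨θ, rfl⟩ := hS.exists_numOp_eq hħ h2
    refine ⟨φ₁, φ₂, θ, h1, h2, rfl, ?_⟩
    rw [graph_unique hb1 (hS.mem_graph_ann hħ.le θ), graph_unique hb2 (hS.mem_graph_cre hħ.le θ)]
    congr 2
    exact graph_unique hv (mem_graph_positionOp.2 (hS.coeFn_potField _))
  · rintro ⟨φ₁, φ₂, θ, h1, h2, rfl, rfl⟩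
    exact ⟨_, _, mem_graph_add.2 ⟨_, _, mem_graph_add.2 ⟨_, _, h1, h2, rfl⟩,
      mem_graph_positionOp.2 (hS.coeFn_potField _), rfl⟩,
      mem_graph_add.2 ⟨_, _, hS.mem_graph_ann hħ.le θ, hS.mem_graph_cre hħ.le θ, rfl⟩, rfl⟩

theorem Admissible.inner_potField (hS : S.Admissible) (ψ φ : Hilb d n) :
    ⟪hS.potField.op ψ, φ⟫_ℂ = ⟪ψ, hS.potField.op φ⟫_ℂ := by
  refine Hilb.inner_congr ?_
  filter_upwards [hS.coeFn_potField ψ, hS.coeFn_potField φ] with x h1 h2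
  rw [h1, h2, inner_smul_left, inner_smul_right, Complex.conj_ofReal]

theorem Admissible.inner_annField (hS : S.Admissible) (hħ : 0 ≤ ħ) (θ η : Hilb d n) :
    ⟪(hS.annField hħ).op θ, numOp d n η⟫_ℂ = ⟪numOp d n θ, (hS.creField hħ).op η⟫_ℂ := by
  refine Hilb.inner_congr ?_
  filter_upwards [coeFn_numOp θ, coeFn_numOp η, (hS.annField hħ).coeFn_op θ,
    (hS.creField hħ).coeFn_op η] with x h1 h2 h3 h4
  rw [h1, h2, h3, h4]
  exact inner_annOp hħ (hS.memLp_G x).1 _ _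

theorem Admissible.inner_creField (hS : S.Admissible) (hħ : 0 ≤ ħ) (θ η : Hilb d n) :
    ⟪(hS.creField hħ).op θ, numOp d n η⟫_ℂ = ⟪numOp d n θ, (hS.annField hħ).op η⟫_ℂ := by
  rw [← inner_conj_symm, ← hS.inner_annField hħ, inner_conj_symm]

theorem Admissible.symm_H (hS : S.Admissible) (hħ : 0 < ħ) : ∀ z ∈ (S.H ħ).graph,
    ∀ y ∈ (S.H ħ).graph, ⟪z.2, y.1⟫_ℂ = ⟪z.1, y.2⟫_ℂ := by
  rintro ⟨ψ, φ⟩ hz ⟨ψ', φ'⟩ hy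
  obtain ⟨φ₁, φ₂, θ, h1, h2, h3, rfl⟩ := (hS.mem_graph_H hħ).1 hz
  obtain ⟨φ₁', φ₂', θ', h1', h2', h3', rfl⟩ := (hS.mem_graph_H hħ).1 hy
  have e1 := (hS.isYosida_H01 ħ).symm _ h1 _ h1'
  have e2 := (hS.isYosida_H02 hħ).symm _ h2 _ h2'
  have e3 := hS.inner_potField ψ ψ'
  have e4 := hS.inner_annField hħ.le θ θ'
  have e5 := hS.inner_creField hħ.le θ θ'
  rw [h3, h3'] at e4 e5
  simp only [inner_add_left, inner_add_right] at e1 e2 ⊢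
  linear_combination e1 + e2 + e3 + e4 + e5

/-! ### Surjectivity of `H ± il` -/

/-- The field `ξ ↦ √(N+1) (dΓ(ω) + f(2πħξ) + il)⁻¹`. -/
def Admissible.rootResField (hS : S.Admissible) (hħ : 0 < ħ) {l : ℝ} (hl : l ≠ 0) :
    OpField d n where
  toFun ξ := ((hS.weightOne hħ).rootRes (S.kinetic ((2 * Real.pi * ħ) • ξ)) hl).op
  meas := by
    obtain ⟨b, hb, h⟩ := (hS.weightOne hħ).exists_number_le
    have h1 : Continuous fun a => ((hS.weightOne hħ).rootRes a hl).op :=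
      continuous_of_norm_sub_le fun a a' =>
        (hS.weightOne hħ).norm_rootRes_sub_le hb.le h a a' hl
    exact (h1.comp (continuous_kinetic.comp (continuous_const_smul _))).stronglyMeasurable
  bound := by
    obtain ⟨b, hb, h⟩ := (hS.weightOne hħ).exists_number_le
    exact ⟨kappa b l, Real.sqrt_nonneg _, fun x => (hS.weightOne hħ).norm_rootRes_le hb.le h _ hl⟩

/-- The field `ξ ↦ f(2πħξ) (dΓ(ω) + f(2πħξ) + il)⁻¹`. -/
def Admissible.kinResField (hS : S.Admissible) (hħ : 0 < ħ) {l : ℝ} (hl : l ≠ 0) :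
    OpField d n where
  toFun ξ := (S.kinetic ((2 * Real.pi * ħ) • ξ) : ℂ) •
    ((numSymbol d).op ∘L (hS.rootResField hħ hl).toFun ξ)
  meas := by
    have h1 : StronglyMeasurable fun ξ : Config d n => (S.kinetic ((2 * Real.pi * ħ) • ξ) : ℂ) :=
      (Complex.measurable_ofReal.comp (measurable_kinetic_smul S ħ)).stronglyMeasurable
    have h2 : StronglyMeasurable fun ξ => (numSymbol d).op ∘L (hS.rootResField hħ hl).toFun ξ :=
      ((ContinuousLinearMap.compL ℂ (Fock d) (Fock d) (Fock d)
        (numSymbol d).op).continuous).comp_stronglyMeasurable (hS.rootResField hħ hl).meas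
    exact h1.smul h2
  bound := ⟨1, zero_le_one, fun ξ =>
    norm_smul_rootRes_le (hS.weightOne hħ) (kinetic_nonneg hS.mass _) hl⟩

/-- The resolvent of `H₀₁ + H₀₂`. -/
theorem Admissible.exists_graph_free (hS : S.Admissible) (hħ : 0 < ħ) {l : ℝ} (hl : l ≠ 0)
    (φ : Hilb d n) : ∃ φ₁ φ₂,
      (numOp d n (fconj (hS.rootResField hħ hl).op φ), φ₁) ∈ (S.H01 ħ).graph ∧
      (numOp d n (fconj (hS.rootResField hħ hl).op φ), φ₂) ∈ (S.H02 ħ).graph ∧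
      φ₁ + φ₂ + (l * Complex.I : ℂ) • numOp d n (fconj (hS.rootResField hħ hl).op φ) = φ := by
  set η := numOp d n (fconj (hS.rootResField hħ hl).op φ) with hη
  set φ₁ := fconj (hS.kinResField hħ hl).op φ with hφ₁
  have hη' : ∀ᵐ ξ, (𝓕 η : Hilb d n) ξ =
      (numSymbol d).op ((hS.rootResField hħ hl).toFun ξ ((𝓕 φ : Hilb d n) ξ)) := by
    have e : 𝓕 η = numOp d n ((hS.rootResField hħ hl).op (𝓕 φ)) := by
      rw [hη, numOp, fourier_const_op, fourier_fconj]
    rw [e]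
    filter_upwards [coeFn_numOp ((hS.rootResField hħ hl).op (𝓕 φ)),
      (hS.rootResField hħ hl).coeFn_op (𝓕 φ)] with ξ h1 h2
    rw [h1, h2]
  have hφ₁' : ∀ᵐ ξ, (𝓕 φ₁ : Hilb d n) ξ =
      (S.kinetic ((2 * Real.pi * ħ) • ξ) : ℂ) • (𝓕 η : Hilb d n) ξ := by
    rw [hφ₁, fourier_fconj]
    filter_upwards [hη', (hS.kinResField hħ hl).coeFn_op (𝓕 φ)] with ξ h1 h2
    rw [h1, h2]
    rfl
  refine ⟨φ₁, φ - φ₁ - (l * Complex.I : ℂ) • η, mem_graph_H01.2 hφ₁', ?_, by abel⟩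
  rw [hS.mem_graph_fourier_H02 hħ, H02, mem_graph_dGamma, fourier_sub', fourier_sub', fourier_smul']
  filter_upwards [hη', hφ₁', Lp.coeFn_sub (𝓕 φ - 𝓕 φ₁ : Hilb d n) ((l * Complex.I : ℂ) • 𝓕 η),
    Lp.coeFn_sub (𝓕 φ : Hilb d n) (𝓕 φ₁), Lp.coeFn_smul (l * Complex.I : ℂ) (𝓕 η : Hilb d n)]
    with ξ h1 h2 h3 h4 h5
  rw [h3, Pi.sub_apply, h4, Pi.sub_apply, h5, Pi.smul_apply, h2, h1]
  exact mem_dGammaGraph_rootRes (hS.weightOne hħ) (fun _ => rfl) (kinetic_nonneg hS.mass _) hl _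

theorem exists_mul_kappa_lt {b : ℝ} (hb : 0 ≤ b) (C : ℝ) :
    ∃ l₀ : ℝ, 0 < l₀ ∧ ∀ l, l₀ ≤ |l| → C * kappa b l < 1 := by
  -- For `|l| ≥ 1` one has `κ² ≤ (1 + b)/|l|`.
  refine ⟨1 + C ^ 2 * (1 + b), by positivity, fun l hl => ?_⟩
  have h1 : 1 ≤ |l| := le_trans (by nlinarith [mul_nonneg (sq_nonneg C) (by linarith : 0 ≤ 1 + b)]) hl
  have h2 : 0 < |l| := by linarith
  refine lt_of_pow_lt_pow_left₀ 2 zero_le_one ?_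
  rw [mul_pow, kappa, Real.sq_sqrt (by positivity), one_pow, ← sq_abs l]
  have h3 : 1 / |l| ^ 2 + b / (2 * |l|) ≤ (1 + b) / |l| := by
    rw [add_div]
    gcongr
    · nlinarith
    · linarith
  calc C ^ 2 * (1 / |l| ^ 2 + b / (2 * |l|)) ≤ C ^ 2 * ((1 + b) / |l|) := by gcongr
    _ < 1 := by
      rw [mul_div_assoc', div_lt_one h2]
      linarith

/-- The Hamiltonian is symmetric and `H ± il` is onto for large `l`: the interaction is a small
perturbation of the free Hamiltonian. -/
theorem Admissible.isResolvable_H (hS : S.Admissible) (hħ : 0 < ħ) : IsResolvable (S.H ħ) := by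
  refine ⟨hS.symm_H hħ, ?_⟩
  obtain ⟨b, hb, h⟩ := (hS.weightOne hħ).exists_number_le
  -- With `Θ = √(N+1)` times the free resolvent, `H + il` applied to the free resolvent of `χ` is
  -- `χ + PΘχ`, and `PΘ` has norm less than `1` for large `|l|`: a Neumann series solves for `χ`.
  set P := hS.potField.op ∘L numOp d n + ((hS.annField hħ.le).op + (hS.creField hħ.le).op) with hP
  obtain ⟨l₀, hl₀, hl⟩ := exists_mul_kappa_lt hb.le ‖P‖
  refine ⟨l₀, fun l hl1 φ => ?_⟩
  have hl0 : l ≠ 0 := abs_pos.1 (hl₀.trans_le hl1)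
  set Θ := fconj (hS.rootResField hħ hl0).op with hΘ
  have hk : 0 ≤ kappa b l := Real.sqrt_nonneg _
  have hΘn : ‖Θ‖ ≤ kappa b l := ContinuousLinearMap.opNorm_le_bound _ hk
    (norm_fconj_apply_le ((hS.rootResField hħ hl0).norm_op_apply_le fun x =>
      (hS.weightOne hħ).norm_rootRes_le hb.le h _ hl0))
  have hK : ‖-(P ∘L Θ)‖ < 1 := by
    rw [norm_neg]
    refine (ContinuousLinearMap.opNorm_comp_le _ _).trans_lt (lt_of_le_of_lt ?_ (hl l hl1))
    gcongr
  obtain ⟨φ', hφ'⟩ : ∃ φ', φ' + P (Θ φ') = φ := by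
    obtain ⟨T, hT⟩ := (isUnit_one_sub_of_norm_lt_one hK).exists_right_inv
    refine ⟨T φ, ?_⟩
    have := congrArg (fun A : Hilb d n →L[ℂ] Hilb d n => A φ) hT
    simpa using this
  obtain ⟨φ₁, φ₂, h1, h2, h3⟩ := hS.exists_graph_free hħ hl0 φ'
  rw [← hΘ] at h1 h2 h3
  refine ⟨_, (hS.mem_graph_H hħ).2 ⟨φ₁, φ₂, Θ φ', h1, h2, rfl, rfl⟩, ?_⟩
  have e : P (Θ φ') = hS.potField.op (numOp d n (Θ φ')) +
    ((hS.annField hħ.le).op (Θ φ') + (hS.creField hħ.le).op (Θ φ')) := rfl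
  rw [← hφ', e]
  linear_combination (norm := module) h3

theorem Admissible.isResolvable_H02 (hS : S.Admissible) (hħ : 0 < ħ) :
    IsResolvable (S.H02 ħ) := by
  refine ⟨(hS.isYosida_H02 hħ).symm, 1, fun l hl φ => ?_⟩
  have hl0 : l ≠ 0 := abs_pos.1 (zero_lt_one.trans_le hl)
  set R := (numSymbol d).op ∘L ((hS.weightOne hħ).rootRes 0 hl0).op with hR
  set η := (OpField.const n R).op φ with hη
  refine ⟨(η, φ - (l * Complex.I : ℂ) • η), ?_, by simp⟩
  rw [H02, mem_graph_dGamma]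
  filter_upwards [OpField.coeFn_const_op R φ, Lp.coeFn_sub φ ((l * Complex.I : ℂ) • η),
    Lp.coeFn_smul (l * Complex.I : ℂ) η] with x h1 h2 h3
  rw [h2, Pi.sub_apply, h3, Pi.smul_apply, hη, h1]
  have := mem_dGammaGraph_rootRes (hS.weightOne hħ) (w := S.ω) (ħ := ħ) (fun _ => rfl) le_rfl hl0
    (φ x)
  simp only [Complex.ofReal_zero, zero_smul, sub_zero] at this
  exact this

end Model

end Hamiltonian

/-! ### Propagation of the field energy -/

section FieldEnergy

variable {d n : ℕ} {ħ : ℝ}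

/-- A bounded symmetric operator that commutes with the resolvent of `A` has a real commutator
form with `A`. -/
theorem IsYosida.im_inner_eq_zero {E : Type*} [NormedAddCommGroup E] [InnerProductSpace ℂ E]
    {A : E →ₗ.[ℂ] E} {J : ℝ → E →L[ℂ] E} (hJ : IsYosida A J) {B : E →L[ℂ] E}
    (hB : ∀ ψ φ, ⟪B ψ, φ⟫_ℂ = ⟪ψ, B φ⟫_ℂ) (hc : ∀ ψ, B (J 1 ψ) = J 1 (B ψ)) {z : E × E}
    (hz : z ∈ A.graph) : (⟪z.2, B z.1⟫_ℂ).im = 0 := by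
  have h1 := hJ.symm _ hz _ (hJ.mem_graph_of_comm hc hz)
  exact Complex.conj_eq_iff_im.1 (by rw [inner_conj_symm, hB, ← h1])

theorem Fock.norm_sq_le_of_comp {ψ φ χ : Fock d} {a b : ℝ} (ha : 0 ≤ a) (hb : 0 ≤ b)
    (h : ∀ m, ∀ᵐ K, ‖ψ.comp m K‖ ^ 2 ≤ a * ‖φ.comp m K‖ ^ 2 + b * ‖χ.comp m K‖ ^ 2) :
    ‖ψ‖ ^ 2 ≤ a * ‖φ‖ ^ 2 + b * ‖χ‖ ^ 2 := by
  rw [← ENNReal.ofReal_le_ofReal_iff (by positivity), ENNReal.ofReal_add (by positivity)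
    (by positivity), ENNReal.ofReal_mul ha, ENNReal.ofReal_mul hb, ψ.ofReal_norm_sq,
    φ.ofReal_norm_sq, χ.ofReal_norm_sq, ← ENNReal.tsum_mul_left, ← ENNReal.tsum_mul_left,
    ← ENNReal.tsum_add]
  refine ENNReal.tsum_le_tsum fun m => ?_
  rw [← lintegral_const_mul' _ _ ENNReal.ofReal_ne_top,
    ← lintegral_const_mul' _ _ ENNReal.ofReal_ne_top,
    ← lintegral_add_left' (((φ.aestronglyMeasurable_comp m).enorm.pow_const 2).const_mul _)]
  refine lintegral_mono_ae ?_
  filter_upwards [h m] with K hK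
  simp only [← ofReal_norm, ← ENNReal.ofReal_pow (norm_nonneg _)]
  rw [← ENNReal.ofReal_mul ha, ← ENNReal.ofReal_mul hb,
    ← ENNReal.ofReal_add (by positivity) (by positivity)]
  exact ENNReal.ofReal_le_ofReal hK

section Yosida

variable (W : Weight d) {ε : ℝ}

/-- The operator `(N/(1+εN))^{1/2}` on the full Hilbert space, with `N = dΓ(W)`. -/
def Weight.rootYos (n : ℕ) (ε : ℝ) (hε : 0 < ε) : Hilb d n →L[ℂ] Hilb d n :=
  (OpField.const n (W.sqrtYos ε hε).op).op

/-- The Yosida approximation `N/(1+εN)` on the full Hilbert space, with `N = dΓ(W)`. -/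
def Weight.yos (n : ℕ) (ε : ℝ) : Hilb d n →L[ℂ] Hilb d n := (OpField.const n (W.fockYos ε)).op

theorem Weight.yos_eq (hε : 0 < ε) (ψ : Hilb d n) :
    W.yos n ε ψ = W.rootYos n ε hε (W.rootYos n ε hε ψ) := by
  apply Lp.ext
  filter_upwards [OpField.coeFn_const_op (W.fockYos ε) ψ,
    OpField.coeFn_const_op (W.sqrtYos ε hε).op (W.rootYos n ε hε ψ),
    OpField.coeFn_const_op (W.sqrtYos ε hε).op ψ] with x h1 h2 h3
  rw [Weight.rootYos] at h2
  rw [Weight.yos, Weight.rootYos, h1, h2, h3, W.fockYos_eq hε]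

theorem Weight.inner_rootYos (hε : 0 < ε) (ψ φ : Hilb d n) :
    ⟪W.rootYos n ε hε ψ, φ⟫_ℂ = ⟪ψ, W.rootYos n ε hε φ⟫_ℂ := by
  refine Hilb.inner_congr ?_
  filter_upwards [OpField.coeFn_const_op (W.sqrtYos ε hε).op ψ,
    OpField.coeFn_const_op (W.sqrtYos ε hε).op φ] with x h1 h2
  rw [Weight.rootYos, h1, h2, W.inner_sqrtYos hε]

theorem Weight.re_inner_yos (hε : 0 < ε) (ψ : Hilb d n) :
    (⟪ψ, W.yos n ε ψ⟫_ℂ).re = ‖W.rootYos n ε hε ψ‖ ^ 2 := by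
  rw [W.yos_eq hε, ← W.inner_rootYos hε, inner_self_eq_norm_sq_to_K]
  norm_cast

theorem Weight.inner_yos (hε : 0 < ε) (ψ φ : Hilb d n) :
    ⟪W.yos n ε ψ, φ⟫_ℂ = ⟪ψ, W.yos n ε φ⟫_ℂ := by
  rw [W.yos_eq hε, W.yos_eq hε, W.inner_rootYos hε, W.inner_rootYos hε]

theorem Weight.fockYos_comm (b : Symbol d) (hε : 0 < ε) (v : Fock d) :
    W.fockYos ε (b.op v) = b.op (W.fockYos ε v) := by
  rw [W.fockYos_eq hε, W.fockYos_eq hε, (W.sqrtYos ε hε).op_comm b v, (W.sqrtYos ε hε).op_comm b]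

end Yosida

namespace Model

variable {S : Model d n}

/-- The constant of the commutator estimate for the field energy, a bound for `‖ω^σ G_x‖`. -/
def fieldConst (S : Model d n) (σ : ℝ) : ℝ := S.mf ^ (σ - 1) * n * l2norm S.u

theorem Admissible.fieldConst_nonneg (hS : S.Admissible) (σ : ℝ) : 0 ≤ S.fieldConst σ := by
  have := l2norm_nonneg S.u
  have := Real.rpow_nonneg hS.mf.le (σ - 1)
  unfold fieldConst
  positivity

/-- The weighted form factor `(ħω^{2σ})^{1/2} G_x` is square-integrable: `ω^σ ≤ m_f^{σ-1} ω` for `σ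
≤ 1`. -/
theorem Admissible.memLp_sqrt_weight (hS : S.Admissible) (hħ : 0 < ħ) {σ : ℝ} (hσ : 0 ≤ σ)
    (hσ1 : σ ≤ 1) (x : Config d n) :
    MemLp (fun k => ((√((hS.weight hħ hσ).toFun k) : ℝ) : ℂ) * S.G x k) 2 volume ∧
      l2norm (fun k => ((√((hS.weight hħ hσ).toFun k) : ℝ) : ℂ) * S.G x k) ≤
        √ħ * S.fieldConst σ := by
  have hm := Real.rpow_nonneg hS.mf.le (σ - 1)
  have h := hS.memLp_mul_G (b := fun k => √((hS.weight hħ hσ).toFun k))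
    (hS.weight hħ hσ).meas.sqrt (c := √ħ * S.mf ^ (σ - 1)) (by positivity) (fun k => by
      have hω := ω_pos hS.mf k
      rw [abs_of_nonneg (Real.sqrt_nonneg _)]
      change √(ħ * S.ω k ^ (2 * σ)) ≤ _
      have e : S.ω k ^ (2 * σ) = (S.ω k ^ σ) ^ 2 := by
        rw [← Real.rpow_natCast, ← Real.rpow_mul hω.le, mul_comm]
        norm_num
      rw [Real.sqrt_mul hħ.le, e, Real.sqrt_sq (by positivity), mul_assoc]
      have e2 : S.ω k ^ σ = S.ω k ^ (σ - 1) * S.ω k := by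
        rw [← Real.rpow_add_one hω.ne']
        norm_num
      rw [e2]
      gcongr ?_ * (?_ * _)
      exact Real.rpow_le_rpow_of_nonpos hS.mf (mf_le_ω k) (by linarith)) x
  refine ⟨h.1, h.2.trans (le_of_eq ?_)⟩
  rw [fieldConst]
  ring

variable {σ ε : ℝ}

/-- The commutator of the Yosida approximation of the field energy with `a(G)`. -/
theorem Admissible.norm_commutator_yos_le (hS : S.Admissible) (hħ : 0 < ħ) (hσ : 0 ≤ σ)
    (hσ1 : σ ≤ 1) (hε : 0 < ε) (θ : Hilb d n) :
    ‖(hS.weight hħ hσ).yos n ε ((hS.annField hħ.le).op θ) -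
      (hS.annField hħ.le).op ((hS.weight hħ hσ).yos n ε θ)‖ ≤
      ħ * S.fieldConst σ * ‖(hS.weight hħ hσ).rootYos n ε hε (numOp d n θ)‖ := by
  set W := hS.weight hħ hσ
  refine Lp.norm_le_mul_norm_of_ae_le_mul ?_
  filter_upwards [Lp.coeFn_sub (W.yos n ε ((hS.annField hħ.le).op θ))
    ((hS.annField hħ.le).op (W.yos n ε θ)),
    OpField.coeFn_const_op (W.fockYos ε) ((hS.annField hħ.le).op θ),
    (hS.annField hħ.le).coeFn_op θ, (hS.annField hħ.le).coeFn_op (W.yos n ε θ),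
    OpField.coeFn_const_op (W.fockYos ε) θ,
    OpField.coeFn_const_op (W.sqrtYos ε hε).op (numOp d n θ), coeFn_numOp θ]
    with x h1 h2 h3 h4 h5 h6 h7
  rw [h1, Pi.sub_apply, h4, Weight.yos, Weight.rootYos, h2, h3, h5, h6, h7]
  have hw := hS.memLp_sqrt_weight hħ hσ hσ1 x
  refine (W.norm_commutator_annOp_le hħ.le hε (hS.memLp_G x).1 hw.1 (θ x)).trans ?_
  rw [W.re_inner_fockYos hε, Real.sqrt_sq (norm_nonneg _)]
  calc _ ≤ √ħ * (√ħ * S.fieldConst σ) * ‖(W.sqrtYos ε hε).op ((numSymbol d).op (θ x))‖ := by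
        gcongr
        exact hw.2
    _ = _ := by rw [← mul_assoc, Real.mul_self_sqrt hħ.le]

/-- The commutator form of the Hamiltonian with the field energy. -/
theorem Admissible.abs_im_inner_yos_le (hS : S.Admissible) (hħ : 0 < ħ) (hσ : 0 ≤ σ)
    (hσ1 : σ ≤ 1) (hε : 0 < ε) {z : Hilb d n × Hilb d n} (hz : z ∈ (S.H ħ).graph) :
    |(⟪z.2, (hS.weight hħ hσ).yos n ε z.1⟫_ℂ).im| ≤
      ‖z.1‖ * (ħ * S.fieldConst σ * ‖(hS.weight hħ hσ).rootYos n ε hε z.1‖) := by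
  set W := hS.weight hħ hσ
  obtain ⟨ψ, φ⟩ := z
  obtain ⟨φ₁, φ₂, θ, h1, h2, rfl, rfl⟩ := (hS.mem_graph_H hħ).1 hz
  set ψ := numOp d n θ with hψ
  -- The kinetic energy, the free field energy and the potential commute with functions of the field
  -- energy, so only the interaction contributes.
  have e1 := (hS.isYosida_H01 ħ).im_inner_eq_zero (W.inner_yos hε) (fun ψ =>
    (fconj_const_comm (T' := W.fockYos ε) (OpField.scalar_op_comm _ _ _) ψ).symm) h1
  have e2 := (hS.isYosida_H02 hħ).im_inner_eq_zero (W.inner_yos hε) (fun ψ =>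
    OpField.const_op_comm (W.fockYos_comm _ hε) ψ) h2
  have e3 : (⟪hS.potField.op ψ, W.yos n ε ψ⟫_ℂ).im = 0 := by
    have h3 : ⟪hS.potField.op ψ, W.yos n ε ψ⟫_ℂ = ⟪W.yos n ε ψ, hS.potField.op ψ⟫_ℂ := by
      rw [hS.inner_potField, W.inner_yos hε]
      congr 1
      exact OpField.scalar_op_comm _ _ _ ψ
    exact Complex.conj_eq_iff_im.1 (by rw [inner_conj_symm, ← h3])
  have hB : numOp d n (W.yos n ε θ) = W.yos n ε ψ :=
    OpField.const_op_comm (fun v => (W.fockYos_comm (numSymbol d) hε v).symm) θ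
  have e4 : ⟪(hS.annField hħ.le).op θ, W.yos n ε ψ⟫_ℂ + ⟪(hS.creField hħ.le).op θ, W.yos n ε ψ⟫_ℂ =
      starRingEnd ℂ ⟪ψ, W.yos n ε ((hS.annField hħ.le).op θ)⟫_ℂ +
        ⟪ψ, (hS.annField hħ.le).op (W.yos n ε θ)⟫_ℂ := by
    rw [inner_conj_symm, W.inner_yos hε, ← hS.inner_creField hħ.le, hB]
  have e5 : (⟪φ₁ + φ₂ + hS.potField.op ψ + ((hS.annField hħ.le).op θ + (hS.creField hħ.le).op θ),
      W.yos n ε ψ⟫_ℂ).im = -(⟪ψ, W.yos n ε ((hS.annField hħ.le).op θ) -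
        (hS.annField hħ.le).op (W.yos n ε θ)⟫_ℂ).im := by
    simp only at e1 e2
    simp only [inner_add_left, inner_sub_right, Complex.add_im, Complex.sub_im]
    have := congrArg Complex.im e4
    simp only [Complex.add_im, Complex.conj_im] at this
    linarith
  simp only
  rw [e5, abs_neg]
  refine (Complex.abs_im_le_norm _).trans ((norm_inner_le_norm _ _).trans ?_)
  gcongr
  exact hS.norm_commutator_yos_le hħ hσ hσ1 hε θ

/-- The unitary group generated by the Hamiltonian. -/
theorem Admissible.group (hS : S.Admissible) (hħ : 0 < ħ) :
    IsUnitaryGroupOf (S.H ħ) (unitaryGroup (S.H ħ)) := (hS.isResolvable_H hħ).isUnitaryGroupOf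

/-- Propagation of the field energy: its Yosida approximations grow at most exponentially, at the
rate `ħ` in the time of the group. -/
theorem Admissible.norm_rootYos_sq_le (hS : S.Admissible) (hħ : 0 < ħ) (hσ : 0 ≤ σ)
    (hσ1 : σ ≤ 1) (hε : 0 < ε) (s : ℝ) (ψ : Hilb d n) :
    ‖(hS.weight hħ hσ).rootYos n ε hε (unitaryGroup (S.H ħ) s ψ)‖ ^ 2 +
        S.fieldConst σ ^ 2 * ‖ψ‖ ^ 2 ≤
      Real.exp (ħ * |s|) * (‖(hS.weight hħ hσ).rootYos n ε hε ψ‖ ^ 2 +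
        S.fieldConst σ ^ 2 * ‖ψ‖ ^ 2) := by
  set W := hS.weight hħ hσ
  have hU := hS.group hħ
  have hc := hS.fieldConst_nonneg σ
  -- Both sides are continuous in `ψ`, because the Yosida approximation is bounded; it suffices to
  -- treat the domain of the Hamiltonian.
  have hcl : IsClosed {ψ : Hilb d n | ‖W.rootYos n ε hε (unitaryGroup (S.H ħ) s ψ)‖ ^ 2 +
        S.fieldConst σ ^ 2 * ‖ψ‖ ^ 2 ≤
      Real.exp (ħ * |s|) * (‖W.rootYos n ε hε ψ‖ ^ 2 + S.fieldConst σ ^ 2 * ‖ψ‖ ^ 2)} := by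
    refine isClosed_le ?_ ?_ <;> fun_prop
  refine hcl.closure_subset_iff.2 (fun ψ hψ => ?_) ((hS.isResolvable_H hħ).dense_domain ψ)
  obtain ⟨φ, hφ⟩ := mem_domain_iff_exists_graph.1 hψ
  have hsa : IsSelfAdjoint (W.yos n ε) := by
    rw [ContinuousLinearMap.isSelfAdjoint_iff_isSymmetric]
    exact W.inner_yos hε
  have h := hU.expectation_le hsa hφ (γ := ħ) (c := S.fieldConst σ ^ 2 * ‖ψ‖ ^ 2) (fun r => by
    have h1 := hS.abs_im_inner_yos_le hħ hσ hσ1 hε (hU.mem_graph hφ r)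
    simp only at h1
    rw [hU.norm_apply] at h1
    rw [W.re_inner_yos hε, abs_mul, abs_two]
    set q := ‖W.rootYos n ε hε (unitaryGroup (S.H ħ) r ψ)‖
    calc _ ≤ 2 * (‖ψ‖ * (ħ * S.fieldConst σ * q)) := by gcongr
      -- The factor `ħ` from the commutator cancels the `1/ħ` in the time of the group `e^{-isH}`,
      -- `s = t/ħ`.
      _ = ħ * (2 * q * (S.fieldConst σ * ‖ψ‖)) := by ring
      _ ≤ ħ * (q ^ 2 + (S.fieldConst σ * ‖ψ‖) ^ 2) := by
          gcongr
          exact two_mul_le_add_sq _ _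
      _ = _ := by ring) s
  rw [W.re_inner_yos hε, W.re_inner_yos hε] at h
  exact h

/-! ### The particle number is controlled by the field energy -/

/-- The constant in `ħ N ≤ C dΓ(ω^{2σ})`, with `N` the particle number. -/
def numConst (S : Model d n) (σ : ℝ) : ℝ := (S.mf ^ (2 * σ))⁻¹

theorem Admissible.numConst_nonneg (hS : S.Admissible) (σ : ℝ) : 0 ≤ S.numConst σ :=
  inv_nonneg.2 (Real.rpow_nonneg hS.mf.le _)

theorem Admissible.mul_card_le (hS : S.Admissible) (hħ : 0 < ħ) (hσ : 0 ≤ σ) {m : ℕ}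
    (K : Fin m → Space d) : ħ * m ≤ S.numConst σ * (hS.weight hħ hσ).total K := by
  have h := Finset.card_nsmul_le_sum (s := Finset.univ)
    (fun j => (hS.weight hħ hσ).toFun (K j)) (ħ * S.mf ^ (2 * σ)) fun j _ => by
      change _ ≤ ħ * S.ω (K j) ^ (2 * σ)
      gcongr
      · exact hS.mf.le
      · exact mf_le_ω _
  rw [Finset.card_univ, Fintype.card_fin, nsmul_eq_mul] at h
  have hp : 0 < S.mf ^ (2 * σ) := Real.rpow_pos_of_pos hS.mf _
  rw [numConst, ← div_eq_inv_mul, le_div_iff₀ hp]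
  exact le_of_eq_of_le (by ring) h

/-- The bound `N ≤ (β/ħ) dΓ(ħω^{2σ})` in a regularized form: `v` plays the role of `(N+1)^{1/2}ψ`,
and the resolvent on the left compensates for the regularization of the field energy on the right. -/
theorem Admissible.norm_sq_fock_le (hS : S.Admissible) (hħ : 0 < ħ) (hσ : 0 ≤ σ) (hε : 0 < ε)
    (v : Fock d) : ħ * ‖((hS.weight hħ hσ).res ε).op v‖ ^ 2 ≤ ħ * ‖(numSymbol d).op v‖ ^ 2 +
      S.numConst σ * ‖((hS.weight hħ hσ).sqrtYos ε hε).op ((numSymbol d).op v)‖ ^ 2 := by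
  set W := hS.weight hħ hσ
  have hβ := hS.numConst_nonneg σ
  have h : ‖(W.res ε).op v‖ ^ 2 ≤ 1 * ‖(numSymbol d).op v‖ ^ 2 +
      S.numConst σ / ħ * ‖(W.sqrtYos ε hε).op ((numSymbol d).op v)‖ ^ 2 := by
    refine Fock.norm_sq_le_of_comp zero_le_one (by positivity) fun m => ?_
    filter_upwards [(W.res ε).comp_op v m, numSymbol_comp v m,
      (W.sqrtYos ε hε).comp_op ((numSymbol d).op v) m] with K h1 h2 h3
    have h0 := W.total_nonneg K
    have hm := hS.mul_card_le hħ hσ K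
    rw [h3, h2, h1]
    simp only [Weight.res, Weight.sqrtYos, Weight.symbol, norm_mul, Complex.norm_real,
      Real.norm_eq_abs, mul_pow, sq_abs, abs_of_pos hε]
    rw [Real.sq_sqrt (by positivity), inv_pow, inv_pow, Real.sq_sqrt (by positivity)]
    set N := W.total K
    set x := ‖v.comp m K‖ ^ 2
    have hx : 0 ≤ x := sq_nonneg _
    have key : ((1 + ε * N) ^ 2)⁻¹ ≤ ((m : ℝ) + 1)⁻¹ +
        S.numConst σ / ħ * (N / (1 + ε * N) * ((m : ℝ) + 1)⁻¹) := by
      have hm' : (m : ℝ) ≤ S.numConst σ / ħ * N := by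
        rw [div_mul_eq_mul_div, le_div_iff₀ hħ, mul_comm]
        exact hm
      have hd : 1 ≤ 1 + ε * N := by linarith [mul_nonneg hε.le h0]
      have e : ((m : ℝ) + 1)⁻¹ + S.numConst σ / ħ * (N / (1 + ε * N) * ((m : ℝ) + 1)⁻¹) =
          (1 + (S.numConst σ / ħ * N) / (1 + ε * N)) / ((m : ℝ) + 1) := by
        field_simp
      rw [e, le_div_iff₀ (by positivity), inv_mul_le_iff₀ (by positivity)]
      have hg : 0 ≤ S.numConst σ / ħ * N := by positivity
      have e2 : (1 + ε * N) ^ 2 * (1 + (S.numConst σ / ħ * N) / (1 + ε * N)) =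
          (1 + ε * N) ^ 2 + (S.numConst σ / ħ * N) * (1 + ε * N) := by
        field_simp
      rw [e2]
      nlinarith [one_le_pow₀ hd (n := 2), mul_le_mul_of_nonneg_left hd hg]
    calc _ ≤ (((m : ℝ) + 1)⁻¹ + S.numConst σ / ħ * (N / (1 + ε * N) * ((m : ℝ) + 1)⁻¹)) * x := by
          gcongr
      _ = _ := by ring
  calc _ ≤ ħ * (1 * ‖(numSymbol d).op v‖ ^ 2 +
      S.numConst σ / ħ * ‖(W.sqrtYos ε hε).op ((numSymbol d).op v)‖ ^ 2) := by gcongr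
    _ = _ := by field_simp

/-- A bound for `ħ ‖(N+1)^{1/2}ψ‖²`, with `N` the particle number, by the field energy. -/
theorem Admissible.mul_norm_sq_le (hS : S.Admissible) (hħ : 0 < ħ) (hσ : 0 ≤ σ) (θ : Hilb d n)
    {F : ℝ} (hF : ∀ ε (hε : 0 < ε), ‖(hS.weight hħ hσ).rootYos n ε hε (numOp d n θ)‖ ^ 2 ≤ F) :
    ħ * ‖θ‖ ^ 2 ≤ ħ * ‖numOp d n θ‖ ^ 2 + S.numConst σ * F := by
  set W := hS.weight hħ hσ
  have hβ := hS.numConst_nonneg σ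
  have hJ := isYosida_dGamma (n := n) (w := fun k => S.ω k ^ (2 * σ)) (ħ := ħ) W fun _ => rfl
  have hlim : Tendsto (fun ε => ħ * ‖(OpField.const n (W.res ε).op).op θ‖ ^ 2) (𝓝[>] 0)
      (𝓝 (ħ * ‖θ‖ ^ 2)) := ((hJ.tendsto_apply θ).norm.pow 2).const_mul ħ
  -- The resolvent on the left tends to the identity as `ε → 0`, while the right side is bounded by
  -- hypothesis.
  refine le_of_tendsto hlim ?_
  filter_upwards [self_mem_nhdsWithin] with ε hε'
  have hε : 0 < ε := hε'
  have h1 : ‖(OpField.const n (W.res ε).op).op θ‖ ^ 2 ≤ 1 * ‖numOp d n θ‖ ^ 2 +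
      S.numConst σ / ħ * ‖W.rootYos n ε hε (numOp d n θ)‖ ^ 2 := by
    refine Hilb.norm_sq_le_of_ae ?_
    filter_upwards [OpField.coeFn_const_op (W.res ε).op θ, coeFn_numOp θ,
      OpField.coeFn_const_op (W.sqrtYos ε hε).op (numOp d n θ)] with x h1 h2 h3
    rw [Weight.rootYos, h1, h3, h2]
    have h4 := hS.norm_sq_fock_le hħ hσ hε (θ x)
    rw [← mul_le_mul_iff_right₀ hħ]
    refine h4.trans (le_of_eq ?_)
    field_simp
    rfl
  calc _ ≤ ħ * (1 * ‖numOp d n θ‖ ^ 2 + S.numConst σ / ħ * F) := by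
        gcongr
        refine h1.trans ?_
        gcongr
        exact hF ε hε
    _ = _ := by field_simp

end Model

end FieldEnergy

/-! ### Translations, modulations and quadratic moments -/

section Moments

variable {d n : ℕ}

theorem ofReal_norm_modulate_sub_sq (h : Config d n) (ψ : Hilb d n) :
    ENNReal.ofReal (‖(modulate h).op ψ - ψ‖ ^ 2) =
      ∫⁻ x, ENNReal.ofReal (‖phase h x - 1‖ ^ 2) * ‖ψ x‖ₑ ^ 2 := by
  rw [Hilb.ofReal_norm_sq]
  refine lintegral_congr_ae ?_
  filter_upwards [coeFn_modulate h ψ, Lp.coeFn_sub ((modulate h).op ψ) ψ] with x h1 h2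
  rw [h2, Pi.sub_apply, h1, ENNReal.ofReal_pow (norm_nonneg _), ofReal_norm, ← mul_pow,
    ← enorm_smul]
  congr 2
  module

theorem norm_phase_sub_one_le (h x : Config d n) : ‖phase h x - 1‖ ≤ 2 * Real.pi * |⟪h, x⟫_ℝ| := by
  have := Real.norm_exp_I_mul_ofReal_sub_one_le (x := 2 * Real.pi * ⟪h, x⟫_ℝ)
  rw [Real.norm_eq_abs, abs_mul, abs_of_pos Real.two_pi_pos, mul_comm Complex.I] at this
  exact this

/-- The second moment of `‖ψ(x)‖²`. -/
def moment (ψ : Hilb d n) : ℝ≥0∞ := ∫⁻ x, ENNReal.ofReal (‖x‖ ^ 2) * ‖ψ x‖ₑ ^ 2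

/-- The difference quotients of the modulations are bounded by the second moment; `moment_le` is the
converse. -/
theorem norm_modulate_sub_le (h : Config d n) {ψ : Hilb d n} {D : ℝ} (hD : 0 ≤ D)
    (hψ : moment ψ ≤ ENNReal.ofReal (D ^ 2)) :
    ‖(modulate h).op ψ - ψ‖ ≤ 2 * Real.pi * ‖h‖ * D := by
  have hpi := Real.pi_pos
  refine (pow_le_pow_iff_left₀ (norm_nonneg _) (by positivity) two_ne_zero).1 ?_
  rw [← ENNReal.ofReal_le_ofReal_iff (by positivity), ofReal_norm_modulate_sub_sq, mul_pow,
    ENNReal.ofReal_mul (by positivity)]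
  calc _ ≤ ∫⁻ x, ENNReal.ofReal ((2 * Real.pi * ‖h‖) ^ 2) *
        (ENNReal.ofReal (‖x‖ ^ 2) * ‖ψ x‖ₑ ^ 2) := by
        refine lintegral_mono fun x => ?_
        simp only
        rw [← mul_assoc, ← ENNReal.ofReal_mul (by positivity), ← mul_pow]
        gcongr
        refine (norm_phase_sub_one_le h x).trans ?_
        calc 2 * Real.pi * |⟪h, x⟫_ℝ| ≤ 2 * Real.pi * (‖h‖ * ‖x‖) := by
              gcongr
              exact abs_real_inner_le_norm h x
          _ = 2 * Real.pi * ‖h‖ * ‖x‖ := by ring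
    _ = ENNReal.ofReal ((2 * Real.pi * ‖h‖) ^ 2) * moment ψ := by
        rw [lintegral_const_mul' _ _ ENNReal.ofReal_ne_top, moment]
    _ ≤ _ := by gcongr

/-- The difference quotients of the phase in direction `e`, along the steps `1/(m+1)`. -/
theorem tendsto_phase_sub_one (e x : Config d n) : Tendsto
    (fun m : ℕ => ENNReal.ofReal (((m : ℝ) + 1) ^ 2) *
      ENNReal.ofReal (‖phase ((1 / ((m : ℝ) + 1)) • e) x - 1‖ ^ 2)) atTop
    (𝓝 (ENNReal.ofReal ((2 * Real.pi * ⟪e, x⟫_ℝ) ^ 2))) := by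
  have hd : HasDerivAt (fun t : ℝ => Complex.exp ((t * (2 * Real.pi * ⟪e, x⟫_ℝ) : ℝ) * Complex.I))
      (((2 * Real.pi * ⟪e, x⟫_ℝ : ℝ) : ℂ) * Complex.I) 0 := by
    have h1 : HasDerivAt (fun t : ℝ => ((t * (2 * Real.pi * ⟪e, x⟫_ℝ) : ℝ) : ℂ) * Complex.I)
        (((2 * Real.pi * ⟪e, x⟫_ℝ : ℝ) : ℂ) * Complex.I) 0 := by
      have := ((hasDerivAt_mul_const (x := (0 : ℝ)) (2 * Real.pi * ⟪e, x⟫_ℝ)).ofReal_comp).mul_const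
        Complex.I
      exact this
    have h2 := h1.cexp
    simpa using h2
  have h3 := hd.tendsto_slope_zero
  have h4 : Tendsto (fun m : ℕ => 1 / ((m : ℝ) + 1)) atTop (𝓝[≠] 0) :=
    tendsto_nhdsWithin_iff.2 ⟨tendsto_one_div_add_atTop_nhds_zero_nat,
      Eventually.of_forall fun m => (Nat.one_div_pos_of_nat (α := ℝ)).ne'⟩
  have h5 := ENNReal.tendsto_ofReal (((h3.comp h4).norm).pow 2)
  have e1 : ‖((2 * Real.pi * ⟪e, x⟫_ℝ : ℝ) : ℂ) * Complex.I‖ ^ 2 =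
      (2 * Real.pi * ⟪e, x⟫_ℝ) ^ 2 := by
    rw [norm_mul, Complex.norm_I, mul_one, Complex.norm_real, Real.norm_eq_abs, sq_abs]
  rw [e1] at h5
  refine h5.congr fun m => ?_
  rw [← ENNReal.ofReal_mul (by positivity), ← mul_pow]
  congr 2
  have h6 : (0 : ℝ) < (m : ℝ) + 1 := by positivity
  simp only [Function.comp_apply, zero_add, norm_smul, phase, inner_smul_left]
  rw [norm_inv, Real.norm_of_nonneg (by positivity), one_div, inv_inv]
  congr 3
  · congr 3
    simp
    ring
  · simp

/-- A uniform bound on the difference quotients of the modulations bounds the second moment. -/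
theorem moment_le {ψ : Hilb d n} {D : ℝ}
    (h : ∀ h : Config d n, ‖h‖ ≤ 1 → ‖(modulate h).op ψ - ψ‖ ≤ ‖h‖ * (2 * Real.pi * D)) :
    moment ψ ≤ ENNReal.ofReal (((d * n : ℕ) : ℝ) * D ^ 2) := by
  have hpi := Real.pi_pos
  -- Let the displacement tend to `0` along each coordinate axis and apply the lemma of Fatou; the sum
  -- over the `dn` axes gives the second moment.
  let b := EuclideanSpace.basisFun (Fin n × Fin d) ℝ
  have hi : ∀ i, ∫⁻ x, ENNReal.ofReal (⟪b i, x⟫_ℝ ^ 2) * ‖ψ x‖ₑ ^ 2 ≤ ENNReal.ofReal (D ^ 2) := by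
    intro i
    have hm : ∀ m : ℕ, AEMeasurable (fun x => ENNReal.ofReal (((m : ℝ) + 1) ^ 2) *
        ENNReal.ofReal (‖phase ((1 / ((m : ℝ) + 1)) • b i) x - 1‖ ^ 2) * ‖ψ x‖ₑ ^ 2) volume := by
      intro m
      refine AEMeasurable.mul (AEMeasurable.const_mul ?_ _)
        ((Lp.aestronglyMeasurable ψ).enorm.pow_const 2)
      exact (((continuous_phase _).sub continuous_const).norm.pow 2).measurable.ennreal_ofReal.aemeasurable
    have h1 : ∫⁻ x, ENNReal.ofReal ((2 * Real.pi * ⟪b i, x⟫_ℝ) ^ 2) * ‖ψ x‖ₑ ^ 2 ≤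
        ENNReal.ofReal ((2 * Real.pi * D) ^ 2) := by
      calc _ = ∫⁻ x, liminf (fun m : ℕ => ENNReal.ofReal (((m : ℝ) + 1) ^ 2) *
            ENNReal.ofReal (‖phase ((1 / ((m : ℝ) + 1)) • b i) x - 1‖ ^ 2) * ‖ψ x‖ₑ ^ 2) atTop := by
            refine lintegral_congr fun x => ?_
            refine (Tendsto.liminf_eq ?_).symm
            exact ENNReal.Tendsto.mul_const (tendsto_phase_sub_one (b i) x)
              (Or.inr (ENNReal.pow_ne_top enorm_ne_top))
        _ ≤ liminf (fun m : ℕ => ∫⁻ x, ENNReal.ofReal (((m : ℝ) + 1) ^ 2) *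
            ENNReal.ofReal (‖phase ((1 / ((m : ℝ) + 1)) • b i) x - 1‖ ^ 2) * ‖ψ x‖ₑ ^ 2) atTop :=
            lintegral_liminf_le' hm
        _ ≤ _ := by
            refine liminf_le_of_le (by isBoundedDefault) fun c hc => ?_
            obtain ⟨m, hm⟩ := hc.exists
            refine hm.trans ?_
            have hp : 0 < (m : ℝ) + 1 := by positivity
            have hb : ‖(1 / ((m : ℝ) + 1)) • b i‖ = 1 / ((m : ℝ) + 1) := by
              rw [norm_smul, b.norm_eq_one, mul_one, Real.norm_of_nonneg (by positivity)]
            have h2 := h ((1 / ((m : ℝ) + 1)) • b i) (by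
              rw [hb, div_le_one hp]; linarith [(Nat.cast_nonneg m : (0 : ℝ) ≤ m)])
            simp_rw [mul_assoc]
            rw [lintegral_const_mul' _ _ ENNReal.ofReal_ne_top, ← ofReal_norm_modulate_sub_sq,
              ← ENNReal.ofReal_mul (by positivity), ← mul_pow]
            refine ENNReal.ofReal_le_ofReal ?_
            refine pow_le_pow_left₀ (by positivity) ?_ 2
            calc _ ≤ ((m : ℝ) + 1) * (‖(1 / ((m : ℝ) + 1)) • b i‖ * (2 * Real.pi * D)) :=
                  mul_le_mul_of_nonneg_left h2 hp.le
              _ = _ := by rw [hb]; field_simp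
    have h3 : ENNReal.ofReal ((2 * Real.pi) ^ 2) ≠ 0 := by
      rw [Ne, ENNReal.ofReal_eq_zero, not_le]; positivity
    rw [← ENNReal.mul_le_mul_iff_right h3 ENNReal.ofReal_ne_top,
      ← lintegral_const_mul' _ _ ENNReal.ofReal_ne_top, ← ENNReal.ofReal_mul (by positivity),
      ← mul_pow]
    refine le_of_eq_of_le (lintegral_congr fun x => ?_) h1
    rw [← mul_assoc, ← ENNReal.ofReal_mul (by positivity), ← mul_pow]
  have hsum : ∀ x : Config d n, ENNReal.ofReal (‖x‖ ^ 2) * ‖ψ x‖ₑ ^ 2 =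
      ∑ i, ENNReal.ofReal (⟪b i, x⟫_ℝ ^ 2) * ‖ψ x‖ₑ ^ 2 := by
    intro x
    rw [← Finset.sum_mul, ← ENNReal.ofReal_sum_of_nonneg fun i _ => sq_nonneg _]
    congr 2
    rw [← b.sum_sq_norm_inner_right x]
    exact Finset.sum_congr rfl fun i _ => by rw [Real.norm_eq_abs, sq_abs]
  rw [moment]
  simp_rw [hsum]
  rw [lintegral_finsetSum']
  · refine (Finset.sum_le_sum fun i _ => hi i).trans (le_of_eq ?_)
    rw [Finset.sum_const, Finset.card_univ, Fintype.card_prod, Fintype.card_fin, Fintype.card_fin,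
      nsmul_eq_mul, ENNReal.ofReal_mul (by positivity), ENNReal.ofReal_natCast, mul_comm n d]
  · intro i _
    refine AEMeasurable.mul ?_ ((Lp.aestronglyMeasurable ψ).enorm.pow_const 2)
    exact ((continuous_const.inner continuous_id).pow 2).measurable.ennreal_ofReal.aemeasurable

theorem quadForm_position_sq (ψ : Hilb d n) :
    quadForm (positionOp fun q => ‖q‖ ^ 2) ψ = moment ψ :=
  quadForm_positionOp (by fun_prop) (fun x => by positivity) ψ

theorem quadForm_momentum_sq (ħ : ℝ) (ψ : Hilb d n) :
    quadForm (momentumOp ħ fun p => ‖p‖ ^ 2) ψ =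
      ENNReal.ofReal ((2 * Real.pi * ħ) ^ 2) * moment (𝓕 ψ : Hilb d n) := by
  rw [quadForm_momentumOp, quadForm_positionOp (by fun_prop) (fun x => by positivity), moment,
    ← lintegral_const_mul' _ _ ENNReal.ofReal_ne_top]
  refine lintegral_congr fun x => ?_
  rw [← mul_assoc, ← ENNReal.ofReal_mul (by positivity), norm_smul, mul_pow, Real.norm_eq_abs,
    sq_abs]

/-- In Fourier space translations become modulations. -/
theorem norm_translate_sub (h : Config d n) (ψ : Hilb d n) :
    ‖translate h ψ - ψ‖ = ‖(modulate h).op (𝓕 ψ) - 𝓕 ψ‖ := by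
  rw [← Lp.norm_fourier_eq, fourier_sub', fourier_translate]

end Moments

/-! ### Commutators of the Hamiltonian with translations and modulations -/

section Commutators

variable {d n : ℕ} {ħ : ℝ}

theorem ae_translate {p : Config d n → Prop} (h : Config d n) (hp : ∀ᵐ x, p x) :
    ∀ᵐ x, p (x + h) :=
  (measurePreserving_add_right volume h).quasiMeasurePreserving.ae hp

theorem translate_const_op (h : Config d n) (T : Fock d →L[ℂ] Fock d) (ψ : Hilb d n) :
    translate h ((OpField.const n T).op ψ) = (OpField.const n T).op (translate h ψ) := by
  apply Lp.ext
  filter_upwards [coeFn_translate h ((OpField.const n T).op ψ),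
    ae_translate h (OpField.coeFn_const_op T ψ), OpField.coeFn_const_op T (translate h ψ),
    coeFn_translate h ψ] with x h1 h2 h3 h4
  rw [h1, h2, h3, h4]

theorem norm_translate_op_sub_le (L : OpField d n) {C : ℝ}
    (hC : ∀ x y, ‖L.toFun x - L.toFun y‖ ≤ C * ‖x - y‖) (h : Config d n) (ψ : Hilb d n) :
    ‖translate h (L.op ψ) - L.op (translate h ψ)‖ ≤ C * ‖h‖ * ‖ψ‖ := by
  rw [← norm_translate h ψ]
  refine Lp.norm_le_mul_norm_of_ae_le_mul ?_
  filter_upwards [coeFn_translate h (L.op ψ), ae_translate h (L.coeFn_op ψ),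
    L.coeFn_op (translate h ψ), coeFn_translate h ψ,
    Lp.coeFn_sub (translate h (L.op ψ)) (L.op (translate h ψ))] with x h1 h2 h3 h4 h5
  rw [h5, Pi.sub_apply, h1, h2, h3, h4, ← sub_apply]
  refine (L.toFun (x + h) - L.toFun x).le_of_opNorm_le ((hC _ _).trans ?_) _
  rw [add_sub_cancel_left]

namespace Model

variable {S : Model d n}

theorem Admissible.mem_graph_H02_of_comm (hS : S.Admissible) (hħ : 0 < ħ)
    {T : Hilb d n →L[ℂ] Hilb d n}
    (hT : ∀ (R : Fock d →L[ℂ] Fock d) ψ, T ((OpField.const n R).op ψ) =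
      (OpField.const n R).op (T ψ)) {ψ φ : Hilb d n} (h : (ψ, φ) ∈ (S.H02 ħ).graph) :
    (T ψ, T φ) ∈ (S.H02 ħ).graph :=
  (hS.isYosida_H02 hħ).mem_graph_of_comm (hT _) h

/-- Translations preserve the domain of the Hamiltonian, and their commutator with it is controlled
by the particle number. -/
theorem Admissible.exists_translate_mem_graph (hS : S.Admissible) : ∃ C : ℝ, 0 ≤ C ∧
    ∀ ħ : ℝ, 0 < ħ → ∀ (h : Config d n) (ψ φ : Hilb d n), (ψ, φ) ∈ (S.H ħ).graph →
      ∃ χ θ, numOp d n θ = ψ ∧ (translate h ψ, χ) ∈ (S.H ħ).graph ∧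
        ‖translate h φ - χ‖ ≤ ‖h‖ * (C * (‖ψ‖ + √ħ * ‖θ‖)) := by
  obtain ⟨C, hC, hV⟩ := hS.V_lipschitz
  have hG := lipG_nonneg (S := S)
  refine ⟨C + 2 * S.lipG, by positivity, fun ħ hħ h ψ φ hz => ?_⟩
  obtain ⟨φ₁, φ₂, θ, h1, h2, rfl, rfl⟩ := (hS.mem_graph_H hħ).1 hz
  set ψ := numOp d n θ with hψ
  -- Translations commute with the kinetic energy and the free field energy; the Lipschitz bounds on
  -- the potential and on `G` control the rest.
  have h1' : (translate h ψ, translate h φ₁) ∈ (S.H01 ħ).graph := by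
    rw [mem_graph_H01, fourier_translate, fourier_translate]
    filter_upwards [mem_graph_H01.1 h1, coeFn_modulate h (𝓕 φ₁), coeFn_modulate h (𝓕 ψ)]
      with ξ e1 e2 e3
    rw [e2, e3, e1, smul_comm]
  have h2' := hS.mem_graph_H02_of_comm hħ (translate_const_op h) h2
  refine ⟨_, θ, rfl, (hS.mem_graph_H hħ).2 ⟨_, _, translate h θ, h1', h2',
    (translate_const_op h _ θ).symm, rfl⟩, ?_⟩
  have b1 := norm_translate_op_sub_le hS.potField (C := C) (fun x y => by
    refine ContinuousLinearMap.opNorm_le_bound _ (by positivity) fun v => ?_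
    change ‖(S.V x : ℂ) • v - (S.V y : ℂ) • v‖ ≤ _
    rw [← sub_smul, norm_smul, ← Complex.ofReal_sub, Complex.norm_real]
    gcongr
    exact hV x y) h ψ
  have b2 := norm_translate_op_sub_le (hS.annField hħ.le) (C := √ħ * S.lipG) (fun x y =>
    (hS.norm_annOp_sub_le hħ.le x y).trans (le_of_eq (by ring))) h θ
  have b3 := norm_translate_op_sub_le (hS.creField hħ.le) (C := √ħ * S.lipG) (fun x y =>
    (hS.norm_creOp_sub_le hħ.le x y).trans (le_of_eq (by ring))) h θ
  simp only [map_add]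
  calc _ = ‖(translate h (hS.potField.op ψ) - hS.potField.op (translate h ψ)) +
        ((translate h ((hS.annField hħ.le).op θ) - (hS.annField hħ.le).op (translate h θ)) +
        (translate h ((hS.creField hħ.le).op θ) - (hS.creField hħ.le).op (translate h θ)))‖ := by
        congr 1; abel
    _ ≤ C * ‖h‖ * ‖ψ‖ + (√ħ * S.lipG * ‖h‖ * ‖θ‖ + √ħ * S.lipG * ‖h‖ * ‖θ‖) :=
        (norm_add_le _ _).trans (add_le_add b1 ((norm_add_le _ _).trans (add_le_add b2 b3)))
    _ ≤ _ := by
        have e : ‖h‖ * ((C + 2 * S.lipG) * (‖ψ‖ + √ħ * ‖θ‖)) =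
            C * ‖h‖ * ‖ψ‖ + (√ħ * S.lipG * ‖h‖ * ‖θ‖ + √ħ * S.lipG * ‖h‖ * ‖θ‖) +
            (2 * S.lipG * ‖h‖ * ‖ψ‖ + C * ‖h‖ * (√ħ * ‖θ‖)) := by ring
        rw [e]
        have : 0 ≤ 2 * S.lipG * ‖h‖ * ‖ψ‖ + C * ‖h‖ * (√ħ * ‖θ‖) := by positivity
        linarith

/-- The increments of the kinetic energy are at most linear in the momentum, hence bounded relative
to the kinetic energy itself. -/
theorem Admissible.memLp_kinetic_increment (hS : S.Admissible) (ħ : ℝ) (h : Config d n)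
    {ψ φ : Hilb d n} (hz : (ψ, φ) ∈ (S.H01 ħ).graph) :
    MemLp (fun ξ => (S.kinetic ((2 * Real.pi * ħ) • (ξ + h)) -
      S.kinetic ((2 * Real.pi * ħ) • ξ) : ℂ) • (𝓕 ψ : Hilb d n) ξ) 2 volume := by
  obtain ⟨c, hc, hc1, hc2⟩ := exists_kinetic_growth hS.mass
  have hmeas : Measurable S.kinetic := (continuous_kinetic (S := S)).measurable
  have hsum : MemLp (fun ξ => ‖(𝓕 ψ : Hilb d n) ξ‖ + ‖(𝓕 φ : Hilb d n) ξ‖) 2 volume :=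
    (Lp.memLp (𝓕 ψ : Hilb d n)).norm.add (Lp.memLp (𝓕 φ : Hilb d n)).norm
  refine hsum.of_le_mul (c := c * (‖(2 * Real.pi * ħ) • h‖ * (1 + ‖(2 * Real.pi * ħ) • h‖ + c)))
    ?_ ?_
  · have hm : Measurable fun ξ : Config d n => (2 * Real.pi * ħ) • ξ := measurable_const_smul _
    have hm' : Measurable fun ξ : Config d n => (S.kinetic ((2 * Real.pi * ħ) • (ξ + h)) -
        S.kinetic ((2 * Real.pi * ħ) • ξ) : ℂ) :=
      (Complex.measurable_ofReal.comp (hmeas.comp (hm.comp (measurable_add_const h)))).sub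
        (Complex.measurable_ofReal.comp (hmeas.comp hm))
    exact hm'.aestronglyMeasurable.smul (Lp.aestronglyMeasurable (𝓕 ψ : Hilb d n))
  · filter_upwards [mem_graph_H01.1 hz] with ξ e1
    have ha0 : 0 ≤ S.kinetic ((2 * Real.pi * ħ) • ξ) := kinetic_nonneg hS.mass _
    have e2 : ‖‖(𝓕 ψ : Hilb d n) ξ‖ + ‖(𝓕 φ : Hilb d n) ξ‖‖ =
        (1 + S.kinetic ((2 * Real.pi * ħ) • ξ)) * ‖(𝓕 ψ : Hilb d n) ξ‖ := by
      rw [Real.norm_of_nonneg (by positivity), e1, norm_smul, Complex.norm_real,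
        Real.norm_of_nonneg ha0]
      ring
    rw [norm_smul, ← Complex.ofReal_sub, Complex.norm_real, e2]
    have b1 := hc1 ((2 * Real.pi * ħ) • ξ) ((2 * Real.pi * ħ) • h)
    rw [← smul_add] at b1
    have b2 := hc2 ((2 * Real.pi * ħ) • ξ)
    generalize S.kinetic ((2 * Real.pi * ħ) • ξ) = a at *
    generalize S.kinetic ((2 * Real.pi * ħ) • (ξ + h)) = a' at *
    generalize ‖(2 * Real.pi * ħ) • ξ‖ = p at *
    have hv := norm_nonneg ((2 * Real.pi * ħ) • h)
    generalize ‖(2 * Real.pi * ħ) • h‖ = v at *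
    have b3 : |a' - a| ≤ c * (v * (1 + v + c)) * (1 + a) := by
      refine b1.trans ?_
      rw [mul_assoc c, mul_assoc v]
      gcongr
      nlinarith [mul_nonneg hv ha0]
    calc _ ≤ c * (v * (1 + v + c)) * (1 + a) * ‖(𝓕 ψ : Hilb d n) ξ‖ := by
          rw [Real.norm_eq_abs]; gcongr
      _ = _ := by ring

/-- In Fourier space the modulated vector is a translate of `ψ`, on which the kinetic energy acts as
`f(ξ + h) = f(ξ) + (f(ξ + h) - f(ξ))`; the second summand produces `g`. -/
theorem mem_graph_H01_modulate (h : Config d n) {ψ φ g : Hilb d n}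
    (hz : (ψ, φ) ∈ (S.H01 ħ).graph)
    (hg : ∀ᵐ ξ, g ξ = (S.kinetic ((2 * Real.pi * ħ) • (ξ + h)) -
      S.kinetic ((2 * Real.pi * ħ) • ξ) : ℂ) • (𝓕 ψ : Hilb d n) ξ) :
    ((modulate h).op ψ, (𝓕⁻ (translate (-h) (𝓕 φ + g)) : Hilb d n)) ∈ (S.H01 ħ).graph := by
  rw [mem_graph_H01, fourier_inv, fourier_modulate]
  filter_upwards [coeFn_translate (-h) (𝓕 φ + g), coeFn_translate (-h) (𝓕 ψ),
    ae_translate (-h) (Lp.coeFn_add (𝓕 φ) g), ae_translate (-h) hg,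
    ae_translate (-h) (mem_graph_H01.1 hz)] with ξ e1 e2 e3 e4 e5
  rw [e1, e2, e3, Pi.add_apply, e4, e5, neg_add_cancel_right]
  module

theorem norm_modulate_sub_fourierInv (h : Config d n) (φ g : Hilb d n) :
    ‖(modulate h).op φ - (𝓕⁻ (translate (-h) (𝓕 φ + g)) : Hilb d n)‖ = ‖g‖ := by
  rw [← Lp.norm_fourier_eq, fourier_sub', fourier_inv, fourier_modulate, map_add, sub_add_cancel_left,
    norm_neg, norm_translate]

theorem modulate_op_comm (h : Config d n) (L : OpField d n) (ψ : Hilb d n) :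
    (modulate h).op (L.op ψ) = L.op ((modulate h).op ψ) :=
  OpField.scalar_op_comm _ _ L ψ

theorem modulate_const_op (h : Config d n) (T : Fock d →L[ℂ] Fock d) (ψ : Hilb d n) :
    (modulate h).op ((OpField.const n T).op ψ) = (OpField.const n T).op ((modulate h).op ψ) :=
  modulate_op_comm h _ ψ

theorem modulate_add_sub (h : Config d n) (L L₁ L₂ : OpField d n) (φ φ' χ ψ θ : Hilb d n) :
    (modulate h).op (φ + φ' + L.op ψ + (L₁.op θ + L₂.op θ)) -
      (χ + (modulate h).op φ' + L.op ((modulate h).op ψ) +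
        (L₁.op ((modulate h).op θ) + L₂.op ((modulate h).op θ))) = (modulate h).op φ - χ := by
  rw [map_add, map_add, map_add, map_add, modulate_op_comm, modulate_op_comm, modulate_op_comm,
    add_sub_add_right_eq_sub, add_sub_add_right_eq_sub, add_sub_add_right_eq_sub]

/-- Modulations preserve the domain of the Hamiltonian, and their commutator with it comes from the
kinetic energy only; it is given by the increments of the kinetic energy in momentum space. -/
theorem Admissible.exists_modulate_mem_graph (hS : S.Admissible) (hħ : 0 < ħ)
    (h : Config d n) {ψ φ : Hilb d n} (hz : (ψ, φ) ∈ (S.H ħ).graph) :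
    ∃ χ g : Hilb d n, ((modulate h).op ψ, χ) ∈ (S.H ħ).graph ∧
      ‖(modulate h).op φ - χ‖ = ‖g‖ ∧ ∀ᵐ ξ, g ξ = (S.kinetic ((2 * Real.pi * ħ) • (ξ + h)) -
        S.kinetic ((2 * Real.pi * ħ) • ξ) : ℂ) • (𝓕 ψ : Hilb d n) ξ := by
  obtain ⟨φ₁, φ₂, θ, h1, h2, h3, h4⟩ := (hS.mem_graph_H hħ).1 hz
  obtain ⟨g, hg⟩ : ∃ g : Hilb d n, ∀ᵐ ξ, g ξ = (S.kinetic ((2 * Real.pi * ħ) • (ξ + h)) -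
      S.kinetic ((2 * Real.pi * ħ) • ξ) : ℂ) • (𝓕 ψ : Hilb d n) ξ :=
    ⟨_, (hS.memLp_kinetic_increment ħ h h1).coeFn_toLp⟩
  have h2' := hS.mem_graph_H02_of_comm hħ (modulate_const_op h) h2
  have h1' := mem_graph_H01_modulate h h1 hg
  have h3' : numOp d n ((modulate h).op θ) = (modulate h).op ψ := by
    rw [← h3, numOp, modulate_const_op]
  refine ⟨(𝓕⁻ (translate (-h) (𝓕 φ₁ + g)) : Hilb d n) + (modulate h).op φ₂ +
    hS.potField.op ((modulate h).op ψ) + ((hS.annField hħ.le).op ((modulate h).op θ) +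
    (hS.creField hħ.le).op ((modulate h).op θ)), g,
    (hS.mem_graph_H hħ).2 ⟨_, _, _, h1', h2', h3', rfl⟩, ?_, hg⟩
  rw [h4, modulate_add_sub, norm_modulate_sub_fourierInv]

end Model

end Commutators

/-! ### Smoothing into the domain of the Hamiltonian -/

section Smoothing

variable {d n : ℕ} {ħ : ℝ}

theorem norm_scalarRes_op_apply_le {g : Config d n → ℝ} (hg : Measurable g) (ε : ℝ)
    (ψ : Hilb d n) : ∀ᵐ x, ‖(scalarRes g hg ε).op ψ x‖ ≤ ‖ψ x‖ := by
  filter_upwards [coeFn_scalarRes hg ε ψ] with x h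
  rw [h, norm_smul, Complex.norm_real, Real.norm_of_nonneg (by positivity)]
  refine mul_le_of_le_one_left (norm_nonneg _) (inv_le_one_of_one_le₀ ?_)
  have : 0 ≤ |ε| * |g x| := by positivity
  linarith

theorem norm_symbol_op_apply_le_of_norm_le {b : Symbol d} (hb : ∀ v, ‖b.op v‖ ≤ ‖v‖)
    (ψ : Hilb d n) : ∀ᵐ x, ‖(OpField.const n b.op).op ψ x‖ ≤ ‖ψ x‖ := by
  filter_upwards [OpField.coeFn_const_op b.op ψ] with x h
  rw [h]
  exact hb _

theorem Weight.norm_res_op_le (W : Weight d) (ε : ℝ) (v : Fock d) : ‖(W.res ε).op v‖ ≤ ‖v‖ := by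
  have h := (W.res ε).norm_op_apply_le zero_le_one (fun m K => by
    change ‖(((1 + |ε| * W.total K)⁻¹ : ℝ) : ℂ)‖ ≤ 1
    have := mul_nonneg (abs_nonneg ε) (W.total_nonneg K)
    rw [Complex.norm_real, Real.norm_of_nonneg (by positivity)]
    exact inv_le_one_of_one_le₀ (by linarith)) v
  rwa [one_mul] at h

theorem fconj_scalarRes_const_op {g : Config d n → ℝ} (hg : Measurable g) (ε : ℝ)
    (T : Fock d →L[ℂ] Fock d) (ψ : Hilb d n) :
    fconj (scalarRes g hg ε).op ((OpField.const n T).op ψ) =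
      (OpField.const n T).op (fconj (scalarRes g hg ε).op ψ) :=
  fconj_const_comm (fun ψ => OpField.scalar_op_comm _ _ _ ψ) ψ

theorem moment_mono {ψ φ : Hilb d n} (h : ∀ᵐ x, ‖ψ x‖ ≤ ‖φ x‖) : moment ψ ≤ moment φ := by
  refine lintegral_mono_ae ?_
  filter_upwards [h] with x hx
  gcongr
  exact enorm_le_iff_norm_le.2 hx

namespace Model

variable {S : Model d n}

/-- The product of the resolvents of the kinetic energy and of the free field energy. It maps into
the domain of the Hamiltonian and tends to the identity as `ε → 0`. -/
def Admissible.smoothing (hS : S.Admissible) (hħ : 0 < ħ) (ε : ℝ) : Hilb d n →L[ℂ] Hilb d n :=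
  fconj (scalarRes _ (measurable_kinetic_smul S ħ) ε).op ∘L
    (OpField.const n ((hS.weightOne hħ).res ε).op).op

theorem Admissible.smoothing_apply (hS : S.Admissible) (hħ : 0 < ħ) (ε : ℝ) (ψ : Hilb d n) :
    hS.smoothing hħ ε ψ = fconj (scalarRes _ (measurable_kinetic_smul S ħ) ε).op
      ((OpField.const n ((hS.weightOne hħ).res ε).op).op ψ) := rfl

theorem Admissible.exists_smoothing_mem_graph (hS : S.Admissible) (hħ : 0 < ħ) {ε : ℝ}
    (hε : 0 < ε) (ψ : Hilb d n) : ∃ φ, (hS.smoothing hħ ε ψ, φ) ∈ (S.H ħ).graph := by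
  have h1 := (hS.isYosida_H01 ħ).res ε hε ((OpField.const n ((hS.weightOne hħ).res ε).op).op ψ)
  have h2 := hS.mem_graph_H02_of_comm hħ
    (T := fconj (scalarRes _ (measurable_kinetic_smul S ħ) ε).op)
    (fconj_scalarRes_const_op _ ε)
    ((hS.isYosida_H02 hħ).res ε hε ψ)
  obtain ⟨θ, hθ⟩ := hS.exists_numOp_eq hħ h2
  exact ⟨_, (hS.mem_graph_H hħ).2 ⟨_, _, θ, h1, h2, hθ, rfl⟩⟩

theorem Admissible.norm_smoothing_le (hS : S.Admissible) (hħ : 0 < ħ) {ε : ℝ} (hε : 0 < ε)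
    (ψ : Hilb d n) : ‖hS.smoothing hħ ε ψ‖ ≤ ‖ψ‖ :=
  ((hS.isYosida_H01 ħ).norm_apply_le hε _).trans ((hS.isYosida_H02 hħ).norm_apply_le hε _)

theorem Admissible.tendsto_smoothing (hS : S.Admissible) (hħ : 0 < ħ) (ψ : Hilb d n) :
    Tendsto (fun ε => hS.smoothing hħ ε ψ) (𝓝[>] 0) (𝓝 ψ) := by
  have h1 := (hS.isYosida_H01 ħ).tendsto_apply ψ
  have h2 := (hS.isYosida_H02 hħ).tendsto_apply ψ
  rw [tendsto_iff_norm_sub_tendsto_zero] at h1 h2 ⊢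
  refine squeeze_zero' (Eventually.of_forall fun _ => norm_nonneg _) ?_ (by simpa using h2.add h1)
  filter_upwards [self_mem_nhdsWithin] with ε hε
  rw [hS.smoothing_apply]
  refine (norm_sub_le_norm_sub_add_norm_sub _
    (fconj (scalarRes _ (measurable_kinetic_smul S ħ) ε).op ψ) _).trans ?_
  gcongr
  rw [← map_sub]
  exact (hS.isYosida_H01 ħ).norm_apply_le hε _

/-- Smoothing commutes with functions of the field energy, so it does not increase the regularized
field energy. -/
theorem Admissible.norm_rootYos_smoothing_le (hS : S.Admissible) (hħ : 0 < ħ) (W : Weight d)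
    {ε δ : ℝ} (hε : 0 < ε) (hδ : 0 < δ) (ψ : Hilb d n) :
    ‖W.rootYos n δ hδ (hS.smoothing hħ ε ψ)‖ ≤ ‖W.rootYos n δ hδ ψ‖ := by
  have h : W.rootYos n δ hδ (hS.smoothing hħ ε ψ) = hS.smoothing hħ ε (W.rootYos n δ hδ ψ) := by
    rw [hS.smoothing_apply, hS.smoothing_apply, Weight.rootYos,
      ← fconj_scalarRes_const_op,
      OpField.const_op_comm (fun v => Symbol.op_comm _ _ v)]
  rw [h]
  exact hS.norm_smoothing_le hħ hε _

theorem Admissible.moment_fourier_smoothing_le (hS : S.Admissible) (hħ : 0 < ħ) (ε : ℝ)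
    (ψ : Hilb d n) : moment (𝓕 (hS.smoothing hħ ε ψ) : Hilb d n) ≤ moment (𝓕 ψ : Hilb d n) := by
  rw [hS.smoothing_apply, fourier_fconj, fourier_const_op]
  refine moment_mono ?_
  filter_upwards [norm_scalarRes_op_apply_le (measurable_kinetic_smul S ħ) ε
    ((OpField.const n ((hS.weightOne hħ).res ε).op).op (𝓕 ψ)),
    norm_symbol_op_apply_le_of_norm_le ((hS.weightOne hħ).norm_res_op_le ε) (𝓕 ψ)] with x h1 h2
  exact h1.trans h2

/-- An estimate that holds for all smoothed vectors, with the same constant, extends to the vector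
itself. -/
theorem Admissible.norm_sub_le_of_smoothing (hS : S.Admissible) (hħ : 0 < ħ)
    (T U : Hilb d n →L[ℂ] Hilb d n) {K : ℝ} (ψ : Hilb d n)
    (h : ∀ ε > 0, ‖T (U (hS.smoothing hħ ε ψ)) - U (hS.smoothing hħ ε ψ)‖ ≤
      ‖T (hS.smoothing hħ ε ψ) - hS.smoothing hħ ε ψ‖ + K) :
    ‖T (U ψ) - U ψ‖ ≤ ‖T ψ - ψ‖ + K := by
  have hlim := hS.tendsto_smoothing hħ ψ
  have c1 : Continuous fun χ : Hilb d n => ‖T (U χ) - U χ‖ := by fun_prop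
  have c2 : Continuous fun χ : Hilb d n => ‖T χ - χ‖ + K := by fun_prop
  refine le_of_tendsto_of_tendsto ((c1.tendsto ψ).comp hlim) ((c2.tendsto ψ).comp hlim) ?_
  filter_upwards [self_mem_nhdsWithin] with ε hε
  exact h ε hε

end Model

end Smoothing

/-! ### Propagation of the kinetic moment -/

section Momentum

variable {d n : ℕ} {ħ : ℝ}

theorem sq_le_two_mul_exp {t : ℝ} (ht : 0 ≤ t) : t ^ 2 ≤ 2 * Real.exp t := by
  have := Real.quadratic_le_exp_of_nonneg ht
  linarith

/-- The commutator with a translation is of size `ν + √ħ θ`, where `ν` is the norm of `ψ` and `θ`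
that of `(N+1)^{1/2}ψ`. The bound on `ħθ²` by the field energy `F` at time `0` turns it into `√(F +
N²)` up to constants, with the exponential growth `e`. -/
theorem add_sqrt_mul_le {ħ β c ν N θ e F : ℝ} (hħ : 0 < ħ) (hħ1 : ħ < 1) (hβ : 0 ≤ β) (hν : 0 ≤ ν)
    (hN : ν ≤ N) (he : 1 ≤ e) (hF : 0 ≤ F)
    (h : ħ * θ ^ 2 ≤ ħ * ν ^ 2 + β * (e * (F + c ^ 2 * N ^ 2))) :
    ν + √ħ * θ ≤ (1 + √(1 + β * (1 + c ^ 2))) * √(e * (F + N ^ 2)) := by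
  have h0 : F + N ^ 2 ≤ e * (F + N ^ 2) := le_mul_of_one_le_left (by positivity) he
  have hN2 : ν ^ 2 ≤ N ^ 2 := by gcongr
  have b1 : ν ≤ √(e * (F + N ^ 2)) := Real.le_sqrt_of_sq_le (by linarith)
  have b2 : √ħ * θ ≤ √(1 + β * (1 + c ^ 2)) * √(e * (F + N ^ 2)) := by
    rw [← Real.sqrt_mul (by positivity)]
    refine Real.le_sqrt_of_sq_le ?_
    rw [mul_pow, Real.sq_sqrt hħ.le]
    have e3 : ħ * ν ^ 2 ≤ ν ^ 2 := mul_le_of_le_one_left (sq_nonneg _) hħ1.le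
    have e4 : β * (e * (F + c ^ 2 * N ^ 2)) ≤ β * ((1 + c ^ 2) * (e * (F + N ^ 2))) := by
      have : F + c ^ 2 * N ^ 2 ≤ (1 + c ^ 2) * (F + N ^ 2) := by
        have := mul_nonneg (sq_nonneg c) hF
        nlinarith [sq_nonneg N]
      rw [mul_left_comm (1 + c ^ 2)]
      gcongr
    linarith
  linarith

/-- The polynomial factor `τ²` from the linear growth in time is absorbed by doubling the
exponential rate. -/
theorem add_mul_sq_le {P G κ τ : ℝ} (hP : 0 ≤ P) (hG : 0 ≤ G) (hτ : 0 ≤ τ) :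
    (√P + κ * √(Real.exp τ * G) * τ) ^ 2 ≤ (2 + 4 * κ ^ 2) * (Real.exp (2 * τ) * (P + G)) := by
  have e2 := add_sq_le (a := √P) (b := κ * √(Real.exp τ * G) * τ)
  rw [mul_pow, mul_pow, Real.sq_sqrt hP, Real.sq_sqrt (by positivity)] at e2
  have e3 : Real.exp τ * G * τ ^ 2 ≤ 2 * (Real.exp (2 * τ) * (P + G)) := by
    calc _ ≤ Real.exp τ * G * (2 * Real.exp τ) := by
          gcongr; exact sq_le_two_mul_exp hτ
      _ = 2 * (Real.exp (2 * τ) * G) := by rw [two_mul τ, Real.exp_add]; ring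
      _ ≤ _ := by gcongr; linarith
  have e4 : P ≤ Real.exp (2 * τ) * (P + G) :=
    (le_add_of_nonneg_right hG).trans (le_mul_of_one_le_left (by positivity)
      (Real.one_le_exp (by positivity)))
  have e5 := mul_le_mul_of_nonneg_left e3 (sq_nonneg κ)
  linarith

/-- The bound on `p̂²` as a second moment of the Fourier transform. -/
theorem moment_le_of_quadForm_le (hħ : 0 < ħ) {ψ : Hilb d n} {P : ℝ} (hP0 : 0 ≤ P)
    (hP : quadForm (momentumOp ħ fun p => ‖p‖ ^ 2) ψ ≤ ENNReal.ofReal P) :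
    moment (𝓕 ψ : Hilb d n) ≤ ENNReal.ofReal ((√P / (2 * Real.pi * ħ)) ^ 2) := by
  have hpi := Real.pi_pos
  have h0 : 0 < (2 * Real.pi * ħ) ^ 2 := by positivity
  have h3 : ENNReal.ofReal ((2 * Real.pi * ħ) ^ 2) ≠ 0 := by
    rw [Ne, ENNReal.ofReal_eq_zero, not_le]; exact h0
  rw [quadForm_momentum_sq] at hP
  rw [← ENNReal.mul_le_mul_iff_right h3 ENNReal.ofReal_ne_top, ← ENNReal.ofReal_mul h0.le, div_pow,
    Real.sq_sqrt hP0, mul_div_cancel₀ _ h0.ne']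
  exact hP

namespace Model

variable {S : Model d n} {σ : ℝ}

/-- The commutator of the Hamiltonian with a translation along the evolution, for initial vectors in
the domain. -/
theorem Admissible.exists_norm_translate_sub_le_of_mem_graph (hS : S.Admissible) (hσ : 0 ≤ σ)
    (hσ1 : σ ≤ 1) : ∃ κ : ℝ, 0 ≤ κ ∧ ∀ (ħ : ℝ) (hħ : 0 < ħ), ħ < 1 → ∀ (t F N : ℝ)
    (h : Config d n) (z : Hilb d n × Hilb d n), z ∈ (S.H ħ).graph → ‖z.1‖ ≤ N →
      (∀ ε (hε : 0 < ε), ‖(hS.weight hħ hσ).rootYos n ε hε z.1‖ ^ 2 ≤ F) →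
      ‖translate h (unitaryGroup (S.H ħ) (t / ħ) z.1) - unitaryGroup (S.H ħ) (t / ħ) z.1‖ ≤
        ‖translate h z.1 - z.1‖ + ‖h‖ * (κ * √(Real.exp |t| * (F + N ^ 2))) * |t / ħ| := by
  obtain ⟨C, hC, hcomm⟩ := hS.exists_translate_mem_graph
  have hβ := hS.numConst_nonneg σ
  refine ⟨C * (1 + √(1 + S.numConst σ * (1 + S.fieldConst σ ^ 2))), by positivity,
    fun ħ hħ hħ1 t F N h z hz hN hF => ?_⟩
  have hN0 : 0 ≤ N := (norm_nonneg _).trans hN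
  have hF0 : 0 ≤ F := (sq_nonneg _).trans (hF 1 one_pos)
  have hU := hS.group hħ
  have hts : ħ * |t / ħ| = |t| := by rw [abs_div, abs_of_pos hħ]; field_simp
  refine hU.norm_apply_sub_le hz ?_ ?_
  · intro y hy
    obtain ⟨χ, -, -, h2, -⟩ := hcomm ħ hħ h y.1 y.2 hy
    exact mem_domain_iff_exists_graph.2 ⟨χ, h2⟩
  · intro r hr χ hχ
    obtain ⟨χ', θ, h1, h2, h3⟩ := hcomm ħ hħ h _ _ (hU.mem_graph hz r)
    rw [graph_unique hχ h2]
    refine h3.trans ?_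
    rw [hU.norm_apply]
    have hF' : ∀ ε (hε : 0 < ε), ‖(hS.weight hħ hσ).rootYos n ε hε (numOp d n θ)‖ ^ 2 ≤
        Real.exp |t| * (F + S.fieldConst σ ^ 2 * N ^ 2) := by
      intro ε hε
      rw [h1]
      have e1 := hS.norm_rootYos_sq_le hħ hσ hσ1 hε r z.1
      have e2 : Real.exp (ħ * |r|) ≤ Real.exp |t| := by
        rw [← hts]; gcongr
      calc _ ≤ Real.exp (ħ * |r|) * (‖(hS.weight hħ hσ).rootYos n ε hε z.1‖ ^ 2 +
            S.fieldConst σ ^ 2 * ‖z.1‖ ^ 2) := by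
            linarith [mul_nonneg (sq_nonneg (S.fieldConst σ)) (sq_nonneg ‖z.1‖)]
        _ ≤ _ := by gcongr; exact hF ε hε
    have hθ := hS.mul_norm_sq_le hħ hσ θ hF'
    rw [h1, hU.norm_apply] at hθ
    -- The field energy at the intermediate time `r` has grown at most by `e^{ħ|r|} ≤ e^{|t|}`.
    have b := add_sqrt_mul_le hħ hħ1 hβ (norm_nonneg z.1) hN
      (Real.one_le_exp (abs_nonneg t)) hF0 hθ
    rw [mul_assoc C]
    exact mul_le_mul_of_nonneg_left (mul_le_mul_of_nonneg_left b hC) (norm_nonneg h)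

/-- The previous estimate for arbitrary vectors with finite field energy. -/
theorem Admissible.exists_norm_translate_sub_le (hS : S.Admissible) (hσ : 0 ≤ σ)
    (hσ1 : σ ≤ 1) : ∃ κ : ℝ, 0 ≤ κ ∧ ∀ (ħ : ℝ) (hħ : 0 < ħ), ħ < 1 → ∀ (t F : ℝ)
    (h : Config d n) (ψ : Hilb d n),
      (∀ ε (hε : 0 < ε), ‖(hS.weight hħ hσ).rootYos n ε hε ψ‖ ^ 2 ≤ F) →
      ‖translate h (unitaryGroup (S.H ħ) (t / ħ) ψ) - unitaryGroup (S.H ħ) (t / ħ) ψ‖ ≤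
        ‖translate h ψ - ψ‖ + ‖h‖ * (κ * √(Real.exp |t| * (F + ‖ψ‖ ^ 2))) * |t / ħ| := by
  obtain ⟨κ, hκ, H⟩ := hS.exists_norm_translate_sub_le_of_mem_graph hσ hσ1
  refine ⟨κ, hκ, fun ħ hħ hħ1 t F h ψ hF => ?_⟩
  refine hS.norm_sub_le_of_smoothing hħ (translate h) (unitaryGroup (S.H ħ) (t / ħ)) ψ
    fun ε hε => ?_
  obtain ⟨φ, hφ⟩ := hS.exists_smoothing_mem_graph hħ hε ψ
  have hN := hS.norm_smoothing_le hħ hε ψ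
  have hR : ∀ δ (hδ : 0 < δ),
      ‖(hS.weight hħ hσ).rootYos n δ hδ (hS.smoothing hħ ε ψ)‖ ^ 2 ≤ F := fun δ hδ =>
    (pow_le_pow_left₀ (norm_nonneg _) (hS.norm_rootYos_smoothing_le hħ _ hε hδ ψ) 2).trans (hF δ hδ)
  exact H ħ hħ hħ1 t F ‖ψ‖ h (hS.smoothing hħ ε ψ, φ) hφ hN hR

/-- Propagation of `p̂²`: its growth is controlled by the field energy. -/
theorem Admissible.exists_quadForm_momentum_le (hS : S.Admissible) (hσ : 0 ≤ σ)
    (hσ1 : σ ≤ 1) : ∃ C : ℝ, 0 ≤ C ∧ ∀ (ħ : ℝ) (hħ : 0 < ħ), ħ < 1 → ∀ (t P F : ℝ)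
    (ψ : Hilb d n), 0 ≤ P → quadForm (momentumOp ħ fun p => ‖p‖ ^ 2) ψ ≤ ENNReal.ofReal P →
      (∀ ε (hε : 0 < ε), ‖(hS.weight hħ hσ).rootYos n ε hε ψ‖ ^ 2 ≤ F) →
      quadForm (momentumOp ħ fun p => ‖p‖ ^ 2) (unitaryGroup (S.H ħ) (t / ħ) ψ) ≤
        ENNReal.ofReal (C * (Real.exp (2 * |t|) * (P + F + ‖ψ‖ ^ 2))) := by
  obtain ⟨κ, hκ, H⟩ := hS.exists_norm_translate_sub_le hσ hσ1
  refine ⟨((d * n : ℕ) : ℝ) * (2 + 4 * κ ^ 2), by positivity,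
    fun ħ hħ hħ1 t P F ψ hP0 hP hF => ?_⟩
  have hpi := Real.pi_pos
  have hF0 : 0 ≤ F := (sq_nonneg _).trans (hF 1 one_pos)
  have hm := moment_le_of_quadForm_le hħ hP0 hP
  have hE0 : 0 ≤ F + ‖ψ‖ ^ 2 := by positivity
  have h1 : moment (𝓕 (unitaryGroup (S.H ħ) (t / ħ) ψ) : Hilb d n) ≤
      ENNReal.ofReal (((d * n : ℕ) : ℝ) *
        ((√P + κ * √(Real.exp |t| * (F + ‖ψ‖ ^ 2)) * |t|) / (2 * Real.pi * ħ)) ^ 2) := by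
    -- A bound on the translations of the evolved vector bounds its momentum; at time zero the
    -- momentum bounds the translations. The `1/ħ` of the time cancels the `ħ` in `p̂`.
    refine moment_le fun h _ => ?_
    rw [← norm_translate_sub]
    refine (H ħ hħ hħ1 t F h ψ hF).trans ?_
    rw [norm_translate_sub]
    have h2 := norm_modulate_sub_le h (by positivity) hm
    rw [abs_div, abs_of_pos hħ]
    refine (add_le_add_left h2 _).trans (le_of_eq ?_)
    field_simp
  rw [quadForm_momentum_sq, add_assoc]
  refine (mul_le_mul_right h1 _).trans ?_
  rw [← ENNReal.ofReal_mul (by positivity)]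
  refine ENNReal.ofReal_le_ofReal ?_
  have e1 := mul_le_mul_of_nonneg_left (add_mul_sq_le (κ := κ) hP0 hE0 (abs_nonneg t))
    (Nat.cast_nonneg (α := ℝ) (d * n))
  rw [div_pow, mul_left_comm, mul_div_cancel₀ _ (by positivity), mul_assoc ((d * n : ℕ) : ℝ)]
  exact e1

end Model

end Momentum

/-! ### Propagation of the position moment -/

section Position

variable {d n : ℕ}

namespace Model

variable {S : Model d n} {σ : ℝ}

/-- The growth bound on the increments of the kinetic energy at momentum displacement `v = 2πħ‖h‖`,
in the squared form that can be integrated against `‖𝓕ψ‖²`. -/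
theorem sq_le_of_growth {ħ c v p x y : ℝ} (hc : 0 ≤ c) (hħ : 0 < ħ) (hħ1 : ħ < 1) (hy0 : 0 ≤ y)
    (hy : y ≤ 1) (hp : 0 ≤ p) (hv : v = 2 * Real.pi * ħ * y) (h : |x| ≤ c * (v * (1 + v + p))) :
    |x| ^ 2 ≤ (ħ * y * (4 * Real.pi * c * (1 + 2 * Real.pi))) ^ 2 * (p ^ 2 + 1) := by
  have hpi := Real.pi_pos
  have hħy : ħ * y ≤ 1 := mul_le_one₀ hħ1.le hy0 hy
  have h1 : 1 + v + p ≤ (1 + 2 * Real.pi) * (1 + p) := by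
    have : v ≤ 2 * Real.pi := by rw [hv, mul_assoc]; exact mul_le_of_le_one_right (by positivity) hħy
    nlinarith [mul_nonneg hpi.le hp]
  have h2 : |x| ≤ ħ * y * (2 * Real.pi * c * (1 + 2 * Real.pi)) * (1 + p) := by
    have hv0 : 0 ≤ v := by rw [hv]; positivity
    calc |x| ≤ c * (v * ((1 + 2 * Real.pi) * (1 + p))) := h.trans (by gcongr)
      _ = _ := by rw [hv]; ring
  have h3 : (1 + p) ^ 2 ≤ 4 * (p ^ 2 + 1) := by nlinarith [sq_nonneg (1 - p)]
  calc |x| ^ 2 ≤ (ħ * y * (2 * Real.pi * c * (1 + 2 * Real.pi)) * (1 + p)) ^ 2 := by gcongr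
    _ = (ħ * y * (2 * Real.pi * c * (1 + 2 * Real.pi))) ^ 2 * (1 + p) ^ 2 := by rw [mul_pow]
    _ ≤ (ħ * y * (2 * Real.pi * c * (1 + 2 * Real.pi))) ^ 2 * (4 * (p ^ 2 + 1)) := by gcongr
    _ = _ := by ring

/-- The commutator of the kinetic energy with a modulation is bounded by the momentum. -/
theorem exists_norm_increment_le (hM : ∀ j, 0 < S.M j) : ∃ κ : ℝ, 0 ≤ κ ∧
    ∀ ħ : ℝ, 0 < ħ → ħ < 1 → ∀ (h : Config d n) (ψ g : Hilb d n) (P : ℝ), ‖h‖ ≤ 1 → 0 ≤ P →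
      quadForm (momentumOp ħ fun p => ‖p‖ ^ 2) ψ ≤ ENNReal.ofReal P →
      (∀ᵐ ξ, g ξ = (S.kinetic ((2 * Real.pi * ħ) • (ξ + h)) -
        S.kinetic ((2 * Real.pi * ħ) • ξ) : ℂ) • (𝓕 ψ : Hilb d n) ξ) →
      ‖g‖ ≤ ħ * ‖h‖ * (κ * √(P + ‖ψ‖ ^ 2)) := by
  obtain ⟨c, hc, hc1, -⟩ := exists_kinetic_growth hM
  have hpi := Real.pi_pos
  refine ⟨4 * Real.pi * c * (1 + 2 * Real.pi), by positivity,
    fun ħ hħ hħ1 h ψ g P hh hP hψ hg => ?_⟩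
  generalize hκ : 4 * Real.pi * c * (1 + 2 * Real.pi) = κ
  have hκ0 : 0 ≤ κ := by rw [← hκ]; positivity
  have hpt : ∀ᵐ ξ, ‖g ξ‖ₑ ^ 2 ≤ ENNReal.ofReal ((ħ * ‖h‖ * κ) ^ 2) *
      (ENNReal.ofReal (‖(2 * Real.pi * ħ) • ξ‖ ^ 2) * ‖(𝓕 ψ : Hilb d n) ξ‖ₑ ^ 2 +
        ‖(𝓕 ψ : Hilb d n) ξ‖ₑ ^ 2) := by
    filter_upwards [hg] with ξ e
    have h1 := hc1 ((2 * Real.pi * ħ) • ξ) ((2 * Real.pi * ħ) • h)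
    rw [← smul_add] at h1
    have h2 := sq_le_of_growth hc hħ hħ1 (norm_nonneg h) hh
      (norm_nonneg ((2 * Real.pi * ħ) • ξ))
      (by rw [norm_smul, Real.norm_of_nonneg (by positivity)]) h1
    rw [hκ] at h2
    rw [e, enorm_smul, mul_pow]
    have h3 : ‖(S.kinetic ((2 * Real.pi * ħ) • (ξ + h)) -
        S.kinetic ((2 * Real.pi * ħ) • ξ) : ℂ)‖ₑ ^ 2 ≤
        ENNReal.ofReal ((ħ * ‖h‖ * κ) ^ 2) *
          (ENNReal.ofReal (‖(2 * Real.pi * ħ) • ξ‖ ^ 2) + 1) := by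
      rw [← Complex.ofReal_sub, ← ofReal_norm, Complex.norm_real, Real.norm_eq_abs,
        ← ENNReal.ofReal_pow (abs_nonneg _), ← ENNReal.ofReal_one,
        ← ENNReal.ofReal_add (by positivity) zero_le_one, ← ENNReal.ofReal_mul (by positivity)]
      exact ENNReal.ofReal_le_ofReal h2
    calc _ ≤ ENNReal.ofReal ((ħ * ‖h‖ * κ) ^ 2) *
          (ENNReal.ofReal (‖(2 * Real.pi * ħ) • ξ‖ ^ 2) + 1) * ‖(𝓕 ψ : Hilb d n) ξ‖ₑ ^ 2 :=
          mul_le_mul_left h3 _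
      _ = _ := by ring
  have hint : ENNReal.ofReal (‖g‖ ^ 2) ≤ ENNReal.ofReal ((ħ * ‖h‖ * κ) ^ 2 * (P + ‖ψ‖ ^ 2)) := by
    rw [Hilb.ofReal_norm_sq]
    refine (lintegral_mono_ae hpt).trans ?_
    rw [lintegral_const_mul' _ _ ENNReal.ofReal_ne_top,
      lintegral_add_right' _ ((Lp.aestronglyMeasurable (𝓕 ψ : Hilb d n)).enorm.pow_const 2),
      ← Hilb.ofReal_norm_sq, ENNReal.ofReal_mul (by positivity),
      ENNReal.ofReal_add hP (by positivity), Lp.norm_fourier_eq]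
    rw [quadForm_momentumOp, quadForm_positionOp (by fun_prop) (fun x => by positivity)] at hψ
    gcongr
  rw [ENNReal.ofReal_le_ofReal_iff (by positivity)] at hint
  refine (pow_le_pow_iff_left₀ (norm_nonneg _) (by positivity) two_ne_zero).1 (hint.trans ?_)
  rw [mul_pow _ (κ * _), mul_pow κ, Real.sq_sqrt (by positivity), mul_pow _ κ, mul_assoc]

/-- The bound on `p̂²` at an intermediate time `s` is absorbed in the one for the final time `t`. -/
theorem mul_exp_add_sq_le {C s t P F ν N : ℝ} (hC : 0 ≤ C) (hst : |s| ≤ |t|) (hP : 0 ≤ P)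
    (hF : 0 ≤ F) (hν : 0 ≤ ν) (hN : ν ≤ N) :
    C * (Real.exp (2 * |s|) * (P + F + ν ^ 2)) + ν ^ 2 ≤
      (C + 1) * (Real.exp (2 * |t|) * (P + F + N ^ 2)) := by
  have e1 : Real.exp (2 * |s|) * (P + F + ν ^ 2) ≤ Real.exp (2 * |t|) * (P + F + N ^ 2) := by
    gcongr
  have e2 : ν ^ 2 ≤ Real.exp (2 * |t|) * (P + F + N ^ 2) := by
    have : ν ^ 2 ≤ N ^ 2 := by gcongr
    refine le_trans ?_ (le_mul_of_one_le_left (by positivity) (Real.one_le_exp (by positivity)))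
    linarith
  have e3 := mul_le_mul_of_nonneg_left e1 hC
  linarith

/-- The commutator of the Hamiltonian with a modulation along the evolution. -/
theorem Admissible.exists_norm_modulate_commutator_le (hS : S.Admissible) (hσ : 0 ≤ σ)
    (hσ1 : σ ≤ 1) : ∃ κ : ℝ, 0 ≤ κ ∧ ∀ (ħ : ℝ) (hħ : 0 < ħ), ħ < 1 → ∀ (t P F N : ℝ)
    (h ψ φ χ), (ψ, φ) ∈ (S.H ħ).graph → ‖ψ‖ ≤ N → ‖h‖ ≤ 1 → 0 ≤ P →
      quadForm (momentumOp ħ fun p => ‖p‖ ^ 2) ψ ≤ ENNReal.ofReal P →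
      (∀ ε (hε : 0 < ε), ‖(hS.weight hħ hσ).rootYos n ε hε ψ‖ ^ 2 ≤ F) → ∀ s, |s * ħ| ≤ |t| →
      ((modulate h).op (unitaryGroup (S.H ħ) s ψ), χ) ∈ (S.H ħ).graph →
      ‖(modulate h).op (unitaryGroup (S.H ħ) s φ) - χ‖ ≤
        ħ * ‖h‖ * (κ * √(Real.exp (2 * |t|) * (P + F + N ^ 2))) := by
  obtain ⟨κ, hκ, hinc⟩ := exists_norm_increment_le hS.mass
  obtain ⟨C, hC, hmom⟩ := hS.exists_quadForm_momentum_le hσ hσ1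
  refine ⟨κ * √(C + 1), mul_nonneg hκ (Real.sqrt_nonneg _),
    fun ħ hħ hħ1 t P F N h ψ φ χ hz hN hh hP0 hP hF s hs hχ => ?_⟩
  have hF0 : 0 ≤ F := (sq_nonneg _).trans (hF 1 one_pos)
  have hU := hS.group hħ
  obtain ⟨χ', g, h1, h2, h3⟩ := hS.exists_modulate_mem_graph hħ h (hU.mem_graph hz s)
  rw [graph_unique hχ h1, h2]
  have hm := hmom ħ hħ hħ1 (s * ħ) P F ψ hP0 hP hF
  rw [mul_div_cancel_right₀ _ hħ.ne'] at hm
  have hb : 0 ≤ C * (Real.exp (2 * |s * ħ|) * (P + F + ‖ψ‖ ^ 2)) :=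
    mul_nonneg hC (mul_nonneg (Real.exp_pos _).le
      (add_nonneg (add_nonneg hP0 hF0) (sq_nonneg _)))
  have hg := hinc ħ hħ hħ1 h (unitaryGroup (S.H ħ) s ψ) g _ hh hb hm h3
  rw [hU.norm_apply] at hg
  rw [mul_assoc κ, ← Real.sqrt_mul (add_nonneg hC zero_le_one)]
  have e5 := Real.sqrt_le_sqrt (mul_exp_add_sq_le hC hs hP0 hF0 (norm_nonneg ψ) hN)
  exact hg.trans (mul_le_mul_of_nonneg_left (mul_le_mul_of_nonneg_left e5 hκ)
    (mul_nonneg hħ.le (norm_nonneg h)))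

/-- The factor `ħ` of the commutator with a modulation cancels the `1/ħ` of the time, which leaves
linear growth in `t`. -/
theorem Admissible.exists_norm_modulate_sub_le_of_mem_graph (hS : S.Admissible) (hσ : 0 ≤ σ)
    (hσ1 : σ ≤ 1) : ∃ κ : ℝ, 0 ≤ κ ∧ ∀ (ħ : ℝ) (hħ : 0 < ħ), ħ < 1 → ∀ (t P F N : ℝ)
    (h : Config d n) (z : Hilb d n × Hilb d n), z ∈ (S.H ħ).graph → ‖z.1‖ ≤ N → ‖h‖ ≤ 1 → 0 ≤ P →
      quadForm (momentumOp ħ fun p => ‖p‖ ^ 2) z.1 ≤ ENNReal.ofReal P →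
      (∀ ε (hε : 0 < ε), ‖(hS.weight hħ hσ).rootYos n ε hε z.1‖ ^ 2 ≤ F) →
      ‖(modulate h).op (unitaryGroup (S.H ħ) (t / ħ) z.1) - unitaryGroup (S.H ħ) (t / ħ) z.1‖ ≤
        ‖(modulate h).op z.1 - z.1‖ +
          ‖h‖ * (κ * √(Real.exp (2 * |t|) * (P + F + N ^ 2))) * |t| := by
  obtain ⟨κ, hκ, H⟩ := hS.exists_norm_modulate_commutator_le hσ hσ1
  refine ⟨κ, hκ, fun ħ hħ hħ1 t P F N h z hz hN hh hP0 hP hF => ?_⟩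
  have hU := hS.group hħ
  have hts : |t / ħ| * ħ = |t| := by rw [abs_div, abs_of_pos hħ, div_mul_cancel₀ _ hħ.ne']
  have hT : ∀ y ∈ (S.H ħ).graph, (modulate h).op y.1 ∈ (S.H ħ).domain := by
    intro y hy
    obtain ⟨χ, g, h1, -, -⟩ := hS.exists_modulate_mem_graph hħ h (ψ := y.1) (φ := y.2) hy
    exact mem_domain_iff_exists_graph.2 ⟨χ, h1⟩
  have key := hU.norm_apply_sub_le (T := (modulate h).op) (s := t / ħ) hz hT fun r hr χ hχ =>
    H ħ hħ hħ1 t P F N h z.1 z.2 χ hz hN hh hP0 hP hF r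
      (by rw [abs_mul, abs_of_pos hħ, ← hts]; exact mul_le_mul_of_nonneg_right hr hħ.le) hχ
  refine key.trans (le_of_eq ?_)
  rw [← hts]
  ring

theorem Admissible.quadForm_momentum_smoothing_le (hS : S.Admissible) {ħ : ℝ} (hħ : 0 < ħ)
    (ε : ℝ) (ψ : Hilb d n) : quadForm (momentumOp ħ fun p => ‖p‖ ^ 2) (hS.smoothing hħ ε ψ) ≤
      quadForm (momentumOp ħ fun p => ‖p‖ ^ 2) ψ := by
  rw [quadForm_momentum_sq, quadForm_momentum_sq]
  gcongr
  exact hS.moment_fourier_smoothing_le hħ ε ψ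

/-- The same estimate for arbitrary vectors with finite kinetic moment and field energy. -/
theorem Admissible.exists_norm_modulate_sub_le (hS : S.Admissible) (hσ : 0 ≤ σ)
    (hσ1 : σ ≤ 1) : ∃ κ : ℝ, 0 ≤ κ ∧ ∀ (ħ : ℝ) (hħ : 0 < ħ), ħ < 1 → ∀ (t P F : ℝ)
    (h : Config d n) (ψ : Hilb d n), ‖h‖ ≤ 1 → 0 ≤ P →
      quadForm (momentumOp ħ fun p => ‖p‖ ^ 2) ψ ≤ ENNReal.ofReal P →
      (∀ ε (hε : 0 < ε), ‖(hS.weight hħ hσ).rootYos n ε hε ψ‖ ^ 2 ≤ F) →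
      ‖(modulate h).op (unitaryGroup (S.H ħ) (t / ħ) ψ) - unitaryGroup (S.H ħ) (t / ħ) ψ‖ ≤
        ‖(modulate h).op ψ - ψ‖ +
          ‖h‖ * (κ * √(Real.exp (2 * |t|) * (P + F + ‖ψ‖ ^ 2))) * |t| := by
  obtain ⟨κ, hκ, H⟩ := hS.exists_norm_modulate_sub_le_of_mem_graph hσ hσ1
  refine ⟨κ, hκ, fun ħ hħ hħ1 t P F h ψ hh hP0 hP hF => ?_⟩
  refine hS.norm_sub_le_of_smoothing hħ (modulate h).op (unitaryGroup (S.H ħ) (t / ħ)) ψ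
    fun ε hε => ?_
  obtain ⟨φ, hφ⟩ := hS.exists_smoothing_mem_graph hħ hε ψ
  have hN := hS.norm_smoothing_le hħ hε ψ
  have hR : ∀ δ (hδ : 0 < δ),
      ‖(hS.weight hħ hσ).rootYos n δ hδ (hS.smoothing hħ ε ψ)‖ ^ 2 ≤ F := fun δ hδ =>
    (pow_le_pow_left₀ (norm_nonneg _) (hS.norm_rootYos_smoothing_le hħ _ hε hδ ψ) 2).trans (hF δ hδ)
  have hP' := (hS.quadForm_momentum_smoothing_le hħ ε ψ).trans hP
  exact H ħ hħ hħ1 t P F ‖ψ‖ h (hS.smoothing hħ ε ψ, φ) hφ hN hh hP0 hP' hR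

/-- Propagation of `q̂²`: its growth is controlled by `p̂²` and the field energy. -/
theorem Admissible.exists_quadForm_position_le (hS : S.Admissible) (hσ : 0 ≤ σ)
    (hσ1 : σ ≤ 1) : ∃ C : ℝ, 0 ≤ C ∧ ∀ (ħ : ℝ) (hħ : 0 < ħ), ħ < 1 → ∀ (t Q P F : ℝ)
    (ψ : Hilb d n), 0 ≤ Q → 0 ≤ P → quadForm (positionOp fun q => ‖q‖ ^ 2) ψ ≤ ENNReal.ofReal Q →
      quadForm (momentumOp ħ fun p => ‖p‖ ^ 2) ψ ≤ ENNReal.ofReal P →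
      (∀ ε (hε : 0 < ε), ‖(hS.weight hħ hσ).rootYos n ε hε ψ‖ ^ 2 ≤ F) →
      quadForm (positionOp fun q => ‖q‖ ^ 2) (unitaryGroup (S.H ħ) (t / ħ) ψ) ≤
        ENNReal.ofReal (C * (Real.exp (3 * |t|) * (Q + P + F + ‖ψ‖ ^ 2))) := by
  obtain ⟨κ, hκ, H⟩ := hS.exists_norm_modulate_sub_le hσ hσ1
  have hpi := Real.pi_pos
  refine ⟨((d * n : ℕ) : ℝ) * (2 + 4 * (κ / (2 * Real.pi)) ^ 2), by positivity,
    fun ħ hħ hħ1 t Q P F ψ hQ0 hP0 hQ hP hF => ?_⟩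
  have hF0 : 0 ≤ F := (sq_nonneg _).trans (hF 1 one_pos)
  rw [quadForm_position_sq] at hQ ⊢
  have hm : moment ψ ≤ ENNReal.ofReal (√Q ^ 2) := by rwa [Real.sq_sqrt hQ0]
  have hG : 0 ≤ Real.exp |t| * (P + F + ‖ψ‖ ^ 2) := by positivity
  have hE : Real.exp |t| * (Real.exp |t| * (P + F + ‖ψ‖ ^ 2)) =
      Real.exp (2 * |t|) * (P + F + ‖ψ‖ ^ 2) := by
    rw [two_mul, Real.exp_add, mul_assoc]
  refine (moment_le (D := √Q + κ / (2 * Real.pi) *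
    √(Real.exp (2 * |t|) * (P + F + ‖ψ‖ ^ 2)) * |t|) fun h hh => ?_).trans ?_
  · refine (H ħ hħ hħ1 t P F h ψ hh hP0 hP hF).trans ?_
    have h2 := norm_modulate_sub_le h (Real.sqrt_nonneg Q) hm
    refine (add_le_add_left h2 _).trans (le_of_eq ?_)
    field_simp
  · refine ENNReal.ofReal_le_ofReal ?_
    -- One factor `e^{|t|}` is put into the constant `G`, so that the growth rate `2` of the
    -- momentum and the factor `t²` combine to the rate `3`.
    have e1 := add_mul_sq_le (κ := κ / (2 * Real.pi)) hQ0 hG (abs_nonneg t)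
    rw [hE] at e1
    have e2 : Real.exp (2 * |t|) * (Q + Real.exp |t| * (P + F + ‖ψ‖ ^ 2)) ≤
        Real.exp (3 * |t|) * (Q + P + F + ‖ψ‖ ^ 2) := by
      have e3 : Real.exp (3 * |t|) = Real.exp (2 * |t|) * Real.exp |t| := by
        rw [← Real.exp_add]; ring_nf
      have e4 : Q ≤ Real.exp |t| * Q := le_mul_of_one_le_left hQ0 (Real.one_le_exp (abs_nonneg t))
      rw [e3, mul_assoc]
      gcongr
      linarith
    rw [mul_assoc ((d * n : ℕ) : ℝ)]
    gcongr
    refine e1.trans ?_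
    gcongr

end Model

end Position

/-! ### Bounds on the forms along the evolution -/

section Forms

variable {d n : ℕ} {ħ σ : ℝ}

namespace Model

variable {S : Model d n}

theorem Admissible.isYosida_fieldEnergy (hS : S.Admissible) (hħ : 0 < ħ) (hσ : 0 ≤ σ) :
    IsYosida (dGamma n ħ fun k => S.ω k ^ (2 * σ))
      (fun ε => (OpField.const n ((hS.weight hħ hσ).res ε).op).op) :=
  isYosida_dGamma (hS.weight hħ hσ) fun _ => rfl

theorem Admissible.re_inner_yosida_fieldEnergy (hS : S.Admissible) (hħ : 0 < ħ) (hσ : 0 ≤ σ)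
    {ε : ℝ} (hε : 0 < ε) (ψ : Hilb d n) :
    (⟪ψ, yosida (fun ε => (OpField.const n ((hS.weight hħ hσ).res ε).op).op) ε ψ⟫_ℂ).re =
      ‖(hS.weight hħ hσ).rootYos n ε hε ψ‖ ^ 2 := by
  rw [yosida_const_res]
  exact (hS.weight hħ hσ).re_inner_yos hε ψ

theorem Admissible.ofReal_norm_rootYos_le (hS : S.Admissible) (hħ : 0 < ħ) (hσ : 0 ≤ σ)
    {ε : ℝ} (hε : 0 < ε) (ψ : Hilb d n) :
    ENNReal.ofReal (‖(hS.weight hħ hσ).rootYos n ε hε ψ‖ ^ 2) ≤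
      quadForm (dGamma n ħ fun k => S.ω k ^ (2 * σ)) ψ := by
  rw [← hS.re_inner_yosida_fieldEnergy hħ hσ hε]
  exact (hS.isYosida_fieldEnergy hħ hσ).ofReal_inner_le_quadForm hε ψ

theorem Admissible.norm_rootYos_sq_le_toReal (hS : S.Admissible) (hħ : 0 < ħ) (hσ : 0 ≤ σ)
    {ψ : Hilb d n} (hψ : quadForm (dGamma n ħ fun k => S.ω k ^ (2 * σ)) ψ ≠ ⊤) (ε : ℝ)
    (hε : 0 < ε) : ‖(hS.weight hħ hσ).rootYos n ε hε ψ‖ ^ 2 ≤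
      (quadForm (dGamma n ħ fun k => S.ω k ^ (2 * σ)) ψ).toReal := by
  rw [← ENNReal.ofReal_le_iff_le_toReal hψ]
  exact hS.ofReal_norm_rootYos_le hħ hσ hε ψ

/-- Propagation of the field energy. -/
theorem Admissible.quadForm_fieldEnergy_le (hS : S.Admissible) (hħ : 0 < ħ) (hσ : 0 ≤ σ)
    (hσ1 : σ ≤ 1) (t : ℝ) (ψ : Hilb d n) :
    quadForm (dGamma n ħ fun k => S.ω k ^ (2 * σ)) (unitaryGroup (S.H ħ) (t / ħ) ψ) ≤
      ENNReal.ofReal (Real.exp |t| * (1 + S.fieldConst σ ^ 2)) *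
        (quadForm (dGamma n ħ fun k => S.ω k ^ (2 * σ)) ψ + ENNReal.ofReal (‖ψ‖ ^ 2)) := by
  refine (hS.isYosida_fieldEnergy hħ hσ).quadForm_le fun ε hε => ?_
  rw [hS.re_inner_yosida_fieldEnergy hħ hσ hε]
  have h1 := hS.norm_rootYos_sq_le hħ hσ hσ1 hε (t / ħ) ψ
  have h2 : ħ * |t / ħ| = |t| := by rw [abs_div, abs_of_pos hħ, mul_div_cancel₀ _ hħ.ne']
  rw [h2] at h1
  refine le_trans (ENNReal.ofReal_le_ofReal (q := Real.exp |t| * (1 + S.fieldConst σ ^ 2) *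
    (‖(hS.weight hħ hσ).rootYos n ε hε ψ‖ ^ 2 + ‖ψ‖ ^ 2)) ?_) ?_
  · have h3 : 0 ≤ Real.exp |t| * (‖ψ‖ ^ 2 + S.fieldConst σ ^ 2 *
        ‖(hS.weight hħ hσ).rootYos n ε hε ψ‖ ^ 2) := by positivity
    have h4 : 0 ≤ S.fieldConst σ ^ 2 * ‖ψ‖ ^ 2 := by positivity
    linarith
  · rw [ENNReal.ofReal_mul (by positivity), ENNReal.ofReal_add (by positivity) (by positivity)]
    gcongr
    exact hS.ofReal_norm_rootYos_le hħ hσ hε ψ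

/-- If one of the forms is infinite there is nothing to prove. -/
theorem le_ofReal_mul_of_ne_top {x a b : ℝ≥0∞} {C ν : ℝ} (hC : 0 < C) (hν : 0 ≤ ν)
    (h : a ≠ ⊤ → b ≠ ⊤ → x ≤ ENNReal.ofReal (C * (a.toReal + b.toReal + ν))) :
    x ≤ ENNReal.ofReal C * (a + (b + ENNReal.ofReal ν)) := by
  have hC' : ENNReal.ofReal C ≠ 0 := by rwa [Ne, ENNReal.ofReal_eq_zero, not_le]
  by_cases ha : a = ⊤
  · rw [ha, top_add, ENNReal.mul_top hC']; exact le_top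
  by_cases hb : b = ⊤
  · rw [hb, top_add, add_top, ENNReal.mul_top hC']; exact le_top
  refine (h ha hb).trans (le_of_eq ?_)
  rw [ENNReal.ofReal_mul hC.le, ENNReal.ofReal_add (by positivity) hν,
    ENNReal.ofReal_add (by positivity) (by positivity), ENNReal.ofReal_toReal ha,
    ENNReal.ofReal_toReal hb, add_assoc]

/-- The forms of the field energy, of `p̂²` and of `q̂²` grow at most exponentially. -/
theorem Admissible.exists_quadForm_le (hS : S.Admissible) (hσ : 0 ≤ σ) (hσ1 : σ ≤ 1) :
    ∃ C : ℝ, 0 < C ∧ ∀ ħ : ℝ, 0 < ħ → ħ < 1 → ∀ (t : ℝ) (ψ : Hilb d n),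
      quadForm (dGamma n ħ fun k => S.ω k ^ (2 * σ)) (unitaryGroup (S.H ħ) (t / ħ) ψ) ≤
        ENNReal.ofReal (C * Real.exp (3 * |t|)) *
          (quadForm (dGamma n ħ fun k => S.ω k ^ (2 * σ)) ψ + ENNReal.ofReal (‖ψ‖ ^ 2)) ∧
      quadForm (momentumOp ħ fun p => ‖p‖ ^ 2) (unitaryGroup (S.H ħ) (t / ħ) ψ) ≤
        ENNReal.ofReal (C * Real.exp (3 * |t|)) * (quadForm (momentumOp ħ fun p => ‖p‖ ^ 2) ψ +
          (quadForm (dGamma n ħ fun k => S.ω k ^ (2 * σ)) ψ + ENNReal.ofReal (‖ψ‖ ^ 2))) ∧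
      quadForm (positionOp fun q => ‖q‖ ^ 2) (unitaryGroup (S.H ħ) (t / ħ) ψ) ≤
        ENNReal.ofReal (C * Real.exp (3 * |t|)) * (quadForm (positionOp fun q => ‖q‖ ^ 2) ψ +
          quadForm (momentumOp ħ fun p => ‖p‖ ^ 2) ψ +
          (quadForm (dGamma n ħ fun k => S.ω k ^ (2 * σ)) ψ + ENNReal.ofReal (‖ψ‖ ^ 2))) := by
  obtain ⟨C₁, hC₁, H₁⟩ := hS.exists_quadForm_momentum_le hσ hσ1
  obtain ⟨C₂, hC₂, H₂⟩ := hS.exists_quadForm_position_le hσ hσ1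
  have hpos : 0 < 1 + S.fieldConst σ ^ 2 + C₁ + C₂ := by positivity
  refine ⟨1 + S.fieldConst σ ^ 2 + C₁ + C₂, hpos, fun ħ hħ hħ1 t ψ => ⟨?_, ?_, ?_⟩⟩
  · refine (hS.quadForm_fieldEnergy_le hħ hσ hσ1 t ψ).trans ?_
    refine mul_le_mul_left (ENNReal.ofReal_le_ofReal ?_) _
    rw [mul_comm]
    have h3 : Real.exp |t| ≤ Real.exp (3 * |t|) :=
      Real.exp_le_exp.2 (by linarith [abs_nonneg t])
    exact mul_le_mul (by linarith) h3 (Real.exp_pos _).le hpos.le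
  · refine le_ofReal_mul_of_ne_top (by positivity) (by positivity) fun hP hF => ?_
    refine (H₁ ħ hħ hħ1 t _ _ ψ ENNReal.toReal_nonneg (ENNReal.ofReal_toReal hP).ge
      (hS.norm_rootYos_sq_le_toReal hħ hσ hF)).trans (ENNReal.ofReal_le_ofReal ?_)
    have h3 : Real.exp (2 * |t|) ≤ Real.exp (3 * |t|) :=
      Real.exp_le_exp.2 (by linarith [abs_nonneg t])
    rw [← mul_assoc]
    gcongr
    linarith [sq_nonneg (S.fieldConst σ)]
  · refine le_ofReal_mul_of_ne_top (by positivity) (by positivity) fun hQP hF => ?_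
    obtain ⟨hQ, hP⟩ := ENNReal.add_ne_top.1 hQP
    refine (H₂ ħ hħ hħ1 t _ _ _ ψ ENNReal.toReal_nonneg ENNReal.toReal_nonneg
      (ENNReal.ofReal_toReal hQ).ge (ENNReal.ofReal_toReal hP).ge
      (hS.norm_rootYos_sq_le_toReal hħ hσ hF)).trans (ENNReal.ofReal_le_ofReal ?_)
    rw [ENNReal.toReal_add hQ hP, ← mul_assoc]
    gcongr
    linarith [sq_nonneg (S.fieldConst σ)]

theorem Admissible.freeGroup (hS : S.Admissible) (hħ : 0 < ħ) :
    IsUnitaryGroupOf (S.H02 ħ) (unitaryGroup (S.H02 ħ)) :=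
  (hS.isResolvable_H02 hħ).isUnitaryGroupOf

/-- The free field evolution does not increase the form of an operator whose resolvent commutes with
the operators that act in the field variables only and are functions of the field energy. -/
theorem Admissible.quadForm_freeGroup_le (hS : S.Admissible) (hħ : 0 < ħ)
    {A : Hilb d n →ₗ.[ℂ] Hilb d n} {J : ℝ → Hilb d n →L[ℂ] Hilb d n} (hJ : IsYosida A J)
    (hc : ∀ (b : Symbol d) ψ, J 1 ((OpField.const n b.op).op ψ) = (OpField.const n b.op).op (J 1 ψ))
    (s : ℝ) (ψ : Hilb d n) : quadForm A (unitaryGroup (S.H02 ħ) s ψ) ≤ quadForm A ψ := by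
  have hU := hS.freeGroup hħ
  refine quadForm_unitary_le (fun z hz => ?_) (hU.mem_unitary s) ψ
  rw [hU.star_eq]
  refine hJ.mem_graph_of_comm (fun φ => ?_) hz
  refine (hU.apply_comm (hS.isResolvable_H02 hħ).dense_domain (fun y hy => ?_) (-s) φ).symm
  exact (hS.isYosida_H02 hħ).mem_graph_of_comm (hc _) hy

theorem Admissible.quadForm_freeGroup_fieldEnergy_le (hS : S.Admissible) (hħ : 0 < ħ) (hσ : 0 ≤ σ)
    (s : ℝ) (ψ : Hilb d n) :
    quadForm (dGamma n ħ fun k => S.ω k ^ (2 * σ)) (unitaryGroup (S.H02 ħ) s ψ) ≤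
      quadForm (dGamma n ħ fun k => S.ω k ^ (2 * σ)) ψ :=
  hS.quadForm_freeGroup_le hħ (hS.isYosida_fieldEnergy hħ hσ)
    (fun _ ψ => OpField.const_op_comm (fun v => Symbol.op_comm _ _ v) ψ) s ψ

theorem Admissible.quadForm_freeGroup_momentum_le (hS : S.Admissible) (hħ : 0 < ħ) (s : ℝ)
    (ψ : Hilb d n) : quadForm (momentumOp ħ fun p => ‖p‖ ^ 2) (unitaryGroup (S.H02 ħ) s ψ) ≤
      quadForm (momentumOp ħ fun p => ‖p‖ ^ 2) ψ :=
  hS.quadForm_freeGroup_le hħ (isYosida_momentumOp (by fun_prop) fun x => by positivity)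
    (fun _ ψ => fconj_scalarRes_const_op _ _ _ ψ) s ψ

theorem Admissible.quadForm_freeGroup_position_le (hS : S.Admissible) (hħ : 0 < ħ) (s : ℝ)
    (ψ : Hilb d n) : quadForm (positionOp fun q => ‖q‖ ^ 2) (unitaryGroup (S.H02 ħ) s ψ) ≤
      quadForm (positionOp fun q => ‖q‖ ^ 2) ψ :=
  hS.quadForm_freeGroup_le hħ (isYosida_positionOp (by fun_prop) fun x => by positivity)
    (fun _ ψ => OpField.scalar_op_comm _ _ _ ψ) s ψ

end Model

end Forms

/-! ### Bounds on the traces -/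

section TraceBounds

/-- A bound on forms gives a bound on traces; the term `‖ψ‖²` contributes `Tr ρ = 1`. -/
theorem traceWith_conj_le_mul {E : Type*} [NormedAddCommGroup E] [InnerProductSpace ℂ E]
    [CompleteSpace E] {ρ W : E →L[ℂ] E} {A : E →ₗ.[ℂ] E} {q : E → ℝ≥0∞} {a : ℝ≥0∞}
    (hρ : IsDensityMatrix ρ) (hW : W ∈ unitary (E →L[ℂ] E))
    (h : ∀ ψ, quadForm A (W ψ) ≤ a * (q ψ + ENNReal.ofReal (‖ψ‖ ^ 2))) :
    traceWith (W * ρ * star W) A ≤ a * (traceOf (fun e => q (CFC.sqrt ρ e)) + 1) := by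
  refine (traceWith_conj_le hρ.1 hW h).trans ((traceOf_const_mul_le _ _).trans ?_)
  gcongr
  refine (traceOf_add_le _ _).trans ?_
  rw [hρ.traceOf_norm_sq]

theorem conj_conj_eq {E : Type*} [NormedAddCommGroup E] [InnerProductSpace ℂ E] [CompleteSpace E]
    (V W ρ : E →L[ℂ] E) : V * (W * ρ * star W) * star V = (V * W) * ρ * star (V * W) := by
  rw [star_mul]
  simp only [mul_assoc]

/-- Traces after conjugation with a unitary operator for which the form of `F` is controlled by
itself, the form of `P` by those of `P` and `F`, and the form of `Q` by all three. -/
theorem traceWith_conj_le_of_quadForm_le {E : Type*} [NormedAddCommGroup E] [InnerProductSpace ℂ E]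
    [CompleteSpace E] {a : ℝ≥0∞} {ρ W : E →L[ℂ] E} {F P Q : E →ₗ.[ℂ] E}
    (hρ : IsDensityMatrix ρ) (hW : W ∈ unitary (E →L[ℂ] E))
    (hF : ∀ ψ, quadForm F (W ψ) ≤ a * (quadForm F ψ + ENNReal.ofReal (‖ψ‖ ^ 2)))
    (hP : ∀ ψ, quadForm P (W ψ) ≤
      a * (quadForm P ψ + (quadForm F ψ + ENNReal.ofReal (‖ψ‖ ^ 2))))
    (hQ : ∀ ψ, quadForm Q (W ψ) ≤
      a * (quadForm Q ψ + quadForm P ψ + (quadForm F ψ + ENNReal.ofReal (‖ψ‖ ^ 2)))) :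
    traceWith (W * ρ * star W) F ≤ a * (traceWith ρ F + 1) ∧
      traceWith (W * ρ * star W) Q + traceWith (W * ρ * star W) P ≤
        a * (2 * (traceWith ρ Q + traceWith ρ P + traceWith ρ F + 1)) := by
  refine ⟨traceWith_conj_le_mul hρ hW hF, ?_⟩
  -- Bracket the right sides so that `‖ψ‖²` is the last summand.
  simp_rw [← add_assoc] at hP hQ
  have h1 := traceWith_conj_le_mul hρ hW hP
  have h2 := traceWith_conj_le_mul hρ hW hQ
  have h3 : traceOf (fun e => quadForm P (CFC.sqrt ρ e) + quadForm F (CFC.sqrt ρ e)) ≤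
      traceWith ρ Q + traceWith ρ P + traceWith ρ F :=
    (traceOf_add_le _ _).trans (add_le_add le_add_self le_rfl)
  have h4 : traceOf (fun e => quadForm Q (CFC.sqrt ρ e) + quadForm P (CFC.sqrt ρ e) +
      quadForm F (CFC.sqrt ρ e)) ≤ traceWith ρ Q + traceWith ρ P + traceWith ρ F :=
    (traceOf_add_le _ _).trans (add_le_add (traceOf_add_le _ _) le_rfl)
  calc _ ≤ a * (traceWith ρ Q + traceWith ρ P + traceWith ρ F + 1) +
        a * (traceWith ρ Q + traceWith ρ P + traceWith ρ F + 1) := by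
        refine add_le_add (h2.trans ?_) (h1.trans ?_)
        · gcongr
        · gcongr
    _ = _ := by ring

variable {d n : ℕ} {σ : ℝ}

namespace Model

variable {S : Model d n}

theorem Admissible.evolved_eq (hS : S.Admissible) {ħ : ℝ} (hħ : 0 < ħ) (t : ℝ)
    (ρ : Hilb d n →L[ℂ] Hilb d n) : S.evolved ħ t ρ =
      unitaryGroup (S.H ħ) (t / ħ) * ρ * star (unitaryGroup (S.H ħ) (t / ħ)) := by
  rw [(hS.group hħ).star_eq, evolved]

/-- The evolution in the interaction picture is conjugation with one unitary operator. -/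
theorem Admissible.evolvedInt_eq (hS : S.Admissible) {ħ : ℝ} (hħ : 0 < ħ) (t : ℝ)
    (ρ : Hilb d n →L[ℂ] Hilb d n) : S.evolvedInt ħ t ρ =
      (unitaryGroup (S.H02 ħ) (-(t / ħ)) * unitaryGroup (S.H ħ) (t / ħ)) * ρ *
        star (unitaryGroup (S.H02 ħ) (-(t / ħ)) * unitaryGroup (S.H ħ) (t / ħ)) := by
  rw [← conj_conj_eq, (hS.freeGroup hħ).star_eq, neg_neg, evolvedInt, hS.evolved_eq hħ]

/-- The traces grow at most exponentially along both evolutions. -/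
theorem Admissible.exists_trace_le (hS : S.Admissible) (hσ : 0 ≤ σ) (hσ1 : σ ≤ 1) :
    ∃ C : ℝ, 0 < C ∧ ∀ ħ : ℝ, 0 < ħ → ħ < 1 → ∀ (t : ℝ) (ρ : Hilb d n →L[ℂ] Hilb d n),
      IsDensityMatrix ρ →
      (IsDensityMatrix (S.evolved ħ t ρ) ∧ IsDensityMatrix (S.evolvedInt ħ t ρ)) ∧
      (S.fieldTrace σ ħ (S.evolved ħ t ρ) ≤
          ENNReal.ofReal (C * Real.exp (3 * |t|)) * (S.fieldTrace σ ħ ρ + 1) ∧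
        S.fieldTrace σ ħ (S.evolvedInt ħ t ρ) ≤
          ENNReal.ofReal (C * Real.exp (3 * |t|)) * (S.fieldTrace σ ħ ρ + 1)) ∧
      (particleTrace ħ (S.evolved ħ t ρ) ≤ ENNReal.ofReal (C * Real.exp (3 * |t|)) *
          (2 * (particleTrace ħ ρ + S.fieldTrace σ ħ ρ + 1)) ∧
        particleTrace ħ (S.evolvedInt ħ t ρ) ≤ ENNReal.ofReal (C * Real.exp (3 * |t|)) *
          (2 * (particleTrace ħ ρ + S.fieldTrace σ ħ ρ + 1))) := by
  obtain ⟨C, hC, H⟩ := hS.exists_quadForm_le (σ := σ) hσ hσ1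
  refine ⟨C, hC, fun ħ hħ hħ1 t ρ hρ => ?_⟩
  have hU := (hS.group hħ).mem_unitary (t / ħ)
  have hW := (unitary (Hilb d n →L[ℂ] Hilb d n)).mul_mem
    ((hS.freeGroup hħ).mem_unitary (-(t / ħ))) hU
  have h1 := traceWith_conj_le_of_quadForm_le hρ hU (fun ψ => (H ħ hħ hħ1 t ψ).1)
    (fun ψ => (H ħ hħ hħ1 t ψ).2.1) (fun ψ => (H ħ hħ hħ1 t ψ).2.2)
  -- In the interaction picture the free evolution is applied last, and it does not increase any of
  -- the forms.
  have h2 := traceWith_conj_le_of_quadForm_le hρ hW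
    (fun ψ => (hS.quadForm_freeGroup_fieldEnergy_le hħ hσ _ _).trans (H ħ hħ hħ1 t ψ).1)
    (fun ψ => (hS.quadForm_freeGroup_momentum_le hħ _ _).trans (H ħ hħ hħ1 t ψ).2.1)
    (fun ψ => (hS.quadForm_freeGroup_position_le hħ _ _).trans (H ħ hħ hħ1 t ψ).2.2)
  rw [hS.evolved_eq hħ, hS.evolvedInt_eq hħ]
  exact ⟨⟨hρ.conj hU, hρ.conj hW⟩, ⟨h1.1, h2.1⟩, ⟨h1.2, h2.2⟩⟩

end Model

end TraceBounds

end Nelson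

end

theorem mainTheorem7 {d n : ℕ} (hd : 1 ≤ d) (S : Nelson.Model d n)
    (hM : ∀ j, 0 < S.M j) (hmf : 0 < S.mf) (σ : ℝ) (hσ : σ ∈ Set.Icc (1 / 2 : ℝ) 1)
    (hV : Nelson.IsCb2 S.V)
    (hχ : MeasureTheory.MemLp (fun k => S.ω k ^ (1 / 2 : ℝ) * S.χ k) 2 MeasureTheory.volume) :
    -- the evolutions are well defined
    (∀ ħ ∈ Set.Ioo (0 : ℝ) 1,
      IsSelfAdjoint (S.H ħ) ∧
      Nelson.IsUnitaryGroupOf (S.H ħ) (Nelson.unitaryGroup (S.H ħ)) ∧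
      IsSelfAdjoint (S.H02 ħ) ∧
      Nelson.IsUnitaryGroupOf (S.H02 ħ) (Nelson.unitaryGroup (S.H02 ħ))) ∧
    -- propagation of the bounds; the rate `C` depends neither on the states nor on `ħ`
    ∃ C > 0, ∀ ρ : ℝ → Nelson.Hilb d n →L[ℂ] Nelson.Hilb d n,
      (∀ ħ ∈ Set.Ioo (0 : ℝ) 1, Nelson.IsDensityMatrix (ρ ħ)) →
      (∃ C₀ > 0, ∀ ħ ∈ Set.Ioo (0 : ℝ) 1, S.fieldTrace σ ħ (ρ ħ) ≤ ENNReal.ofReal C₀) →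
      (∃ C₁ > 0, ∀ ħ ∈ Set.Ioo (0 : ℝ) 1,
        Nelson.particleTrace ħ (ρ ħ) ≤ ENNReal.ofReal C₁) →
      -- the evolved operators are density matrices
      (∀ t : ℝ, ∀ ħ ∈ Set.Ioo (0 : ℝ) 1,
        Nelson.IsDensityMatrix (S.evolved ħ t (ρ ħ)) ∧
        Nelson.IsDensityMatrix (S.evolvedInt ħ t (ρ ħ))) ∧
      -- the bounds hold uniformly in time on compact intervals
      (∀ a b : ℝ, ∃ C₀ > 0, ∀ t ∈ Set.Icc a b, ∀ ħ ∈ Set.Ioo (0 : ℝ) 1,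
        S.fieldTrace σ ħ (S.evolved ħ t (ρ ħ)) ≤ ENNReal.ofReal C₀ ∧
        S.fieldTrace σ ħ (S.evolvedInt ħ t (ρ ħ)) ≤ ENNReal.ofReal C₀) ∧
      (∀ a b : ℝ, ∃ C₁ > 0, ∀ t ∈ Set.Icc a b, ∀ ħ ∈ Set.Ioo (0 : ℝ) 1,
        Nelson.particleTrace ħ (S.evolved ħ t (ρ ħ)) ≤ ENNReal.ofReal C₁ ∧
        Nelson.particleTrace ħ (S.evolvedInt ħ t (ρ ħ)) ≤ ENNReal.ofReal C₁) ∧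
      -- and they grow at most exponentially in time
      (∃ C₀ > 0, ∀ t : ℝ, ∀ ħ ∈ Set.Ioo (0 : ℝ) 1,
        S.fieldTrace σ ħ (S.evolved ħ t (ρ ħ)) ≤
          ENNReal.ofReal (C₀ * Real.exp (C * |t|)) ∧
        S.fieldTrace σ ħ (S.evolvedInt ħ t (ρ ħ)) ≤
          ENNReal.ofReal (C₀ * Real.exp (C * |t|))) ∧
      (∃ C₁ > 0, ∀ t : ℝ, ∀ ħ ∈ Set.Ioo (0 : ℝ) 1,
        Nelson.particleTrace ħ (S.evolved ħ t (ρ ħ)) ≤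
          ENNReal.ofReal (C₁ * Real.exp (C * |t|)) ∧
        Nelson.particleTrace ħ (S.evolvedInt ħ t (ρ ħ)) ≤
          ENNReal.ofReal (C₁ * Real.exp (C * |t|))) := by
  have hS : S.Admissible := ⟨hM, hmf, hV, hχ⟩
  have hσ0 : 0 ≤ σ := le_trans (by norm_num) hσ.1
  refine ⟨fun ħ hħ => ⟨(hS.isResolvable_H hħ.1).isSelfAdjoint, hS.group hħ.1,
    (hS.isResolvable_H02 hħ.1).isSelfAdjoint, hS.freeGroup hħ.1⟩, 3, by norm_num, ?_⟩
  obtain ⟨C, hC, H⟩ := hS.exists_trace_le hσ0 hσ.2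
  rintro ρ hρ ⟨C₀, hC₀, h0⟩ ⟨C₁, hC₁, h1⟩
  -- The exponential bounds; those on compact intervals follow from them.
  have hfield : ∀ t : ℝ, ∀ ħ ∈ Set.Ioo (0 : ℝ) 1,
      S.fieldTrace σ ħ (S.evolved ħ t (ρ ħ)) ≤
          ENNReal.ofReal (C * (C₀ + 1) * Real.exp (3 * |t|)) ∧
        S.fieldTrace σ ħ (S.evolvedInt ħ t (ρ ħ)) ≤
          ENNReal.ofReal (C * (C₀ + 1) * Real.exp (3 * |t|)) := by
    intro t ħ hħ
    have e : ENNReal.ofReal (C * Real.exp (3 * |t|)) * (S.fieldTrace σ ħ (ρ ħ) + 1) ≤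
        ENNReal.ofReal (C * (C₀ + 1) * Real.exp (3 * |t|)) := by
      rw [mul_right_comm, ENNReal.ofReal_mul (p := C * Real.exp (3 * |t|)) (by positivity),
        ENNReal.ofReal_add hC₀.le zero_le_one,
        ENNReal.ofReal_one]
      gcongr
      exact h0 ħ hħ
    exact (H ħ hħ.1 hħ.2 t _ (hρ ħ hħ)).2.1.imp (fun h => h.trans e) fun h => h.trans e
  have hpart : ∀ t : ℝ, ∀ ħ ∈ Set.Ioo (0 : ℝ) 1,
      Nelson.particleTrace ħ (S.evolved ħ t (ρ ħ)) ≤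
          ENNReal.ofReal (C * (2 * (C₁ + C₀ + 1)) * Real.exp (3 * |t|)) ∧
        Nelson.particleTrace ħ (S.evolvedInt ħ t (ρ ħ)) ≤
          ENNReal.ofReal (C * (2 * (C₁ + C₀ + 1)) * Real.exp (3 * |t|)) := by
    intro t ħ hħ
    have e : ENNReal.ofReal (C * Real.exp (3 * |t|)) *
        (2 * (Nelson.particleTrace ħ (ρ ħ) + S.fieldTrace σ ħ (ρ ħ) + 1)) ≤
        ENNReal.ofReal (C * (2 * (C₁ + C₀ + 1)) * Real.exp (3 * |t|)) := by
      rw [mul_right_comm, ENNReal.ofReal_mul (p := C * Real.exp (3 * |t|)) (by positivity),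
        ENNReal.ofReal_mul zero_le_two,
        ENNReal.ofReal_add (by positivity) zero_le_one, ENNReal.ofReal_add hC₁.le hC₀.le,
        ENNReal.ofReal_one, ENNReal.ofReal_ofNat]
      gcongr
      · exact h1 ħ hħ
      · exact h0 ħ hħ
    exact (H ħ hħ.1 hħ.2 t _ (hρ ħ hħ)).2.2.imp (fun h => h.trans e) fun h => h.trans e
  -- On `[a, b]` one has `|t| ≤ max |a| |b|`.
  have hcpt : ∀ (a b : ℝ) (c : ℝ), 0 < c → ∀ t ∈ Set.Icc a b,
      ENNReal.ofReal (c * Real.exp (3 * |t|)) ≤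
        ENNReal.ofReal (c * Real.exp (3 * max |a| |b|)) := by
    intro a b c hc t ht
    have := abs_le_max_abs_abs ht.1 ht.2
    gcongr
  refine ⟨fun t ħ hħ => (H ħ hħ.1 hħ.2 t _ (hρ ħ hħ)).1, fun a b => ?_, fun a b => ?_,
    ⟨_, by positivity, hfield⟩, ⟨_, by positivity, hpart⟩⟩
  · refine ⟨C * (C₀ + 1) * Real.exp (3 * max |a| |b|), by positivity, fun t ht ħ hħ => ?_⟩
    have e := hcpt a b (C * (C₀ + 1)) (by positivity) t ht
    exact (hfield t ħ hħ).imp (fun h => h.trans e) fun h => h.trans e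
  · refine ⟨C * (2 * (C₁ + C₀ + 1)) * Real.exp (3 * max |a| |b|), by positivity,
      fun t ht ħ hħ => ?_⟩
    have e := hcpt a b (C * (2 * (C₁ + C₀ + 1))) (by positivity) t ht
    exact (hpart t ħ hħ).imp (fun h => h.trans e) fun h => h.trans e
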